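/- **Computation model.** A program for an integer random access machine (integer registers and integer arrays; assignment, sequencing, branching and looping on a sign test; addition, subtraction, multiplication, division, shifts) is charged by bit operations: every operation and memory access is charged, up to a constant, the sum of the bit lengths of the numbers (including addresses) involved, a left shift by $s$ is charged in addition $s$, and multiplication and division are charged the product of the bit lengths of the operands. A real number $x$ is given as a bit stream: a request for its first $L$ bits returns an integer $c$ with $|2^L x-c|\le 1$, and is charged $L$ plus the bit lengths of $c$ and of the number of the stream. A nonzero polynomial $p=\sum_{k=0}^d a_kX^k\in\mathbb C[X]$ is given by bit streams of the real and imaginary parts of $a_k/2^E$, $k\ge 0$ (with $a_k=0$ for $k>d$), where the common binary exponent $E\in\mathbb Z$ satisfies $|a_k|\le 2^E\le 2\|p\|_1$ for all $k$, and $\|p\|_1=\sum_k|a_k|$. A complex number $z$ is given by bit streams of its real and imaginary parts. Outputs are complex numbers $2^{E-s}(u+iv)$, with integers $s,u,v$ computed by the program ($s$ common to all outputs). **Statement.** There are a program $P$ and constants $C>0$, $c\in\mathbb N$ such that for all integers $n\ge 1$, $m\ge 1$ and $1\le N\le 2^{n+4}$, all $z\in\mathbb C$ with $|z|\le 1-1/2^n$,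 and every nonzero polynomial $p\in\mathbb C[X]$ of any degree, the program $P$, started on $n,N,m$ with $z$ and $p$ given as above, computes approximations of the $N$ values $p(ze^{2\pi ik/N})$, $0\le k<N$, each with absolute error less than $\|p\|_1/2^m$, and halts after at most $$C\,2^n\,(m+n)^2\,(1+\log m)^c$$ bit operations; that is, after $O\big(2^n(m+n)^2\,\mathrm{polylog}(m)\big)$ bit operations, uniformly in $z$ and $p$ and independently of the degree of $p$. -/

import Mathlib

/-- The norm `‖p‖₁ = ∑ₖ |aₖ|` of a polynomial `p = ∑ₖ aₖ Xᵏ`. -/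
noncomputable def coeffNorm (p : Polynomial ℂ) : ℝ :=
  p.sum fun _ a => ‖a‖

namespace BitRAM

/-! A random access machine on integers, programmed by structured programs, in which every
operation is charged by the number of bit operations it stands for (the logarithmic cost
criterion).  Multiplication and division are charged at the schoolbook rate, the product of the
lengths of the operands; all other operations are charged linearly. -/

/-- The bit length of an integer. -/
def len (x : ℤ) : ℕ := Nat.size x.natAbs

/-- A state: the integer registers, and the integer arrays (a program names only finitely many). -/
structure State where
  reg : ℕ → ℤ
  mem : ℕ → ℤ → ℤ

/-- Expressions. -/
inductive Expr where
  /-- an integer constant -/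
  | const (c : ℤ)
  /-- the content of a register -/
  | reg (r : ℕ)
  /-- the entry of array `A` at a computed index -/
  | get (A : ℕ) (i : Expr)
  | add (a b : Expr)
  | sub (a b : Expr)
  | mul (a b : Expr)
  | div (a b : Expr)
  /-- shift to the left -/
  | shl (a s : Expr)
  /-- shift to the right -/
  | shr (a s : Expr)
  /-- the first `L` bits of the input stream number `i` -/
  | query (i L : Expr)

/-- Programs. -/
inductive Cmd where
  | skip
  /-- assign the value of an expression to a register -/
  | assign (r : ℕ) (e : Expr)
  /-- write the value of `e` into array `A` at a computed index -/
  | put (A : ℕ) (i e : Expr)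
  | seq (c₁ c₂ : Cmd)
  /-- run `c₁` if the test is positive, and `c₂` otherwise -/
  | branch (test : Expr) (c₁ c₂ : Cmd)
  /-- repeat the body as long as the test is positive -/
  | loop (test : Expr) (body : Cmd)

/-- The value of an expression; `O i L` is what the input stream number `i` delivers when its
first `L` bits are requested. -/
def Expr.eval (O : ℕ → ℕ → ℤ) (σ : State) : Expr → ℤ
  | .const c => c
  | .reg r => σ.reg r
  | .get A i => σ.mem A (i.eval O σ)
  | .add a b => a.eval O σ + b.eval O σ
  | .sub a b => a.eval O σ - b.eval O σ
  | .mul a b => a.eval O σ * b.eval O σ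
  | .div a b => a.eval O σ / b.eval O σ
  | .shl a s => a.eval O σ * 2 ^ (s.eval O σ).toNat
  | .shr a s => a.eval O σ / 2 ^ (s.eval O σ).toNat
  | .query i L => O (i.eval O σ).toNat (L.eval O σ).toNat

/-- The number of bit operations charged for the evaluation of an expression. Shifting by `s` to
the left is charged `s`, and requesting `L` bits of a stream is charged `L`. -/
def Expr.cost (O : ℕ → ℕ → ℤ) (σ : State) : Expr → ℕ
  | .const c => 1 + len c
  | .reg r => 1 + len (σ.reg r)
  | .get A i => i.cost O σ + 1 + len (i.eval O σ) + len (σ.mem A (i.eval O σ))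
  | .add a b => a.cost O σ + b.cost O σ + 1 + len (a.eval O σ) + len (b.eval O σ)
  | .sub a b => a.cost O σ + b.cost O σ + 1 + len (a.eval O σ) + len (b.eval O σ)
  | .mul a b => a.cost O σ + b.cost O σ + (1 + len (a.eval O σ)) * (1 + len (b.eval O σ))
  | .div a b => a.cost O σ + b.cost O σ + (1 + len (a.eval O σ)) * (1 + len (b.eval O σ))
  | .shl a s => a.cost O σ + s.cost O σ + 1 + len (a.eval O σ) + (s.eval O σ).toNat
  | .shr a s => a.cost O σ + s.cost O σ + 1 + len (a.eval O σ)
  | .query i L => i.cost O σ + L.cost O σ + 1 + len (i.eval O σ) + (L.eval O σ).toNat +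
      len (O (i.eval O σ).toNat (L.eval O σ).toNat)

/-- `Runs O c σ σ' t`: the program `c`, started in state `σ`, halts in state `σ'` after `t` bit
operations. -/
inductive Runs (O : ℕ → ℕ → ℤ) : Cmd → State → State → ℕ → Prop where
  | skip (σ : State) : Runs O .skip σ σ 1
  | assign (r : ℕ) (e : Expr) (σ : State) :
      Runs O (.assign r e) σ ⟨Function.update σ.reg r (e.eval O σ), σ.mem⟩
        (e.cost O σ + 1 + len (e.eval O σ))
  | put (A : ℕ) (i e : Expr) (σ : State) :
      Runs O (.put A i e) σ
        ⟨σ.reg, Function.update σ.mem A (Function.update (σ.mem A) (i.eval O σ) (e.eval O σ))⟩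
        (i.cost O σ + e.cost O σ + 1 + len (i.eval O σ) + len (e.eval O σ))
  | seq {c₁ c₂ : Cmd} {σ₁ σ₂ σ₃ : State} {t₁ t₂ : ℕ} :
      Runs O c₁ σ₁ σ₂ t₁ → Runs O c₂ σ₂ σ₃ t₂ → Runs O (.seq c₁ c₂) σ₁ σ₃ (t₁ + t₂)
  | branch_pos {e : Expr} {c₁ c₂ : Cmd} {σ σ' : State} {t : ℕ} :
      0 < e.eval O σ → Runs O c₁ σ σ' t → Runs O (.branch e c₁ c₂) σ σ' (e.cost O σ + 1 + t)
  | branch_nonpos {e : Expr} {c₁ c₂ : Cmd} {σ σ' : State} {t : ℕ} :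
      e.eval O σ ≤ 0 → Runs O c₂ σ σ' t → Runs O (.branch e c₁ c₂) σ σ' (e.cost O σ + 1 + t)
  | loop_done {e : Expr} {c : Cmd} {σ : State} :
      e.eval O σ ≤ 0 → Runs O (.loop e c) σ σ (e.cost O σ + 1)
  | loop_step {e : Expr} {c : Cmd} {σ₁ σ₂ σ₃ : State} {t₁ t₂ : ℕ} :
      0 < e.eval O σ₁ → Runs O c σ₁ σ₂ t₁ → Runs O (.loop e c) σ₂ σ₃ t₂ →
        Runs O (.loop e c) σ₁ σ₃ (e.cost O σ₁ + 1 + t₁ + t₂)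

/-- The state in which registers `0, 1, 2` hold `n, N, m` and everything else is zero. -/
def initState (n N m : ℕ) : State where
  reg := fun r => if r = 0 then n else if r = 1 then N else if r = 2 then m else 0
  mem := fun _ _ => 0

/-- `s` is a bit stream of the real number `x`: what it delivers on a request for `L` bits is `x`
cut off after `L` binary digits behind the point, up to one unit in the last of them. All binary
expansions of `x`, signed or in two's complement, are covered. -/
def IsBitStream (x : ℝ) (s : ℕ → ℤ) : Prop :=
  ∀ L : ℕ, |x * 2 ^ L - (s L : ℝ)| ≤ 1

/-- The input streams `O` present the number `z` (real part in stream `0`, imaginary part in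
stream `1`) and the polynomial `p` with common binary exponent `E`: the coefficient of `Xᵏ`,
divided by `2 ^ E`, has its real part in stream `2k + 2` and its imaginary part in stream
`2k + 3`. The exponent fits `p`: no coefficient exceeds `2 ^ E`, and `2 ^ E` is at most `2 ‖p‖₁`
(in particular `p ≠ 0`; every nonzero `p` has such an `E`). -/
structure Presents (O : ℕ → ℕ → ℤ) (z : ℂ) (p : Polynomial ℂ) (E : ℤ) : Prop where
  coeff_le : ∀ k : ℕ, ‖p.coeff k‖ ≤ (2 : ℝ) ^ E
  le_norm : (2 : ℝ) ^ E ≤ 2 * coeffNorm p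
  re_z : IsBitStream z.re (O 0)
  im_z : IsBitStream z.im (O 1)
  re_coeff : ∀ k : ℕ, IsBitStream ((p.coeff k).re / (2 : ℝ) ^ E) (O (2 * k + 2))
  im_coeff : ∀ k : ℕ, IsBitStream ((p.coeff k).im / (2 : ℝ) ^ E) (O (2 * k + 3))

/-- The `k`-th output of a halted machine, for inputs with common binary exponent `E`: arrays `0`
and `1` hold the real and imaginary parts as integers, to be divided by `2 ^ s`, where `s` is the
content of register `0`. -/
noncomputable def output (σ : State) (E : ℤ) (k : ℕ) : ℂ :=
  ((σ.mem 0 k : ℂ) + (σ.mem 1 k : ℂ) * Complex.I) * (2 : ℂ) ^ (E - σ.reg 0)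

end BitRAM

/-!
# Evaluation of a polynomial at equidistant points of a circle

Inside the disc of radius `1 - 2⁻ⁿ`, the terms of degree at least `D = 2ⁿ (m + 2)` of a polynomial
`p` contribute less than `‖p‖₁ / 2^(m + 2)` to its values (`norm_eval_sub_sum_le`, `pow_terms_lt`),
so the degree of `p` plays no role. Let `ν = 8 N` and `η = exp (π i / ν)`, so that `η^(2ν) = 1` and
the points are `z η^(2K)` for `K = 8 k`. Adding up the terms `aₖ zᵏ` in residue classes modulo `ν`
(`sum_foldSum`) leaves the `ν` coefficients `cⱼ` of a discrete Fourier transform whose length need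
not be a power of two. The identity `2 j K = j² + K² - (K - j)²` makes it a convolution of
`cⱼ η^(j²)` with the chirp `η^(-t²)` (`bluestein`), of which a cyclic convolution of length
`R = 2^(n + 8) ≥ 2 ν` is enough. It is computed by three Fourier transforms of length `R`
(`convC_spec`). All of this is done in fixed-point arithmetic with `q = 100 (n + m)` binary digits,
starting from `π` and the exponential series (`piC_spec`, `rootC_spec`); the errors stay below
`2^(9 (n + m) + 58)` units of the last place (`eval_bounds`), far below the required precision.

The procedure needs `O(D + R log R)` multiplications of numbers of `O(n + m)` bits, and
`D + R log R` is `O(2ⁿ (n + m))`. The bound to be proved hence leaves `O((n + m) polylog m)` bit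
operations for a multiplication, while the built-in one is charged `(n + m)²`. There are two cases.

* If `m ≤ n`, there is time to tabulate the squares of all numbers of `n + 1` bits. The factors have
  a bounded number of digits in base `2ⁿ`, and the products of the digits are read off the table by
  `4 x y = (x + y)² - (x - y)²` (`tableMulC_spec`, `tablePrepC_spec`).
* If `n < m`, the bits of the factors are convolved by Fourier transforms of length `2^κ = O(m)`, in
  fixed-point arithmetic with `O(κ)` digits and the built-in multiplication, and the result is rounded
  (`fftMulC_spec`, `fftPrepC_spec`). This takes `O(m κ³)` bit operations, and `κ = O(log m)`.

Programs are treated by total correctness triples `Tri` with a bound for the running time. The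
subroutines are placed relative to a base register, and `Same` records the registers and the arrays
that they leave alone. Thus the same Fourier transform serves for both purposes, with different
multiplication routines (`RMul`, `CMul`) plugged in. A complex array
`A` is the pair of arrays `A`, `A + 1` of the real and imaginary parts.
-/

namespace BitRAM

/-! ### Bit lengths -/

theorem len_le_iff {x : ℤ} {L : ℕ} : len x ≤ L ↔ |x| < 2 ^ L := by
  unfold len
  rw [Nat.size_le, Int.abs_eq_natAbs]
  exact_mod_cast Iff.rfl

theorem abs_lt_two_pow_len (x : ℤ) : |x| < 2 ^ len x := len_le_iff.1 le_rfl

theorem len_add_le {a b : ℤ} {L : ℕ} (ha : len a ≤ L) (hb : len b ≤ L) : len (a + b) ≤ L + 1 := by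
  rw [len_le_iff] at *
  have := abs_add_le a b
  rw [pow_succ]; omega

theorem len_neg (a : ℤ) : len (-a) = len a := by simp [len]

theorem len_sub_le {a b : ℤ} {L : ℕ} (ha : len a ≤ L) (hb : len b ≤ L) : len (a - b) ≤ L + 1 := by
  rw [sub_eq_add_neg]; exact len_add_le ha (by rwa [len_neg])

theorem len_mul_le (a b : ℤ) : len (a * b) ≤ len a + len b := by
  rw [len_le_iff, abs_mul, pow_add]
  exact mul_lt_mul'' (abs_lt_two_pow_len a) (abs_lt_two_pow_len b) (abs_nonneg _) (abs_nonneg _)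

theorem len_ediv_le (a b : ℤ) : len (a / b) ≤ len a := by
  unfold len
  exact Nat.size_le_size (Int.natAbs_ediv_le_natAbs a b)

theorem len_two_pow (k : ℕ) : len (2 ^ k) = k + 1 := by
  apply le_antisymm
  · rw [len_le_iff, abs_of_pos (by positivity)]
    exact pow_lt_pow_right₀ (by norm_num) (by omega)
  · by_contra h
    have h' : len ((2 : ℤ) ^ k) ≤ k := by omega
    rw [len_le_iff, abs_of_pos (by positivity)] at h'
    exact lt_irrefl _ h'

theorem len_mul_two_pow_le (a : ℤ) (k : ℕ) : len (a * 2 ^ k) ≤ len a + k := by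
  rw [len_le_iff, abs_mul, pow_add, abs_of_pos (by positivity : (0 : ℤ) < 2 ^ k)]
  exact mul_lt_mul_of_pos_right (abs_lt_two_pow_len a) (by positivity)

theorem len_natCast_le {k L : ℕ} : len (k : ℤ) ≤ L ↔ k < 2 ^ L := by
  rw [len, Int.natAbs_natCast, Nat.size_le]

theorem len_natCast_mono {a b : ℕ} (h : a ≤ b) : len (a : ℤ) ≤ len (b : ℤ) := by
  simp only [len, Int.natAbs_natCast]
  exact Nat.size_le_size h

theorem len_natCast_le_self (k : ℕ) : len (k : ℤ) ≤ k :=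
  len_natCast_le.2 Nat.lt_two_pow_self

/-! ### States and expressions -/

/-- The state with register `r` overwritten. -/
def State.setR (σ : State) (r : ℕ) (v : ℤ) : State := ⟨Function.update σ.reg r v, σ.mem⟩

/-- The state with one array entry overwritten. -/
def State.setM (σ : State) (A : ℕ) (i v : ℤ) : State :=
  ⟨σ.reg, Function.update σ.mem A (Function.update (σ.mem A) i v)⟩

@[simp] theorem State.setR_reg (σ : State) (r : ℕ) (v : ℤ) (r' : ℕ) :
    (σ.setR r v).reg r' = if r' = r then v else σ.reg r' := by
  simp [State.setR, Function.update_apply]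

@[simp] theorem State.setR_mem (σ : State) (r : ℕ) (v : ℤ) : (σ.setR r v).mem = σ.mem := rfl

@[simp] theorem State.setM_reg (σ : State) (A : ℕ) (i v : ℤ) : (σ.setM A i v).reg = σ.reg := rfl

@[simp] theorem State.setM_mem (σ : State) (A : ℕ) (i v : ℤ) (A' : ℕ) (j : ℤ) :
    (σ.setM A i v).mem A' j = if A' = A ∧ j = i then v else σ.mem A' j := by
  by_cases h : A' = A
  · subst h; simp [State.setM, Function.update_apply]
  · simp [State.setM, h]

namespace Expr

/-- The number of nodes of an expression. -/
def sz : Expr → ℕ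
  | const _ => 1
  | reg _ => 1
  | get _ i => i.sz + 1
  | add a b => a.sz + b.sz + 1
  | sub a b => a.sz + b.sz + 1
  | mul a b => a.sz + b.sz + 1
  | div a b => a.sz + b.sz + 1
  | shl a s => a.sz + s.sz + 1
  | shr a s => a.sz + s.sz + 1
  | query i l => i.sz + l.sz + 1

/-- All inputs of the expression have at most `L` bits, shift amounts and requested precisions are
at most `L`, and in each product or quotient one operand has at most `ℓ` bits. -/
def Leaf (O : ℕ → ℕ → ℤ) (σ : State) (L ℓ : ℕ) : Expr → Prop
  | const c => len c ≤ L
  | reg r => len (σ.reg r) ≤ L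
  | get A i => i.Leaf O σ L ℓ ∧ len (σ.mem A (i.eval O σ)) ≤ L
  | add a b => a.Leaf O σ L ℓ ∧ b.Leaf O σ L ℓ
  | sub a b => a.Leaf O σ L ℓ ∧ b.Leaf O σ L ℓ
  | mul a b => a.Leaf O σ L ℓ ∧ b.Leaf O σ L ℓ ∧ (len (a.eval O σ) ≤ ℓ ∨ len (b.eval O σ) ≤ ℓ)
  | div a b => a.Leaf O σ L ℓ ∧ b.Leaf O σ L ℓ ∧ (len (a.eval O σ) ≤ ℓ ∨ len (b.eval O σ) ≤ ℓ)
  | shl a s => a.Leaf O σ L ℓ ∧ s.Leaf O σ L ℓ ∧ (s.eval O σ).toNat ≤ L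
  | shr a s => a.Leaf O σ L ℓ ∧ s.Leaf O σ L ℓ
  | query i l => i.Leaf O σ L ℓ ∧ l.Leaf O σ L ℓ ∧ (l.eval O σ).toNat ≤ L ∧
      len (O (i.eval O σ).toNat (l.eval O σ).toNat) ≤ L

variable {O : ℕ → ℕ → ℤ} {σ : State} {L ℓ : ℕ}

theorem len_eval_le (hL : 1 ≤ L) : ∀ e : Expr, e.Leaf O σ L ℓ → len (e.eval O σ) ≤ e.sz * L
  | const c, h => by simpa [sz, eval, Leaf] using h
  | reg r, h => by simpa [sz, eval, Leaf] using h
  | get A i, h => by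
      have := h.2
      simp only [sz, eval]; nlinarith
  | add a b, h => by
      have ha := len_eval_le hL a h.1
      have hb := len_eval_le hL b h.2
      simp only [sz, eval]
      have := len_add_le (L := a.sz * L + b.sz * L) (ha.trans (by omega)) (hb.trans (by omega))
      nlinarith
  | sub a b, h => by
      have ha := len_eval_le hL a h.1
      have hb := len_eval_le hL b h.2
      simp only [sz, eval]
      have := len_sub_le (L := a.sz * L + b.sz * L) (ha.trans (by omega)) (hb.trans (by omega))
      nlinarith
  | mul a b, h => by
      have ha := len_eval_le hL a h.1
      have hb := len_eval_le hL b h.2.1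
      simp only [sz, eval]
      have := len_mul_le (a.eval O σ) (b.eval O σ)
      nlinarith
  | div a b, h => by
      have ha := len_eval_le hL a h.1
      simp only [sz, eval]
      have := len_ediv_le (a.eval O σ) (b.eval O σ)
      nlinarith
  | shl a s, h => by
      have ha := len_eval_le hL a h.1
      have hs := h.2.2
      simp only [sz, eval]
      have := len_mul_two_pow_le (a.eval O σ) (s.eval O σ).toNat
      nlinarith
  | shr a s, h => by
      have ha := len_eval_le hL a h.1
      simp only [sz, eval]
      have := len_ediv_le (a.eval O σ) (2 ^ (s.eval O σ).toNat)
      nlinarith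
  | query i l, h => by
      have := h.2.2.2
      simp only [sz, eval]
      nlinarith

/-- Up to a factor that depends on the expression only, the evaluation costs `L (1 + ℓ)`: a product of
a number of `L` bits with one of `ℓ` bits is charged `L ℓ`, and everything else is charged linearly. -/
theorem cost_le (hL : 1 ≤ L) : ∀ e : Expr, e.Leaf O σ L ℓ →
    e.cost O σ ≤ 4 * e.sz ^ 2 * (L * (1 + ℓ))
  | const c, h => by
      simp only [sz, cost, Leaf] at *
      nlinarith [Nat.zero_le (L * ℓ)]
  | reg r, h => by
      simp only [sz, cost, Leaf] at *
      nlinarith [Nat.zero_le (L * ℓ)]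
  | get A i, h => by
      have hi := len_eval_le hL i h.1
      have ci := cost_le hL i h.1
      have hl := h.2
      simp only [sz, cost]
      have hX : L ≤ L * (1 + ℓ) := by nlinarith [Nat.zero_le (L * ℓ)]
      generalize L * (1 + ℓ) = X at *
      nlinarith [Nat.mul_le_mul_left i.sz hX, Nat.zero_le (i.sz * X)]
  | add a b, h => by
      have ha := len_eval_le hL a h.1
      have hb := len_eval_le hL b h.2
      have ca := cost_le hL a h.1
      have cb := cost_le hL b h.2
      simp only [sz, cost]
      have hX : L ≤ L * (1 + ℓ) := by nlinarith [Nat.zero_le (L * ℓ)]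
      generalize L * (1 + ℓ) = X at *
      nlinarith [Nat.mul_le_mul_left a.sz hX, Nat.mul_le_mul_left b.sz hX,
        Nat.zero_le (a.sz * X), Nat.zero_le (b.sz * X), Nat.zero_le (a.sz * b.sz * X)]
  | sub a b, h => by
      have ha := len_eval_le hL a h.1
      have hb := len_eval_le hL b h.2
      have ca := cost_le hL a h.1
      have cb := cost_le hL b h.2
      simp only [sz, cost]
      have hX : L ≤ L * (1 + ℓ) := by nlinarith [Nat.zero_le (L * ℓ)]
      generalize L * (1 + ℓ) = X at *
      nlinarith [Nat.mul_le_mul_left a.sz hX, Nat.mul_le_mul_left b.sz hX,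
        Nat.zero_le (a.sz * X), Nat.zero_le (b.sz * X), Nat.zero_le (a.sz * b.sz * X)]
  | mul a b, h => by
      have ha := len_eval_le hL a h.1
      have hb := len_eval_le hL b h.2.1
      have ca := cost_le hL a h.1
      have cb := cost_le hL b h.2.1
      have key : (1 + len (a.eval O σ)) * (1 + len (b.eval O σ)) ≤
          (1 + a.sz + b.sz) * (L * (1 + ℓ)) := by
        rcases h.2.2 with h' | h'
        · calc _ ≤ (1 + ℓ) * (L + b.sz * L) := by gcongr
            _ ≤ _ := by nlinarith [Nat.zero_le (a.sz * (L * (1 + ℓ)))]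
        · calc _ ≤ (L + a.sz * L) * (1 + ℓ) := by gcongr
            _ ≤ _ := by nlinarith [Nat.zero_le (b.sz * (L * (1 + ℓ)))]
      simp only [sz, cost]
      generalize L * (1 + ℓ) = X at *
      nlinarith [Nat.zero_le (a.sz * X), Nat.zero_le (b.sz * X), Nat.zero_le (a.sz * b.sz * X)]
  | div a b, h => by
      have ha := len_eval_le hL a h.1
      have hb := len_eval_le hL b h.2.1
      have ca := cost_le hL a h.1
      have cb := cost_le hL b h.2.1
      have key : (1 + len (a.eval O σ)) * (1 + len (b.eval O σ)) ≤
          (1 + a.sz + b.sz) * (L * (1 + ℓ)) := by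
        rcases h.2.2 with h' | h'
        · calc _ ≤ (1 + ℓ) * (L + b.sz * L) := by gcongr
            _ ≤ _ := by nlinarith [Nat.zero_le (a.sz * (L * (1 + ℓ)))]
        · calc _ ≤ (L + a.sz * L) * (1 + ℓ) := by gcongr
            _ ≤ _ := by nlinarith [Nat.zero_le (b.sz * (L * (1 + ℓ)))]
      simp only [sz, cost]
      generalize L * (1 + ℓ) = X at *
      nlinarith [Nat.zero_le (a.sz * X), Nat.zero_le (b.sz * X), Nat.zero_le (a.sz * b.sz * X)]
  | shl a s, h => by
      have ha := len_eval_le hL a h.1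
      have hs := h.2.2
      have ca := cost_le hL a h.1
      have cb := cost_le hL s h.2.1
      simp only [sz, cost]
      have hX : L ≤ L * (1 + ℓ) := by nlinarith [Nat.zero_le (L * ℓ)]
      generalize L * (1 + ℓ) = X at *
      nlinarith [Nat.mul_le_mul_left a.sz hX, Nat.mul_le_mul_left s.sz hX,
        Nat.zero_le (a.sz * X), Nat.zero_le (s.sz * X), Nat.zero_le (a.sz * s.sz * X)]
  | shr a s, h => by
      have ha := len_eval_le hL a h.1
      have ca := cost_le hL a h.1
      have cb := cost_le hL s h.2
      simp only [sz, cost]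
      have hX : L ≤ L * (1 + ℓ) := by nlinarith [Nat.zero_le (L * ℓ)]
      generalize L * (1 + ℓ) = X at *
      nlinarith [Nat.mul_le_mul_left a.sz hX, Nat.mul_le_mul_left s.sz hX,
        Nat.zero_le (a.sz * X), Nat.zero_le (s.sz * X), Nat.zero_le (a.sz * s.sz * X)]
  | query i l, h => by
      have hi := len_eval_le hL i h.1
      have h1 := h.2.2.1
      have h2 := h.2.2.2
      have ca := cost_le hL i h.1
      have cb := cost_le hL l h.2.1
      simp only [sz, cost]
      have hX : L ≤ L * (1 + ℓ) := by nlinarith [Nat.zero_le (L * ℓ)]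
      generalize L * (1 + ℓ) = X at *
      nlinarith [Nat.mul_le_mul_left i.sz hX, Nat.mul_le_mul_left l.sz hX,
        Nat.zero_le (i.sz * X), Nat.zero_le (l.sz * X), Nat.zero_le (i.sz * l.sz * X)]

end Expr

/-! ### Straight-line programs -/

namespace Cmd

/-- The effect of a straight-line program. -/
def exec (O : ℕ → ℕ → ℤ) : Cmd → State → State
  | assign r e, σ => σ.setR r (e.eval O σ)
  | put A i e, σ => σ.setM A (i.eval O σ) (e.eval O σ)
  | seq c₁ c₂, σ => c₂.exec O (c₁.exec O σ)
  | _, σ => σ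

/-- Programs without branches and loops. -/
def Straight : Cmd → Prop
  | skip => True
  | assign _ _ => True
  | put _ _ _ => True
  | seq c₁ c₂ => c₁.Straight ∧ c₂.Straight
  | _ => False

/-- The size of a straight-line program. -/
def sz : Cmd → ℕ
  | assign _ e => e.sz + 1
  | put _ i e => i.sz + e.sz + 1
  | seq c₁ c₂ => c₁.sz + c₂.sz
  | _ => 1

/-- `Expr.Leaf` for all expressions evaluated by a straight-line program. -/
def Leaf (O : ℕ → ℕ → ℤ) (L ℓ : ℕ) : Cmd → State → Prop
  | assign _ e, σ => e.Leaf O σ L ℓ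
  | put _ i e, σ => i.Leaf O σ L ℓ ∧ e.Leaf O σ L ℓ
  | seq c₁ c₂, σ => c₁.Leaf O L ℓ σ ∧ c₂.Leaf O L ℓ (c₁.exec O σ)
  | _, _ => True

/-- A straight-line program halts with the effect `Cmd.exec`, at the cost known from its expressions. -/
theorem runs_exec {O : ℕ → ℕ → ℤ} {L ℓ : ℕ} (hL : 1 ≤ L) : ∀ (c : Cmd) (σ : State),
    c.Straight → c.Leaf O L ℓ σ →
      ∃ t, Runs O c σ (c.exec O σ) t ∧ t ≤ 4 * c.sz ^ 2 * (L * (1 + ℓ))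
  | skip, σ, _, _ => ⟨1, .skip σ, by simp only [sz]; nlinarith [Nat.zero_le (L * ℓ)]⟩
  | assign r e, σ, _, h => by
      refine ⟨_, .assign r e σ, ?_⟩
      have h1 := e.cost_le hL h
      have h2 := e.len_eval_le hL h
      simp only [sz]
      have hX : L ≤ L * (1 + ℓ) := by nlinarith [Nat.zero_le (L * ℓ)]
      generalize L * (1 + ℓ) = X at *
      nlinarith [Nat.mul_le_mul_left e.sz hX, Nat.zero_le (e.sz * X)]
  | put A i e, σ, _, h => by
      refine ⟨_, .put A i e σ, ?_⟩
      have h1 := e.cost_le hL h.2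
      have h2 := e.len_eval_le hL h.2
      have h3 := i.cost_le hL h.1
      have h4 := i.len_eval_le hL h.1
      simp only [sz]
      have hX : L ≤ L * (1 + ℓ) := by nlinarith [Nat.zero_le (L * ℓ)]
      generalize L * (1 + ℓ) = X at *
      nlinarith [Nat.mul_le_mul_left e.sz hX, Nat.mul_le_mul_left i.sz hX, Nat.zero_le (e.sz * X),
        Nat.zero_le (i.sz * X), Nat.zero_le (i.sz * e.sz * X)]
  | seq c₁ c₂, σ, hs, h => by
      obtain ⟨t₁, r₁, h₁⟩ := runs_exec hL c₁ σ hs.1 h.1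
      obtain ⟨t₂, r₂, h₂⟩ := runs_exec hL c₂ _ hs.2 h.2
      refine ⟨_, .seq r₁ r₂, ?_⟩
      simp only [sz]
      nlinarith [Nat.zero_le (c₁.sz * c₂.sz * (L * (1 + ℓ)))]

end Cmd

/-! ### Total correctness with a bound for the running time -/

/-- Started in `σ`, the program `c` halts after at most `T` bit operations in a state that
satisfies `Q`. -/
def Tri (O : ℕ → ℕ → ℤ) (c : Cmd) (σ : State) (T : ℕ) (Q : State → Prop) : Prop :=
  ∃ σ' t, Runs O c σ σ' t ∧ t ≤ T ∧ Q σ'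

namespace Tri

variable {O : ℕ → ℕ → ℤ}

theorem mono {c : Cmd} {σ : State} {T T' : ℕ} {Q Q' : State → Prop} (h : Tri O c σ T Q)
    (hT : T ≤ T') (hQ : ∀ σ', Q σ' → Q' σ') : Tri O c σ T' Q' := by
  obtain ⟨σ', t, h₁, h₂, h₃⟩ := h
  exact ⟨σ', t, h₁, h₂.trans hT, hQ _ h₃⟩

theorem seq {c₁ c₂ : Cmd} {σ : State} {T₁ T₂ : ℕ} {Q R : State → Prop} (h₁ : Tri O c₁ σ T₁ Q)
    (h₂ : ∀ σ', Q σ' → Tri O c₂ σ' T₂ R) : Tri O (.seq c₁ c₂) σ (T₁ + T₂) R := by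
  obtain ⟨σ₁, t₁, r₁, l₁, q₁⟩ := h₁
  obtain ⟨σ₂, t₂, r₂, l₂, q₂⟩ := h₂ _ q₁
  exact ⟨σ₂, _, .seq r₁ r₂, by omega, q₂⟩

theorem straight {c : Cmd} {σ : State} {L ℓ : ℕ} {Q : State → Prop} (hL : 1 ≤ L)
    (hs : c.Straight) (hl : c.Leaf O L ℓ σ) (hQ : Q (c.exec O σ)) :
    Tri O c σ (4 * c.sz ^ 2 * (L * (1 + ℓ))) Q := by
  obtain ⟨t, r, h⟩ := c.runs_exec hL σ hs hl
  exact ⟨_, t, r, h, hQ⟩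

/-- `Tri.straight` with a numeral for the size of the program. -/
theorem line (s : ℕ) {c : Cmd} {σ : State} {L ℓ : ℕ} {Q : State → Prop} (hL : 1 ≤ L)
    (hs : c.Straight) (hsz : c.sz ≤ s) (hl : c.Leaf O L ℓ σ) (hQ : Q (c.exec O σ)) :
    Tri O c σ (4 * s ^ 2 * (L * (1 + ℓ))) Q :=
  (straight hL hs hl hQ).mono (by gcongr) fun _ h => h

theorem branch {e : Expr} {c₁ c₂ : Cmd} {σ : State} {T T' : ℕ} {Q : State → Prop}
    (he : e.cost O σ + 1 ≤ T')
    (h₁ : 0 < e.eval O σ → Tri O c₁ σ T Q) (h₂ : e.eval O σ ≤ 0 → Tri O c₂ σ T Q) :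
    Tri O (.branch e c₁ c₂) σ (T' + T) Q := by
  rcases lt_or_ge 0 (e.eval O σ) with h | h
  · obtain ⟨σ', t, r, l, q⟩ := h₁ h
    exact ⟨σ', _, .branch_pos h r, by omega, q⟩
  · obtain ⟨σ', t, r, l, q⟩ := h₂ h
    exact ⟨σ', _, .branch_nonpos h r, by omega, q⟩

/-- A loop with an invariant `I k` that refers to the number `k` of completed iterations. -/
theorem loop {e : Expr} {c : Cmd} (I : ℕ → State → Prop) (N : ℕ) (T : ℕ → ℕ) (T' : ℕ)
    (htest : ∀ k σ, k ≤ N → I k σ → (0 < e.eval O σ ↔ k < N) ∧ e.cost O σ + 1 ≤ T')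
    (hbody : ∀ k σ, k < N → I k σ → Tri O c σ (T k) (I (k + 1))) {σ : State} (h0 : I 0 σ) :
    Tri O (.loop e c) σ (∑ k ∈ Finset.range N, T k + (N + 1) * T') (I N) := by
  suffices H : ∀ d k σ, k + d = N → I k σ →
      Tri O (.loop e c) σ (∑ j ∈ Finset.Ico k N, T j + (d + 1) * T') (I N) by
    simpa using H N 0 σ (by omega) h0
  intro d
  induction d with
  | zero =>
    intro k σ hk hI
    obtain rfl : k = N := by omega
    obtain ⟨h₁, h₂⟩ := htest k σ le_rfl hI
    exact ⟨σ, _, .loop_done (by by_contra h; exact lt_irrefl _ (h₁.1 (by omega))),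
      by simpa using h₂, hI⟩
  | succ d ih =>
    intro k σ hk hI
    obtain ⟨h₁, h₂⟩ := htest k σ (by omega) hI
    obtain ⟨σ₁, t₁, r₁, l₁, q₁⟩ := hbody k σ (by omega) hI
    obtain ⟨σ₂, t₂, r₂, l₂, q₂⟩ := ih (k + 1) σ₁ (by omega) q₁
    refine ⟨σ₂, _, .loop_step (h₁.2 (by omega)) r₁ r₂, ?_, q₂⟩
    rw [Finset.sum_eq_sum_Ico_succ_bot (by omega : k < N)]
    have : (d + 1 + 1) * T' = (d + 1) * T' + T' := by ring
    omega

end Tri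

/-- Run `body` for the values `0, 1, …` of register `i` below the content of register `cnt`. -/
def Cmd.for (i cnt : ℕ) (body : Cmd) : Cmd :=
  .seq (.assign i (.const 0))
    (.loop (.sub (.reg cnt) (.reg i)) (.seq body (.assign i (.add (.reg i) (.const 1)))))

/-- A counted loop with the invariant `I`. The body has to establish the next instance of `I` for the
state in which the counter has been increased; it does not increase the counter itself. -/
theorem Tri.for {O : ℕ → ℕ → ℤ} {i cnt : ℕ} {body : Cmd} (I : ℕ → State → Prop) (N : ℕ)
    (T : ℕ → ℕ) {L : ℕ} (hN : len (N : ℤ) ≤ L) (hL : 1 ≤ L)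
    (hcnt : ∀ k σ, I k σ → σ.reg cnt = N) (hi : ∀ k σ, I k σ → σ.reg i = k)
    (hbody : ∀ k σ, k < N → I k σ → Tri O body σ (T k)
      (fun σ' => σ'.reg i = k ∧ I (k + 1) (σ'.setR i (k + 1))))
    {σ : State} (h0 : I 0 (σ.setR i 0)) :
    Tri O (Cmd.for i cnt body) σ (∑ k ∈ Finset.range N, T k + (N + 1) * (100 * L)) (I N) := by
  have h₁ : Tri O (.assign i (.const 0)) σ 3 (I 0) :=
    ⟨_, _, .assign i _ σ, by simp [Expr.cost, len, Expr.eval], h0⟩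
  have hlen : ∀ k ≤ N, len (k : ℤ) ≤ L := fun k hk => (len_natCast_mono hk).trans hN
  refine (h₁.seq (T₂ := ∑ k ∈ Finset.range N, (T k + 64 * L) + (N + 1) * (5 * L + 4))
    fun σ' h' => Tri.loop I N (fun k => T k + 64 * L) (5 * L + 4) ?_ ?_ h').mono ?_ fun _ h => h
  · intro k σ hk hI
    have a := hcnt k σ hI
    have b := hi k σ hI
    have := hlen k hk
    simp only [Expr.eval, Expr.cost, a, b]
    refine ⟨by omega, by omega⟩
  · intro k σ hk hI
    refine ((hbody k σ hk hI).seq (T₂ := 64 * L) (R := I (k + 1)) ?_)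
    rintro σ' ⟨hr, hI'⟩
    have := hlen k hk.le
    refine ((Tri.straight (c := .assign i (.add (.reg i) (.const 1))) (L := L) (ℓ := 0)
      (Q := I (k + 1)) hL trivial ?_ ?_).mono ?_ fun _ h => h)
    · simp [Cmd.Leaf, Expr.Leaf, hr, this]
      exact (by decide : len 1 = 1) ▸ hL
    · simpa [Cmd.exec, Expr.eval, hr] using hI'
    · simp [Cmd.sz, Expr.sz]
  · simp only [Finset.sum_add_distrib, Finset.sum_const, Finset.card_range, smul_eq_mul]
    nlinarith

/-- The states `σ` and `σ'` agree on the registers in `R` and on the arrays in `A`. -/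
def Same (R A : ℕ → Prop) (σ σ' : State) : Prop :=
  (∀ r, R r → σ'.reg r = σ.reg r) ∧ ∀ a, A a → ∀ j, σ'.mem a j = σ.mem a j

/-! ### Multiplication routines -/

/-- The program `mu` multiplies the integers in registers `B` and `B + 1` exactly, provided they
are at most `2 ^ Q` in absolute value, and leaves the product in register `B + 2`, with at most `M`
bit operations. It works in registers and arrays numbered from `B` on. The predicate `I` says that
the data prepared for the routine are in place; they are not kept in registers `B`, `B + 1`,
`B + 2`. -/
structure RMul (O : ℕ → ℕ → ℤ) (B : ℕ) (mu : Cmd) (I : State → Prop) (Q M : ℕ) : Prop where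
  stable : ∀ σ σ', I σ → Same (fun r => B + 3 ≤ r) (fun a => B ≤ a) σ σ' → I σ'
  run : ∀ σ, I σ → |σ.reg B| ≤ 2 ^ Q → |σ.reg (B + 1)| ≤ 2 ^ Q →
    Tri O mu σ M fun σ' => I σ' ∧ σ'.reg (B + 2) = σ.reg B * σ.reg (B + 1) ∧
      Same (· < B) (· < B) σ σ'

/-- The program `cm` multiplies the complex fixed-point numbers with real and imaginary parts in
registers `c`, `c + 1` and `c + 2`, `c + 3`, with `q` digits behind the binary point, and leaves
the product in registers `c + 5`, `c + 6`. Register `c + 4` holds `q`. -/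
structure CMul (O : ℕ → ℕ → ℤ) (c : ℕ) (cm : Cmd) (J : State → Prop) (q Q M : ℕ) : Prop where
  stable : ∀ σ σ', J σ → Same (fun r => c + 4 ≤ r ∧ r ≠ c + 5 ∧ r ≠ c + 6) (fun a => c ≤ a) σ σ' →
    J σ'
  prec : ∀ σ, J σ → σ.reg (c + 4) = q
  run : ∀ σ, J σ → |σ.reg c| ≤ 2 ^ Q → |σ.reg (c + 1)| ≤ 2 ^ Q → |σ.reg (c + 2)| ≤ 2 ^ Q →
    |σ.reg (c + 3)| ≤ 2 ^ Q →
    Tri O cm σ M fun σ' => J σ' ∧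
      σ'.reg (c + 5) =
        (σ.reg c * σ.reg (c + 2) - σ.reg (c + 1) * σ.reg (c + 3)) / 2 ^ q ∧
      σ'.reg (c + 6) =
        (σ.reg c * σ.reg (c + 3) + σ.reg (c + 1) * σ.reg (c + 2)) / 2 ^ q ∧
      Same (· < c) (· < c) σ σ'

/-- The routine that uses the built-in multiplication. -/
def builtinMul (B : ℕ) : Cmd := .assign (B + 2) (.mul (.reg B) (.reg (B + 1)))

theorem len_le_of_abs_le {x : ℤ} {Q L : ℕ} (h : |x| ≤ 2 ^ Q) (hL : Q + 1 ≤ L) : len x ≤ L :=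
  (len_le_iff.2 (h.trans_lt (by rw [pow_succ]; linarith [pow_pos (two_pos : (0 : ℤ) < 2) Q]))).trans
    hL

theorem builtinMul_spec (O : ℕ → ℕ → ℤ) (B Q : ℕ) :
    RMul O B (builtinMul B) (fun _ => True) Q (64 * ((Q + 1) * (Q + 2))) where
  stable _ _ _ _ := trivial
  run σ _ h₁ h₂ := by
    refine (Tri.straight (L := Q + 1) (ℓ := Q + 1) (by omega) (by simp [builtinMul, Cmd.Straight]) ?_ ?_).mono ?_ fun _ h => h
    · have := len_le_of_abs_le h₁ le_rfl
      have := len_le_of_abs_le h₂ le_rfl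
      simp [builtinMul, Cmd.Leaf, Expr.Leaf, Expr.eval, *]
    · simp only [builtinMul, Cmd.exec, Expr.eval, Same]
      refine ⟨trivial, by simp, ?_, ?_⟩
      · intro r hr; simp; omega
      · intro a _ j; simp
    · simp [builtinMul, Cmd.sz, Expr.sz]; nlinarith

/-- The complex product made from four calls of a real multiplication routine. -/
def complexMul (c : ℕ) (mu : Cmd) : Cmd :=
  .seq (.seq (.assign (c + 8) (.reg c)) (.assign (c + 9) (.reg (c + 2)))) <| .seq mu <|
  .seq (.seq (.assign (c + 7) (.reg (c + 10)))
    (.seq (.assign (c + 8) (.reg (c + 1))) (.assign (c + 9) (.reg (c + 3))))) <| .seq mu <|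
  .seq (.seq (.assign (c + 5) (.shr (.sub (.reg (c + 7)) (.reg (c + 10))) (.reg (c + 4))))
    (.seq (.assign (c + 8) (.reg c)) (.assign (c + 9) (.reg (c + 3))))) <| .seq mu <|
  .seq (.seq (.assign (c + 7) (.reg (c + 10)))
    (.seq (.assign (c + 8) (.reg (c + 1))) (.assign (c + 9) (.reg (c + 2))))) <| .seq mu <|
  .assign (c + 6) (.shr (.add (.reg (c + 7)) (.reg (c + 10))) (.reg (c + 4)))

theorem abs_mul_le_two_pow {a b : ℤ} {P Q : ℕ} (ha : |a| ≤ 2 ^ P) (hb : |b| ≤ 2 ^ Q) :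
    |a * b| ≤ 2 ^ (P + Q) := by
  rw [abs_mul, pow_add]; exact mul_le_mul ha hb (abs_nonneg _) (by positivity)

/-- A real multiplication routine makes a complex one. The products have `2 Q` bits, and the final
shifts round them down. -/
theorem complexMul_spec {O : ℕ → ℕ → ℤ} {c : ℕ} {mu : Cmd} {I : State → Prop} {q Q M L : ℕ}
    (h : RMul O (c + 8) mu I Q M) (hq : len (q : ℤ) ≤ L) (hL : 2 * Q + 1 ≤ L) :
    CMul O c (complexMul c mu) (fun σ => I σ ∧ σ.reg (c + 4) = q) q Q (4 * M + 1500 * L) where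
  stable σ σ' hJ hs := by
    refine ⟨h.stable σ σ' hJ.1 ⟨fun r hr => hs.1 r ⟨by omega, by omega, by omega⟩,
      fun a ha => hs.2 a (by omega)⟩, ?_⟩
    rw [hs.1 _ ⟨le_rfl, by omega, by omega⟩, hJ.2]
  prec σ hJ := hJ.2
  run σ hJ h0 h1 h2 h3 := by
    have hL1 : 1 ≤ L := by omega
    have l0 := len_le_of_abs_le (L := L) h0 (by omega)
    have l1 := len_le_of_abs_le (L := L) h1 (by omega)
    have l2 := len_le_of_abs_le (L := L) h2 (by omega)
    have l3 := len_le_of_abs_le (L := L) h3 (by omega)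
    have p02 := len_le_of_abs_le (L := L) (abs_mul_le_two_pow h0 h2) (by omega)
    have p13 := len_le_of_abs_le (L := L) (abs_mul_le_two_pow h1 h3) (by omega)
    have p03 := len_le_of_abs_le (L := L) (abs_mul_le_two_pow h0 h3) (by omega)
    have p12 := len_le_of_abs_le (L := L) (abs_mul_le_two_pow h1 h2) (by omega)
    refine Tri.mono (T := 4 * 4 ^ 2 * (L * (1 + 0)) + (M + (4 * 6 ^ 2 * (L * (1 + 0)) +
      (M + (4 * 10 ^ 2 * (L * (1 + 0)) + (M + (4 * 6 ^ 2 * (L * (1 + 0)) + (M +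
        4 * 6 ^ 2 * (L * (1 + 0)))))))))) ?_ (by omega) fun _ h => h
    refine (Tri.straight (Q := fun σ₁ => I σ₁ ∧ σ₁.reg (c + 8) = σ.reg c ∧
      σ₁.reg (c + 9) = σ.reg (c + 2) ∧ Same (· < c + 8) (· < c + 8) σ σ₁)
      hL1 (by simp [Cmd.Straight]) ?_ ?_).seq ?_
    · simp [Cmd.Leaf, Expr.Leaf, Cmd.exec, Expr.eval, *]
    · simp only [Cmd.exec, Expr.eval]
      refine ⟨h.stable _ _ hJ.1 ⟨fun r hr => ?_, fun a ha j => by simp⟩, by simp, by simp,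
        fun r hr => ?_, fun a ha j => by simp⟩
      · simp; grind
      · simp; grind
    rintro σ₁ ⟨i1, e1, e2, s1⟩
    refine (h.run σ₁ i1 (by rwa [e1]) (by rwa [e2])).seq ?_
    rintro σ₂ ⟨i2, r2, s2⟩
    have c1 : σ₂.reg (c + 1) = σ.reg (c + 1) := by rw [s2.1 _ (by omega), s1.1 _ (by omega)]
    have c3 : σ₂.reg (c + 3) = σ.reg (c + 3) := by rw [s2.1 _ (by omega), s1.1 _ (by omega)]
    have s02 : Same (· < c + 8) (· < c + 8) σ σ₂ :=
      ⟨fun r hr => by rw [s2.1 _ hr, s1.1 _ hr], fun a ha j => by rw [s2.2 _ ha, s1.2 _ ha]⟩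
    rw [e1, e2] at r2
    change σ₂.reg (c + 10) = _ at r2
    refine (Tri.straight (Q := fun σ₃ => I σ₃ ∧ σ₃.reg (c + 8) = σ.reg (c + 1) ∧
      σ₃.reg (c + 9) = σ.reg (c + 3) ∧ σ₃.reg (c + 7) = σ.reg c * σ.reg (c + 2) ∧
      Same (· < c + 7) (· < c + 8) σ σ₃) hL1 (by simp [Cmd.Straight]) ?_ ?_).seq ?_
    · simp [Cmd.Leaf, Expr.Leaf, Cmd.exec, Expr.eval, *]
    · simp only [Cmd.exec, Expr.eval]
      refine ⟨h.stable _ _ i2 ⟨fun r hr => ?_, fun a ha j => by simp⟩, by simp [c1], by simp [c3],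
        by simp [r2], fun r hr => ?_, fun a ha j => by simpa using s02.2 a ha j⟩
      · simp; grind
      · have := s02.1 r (by omega); simp; grind
    rintro σ₃ ⟨i3, e1, e2, e3, s3⟩
    refine (h.run σ₃ i3 (by rwa [e1]) (by rwa [e2])).seq ?_
    rintro σ₄ ⟨i4, r4, s4⟩
    rw [e1, e2] at r4
    change σ₄.reg (c + 10) = _ at r4
    have d4 : σ₄.reg (c + 4) = q := by rw [s4.1 _ (by omega), s3.1 _ (by omega), hJ.2]
    have d0 : σ₄.reg c = σ.reg c := by rw [s4.1 _ (by omega), s3.1 _ (by omega)]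
    have d3 : σ₄.reg (c + 3) = σ.reg (c + 3) := by rw [s4.1 _ (by omega), s3.1 _ (by omega)]
    have d7 : σ₄.reg (c + 7) = σ.reg c * σ.reg (c + 2) := by rw [s4.1 _ (by omega), e3]
    have s04 : Same (· < c + 7) (· < c + 8) σ σ₄ :=
      ⟨fun r hr => by rw [s4.1 _ (by omega), s3.1 _ hr], fun a ha j => by rw [s4.2 _ ha, s3.2 _ ha]⟩
    refine (Tri.straight (Q := fun σ₅ => I σ₅ ∧ σ₅.reg (c + 8) = σ.reg c ∧
      σ₅.reg (c + 9) = σ.reg (c + 3) ∧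
      σ₅.reg (c + 5) = (σ.reg c * σ.reg (c + 2) - σ.reg (c + 1) * σ.reg (c + 3)) / 2 ^ q ∧
      Same (fun r => r < c + 7 ∧ r ≠ c + 5) (· < c + 8) σ σ₅) hL1 (by simp [Cmd.Straight])
        ?_ ?_).seq ?_
    · simp [Cmd.Leaf, Expr.Leaf, Cmd.exec, Expr.eval, *]
    · simp only [Cmd.exec, Expr.eval]
      refine ⟨h.stable _ _ i4 ⟨fun r hr => ?_, fun a ha j => by simp⟩, by simp [d0], by simp [d3],
        by simp [d7, r4, d4], fun r hr => ?_, fun a ha j => by simpa using s04.2 a ha j⟩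
      · simp; grind
      · have := s04.1 r (by omega); simp; grind
    rintro σ₅ ⟨i5, e1, e2, e3, s5⟩
    refine (h.run σ₅ i5 (by rwa [e1]) (by rwa [e2])).seq ?_
    rintro σ₆ ⟨i6, r6, s6⟩
    rw [e1, e2] at r6
    change σ₆.reg (c + 10) = _ at r6
    have c1 : σ₆.reg (c + 1) = σ.reg (c + 1) := by
      rw [s6.1 _ (by omega), s5.1 _ ⟨by omega, by omega⟩]
    have c2 : σ₆.reg (c + 2) = σ.reg (c + 2) := by
      rw [s6.1 _ (by omega), s5.1 _ ⟨by omega, by omega⟩]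
    have s06 : Same (fun r => r < c + 7 ∧ r ≠ c + 5) (· < c + 8) σ σ₆ :=
      ⟨fun r hr => by rw [s6.1 _ (by omega), s5.1 _ hr], fun a ha j => by rw [s6.2 _ ha, s5.2 _ ha]⟩
    have d5 := s6.1 (c + 5) (by omega)
    rw [e3] at d5
    refine (Tri.straight (Q := fun σ₇ => I σ₇ ∧ σ₇.reg (c + 8) = σ.reg (c + 1) ∧
      σ₇.reg (c + 9) = σ.reg (c + 2) ∧ σ₇.reg (c + 7) = σ.reg c * σ.reg (c + 3) ∧
      σ₇.reg (c + 5) = (σ.reg c * σ.reg (c + 2) - σ.reg (c + 1) * σ.reg (c + 3)) / 2 ^ q ∧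
      Same (fun r => r < c + 7 ∧ r ≠ c + 5) (· < c + 8) σ σ₇) hL1 (by simp [Cmd.Straight])
        ?_ ?_).seq ?_
    · simp [Cmd.Leaf, Expr.Leaf, Cmd.exec, Expr.eval, *]
    · simp only [Cmd.exec, Expr.eval]
      refine ⟨h.stable _ _ i6 ⟨fun r hr => ?_, fun a ha j => by simp⟩, by simp [c1], by simp [c2],
        by simp [r6], by simp [d5], fun r hr => ?_, fun a ha j => by simpa using s06.2 a ha j⟩
      · simp; grind
      · have := s06.1 r hr; simp; grind
    rintro σ₇ ⟨i7, e1, e2, e3, e5, s7⟩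
    refine (h.run σ₇ i7 (by rwa [e1]) (by rwa [e2])).seq ?_
    rintro σ₈ ⟨i8, r8, s8⟩
    rw [e1, e2] at r8
    change σ₈.reg (c + 10) = _ at r8
    have d4 : σ₈.reg (c + 4) = q := by
      rw [s8.1 _ (by omega), s7.1 _ ⟨by omega, by omega⟩, hJ.2]
    have d7 : σ₈.reg (c + 7) = σ.reg c * σ.reg (c + 3) := by rw [s8.1 _ (by omega), e3]
    have d5 := s8.1 (c + 5) (by omega)
    rw [e5] at d5
    refine Tri.straight hL1 (by simp [Cmd.Straight]) ?_ ?_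
    · simp [Cmd.Leaf, Expr.Leaf, *]
    · simp only [Cmd.exec, Expr.eval]
      refine ⟨⟨h.stable _ _ i8 ⟨fun r hr => ?_, fun a ha j => by simp⟩, by simp [d4]⟩,
        by simp [d5], by simp [d7, r8, d4], fun r hr => ?_, fun a ha j => ?_⟩
      · simp; grind
      · have h1 := s7.1 r ⟨by omega, by omega⟩
        have h2 := s8.1 r (by omega)
        simp; grind
      · have h1 := s7.2 a (by omega) j
        have h2 := s8.2 a (by omega) j
        simp [h2, h1]

/-! ### Fixed-point complex arithmetic -/

/-- The Gaussian integer `a + b i` as a complex number. -/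
noncomputable def gi (a b : ℤ) : ℂ := (a : ℂ) + (b : ℂ) * Complex.I

/-- The entry at index `i` of the complex array stored in arrays `A` and `A + 1`. -/
noncomputable def State.cv (σ : State) (A : ℕ) (i : ℤ) : ℂ := gi (σ.mem A i) (σ.mem (A + 1) i)

@[simp] theorem gi_re (a b : ℤ) : (gi a b).re = a := by simp [gi]

@[simp] theorem gi_im (a b : ℤ) : (gi a b).im = b := by simp [gi]

theorem gi_mul (a b u v : ℤ) : gi a b * gi u v = gi (a * u - b * v) (a * v + b * u) := by
  apply Complex.ext <;> simp

theorem gi_add (a b u v : ℤ) : gi a b + gi u v = gi (a + u) (b + v) := by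
  apply Complex.ext <;> simp

theorem conj_gi (a b : ℤ) : (starRingEnd ℂ) (gi a b) = gi a (-b) := by
  apply Complex.ext <;> simp

theorem abs_floor_div_sub (a : ℤ) {d : ℤ} (hd : 0 < d) : |((a / d : ℤ) : ℝ) - (a : ℝ) / d| ≤ 1 := by
  have hd' : (0 : ℝ) < d := by exact_mod_cast hd
  have h1 : ((a / d : ℤ) : ℝ) * d ≤ a := by exact_mod_cast Int.ediv_mul_le a hd.ne'
  have h2 : (a : ℝ) ≤ ((a / d : ℤ) : ℝ) * d + d := by
    have := Int.lt_ediv_add_one_mul_self a hd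
    have : a ≤ a / d * d + d := by linarith
    exact_mod_cast this
  rw [abs_le]
  constructor
  · rw [neg_le_sub_iff_le_add, div_le_iff₀ hd']; linarith
  · have : ((a / d : ℤ) : ℝ) ≤ (a : ℝ) / d := by rw [le_div_iff₀ hd']; exact h1
    linarith

theorem norm_gi_ediv_sub (x y : ℤ) {d : ℤ} (hd : 0 < d) :
    ‖gi (x / d) (y / d) - gi x y / (d : ℂ)‖ ≤ 2 := by
  refine (Complex.norm_le_abs_re_add_abs_im _).trans ?_
  have h1 := abs_floor_div_sub x hd
  have h2 := abs_floor_div_sub y hd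
  have e1 : (gi (x / d) (y / d) - gi x y / (d : ℂ)).re = ((x / d : ℤ) : ℝ) - (x : ℝ) / d := by
    rw [Complex.sub_re, ← Complex.ofReal_intCast, Complex.div_ofReal_re]; simp
  have e2 : (gi (x / d) (y / d) - gi x y / (d : ℂ)).im = ((y / d : ℤ) : ℝ) - (y : ℝ) / d := by
    rw [Complex.sub_im, ← Complex.ofReal_intCast, Complex.div_ofReal_im]; simp
  rw [e1, e2]; linarith

theorem norm_gi_shr_sub (x y : ℤ) (q : ℕ) :
    ‖gi (x / 2 ^ q) (y / 2 ^ q) - gi x y / 2 ^ q‖ ≤ 2 := by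
  simpa using norm_gi_ediv_sub x y (d := 2 ^ q) (by positivity)

/-- The error of a fixed-point product of approximate factors, in units of the last place. -/
theorem norm_mul_shr_sub_le {a b u v : ℤ} {q : ℕ} {α ω : ℂ} {Ea Ew Ab Om : ℝ}
    (ha : ‖gi a b - 2 ^ q * α‖ ≤ Ea) (hw : ‖gi u v - 2 ^ q * ω‖ ≤ Ew) (hα : ‖α‖ ≤ Ab)
    (hω : ‖ω‖ ≤ Om) (hE : Ea ≤ 2 ^ q) :
    ‖gi ((a * u - b * v) / 2 ^ q) ((a * v + b * u) / 2 ^ q) - 2 ^ q * (α * ω)‖ ≤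
      Ea * Om + (Ab + 1) * Ew + 2 := by
  have hS : (0 : ℝ) < 2 ^ q := by positivity
  have hS' : (2 : ℂ) ^ q ≠ 0 := pow_ne_zero _ two_ne_zero
  have h1 := norm_gi_shr_sub (a * u - b * v) (a * v + b * u) q
  rw [← gi_mul] at h1
  have hEa := (norm_nonneg _).trans ha
  have hEw := (norm_nonneg _).trans hw
  have hA : ‖gi a b / 2 ^ q‖ ≤ Ab + 1 := by
    have : gi a b / 2 ^ q = α + (gi a b - 2 ^ q * α) / 2 ^ q := by field_simp; ring
    rw [this]
    refine (norm_add_le _ _).trans (add_le_add hα ?_)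
    rw [norm_div, norm_pow, Complex.norm_ofNat, div_le_one hS]
    exact ha.trans hE
  have e : gi a b * gi u v / 2 ^ q - 2 ^ q * (α * ω) =
      (gi a b - 2 ^ q * α) * ω + gi a b / 2 ^ q * (gi u v - 2 ^ q * ω) := by
    field_simp; ring
  have h2 : ‖gi a b * gi u v / 2 ^ q - 2 ^ q * (α * ω)‖ ≤ Ea * Om + (Ab + 1) * Ew := by
    rw [e]
    refine (norm_add_le _ _).trans (add_le_add ?_ ?_)
    · rw [norm_mul]; exact mul_le_mul ha hω (norm_nonneg _) hEa
    · rw [norm_mul]; exact mul_le_mul hA hw (norm_nonneg _) ((norm_nonneg _).trans hA)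
  calc _ ≤ _ := norm_sub_le_norm_sub_add_norm_sub _ (gi a b * gi u v / 2 ^ q) _
    _ ≤ _ := by linarith

theorem abs_le_of_norm_gi_le {a b : ℤ} {Q : ℕ} (h : ‖gi a b‖ ≤ 2 ^ Q) :
    |a| ≤ 2 ^ Q ∧ |b| ≤ 2 ^ Q := by
  have h1 := (Complex.abs_re_le_norm _).trans h
  have h2 := (Complex.abs_im_le_norm _).trans h
  simp only [gi_re, gi_im] at h1 h2
  exact ⟨by exact_mod_cast h1, by exact_mod_cast h2⟩

theorem norm_le_of_approx {w : ℂ} {q : ℕ} {α : ℂ} {E A B : ℝ}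
    (h : ‖w - 2 ^ q * α‖ ≤ E) (hα : ‖α‖ ≤ A) (hB : 2 ^ q * A + E ≤ B) : ‖w‖ ≤ B := by
  have : w = 2 ^ q * α + (w - 2 ^ q * α) := by ring
  rw [this]
  refine (norm_add_le _ _).trans (le_trans (add_le_add ?_ h) hB)
  rw [norm_mul, norm_pow, Complex.norm_ofNat]
  gcongr

theorem abs_le_of_approx {a b : ℤ} {q Q : ℕ} {α : ℂ} {E A : ℝ}
    (h : ‖gi a b - 2 ^ q * α‖ ≤ E) (hα : ‖α‖ ≤ A) (hQ : 2 ^ q * A + E ≤ 2 ^ Q) :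
    |a| ≤ 2 ^ Q ∧ |b| ≤ 2 ^ Q :=
  abs_le_of_norm_gi_le (norm_le_of_approx h hα hQ)

/-- A call of the complex multiplication routine on approximate factors. -/
theorem CMul.run_approx {O : ℕ → ℕ → ℤ} {c : ℕ} {cm : Cmd} {J : State → Prop} {q Q M : ℕ}
    (h : CMul O c cm J q Q M) {σ : State} (hJ : J σ) {α ω : ℂ} {Ea Ew Ab Om : ℝ}
    (ha : ‖gi (σ.reg c) (σ.reg (c + 1)) - 2 ^ q * α‖ ≤ Ea)
    (hw : ‖gi (σ.reg (c + 2)) (σ.reg (c + 3)) - 2 ^ q * ω‖ ≤ Ew) (hα : ‖α‖ ≤ Ab) (hω : ‖ω‖ ≤ Om)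
    (hE : Ea ≤ 2 ^ q) (hQa : 2 ^ q * Ab + Ea ≤ 2 ^ Q) (hQw : 2 ^ q * Om + Ew ≤ 2 ^ Q) :
    Tri O cm σ M fun σ' => J σ' ∧
      ‖gi (σ'.reg (c + 5)) (σ'.reg (c + 6)) - 2 ^ q * (α * ω)‖ ≤ Ea * Om + (Ab + 1) * Ew + 2 ∧
      Same (· < c) (· < c) σ σ' := by
  obtain ⟨h0, h1⟩ := abs_le_of_approx ha hα hQa
  obtain ⟨h2, h3⟩ := abs_le_of_approx hw hω hQw
  refine (h.run σ hJ h0 h1 h2 h3).mono le_rfl ?_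
  rintro σ' ⟨hJ', e5, e6, hs⟩
  refine ⟨hJ', ?_, hs⟩
  rw [e5, e6]
  exact norm_mul_shr_sub_le ha hw hα hω hE

theorem Same.trans {R A : ℕ → Prop} {σ₁ σ₂ σ₃ : State} (h : Same R A σ₁ σ₂) (h' : Same R A σ₂ σ₃) :
    Same R A σ₁ σ₃ :=
  ⟨fun r hr => (h'.1 r hr).trans (h.1 r hr), fun a ha j => (h'.2 a ha j).trans (h.2 a ha j)⟩

theorem Same.mono {R A R' A' : ℕ → Prop} {σ₁ σ₂ : State} (h : Same R A σ₁ σ₂)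
    (hR : ∀ r, R' r → R r) (hA : ∀ a, A' a → A a) : Same R' A' σ₁ σ₂ :=
  ⟨fun r hr => h.1 r (hR r hr), fun a ha => h.2 a (hA a ha)⟩

theorem Same.cv {R A : ℕ → Prop} {σ σ' : State} (h : Same R A σ σ') {X : ℕ} (h1 : A X)
    (h2 : A (X + 1)) (i : ℤ) : σ'.cv X i = σ.cv X i := by
  simp [State.cv, h.2 X h1 i, h.2 (X + 1) h2 i]

/-! ### Tables of powers -/

/-- Tabulate the powers, with exponents up to the content of register `cnt`, of the number in
registers `b + 12`, `b + 13` in the complex array `dst`. -/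
def powersC (b dst cnt : ℕ) (cm : Cmd) : Cmd :=
  .seq (.seq (.put dst (.const 0) (.shl (.const 1) (.reg (b + 36))))
    (.put (dst + 1) (.const 0) (.const 0))) <|
  .for (b + 3) cnt <|
    .seq (.seq (.assign (b + 32) (.get dst (.reg (b + 3))))
      (.seq (.assign (b + 33) (.get (dst + 1) (.reg (b + 3))))
      (.seq (.assign (b + 34) (.reg (b + 12))) (.assign (b + 35) (.reg (b + 13)))))) <|
    .seq cm <|
      .seq (.put dst (.add (.reg (b + 3)) (.const 1)) (.reg (b + 37)))
        (.put (dst + 1) (.add (.reg (b + 3)) (.const 1)) (.reg (b + 38)))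

theorem len_zero : len 0 = 0 := by decide

theorem len_one : len 1 = 1 := by decide

/-- The errors grow linearly with the exponent, as the base has norm at most `1`. -/
theorem powersC_spec {O : ℕ → ℕ → ℤ} {b dst cnt : ℕ} {cm : Cmd} {J : State → Prop} {q Q M L N : ℕ}
    (h : CMul O (b + 32) cm J q Q M) (hQ : q + 1 ≤ Q) (hL : Q + 2 ≤ L) (hN : len (N : ℤ) ≤ L)
    (hqL : len (q : ℤ) ≤ L)
    (hcnt : cnt < b + 32 ∧ cnt ≠ b + 3) (hdst : dst + 1 < b + 32) {x : ℂ} (hx : ‖x‖ ≤ 1) {δ : ℝ}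
    (hδ : N * (2 * δ + 2) ≤ 2 ^ q) (hδq : δ ≤ 2 ^ q) {σ : State} (hJ : J σ) (hc : σ.reg cnt = N)
    (hb : ‖gi (σ.reg (b + 12)) (σ.reg (b + 13)) - 2 ^ q * x‖ ≤ δ) :
    Tri O (powersC b dst cnt cm) σ ((N + 1) * (M + 2000 * L)) fun σ' => J σ' ∧
      (∀ k : ℕ, k ≤ N → ‖σ'.cv dst k - 2 ^ q * x ^ k‖ ≤ k * (2 * δ + 2)) ∧
      Same (fun r => r < b + 32 ∧ r ≠ b + 3) (fun a => a < b + 32 ∧ a ≠ dst ∧ a ≠ dst + 1) σ σ' := by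
  have hL1 : 1 ≤ L := by omega
  have hδ0 : 0 ≤ δ := (norm_nonneg _).trans hb
  have hq := h.prec σ hJ
  rw [show b + 32 + 4 = b + 36 by ring] at hq
  have hS : (0 : ℝ) < 2 ^ q := by positivity
  have hQ' : (2 : ℝ) ^ q + 2 ^ q ≤ 2 ^ Q := by
    rw [← two_mul, ← pow_succ']
    exact pow_le_pow_right₀ (by norm_num) hQ
  have hstab : ∀ τ τ', J τ → Same (fun r => b + 36 ≤ r ∧ r ≠ b + 37 ∧ r ≠ b + 38)
      (fun a => b + 32 ≤ a) τ τ' → J τ' := h.stable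
  have hkE : ∀ k : ℕ, k ≤ N → (k : ℝ) * (2 * δ + 2) ≤ 2 ^ q := fun k hk =>
    le_trans (by gcongr) hδ
  have hpow : ∀ k : ℕ, ‖x ^ k‖ ≤ 1 := fun k => by
    rw [norm_pow]; exact pow_le_one₀ (norm_nonneg _) hx
  let I : ℕ → State → Prop := fun k τ => J τ ∧ τ.reg (b + 3) = k ∧
    (∀ j : ℕ, j ≤ k → ‖τ.cv dst j - 2 ^ q * x ^ j‖ ≤ j * (2 * δ + 2)) ∧
    Same (fun r => r < b + 32 ∧ r ≠ b + 3) (fun a => a < b + 32 ∧ a ≠ dst ∧ a ≠ dst + 1) σ τ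
  refine ((Tri.straight (L := L) (ℓ := 0) (Q := fun τ => I 0 (τ.setR (b + 3) 0)) hL1
    (by simp [Cmd.Straight]) ?_ ?_).seq fun τ hτ => ?_).mono (T := 4 * 8 ^ 2 * (L * (1 + 0)) +
      (∑ k ∈ Finset.range N, (4 * 10 ^ 2 * (L * (1 + 0)) + (M + 4 * 10 ^ 2 * (L * (1 + 0)))) +
      (N + 1) * (100 * L))) ?_ (Q := I N) ?_
  · simp [Cmd.Leaf, Expr.Leaf, Expr.eval, len_zero, len_one, hq, hqL]; omega
  · simp only [Cmd.exec, Expr.eval, I]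
    refine ⟨hstab _ _ hJ ⟨fun r hr => ?_, fun a ha j => ?_⟩, by simp, ?_, fun r hr => ?_,
      fun a ha j => ?_⟩
    · simp; grind
    · simp; grind
    · intro j hj
      obtain rfl : j = 0 := by omega
      simp [State.cv, hq, gi]
    · simp; grind
    · simp; grind
  · refine Tri.for I N _ hN hL1 ?_ ?_ ?_ hτ
    · rintro k τ ⟨-, -, -, hs⟩
      rw [hs.1 _ hcnt, hc]
    · rintro k τ hI; exact hI.2.1
    rintro k τ hk ⟨hJk, hik, hv, hs⟩
    have hkL : len (k : ℤ) ≤ L := (len_natCast_mono hk.le).trans hN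
    have hvk := hv k le_rfl
    have h12 := hs.1 (b + 12) ⟨by omega, by omega⟩
    have h13 := hs.1 (b + 13) ⟨by omega, by omega⟩
    obtain ⟨m0, m1⟩ := abs_le_of_approx (Q := Q) hvk (hpow k) (by linarith [hkE k hk.le])
    obtain ⟨m2, m3⟩ := abs_le_of_approx (Q := Q) hb hx (by linarith)
    have m0 := len_le_of_abs_le (L := L) m0 (by omega)
    have m1 := len_le_of_abs_le (L := L) m1 (by omega)
    have m2 := len_le_of_abs_le (L := L) m2 (by omega)
    have m3 := len_le_of_abs_le (L := L) m3 (by omega)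
    refine (Tri.straight (L := L) (ℓ := 0) (Q := fun τ' => J τ' ∧ τ'.reg (b + 3) = k ∧
      gi (τ'.reg (b + 32)) (τ'.reg (b + 33)) = τ.cv dst k ∧ τ'.reg (b + 34) = σ.reg (b + 12) ∧
      τ'.reg (b + 35) = σ.reg (b + 13) ∧ Same (· < b + 32) (· < b + 32) τ τ') hL1
      (by simp [Cmd.Straight]) ?_ ?_).seq fun τ₁ hτ₁ => ?_
    · simp [Cmd.Leaf, Expr.Leaf, Expr.eval, Cmd.exec, *]
    · simp only [Cmd.exec, Expr.eval]
      refine ⟨hstab _ _ hJk ⟨fun r hr => ?_, fun a ha j => ?_⟩, by simp [hik], ?_, by simp [h12],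
        by simp [h13], fun r hr => ?_, fun a ha j => ?_⟩
      · simp; grind
      · simp
      · simp [State.cv, hik]
      · simp; grind
      · simp
    obtain ⟨j1, i1, e1, e2, e3, s1⟩ := hτ₁
    refine (h.run_approx j1 (α := x ^ k) (ω := x) (Ea := k * (2 * δ + 2)) (Ew := δ) (Ab := 1)
      (Om := 1) ?_ ?_ (hpow k) hx (hkE k hk.le) (by linarith [hkE k hk.le])
      (by linarith)).seq fun τ₂ hτ₂ => ?_
    · exact e1 ▸ hvk
    · show ‖gi (τ₁.reg (b + 34)) (τ₁.reg (b + 35)) - _‖ ≤ _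
      rw [e2, e3]; exact hb
    obtain ⟨j2, a2, s2⟩ := hτ₂
    change ‖gi (τ₂.reg (b + 37)) (τ₂.reg (b + 38)) - _‖ ≤ _ at a2
    have a2' : ‖gi (τ₂.reg (b + 37)) (τ₂.reg (b + 38)) - 2 ^ q * x ^ (k + 1)‖ ≤
        (k + 1 : ℕ) * (2 * δ + 2) := by
      rw [pow_succ]; refine a2.trans (le_of_eq ?_); push_cast; ring
    obtain ⟨m7, m8⟩ := abs_le_of_approx (Q := Q) a2' (hpow (k + 1)) (by linarith [hkE (k + 1) hk])
    have m7 := len_le_of_abs_le (L := L) m7 (by omega)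
    have m8 := len_le_of_abs_le (L := L) m8 (by omega)
    have i2 : τ₂.reg (b + 3) = k := by rw [s2.1 _ (by omega), i1]
    have s02 := s1.trans s2
    refine Tri.straight hL1 (by simp [Cmd.Straight]) ?_ ?_
    · simp [Cmd.Leaf, Expr.Leaf, Cmd.exec, len_one, *]
    · simp only [Cmd.exec, Expr.eval]
      refine ⟨by simp [i2], hstab _ _ j2 ⟨fun r hr => ?_, fun a ha j => ?_⟩, by simp, ?_,
        fun r hr => ?_, fun a ha j => ?_⟩
      · simp; grind
      · simp; grind
      · intro j hj
        rcases Nat.lt_or_ge k j with hkj | hkj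
        · obtain rfl : j = k + 1 := by omega
          simpa [State.cv, i2] using a2'
        · have e := s02.cv (X := dst) (by omega) (by omega) j
          have : ((j : ℤ) = k + 1) = False := by simp; omega
          have hj' := hv j hkj
          rw [← e] at hj'
          simpa [State.cv, i2, this] using hj'
      · have := s02.1 r hr.1
        have := hs.1 r hr
        simp; grind
      · have := s02.2 a ha.1 j
        have := hs.2 a ha j
        simp; grind
  · rw [Finset.sum_const, Finset.card_range, smul_eq_mul]
    nlinarith [Nat.zero_le (N * L), Nat.zero_le (N * M)]
  · rintro τ ⟨h1, -, h2, h3⟩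
    exact ⟨h1, h2, h3⟩

/-! ### The number `π` and roots of unity -/

theorem abs_ediv_sub_le (a : ℤ) {x : ℝ} {e : ℝ} (d : ℕ) (hd : 0 < d) (h : |(a : ℝ) - x| ≤ e) :
    |((a / (d : ℤ) : ℤ) : ℝ) - x / d| ≤ e + 1 := by
  have h1 := abs_floor_div_sub a (d := d) (by exact_mod_cast hd)
  have hd' : (1 : ℝ) ≤ d := by exact_mod_cast hd
  have h2 : |(a : ℝ) / d - x / d| ≤ e := by
    rw [← sub_div, abs_div, abs_of_pos (by linarith : (0 : ℝ) < d)]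
    exact (div_le_self (abs_nonneg _) hd').trans h
  push_cast at h1
  calc _ ≤ _ := abs_sub_le _ ((a : ℝ) / d) _
    _ ≤ _ := by linarith

/-- The terms of the fixed-point version of `4 arctan (1 / 2) + 4 arctan (1 / 3)`. -/
def piTerm (q j : ℕ) : ℤ :=
  (-1) ^ j * (2 ^ (q + 1) / 4 ^ j / (2 * j + 1 : ℕ) + 2 ^ (q + 2) / 3 / 9 ^ j / (2 * j + 1 : ℕ))

theorem abs_piTerm_sub (q j : ℕ) :
    |(piTerm q j : ℝ) - 2 ^ q * (4 * ((-1) ^ j * (2⁻¹ : ℝ) ^ (2 * j + 1) / (2 * j + 1 : ℕ) +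
      (-1) ^ j * (3⁻¹ : ℝ) ^ (2 * j + 1) / (2 * j + 1 : ℕ)))| ≤ 5 := by
  have h2 : |((2 ^ (q + 1) / 4 ^ j : ℤ) : ℝ) - 2 ^ (q + 1) / 4 ^ j| ≤ 1 := by
    simpa using abs_floor_div_sub (2 ^ (q + 1)) (d := 4 ^ j) (by positivity)
  have h3 : |((2 ^ (q + 2) / 3 : ℤ) : ℝ) - 2 ^ (q + 2) / 3| ≤ 1 := by
    simpa using abs_floor_div_sub (2 ^ (q + 2)) (d := 3) (by positivity)
  have h3' := abs_ediv_sub_le _ (9 ^ j) (by positivity) h3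
  have h2' := abs_ediv_sub_le _ (2 * j + 1) (by positivity) h2
  have h3'' := abs_ediv_sub_le _ (2 * j + 1) (by positivity) h3'
  have e : (piTerm q j : ℝ) - 2 ^ q * (4 * ((-1) ^ j * (2⁻¹ : ℝ) ^ (2 * j + 1) / (2 * j + 1 : ℕ) +
      (-1) ^ j * (3⁻¹ : ℝ) ^ (2 * j + 1) / (2 * j + 1 : ℕ))) =
      (-1) ^ j * (((2 ^ (q + 1) / 4 ^ j / (2 * j + 1 : ℕ) : ℤ) : ℝ) -
        2 ^ (q + 1) / 4 ^ j / (2 * j + 1 : ℕ)) +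
      (-1) ^ j * (((2 ^ (q + 2) / 3 / (9 ^ j : ℕ) / (2 * j + 1 : ℕ) : ℤ) : ℝ) -
        2 ^ (q + 2) / 3 / (9 ^ j : ℕ) / (2 * j + 1 : ℕ)) := by
    have a : (2⁻¹ : ℝ) ^ (2 * j + 1) = 1 / 2 / 4 ^ j := by
      rw [pow_succ, pow_mul, show (2⁻¹ : ℝ) ^ 2 = 4⁻¹ by norm_num, inv_pow]; ring
    have b : (3⁻¹ : ℝ) ^ (2 * j + 1) = 1 / 3 / 9 ^ j := by
      rw [pow_succ, pow_mul, show (3⁻¹ : ℝ) ^ 2 = 9⁻¹ by norm_num, inv_pow]; ring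
    rw [a, b, piTerm]
    push_cast
    ring
  rw [e]
  refine (abs_add_le _ _).trans ?_
  rw [abs_mul, abs_mul, abs_pow, abs_neg, abs_one, one_pow, one_mul, one_mul]
  linarith

/-- The series converge like powers of `1 / 4`, so that the tail after `q` terms is at most `6` units;
rounding down costs at most `5` units for each term. -/
theorem abs_sum_piTerm_sub {q : ℕ} (hq : 1 ≤ q) :
    |((∑ j ∈ Finset.range q, piTerm q j : ℤ) : ℝ) - 2 ^ q * Real.pi| ≤ 11 * q := by
  set f : ℕ → ℝ := fun j => 2 ^ q * (4 * ((-1) ^ j * (2⁻¹ : ℝ) ^ (2 * j + 1) / (2 * j + 1 : ℕ) +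
      (-1) ^ j * (3⁻¹ : ℝ) ^ (2 * j + 1) / (2 * j + 1 : ℕ))) with hf
  have hs : HasSum f (2 ^ q * Real.pi) := by
    have h2 := Real.hasSum_arctan (x := 2⁻¹) (by norm_num)
    have h3 := Real.hasSum_arctan (x := 3⁻¹) (by norm_num)
    have := ((h2.add h3).mul_left 4).mul_left (2 ^ q)
    rw [Real.arctan_inv_2_add_arctan_inv_3] at this
    rw [show (2 : ℝ) ^ q * Real.pi = 2 ^ q * (4 * (Real.pi / 4)) by ring]
    exact this
  have hb : ∀ j, ‖f j‖ ≤ 2 ^ q * 4 * (1 / 4 : ℝ) ^ j := by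
    intro j
    have hd : (1 : ℝ) ≤ (2 * j + 1 : ℕ) := by push_cast; linarith [(Nat.cast_nonneg j : (0 : ℝ) ≤ j)]
    have key : ∀ y : ℝ, 0 ≤ y → y ^ 2 ≤ 1 / 4 → y ≤ 1 / 2 →
        ‖(-1) ^ j * y ^ (2 * j + 1) / ((2 * j + 1 : ℕ) : ℝ)‖ ≤ (1 / 4) ^ j * (1 / 2) := by
      intro y hy h1 h2
      rw [norm_div, norm_mul, norm_pow, norm_neg, norm_one, one_pow, one_mul, Real.norm_of_nonneg
        (by positivity), Real.norm_of_nonneg (by positivity)]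
      refine (div_le_self (by positivity) hd).trans ?_
      rw [pow_succ, pow_mul]
      gcongr
    have k2 := key 2⁻¹ (by norm_num) (by norm_num) (by norm_num)
    have k3 := key 3⁻¹ (by norm_num) (by norm_num) (by norm_num)
    rw [hf]
    simp only
    rw [norm_mul, norm_mul, norm_pow, Real.norm_ofNat, Real.norm_ofNat, mul_assoc]
    have := norm_add_le ((-1) ^ j * (2⁻¹ : ℝ) ^ (2 * j + 1) / ((2 * j + 1 : ℕ) : ℝ))
      ((-1) ^ j * (3⁻¹ : ℝ) ^ (2 * j + 1) / ((2 * j + 1 : ℕ) : ℝ))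
    gcongr
    linarith
  have ht := norm_sub_le_of_geometric_bound_of_hasSum (by norm_num : (1 / 4 : ℝ) < 1) hb hs q
  have ht' : 2 ^ q * 4 * (1 / 4 : ℝ) ^ q / (1 - 1 / 4) ≤ 6 := by
    have : (2 : ℝ) ^ q * (1 / 4) ^ q = (1 / 2) ^ q := by rw [← mul_pow]; norm_num
    have h1 : (1 / 2 : ℝ) ^ q ≤ 1 := pow_le_one₀ (by norm_num) (by norm_num)
    have : 2 ^ q * 4 * (1 / 4 : ℝ) ^ q / (1 - 1 / 4) = 16 / 3 * (1 / 2 : ℝ) ^ q := by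
      rw [← this]; ring
    rw [this]; linarith
  have hd : |((∑ j ∈ Finset.range q, piTerm q j : ℤ) : ℝ) - ∑ j ∈ Finset.range q, f j| ≤ q * 5 := by
    push_cast
    rw [← Finset.sum_sub_distrib]
    refine (Finset.abs_sum_le_sum_abs _ _).trans ?_
    refine (Finset.sum_le_sum fun j _ => abs_piTerm_sub q j).trans ?_
    simp
  rw [Real.norm_eq_abs] at ht
  have hq' : (1 : ℝ) ≤ q := by exact_mod_cast hq
  calc _ ≤ _ := abs_sub_le _ (∑ j ∈ Finset.range q, f j) _
    _ ≤ _ := by linarith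

/-- Compute `2 ^ q π` in register `b + 10`, where `q` is the content of register `b + 36`. -/
def piC (b : ℕ) : Cmd :=
  .seq (.seq (.assign (b + 4) (.shl (.const 1) (.add (.reg (b + 36)) (.const 1)))) <|
    .seq (.assign (b + 5) (.div (.shl (.const 1) (.add (.reg (b + 36)) (.const 2))) (.const 3))) <|
    .seq (.assign (b + 6) (.const 1)) <| .seq (.assign (b + 7) (.const 1)) <|
      .assign (b + 10) (.const 0)) <|
  .for (b + 3) (b + 36) <|
    .seq (.assign (b + 10) (.add (.reg (b + 10)) (.mul (.reg (b + 6))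
      (.add (.div (.reg (b + 4)) (.reg (b + 7))) (.div (.reg (b + 5)) (.reg (b + 7))))))) <|
    .seq (.assign (b + 4) (.div (.reg (b + 4)) (.const 4))) <|
    .seq (.assign (b + 5) (.div (.reg (b + 5)) (.const 9))) <|
    .seq (.assign (b + 6) (.sub (.const 0) (.reg (b + 6)))) <|
      .assign (b + 7) (.add (.reg (b + 7)) (.const 2))

theorem len_ediv_two_pow_le (k : ℕ) (d : ℤ) : len (2 ^ k / d) ≤ k + 1 :=
  (len_ediv_le _ _).trans (len_two_pow k).le

theorem piC_spec {O : ℕ → ℕ → ℤ} {b q L ℓ : ℕ} (hq : 1 ≤ q) (hL : 2 * q + 10 ≤ L)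
    (hℓ : len ((2 * q + 1 : ℕ) : ℤ) ≤ ℓ) (hℓ4 : 4 ≤ ℓ) {σ : State} (hr : σ.reg (b + 36) = q) :
    Tri O (piC b) σ ((q + 1) * (6000 * (L * (1 + ℓ)))) fun σ' =>
      |(σ'.reg (b + 10) : ℝ) - 2 ^ q * Real.pi| ≤ 11 * q ∧
      Same (fun r => r < b + 3 ∨ b + 10 < r) (fun _ => True) σ σ' := by
  have hqL : len (q : ℤ) ≤ L := (len_natCast_le_self q).trans (by omega)
  have l1 : len 1 = 1 := by decide
  have l2 : len 2 = 2 := by decide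
  have l3 : len 3 = 2 := by decide
  have l4 : len 4 = 3 := by decide
  have l9 : len 9 = 4 := by decide
  have lm : ∀ k : ℕ, len ((-1) ^ k) = 1 := fun k => by
    rcases neg_one_pow_eq_or ℤ k with h | h <;> rw [h] <;> decide
  have hL1 : 1 ≤ L := by omega
  let I : ℕ → State → Prop := fun k τ => τ.reg (b + 3) = k ∧
    τ.reg (b + 4) = 2 ^ (q + 1) / 4 ^ k ∧ τ.reg (b + 5) = 2 ^ (q + 2) / 3 / 9 ^ k ∧
    τ.reg (b + 6) = (-1) ^ k ∧ τ.reg (b + 7) = (2 * k + 1 : ℕ) ∧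
    τ.reg (b + 10) = ∑ j ∈ Finset.range k, piTerm q j ∧
    Same (fun r => r < b + 3 ∨ b + 10 < r) (fun _ => True) σ τ
  refine ((Tri.straight (L := L) (ℓ := ℓ) (Q := fun τ => I 0 (τ.setR (b + 3) 0)) hL1
    (by simp [Cmd.Straight]) ?_ ?_).seq (T₂ := (∑ k ∈ Finset.range q,
      (4 * 28 ^ 2 * (L * (1 + ℓ)))) + (q + 1) * (100 * L)) (R := I q) fun τ hτ => ?_).mono ?_ ?_
  · simp [Cmd.Leaf, Expr.Leaf, Cmd.exec, Expr.eval, len_zero, *]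
    omega
  · simp only [Cmd.exec, Expr.eval, I]
    refine ⟨by simp, ?_, ?_, by simp, by simp, by simp, fun r hr' => ?_, fun a ha j => by simp⟩
    · simp [hr, show ((q : ℤ) + 1).toNat = q + 1 by omega]
    · simp [hr, show ((q : ℤ) + 2).toNat = q + 2 by omega]
    · simp; grind
  · refine Tri.for I q _ hqL hL1 ?_ ?_ ?_ hτ
    · rintro k τ ⟨-, -, -, -, -, -, hs⟩
      rw [hs.1 _ (by omega), hr]
    · rintro k τ hI; exact hI.1
    rintro k τ hk ⟨h3, h4, h5, h6, h7, h10, hs⟩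
    have hkL : len (k : ℤ) ≤ L := (len_natCast_mono hk.le).trans hqL
    have m4 : len (2 ^ (q + 1) / 4 ^ k : ℤ) ≤ L := (len_ediv_two_pow_le _ _).trans (by omega)
    have m5 : len (2 ^ (q + 2) / 3 / 9 ^ k : ℤ) ≤ L :=
      (len_ediv_le _ _).trans ((len_ediv_two_pow_le _ _).trans (by omega))
    have m7 : len ((2 * k + 1 : ℕ) : ℤ) ≤ ℓ := (len_natCast_mono (by omega)).trans hℓ
    have m7' : len ((2 * k + 1 : ℕ) : ℤ) ≤ L :=
      ((len_natCast_mono (by omega : 2 * k + 1 ≤ 2 * q + 1)).trans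
        (len_natCast_le_self _)).trans (by omega)
    have m10 : len (∑ j ∈ Finset.range k, piTerm q j) ≤ L := by
      have hb : |∑ j ∈ Finset.range k, piTerm q j| ≤ k * 2 ^ (q + 3) := by
        refine (Finset.abs_sum_le_sum_abs _ _).trans ?_
        have : ∀ j ∈ Finset.range k, |piTerm q j| ≤ 2 ^ (q + 3) := by
          intro j _
          rw [piTerm, abs_mul, abs_pow, abs_neg, abs_one, one_pow, one_mul]
          have a3 : (2 : ℤ) ^ (q + 2) / 3 / 9 ^ j / (2 * j + 1 : ℕ) ≤ 2 ^ (q + 2) :=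
            (Int.ediv_le_self _ (by positivity)).trans ((Int.ediv_le_self _ (by positivity)).trans
              (Int.ediv_le_self _ (by positivity)))
          have a4 : (2 : ℤ) ^ (q + 1) / 4 ^ j / (2 * j + 1 : ℕ) ≤ 2 ^ (q + 1) :=
            (Int.ediv_le_self _ (by positivity)).trans (Int.ediv_le_self _ (by positivity))
          have a5 : (0 : ℤ) ≤ 2 ^ (q + 1) / 4 ^ j / (2 * j + 1 : ℕ) := by
            refine Int.ediv_nonneg (Int.ediv_nonneg ?_ ?_) ?_ <;> positivity
          have a6 : (0 : ℤ) ≤ 2 ^ (q + 2) / 3 / 9 ^ j / (2 * j + 1 : ℕ) := by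
            refine Int.ediv_nonneg (Int.ediv_nonneg (Int.ediv_nonneg ?_ ?_) ?_) ?_ <;> positivity
          rw [abs_of_nonneg (by linarith)]
          have : (2 : ℤ) ^ (q + 3) = 2 ^ (q + 1) + 2 ^ (q + 2) + 2 ^ (q + 1) := by ring
          have : (0 : ℤ) ≤ 2 ^ (q + 1) := by positivity
          linarith
        refine (Finset.sum_le_sum this).trans ?_
        simp
      have hk2 : (k : ℤ) ≤ 2 ^ q := by exact_mod_cast hk.le.trans Nat.lt_two_pow_self.le
      refine len_le_of_abs_le (Q := q + (q + 3)) (hb.trans ?_) (by omega)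
      rw [pow_add 2 q (q + 3)]
      exact mul_le_mul_of_nonneg_right hk2 (by positivity)
    refine Tri.line 28 hL1 (by simp [Cmd.Straight]) (by simp [Cmd.sz, Expr.sz]) ?_ ?_
    · simp only [Cmd.Leaf, Expr.Leaf, Cmd.exec, Expr.eval, State.setR_reg, add_right_inj,
        Nat.reduceEqDiff, if_false, h4, h5, h6, h7, h10, lm, l2, l4, l9, len_zero]
      refine ⟨⟨m10, hL1, ⟨⟨m4, m7', Or.inr m7⟩, ⟨m5, m7', Or.inr m7⟩⟩, Or.inl (by omega)⟩,
        ⟨m4, by omega, Or.inr (by omega)⟩, ⟨m5, by omega, Or.inr (by omega)⟩, ⟨by omega, hL1⟩,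
        m7', by omega⟩
    · simp only [Cmd.exec, Expr.eval, I]
      refine ⟨by simp [h3], by simp, ?_, ?_, ?_, ?_, ?_, fun r hr' => ?_, fun a ha j => ?_⟩
      · simp [h4, pow_succ, Int.ediv_ediv_of_nonneg]
      · simp [h5, pow_succ, Int.ediv_ediv_of_nonneg, mul_assoc]
      · simp [h6, pow_succ]
      · simp [h7]; ring
      · rw [Finset.sum_range_succ, piTerm]; simp [h4, h5, h6, h7, h10]
      · have := hs.1 r hr'
        simp; grind
      · simpa using hs.2 a ha j
  · simp only [Cmd.sz, Expr.sz]
    rw [Finset.sum_const, Finset.card_range, smul_eq_mul]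
    nlinarith [Nat.zero_le (q * (L * ℓ)), Nat.zero_le (L * ℓ), Nat.zero_le (q * L)]
  · rintro τ ⟨-, -, -, -, -, h10, hs⟩
    exact ⟨h10 ▸ abs_sum_piTerm_sub hq, hs⟩

/-- Horner's scheme for the exponential series, cut off after the term of degree `K`, started from
the innermost bracket. -/
noncomputable def hornerExp (K : ℕ) (x : ℂ) : ℕ → ℂ
  | 0 => 1
  | i + 1 => 1 + hornerExp K x i * x / (K - i : ℕ)

theorem norm_hornerExp_le {K : ℕ} {x : ℂ} (hx : ‖x‖ ≤ 1 / 2) : ∀ i, ‖hornerExp K x i‖ ≤ 2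
  | 0 => by simp [hornerExp]
  | i + 1 => by
      have ih := norm_hornerExp_le (K := K) hx i
      rw [hornerExp]
      refine (norm_add_le _ _).trans ?_
      rw [norm_one, norm_div, norm_mul, Complex.norm_natCast]
      have h1 : ‖hornerExp K x i‖ * ‖x‖ ≤ 2 * (1 / 2) := by gcongr
      rcases Nat.eq_zero_or_pos (K - i) with h | h
      · rw [h]; simp
      · have h' : (1 : ℝ) ≤ (K - i : ℕ) := by exact_mod_cast h
        have := div_le_self (mul_nonneg (norm_nonneg (hornerExp K x i)) (norm_nonneg x)) h'
        linarith

/-- The invariant of Horner's scheme: the unevaluated terms together with the current bracket make up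
the whole sum. -/
theorem sum_add_hornerExp (K : ℕ) (x : ℂ) : ∀ i ≤ K,
    ∑ j ∈ Finset.range (K - i), x ^ j / (j.factorial : ℂ) +
      x ^ (K - i) / ((K - i).factorial : ℂ) * hornerExp K x i =
    ∑ j ∈ Finset.range (K + 1), x ^ j / (j.factorial : ℂ)
  | 0, _ => by simp [hornerExp, Finset.sum_range_succ]
  | i + 1, hi => by
      rw [← sum_add_hornerExp K x i (by omega), hornerExp]
      obtain ⟨d, hd⟩ : ∃ d, K - i = d + 1 := ⟨K - (i + 1), by omega⟩
      have hd' : K - (i + 1) = d := by omega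
      rw [hd, hd', Finset.sum_range_succ, Nat.factorial_succ]
      have : ((d : ℂ) + 1) ≠ 0 := by exact_mod_cast Nat.succ_ne_zero d
      have : (d.factorial : ℂ) ≠ 0 := by exact_mod_cast d.factorial_ne_zero
      push_cast
      field_simp
      ring

theorem norm_hornerExp_sub_exp {K : ℕ} {x : ℂ} (hx : ‖x‖ ≤ 1 / 2) :
    ‖hornerExp K x K - Complex.exp x‖ ≤ (1 / 2) ^ K := by
  have h := sum_add_hornerExp K x K le_rfl
  simp only [Nat.sub_self, Finset.range_zero, Finset.sum_empty, zero_add, pow_zero,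
    Nat.factorial_zero, Nat.cast_one, div_one, one_mul] at h
  rw [h, norm_sub_rev]
  refine (Complex.exp_bound (hx.trans (by norm_num)) (Nat.succ_pos K)).trans ?_
  have h1 : ((K + 1).succ : ℝ) * (((K + 1).factorial : ℝ) * ((K + 1 : ℕ) : ℝ))⁻¹ ≤ 2 := by
    rw [← div_eq_mul_inv, div_le_iff₀ (by positivity)]
    have : (1 : ℝ) ≤ (K + 1).factorial := by exact_mod_cast Nat.factorial_pos _
    push_cast
    nlinarith [(Nat.cast_nonneg K : (0 : ℝ) ≤ K)]
  calc _ ≤ (1 / 2 : ℝ) ^ (K + 1) * 2 :=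
        mul_le_mul (pow_le_pow_left₀ (norm_nonneg _) hx _) h1 (by positivity) (by positivity)
    _ = _ := by rw [pow_succ]; ring

/-- Compute `exp (π i / ν)`, where `ν` is the content of register `nr`, from the value of `π` in
register `b + 10`, in registers `b + 12` and `b + 13`. -/
def rootC (b nr : ℕ) (cm : Cmd) : Cmd :=
  .seq (.seq (.assign (b + 11) (.div (.reg (b + 10)) (.reg nr))) <|
    .seq (.assign (b + 12) (.shl (.const 1) (.reg (b + 36)))) (.assign (b + 13) (.const 0))) <|
  .for (b + 3) (b + 36) <|
    .seq (.seq (.assign (b + 4) (.sub (.reg (b + 36)) (.reg (b + 3)))) <|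
      .seq (.assign (b + 32) (.reg (b + 12))) <| .seq (.assign (b + 33) (.reg (b + 13))) <|
      .seq (.assign (b + 34) (.const 0)) (.assign (b + 35) (.reg (b + 11)))) <|
    .seq cm <|
      .seq (.assign (b + 12) (.add (.shl (.const 1) (.reg (b + 36)))
          (.div (.reg (b + 37)) (.reg (b + 4)))))
        (.assign (b + 13) (.div (.reg (b + 38)) (.reg (b + 4))))

set_option maxHeartbeats 400000 in
/-- Horner's scheme at the argument `π i / ν`, of norm at most `1 / 2` since `8 ≤ ν`: every step halves
the error made so far, so that the errors do not accumulate. -/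
theorem rootC_spec {O : ℕ → ℕ → ℤ} {b nr : ℕ} {cm : Cmd} {J : State → Prop} {q Q M L ℓ ν : ℕ}
    (h : CMul O (b + 32) cm J q Q M) (hq : 8 ≤ q) (hQ : q + 2 ≤ Q) (hL : Q + 2 ≤ L)
    (hℓ : len (q : ℤ) ≤ ℓ) (hν : 8 ≤ ν) (hνL : len (ν : ℤ) ≤ L)
    (hνℓ : len (ν : ℤ) ≤ ℓ)
    {σ : State} (hJ : J σ) (hnr : σ.reg nr = ν)
    (hpi : |(σ.reg (b + 10) : ℝ) - 2 ^ q * Real.pi| ≤ 11 * q) :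
    Tri O (rootC b nr cm) σ ((q + 1) * (M + 4000 * (L * (1 + ℓ)))) fun σ' => J σ' ∧
      ‖gi (σ'.reg (b + 12)) (σ'.reg (b + 13)) - 2 ^ q * Complex.exp (Real.pi / ν * Complex.I)‖ ≤
        32 * q ∧
      Same (fun r => r < b + 32 ∧ r ≠ b + 3 ∧ r ≠ b + 4 ∧ r ≠ b + 11 ∧ r ≠ b + 12 ∧ r ≠ b + 13)
        (fun a => a < b + 32) σ σ' := by
  have hL1 : 1 ≤ L := by omega
  have hqr : (8 : ℝ) ≤ q := by exact_mod_cast hq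
  have hνr : (8 : ℝ) ≤ ν := by exact_mod_cast hν
  have hqr' := h.prec σ hJ
  rw [show b + 32 + 4 = b + 36 by ring] at hqr'
  have hqL : len (q : ℤ) ≤ L := (len_natCast_le_self q).trans (by omega)
  have hstab : ∀ τ τ', J τ → Same (fun r => b + 36 ≤ r ∧ r ≠ b + 37 ∧ r ≠ b + 38)
      (fun a => b + 32 ≤ a) τ τ' → J τ' := h.stable
  have h2q : (18 : ℝ) * q + 8 ≤ 2 ^ q := by
    have : 18 * q + 8 ≤ 2 ^ q := by
      induction q, hq using Nat.le_induction with
      | base => norm_num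
      | succ k hk ih =>
        clear * - hk
        induction k, hk using Nat.le_induction with
        | base => norm_num
        | succ k hk ih => rw [pow_succ]; omega
    exact_mod_cast this
  have hQ2 : (2 : ℝ) ^ q * 4 ≤ 2 ^ Q := by
    calc (2 : ℝ) ^ q * 4 = 2 ^ (q + 2) := by ring
      _ ≤ _ := pow_le_pow_right₀ (by norm_num) hQ
  set x : ℂ := Real.pi / ν * Complex.I with hx
  have hxn : ‖x‖ ≤ 1 / 2 := by
    rw [hx, norm_mul, Complex.norm_I, mul_one, norm_div, Complex.norm_real, Complex.norm_natCast,
      Real.norm_of_nonneg Real.pi_pos.le, div_le_iff₀ (by linarith)]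
    linarith [Real.pi_lt_four]
  set θ : ℤ := σ.reg (b + 10) / ν with hθ
  have hθx : ‖gi 0 θ - 2 ^ q * x‖ ≤ 3 * q := by
    have h1 := abs_floor_div_sub (σ.reg (b + 10)) (d := ν) (by exact_mod_cast (by omega : 0 < ν))
    have h2 : |(σ.reg (b + 10) : ℝ) / ν - 2 ^ q * Real.pi / ν| ≤ 11 * q / 8 := by
      rw [← sub_div, abs_div, abs_of_pos (by linarith : (0 : ℝ) < ν)]
      exact div_le_div₀ (by positivity) hpi (by norm_num) hνr
    have e : gi 0 θ - 2 ^ q * x = (((θ : ℝ) - 2 ^ q * Real.pi / ν : ℝ) : ℂ) * Complex.I := by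
      rw [hx, gi]; push_cast; ring
    rw [e, norm_mul, Complex.norm_I, mul_one, Complex.norm_real, Real.norm_eq_abs]
    push_cast at h1
    calc _ ≤ _ := abs_sub_le _ ((σ.reg (b + 10) : ℝ) / ν) _
      _ ≤ _ := by rw [hθ]; linarith
  have hpiL : len (σ.reg (b + 10)) ≤ L := by
    refine len_le_of_abs_le (Q := Q) ?_ (by omega)
    have : |(σ.reg (b + 10) : ℝ)| ≤ 2 ^ Q := by
      have := abs_sub_le (σ.reg (b + 10) : ℝ) (2 ^ q * Real.pi) 0
      rw [sub_zero, sub_zero, abs_of_pos (by positivity : 0 < 2 ^ q * Real.pi)] at this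
      have hpi4 := mul_le_mul_of_nonneg_left Real.pi_lt_d2.le (by positivity : (0 : ℝ) ≤ 2 ^ q)
      linarith
    exact_mod_cast this
  set F := hornerExp q x with hF
  have hFn : ∀ i, ‖F i‖ ≤ 2 := norm_hornerExp_le hxn
  let I : ℕ → State → Prop := fun k τ => J τ ∧ τ.reg (b + 3) = k ∧ τ.reg (b + 11) = θ ∧
    ‖gi (τ.reg (b + 12)) (τ.reg (b + 13)) - 2 ^ q * F k‖ ≤ 18 * q + 8 ∧
    Same (fun r => r < b + 32 ∧ r ≠ b + 3 ∧ r ≠ b + 4 ∧ r ≠ b + 11 ∧ r ≠ b + 12 ∧ r ≠ b + 13)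
        (fun a => a < b + 32) σ τ
  refine ((Tri.line 10 (L := L) (ℓ := ℓ) (Q := fun τ => I 0 (τ.setR (b + 3) 0)) hL1
    (by simp [Cmd.Straight]) (by simp [Cmd.sz, Expr.sz]) ?_ ?_).seq (T₂ := (∑ k ∈ Finset.range q,
      (4 * 12 ^ 2 * (L * (1 + ℓ)) + (M + 4 * 12 ^ 2 * (L * (1 + ℓ))))) + (q + 1) * (100 * L))
      (R := I q) fun τ hτ => ?_).mono ?_ ?_
  · simp [Cmd.Leaf, Expr.Leaf, Cmd.exec, Expr.eval, len_zero, len_one, *]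
    omega
  · simp only [Cmd.exec, Expr.eval, I]
    refine ⟨hstab _ _ hJ ⟨fun r hr => ?_, fun a ha j => ?_⟩, by simp, by simp [hnr, hθ], ?_,
      fun r hr => ?_, fun a ha j => ?_⟩
    · simp; grind
    · simp
    · simp [hqr', hF, hornerExp, gi]; positivity
    · simp; grind
    · simp
  · refine Tri.for I q _ hqL hL1 ?_ ?_ ?_ hτ
    · rintro k τ ⟨hJk, -⟩
      exact h.prec τ hJk
    · rintro k τ hI; exact hI.2.1
    rintro k τ hk ⟨hJk, h3, h11, happ, hs⟩
    have hq' := h.prec τ hJk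
    rw [show b + 32 + 4 = b + 36 by ring] at hq'
    have hkL : len (k : ℤ) ≤ L := (len_natCast_mono hk.le).trans hqL
    have hd : (q : ℤ) - k = (q - k : ℕ) := by omega
    have hdℓ : len ((q - k : ℕ) : ℤ) ≤ ℓ := (len_natCast_mono (by omega)).trans hℓ
    have hdL : len ((q - k : ℕ) : ℤ) ≤ L := (len_natCast_mono (by omega)).trans hqL
    obtain ⟨m0, m1⟩ := abs_le_of_approx (Q := Q) happ (hFn k) (by linarith)
    obtain ⟨-, m2⟩ := abs_le_of_approx (Q := Q) hθx hxn (by linarith)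
    have m0 := len_le_of_abs_le (L := L) m0 (by omega)
    have m1 := len_le_of_abs_le (L := L) m1 (by omega)
    have m2 := len_le_of_abs_le (L := L) m2 (by omega)
    have m2' : len (σ.reg (b + 10) / ν) ≤ L := m2
    refine (Tri.line 12 (L := L) (ℓ := ℓ) (Q := fun τ' => J τ' ∧ τ'.reg (b + 3) = k ∧
      τ'.reg (b + 4) = (q - k : ℕ) ∧ τ'.reg (b + 11) = θ ∧
      τ'.reg (b + 32) = τ.reg (b + 12) ∧ τ'.reg (b + 33) = τ.reg (b + 13) ∧ τ'.reg (b + 34) = 0 ∧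
      τ'.reg (b + 35) = θ ∧ Same (fun r => r < b + 32 ∧ r ≠ b + 4) (· < b + 32) τ τ') hL1
      (by simp [Cmd.Straight]) (by simp [Cmd.sz, Expr.sz]) ?_ ?_).seq fun τ₁ hτ₁ => ?_
    · simp [Cmd.Leaf, Expr.Leaf, Expr.eval, Cmd.exec, len_zero, *]
    · simp only [Cmd.exec, Expr.eval]
      refine ⟨hstab _ _ hJk ⟨fun r hr => ?_, fun a ha j => ?_⟩, by simp [h3], by simp [h3, hq', hd],
        by simp [h11], by simp, by simp, by simp, by simp [h11], fun r hr => ?_, fun a ha j => ?_⟩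
      · simp; grind
      · simp
      · simp; grind
      · simp
    obtain ⟨j1, i1, e4, e11, e1, e2, e34, e35, s1⟩ := hτ₁
    refine (h.run_approx j1 (α := F k) (ω := x) (Ea := 18 * q + 8) (Ew := 3 * q) (Ab := 2)
      (Om := 1 / 2) ?_ ?_ (hFn k) hxn h2q (by linarith) (by linarith)).seq fun τ₂ hτ₂ => ?_
    · show ‖gi (τ₁.reg (b + 32)) (τ₁.reg (b + 33)) - _‖ ≤ _
      rw [e1, e2]; exact happ
    · show ‖gi (τ₁.reg (b + 34)) (τ₁.reg (b + 35)) - _‖ ≤ _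
      rw [e34, e35]; exact hθx
    obtain ⟨j2, a2, s2⟩ := hτ₂
    change ‖gi (τ₂.reg (b + 37)) (τ₂.reg (b + 38)) - _‖ ≤ _ at a2
    have hFx : ‖F k * x‖ ≤ 1 := by
      rw [norm_mul]
      calc _ ≤ 2 * (1 / 2 : ℝ) := by gcongr; exact hFn k
        _ = 1 := by norm_num
    obtain ⟨m7, m8⟩ := abs_le_of_approx (Q := Q) a2 hFx (by linarith)
    have m7 := len_le_of_abs_le (L := L) m7 (by omega)
    have m8 := len_le_of_abs_le (L := L) m8 (by omega)
    have e4' : τ₂.reg (b + 4) = (q - k : ℕ) := by rw [s2.1 _ (by omega), e4]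
    have hq2 := h.prec τ₂ j2
    rw [show b + 32 + 4 = b + 36 by ring] at hq2
    refine Tri.line 12 (L := L) (ℓ := ℓ) hL1 (by simp [Cmd.Straight]) (by simp [Cmd.sz, Expr.sz])
      ?_ ?_
    · simp [Cmd.Leaf, Expr.Leaf, Cmd.exec, Expr.eval, len_one, *]
      omega
    · simp only [Cmd.exec, Expr.eval, I]
      refine ⟨?_, hstab _ _ j2 ⟨fun r hr => ?_, fun a ha j => ?_⟩, by simp, ?_, ?_,
        fun r hr => ?_, fun a ha j => ?_⟩
      · simp [s2.1 (b + 3) (by omega), i1]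
      · simp; grind
      · simp
      · simp [s2.1 (b + 11) (by omega), e11]
      · simp only [State.setR_reg, add_right_inj, Nat.reduceEqDiff, if_true, if_false, e4', hq2,
          Int.toNat_natCast]
        have hdpos : 0 < q - k := by omega
        have hd1 : (1 : ℝ) ≤ (q - k : ℕ) := by exact_mod_cast hdpos
        have hd0 : ((q - k : ℕ) : ℂ) ≠ 0 := by exact_mod_cast hdpos.ne'
        set u := τ₂.reg (b + 37)
        set v := τ₂.reg (b + 38)
        have f1 := norm_gi_ediv_sub u v (d := (q - k : ℕ)) (by exact_mod_cast hdpos)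
        have f2 : ‖gi u v / ((q - k : ℕ) : ℂ) - 2 ^ q * (F k * x) / ((q - k : ℕ) : ℂ)‖ ≤
            18 * q + 6 := by
          rw [← sub_div, norm_div, Complex.norm_natCast]
          refine (div_le_self (norm_nonneg _) hd1).trans (a2.trans ?_)
          linarith
        have e : gi (1 * 2 ^ q + u / ((q - k : ℕ) : ℤ)) (v / ((q - k : ℕ) : ℤ)) -
            2 ^ q * F (k + 1) = (gi (u / ((q - k : ℕ) : ℤ)) (v / ((q - k : ℕ) : ℤ)) -
              gi u v / ((q - k : ℕ) : ℂ)) +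
              (gi u v / ((q - k : ℕ) : ℂ) - 2 ^ q * (F k * x) / ((q - k : ℕ) : ℂ)) := by
          rw [hF, hornerExp]
          simp only [gi]; push_cast; ring
        rw [e]
        refine (norm_add_le _ _).trans ?_
        push_cast at f1
        linarith
      · have := s2.1 r hr.1
        have := s1.1 r ⟨hr.1, hr.2.2.1⟩
        have := hs.1 r hr
        simp; grind
      · have := s2.2 a ha j
        have := s1.2 a ha j
        have := hs.2 a ha j
        simp; grind
  · rw [Finset.sum_const, Finset.card_range, smul_eq_mul]
    nlinarith [Nat.zero_le (q * (L * ℓ)), Nat.zero_le (L * ℓ), Nat.zero_le (q * L)]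
  · rintro τ ⟨h1, -, -, h2, h3⟩
    refine ⟨h1, ?_, h3⟩
    have e : gi (τ.reg (b + 12)) (τ.reg (b + 13)) - 2 ^ q * Complex.exp x =
      (gi (τ.reg (b + 12)) (τ.reg (b + 13)) - 2 ^ q * F q) +
        2 ^ q * (hornerExp q x q - Complex.exp x) := by rw [hF]; ring
    rw [e]
    refine (norm_add_le _ _).trans ?_
    rw [norm_mul, norm_pow, Complex.norm_ofNat]
    have h5 := mul_le_mul_of_nonneg_left (norm_hornerExp_sub_exp (K := q) hxn)
      (by positivity : (0 : ℝ) ≤ 2 ^ q)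
    rw [← mul_pow, show (2 : ℝ) * (1 / 2) = 1 by norm_num, one_pow] at h5
    linarith

/-! ### The fast Fourier transform -/

/-- The discrete Fourier transforms of length `2 ^ l` of the subsequences of `x` with step
`2 ^ (r - l)`. The one that starts at `x p` occupies the positions `p 2 ^ l, …, (p + 1) 2 ^ l - 1`;
`l = 0` is the sequence `x` and `l = r` is its Fourier transform. -/
noncomputable def partialDft (ζ : ℂ) (r : ℕ) (x : ℕ → ℂ) (l i : ℕ) : ℂ :=
  ∑ j ∈ Finset.range (2 ^ l), x (i / 2 ^ l + j * 2 ^ (r - l)) * ζ ^ (2 ^ (r - l) * j * (i % 2 ^ l))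

theorem partialDft_zero (ζ : ℂ) (r : ℕ) (x : ℕ → ℂ) (i : ℕ) : partialDft ζ r x 0 i = x i := by
  simp [partialDft, Nat.mod_one]

theorem partialDft_self (ζ : ℂ) (r : ℕ) (x : ℕ → ℂ) {i : ℕ} (hi : i < 2 ^ r) :
    partialDft ζ r x r i = ∑ j ∈ Finset.range (2 ^ r), x j * ζ ^ (j * i) := by
  simp [partialDft, Nat.div_eq_of_lt hi, Nat.mod_eq_of_lt hi]

theorem sum_range_two_mul {M : Type*} [AddCommMonoid M] (f : ℕ → M) (n : ℕ) :
    ∑ j ∈ Finset.range (2 * n), f j = ∑ j ∈ Finset.range n, (f (2 * j) + f (2 * j + 1)) := by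
  induction n with
  | zero => simp
  | succ n ih =>
    rw [show 2 * (n + 1) = 2 * n + 1 + 1 by ring, Finset.sum_range_succ, Finset.sum_range_succ, ih,
      Finset.sum_range_succ, add_assoc]

/-- The index of the first operand of the butterfly that computes entry `i` from level `l`. -/
def butterflyIdx (l i : ℕ) : ℕ := i / 2 ^ (l + 1) * 2 ^ l + i % 2 ^ l

theorem butterflyIdx_lt {r l i : ℕ} (hl : l < r) (hi : i < 2 ^ r) :
    butterflyIdx l i < 2 ^ (r - 1) := by
  have h1 : i / 2 ^ (l + 1) < 2 ^ (r - 1 - l) := by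
    rw [Nat.div_lt_iff_lt_mul (by positivity), ← pow_add]
    convert hi using 2; omega
  have h2 : i % 2 ^ l < 2 ^ l := Nat.mod_lt _ (by positivity)
  have h3 : 2 ^ (r - 1) = 2 ^ (r - 1 - l) * 2 ^ l := by rw [← pow_add]; congr 1; omega
  rw [butterflyIdx, h3]
  have := Nat.mul_le_mul_right (2 ^ l) (Nat.succ_le_of_lt h1)
  rw [Nat.succ_mul] at this
  omega

/-- The butterfly. With this arrangement of the transforms, no permutation of the input is needed. -/
theorem partialDft_succ {ζ : ℂ} {r : ℕ} (hζ : ζ ^ 2 ^ r = 1) (x : ℕ → ℂ) {l : ℕ} (hl : l < r)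
    (i : ℕ) : partialDft ζ r x (l + 1) i = partialDft ζ r x l (butterflyIdx l i) +
      partialDft ζ r x l (butterflyIdx l i + 2 ^ (r - 1)) *
        ζ ^ (i % 2 ^ (l + 1) * 2 ^ (r - l - 1)) := by
  have hm : 0 < 2 ^ l := by positivity
  have e1 : butterflyIdx l i / 2 ^ l = i / 2 ^ (l + 1) := by
    rw [butterflyIdx, mul_comm, Nat.mul_add_div hm, Nat.div_eq_of_lt (Nat.mod_lt _ hm), add_zero]
  have e2 : butterflyIdx l i % 2 ^ l = i % 2 ^ l := by
    rw [butterflyIdx, mul_comm, Nat.mul_add_mod, Nat.mod_mod]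
  have hr : 2 ^ (r - 1) = 2 ^ l * 2 ^ (r - l - 1) := by rw [← pow_add]; congr 1; omega
  have e3 : (butterflyIdx l i + 2 ^ (r - 1)) / 2 ^ l = i / 2 ^ (l + 1) + 2 ^ (r - l - 1) := by
    rw [hr, Nat.add_mul_div_left _ _ hm, e1]
  have e4 : (butterflyIdx l i + 2 ^ (r - 1)) % 2 ^ l = i % 2 ^ l := by
    rw [hr, Nat.add_mul_mod_self_left, e2]
  have h2 : 2 ^ (r - l) = 2 * 2 ^ (r - l - 1) := by rw [← pow_succ']; congr 1; omega
  obtain ⟨k, hk⟩ : ∃ k, i % 2 ^ (l + 1) = i % 2 ^ l + 2 ^ l * k :=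
    ⟨i / 2 ^ l % 2, by rw [pow_succ, Nat.mod_mul]⟩
  have hper : ∀ j, ζ ^ (2 ^ (r - l) * j * (i % 2 ^ (l + 1))) =
      ζ ^ (2 ^ (r - l) * j * (i % 2 ^ l)) := by
    intro j
    have : 2 ^ (r - l) * j * (i % 2 ^ (l + 1)) = 2 ^ (r - l) * j * (i % 2 ^ l) + 2 ^ r * (j * k) := by
      rw [hk, show 2 ^ r = 2 ^ (r - l) * 2 ^ l by rw [← pow_add]; congr 1; omega]; ring
    rw [this, pow_add, pow_mul ζ (2 ^ r), hζ, one_pow, mul_one]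
  rw [partialDft, partialDft, partialDft, e1, e2, e3, e4, pow_succ', sum_range_two_mul,
    Finset.sum_add_distrib, Finset.sum_mul, ← pow_succ', show r - (l + 1) = r - l - 1 by omega]
  congr 1
  · refine Finset.sum_congr rfl fun j _ => ?_
    rw [← hper j, h2]
    congr 2 <;> ring
  · refine Finset.sum_congr rfl fun j _ => ?_
    rw [← hper j, h2, mul_assoc (x (i / 2 ^ (l + 1) + 2 ^ (r - l - 1) + j * (2 * 2 ^ (r - l - 1)))),
      ← pow_add]
    congr 2 <;> ring

theorem norm_partialDft_le {ζ : ℂ} (hζ : ‖ζ‖ = 1) (r : ℕ) {x : ℕ → ℂ} {B : ℝ}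
    (hx : ∀ i, ‖x i‖ ≤ B) (l i : ℕ) : ‖partialDft ζ r x l i‖ ≤ 2 ^ l * B := by
  refine (norm_sum_le _ _).trans ((Finset.sum_le_card_nsmul _ _ B fun j _ => ?_).trans ?_)
  · rw [norm_mul, norm_pow, hζ, one_pow, mul_one]; exact hx _
  · simp

/-- Copy the first `R` entries of the complex array `Y` to `X`, where `R` is the content of register
`b + 1`. -/
def copyC (b X Y : ℕ) : Cmd :=
  .for (b + 3) (b + 1) <| .seq (.put X (.reg (b + 3)) (.get Y (.reg (b + 3))))
    (.put (X + 1) (.reg (b + 3)) (.get (Y + 1) (.reg (b + 3))))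

theorem copyC_spec {O : ℕ → ℕ → ℤ} {b X Y R L : ℕ} (hL1 : 1 ≤ L) (hRL : len (R : ℤ) ≤ L)
    (hXY : Y + 1 < X ∨ X + 1 < Y) {σ : State} (hR : σ.reg (b + 1) = R)
    (hY : ∀ i : ℕ, i < R → len (σ.mem Y i) ≤ L ∧ len (σ.mem (Y + 1) i) ≤ L) :
    Tri O (copyC b X Y) σ ((R + 1) * (400 * L)) fun σ' =>
      (∀ i : ℕ, i < R → σ'.cv X i = σ.cv Y i) ∧
      Same (fun r => r ≠ b + 3) (fun a => a ≠ X ∧ a ≠ X + 1) σ σ' := by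
  let I : ℕ → State → Prop := fun k τ => τ.reg (b + 3) = k ∧
    (∀ i : ℕ, i < k → τ.cv X i = σ.cv Y i) ∧
    Same (fun r => r ≠ b + 3) (fun a => a ≠ X ∧ a ≠ X + 1) σ τ
  refine (Tri.for I R (fun _ => 4 * 8 ^ 2 * (L * (1 + 0))) hRL hL1 ?_ ?_ ?_ ?_).mono ?_ ?_
  · rintro k τ ⟨-, -, hs⟩
    rw [hs.1 _ (by omega), hR]
  · rintro k τ hI; exact hI.1
  · rintro k τ hk ⟨h3, hv, hs⟩
    have hkL : len (k : ℤ) ≤ L := (len_natCast_mono hk.le).trans hRL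
    have y0 := hs.2 Y ⟨by omega, by omega⟩ k
    have y1 := hs.2 (Y + 1) ⟨by omega, by omega⟩ k
    obtain ⟨m0, m1⟩ := hY k hk
    have n1 : Y + 1 ≠ X := by omega
    have n2 : Y + 1 ≠ X + 1 := by omega
    refine Tri.line 8 (L := L) (ℓ := 0) hL1 (by simp [Cmd.Straight])
      (by simp [Cmd.sz, Expr.sz]) ?_ ?_
    · simp [Cmd.Leaf, Expr.Leaf, Cmd.exec, Expr.eval, *]
    · simp only [Cmd.exec, Expr.eval, I]
      refine ⟨by simp [h3], by simp, ?_, fun r hr => ?_, fun a ha j => ?_⟩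
      · intro j hj
        rcases Nat.lt_or_ge j k with hjk | hjk
        · have : ((j : ℤ) = k) = False := by simp; omega
          have hj' := hv j hjk
          simpa [State.cv, h3, this] using hj'
        · obtain rfl : j = k := by omega
          simp [State.cv, h3, y0, y1, n1]
      · have := hs.1 r hr
        simp; grind
      · have := hs.2 a ha j
        simp; grind
  · refine ⟨by simp, fun i hi => by omega, fun r hr => ?_, fun a ha j => by simp⟩
    simp; grind
  · rw [Finset.sum_const, Finset.card_range, smul_eq_mul]
    nlinarith [Nat.zero_le (R * L)]
  · rintro τ ⟨-, h2, h3⟩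
    exact ⟨h2, h3⟩

theorem intCast_div_two_pow (i k : ℕ) : (i : ℤ) / 2 ^ k = ((i / 2 ^ k : ℕ) : ℤ) := by push_cast; rfl

theorem intCast_sub_div_mul (i k : ℕ) :
    (i : ℤ) - ((i / 2 ^ k : ℕ) : ℤ) * 2 ^ k = ((i % 2 ^ k : ℕ) : ℤ) := by
  have := Nat.div_add_mod i (2 ^ k)
  have h : ((2 ^ k * (i / 2 ^ k) + i % 2 ^ k : ℕ) : ℤ) = i := by rw [this]
  push_cast at h ⊢
  linarith

/-- One level of the transform of the complex array `X`, with the result in the array `b + 6`. The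
array `b` holds the powers of a root of unity of order `2 ^ r`, registers `b` and `b + 1` hold `r`
and `2 ^ r`, register `b + 2` the number of the level. -/
def fftLevelC (b X : ℕ) (cm : Cmd) : Cmd :=
  .for (b + 3) (b + 1) <|
    .seq (.seq (.assign (b + 4) (.shr (.reg (b + 3)) (.add (.reg (b + 2)) (.const 1)))) <|
      .seq (.assign (b + 5) (.sub (.reg (b + 3))
        (.shl (.reg (b + 4)) (.add (.reg (b + 2)) (.const 1))))) <|
      .seq (.assign (b + 6) (.add (.shl (.reg (b + 4)) (.reg (b + 2)))
        (.sub (.reg (b + 3)) (.shl (.shr (.reg (b + 3)) (.reg (b + 2))) (.reg (b + 2)))))) <|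
      .seq (.assign (b + 7) (.shl (.reg (b + 5))
        (.sub (.sub (.reg b) (.reg (b + 2))) (.const 1)))) <|
      .seq (.assign (b + 8) (.add (.reg (b + 6)) (.shr (.reg (b + 1)) (.const 1)))) <|
      .seq (.assign (b + 32) (.get X (.reg (b + 8)))) <|
      .seq (.assign (b + 33) (.get (X + 1) (.reg (b + 8)))) <|
      .seq (.assign (b + 34) (.get b (.reg (b + 7)))) <|
        .assign (b + 35) (.get (b + 1) (.reg (b + 7)))) <|
    .seq cm <|
      .seq (.put (b + 6) (.reg (b + 3)) (.add (.get X (.reg (b + 6))) (.reg (b + 37))))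
        (.put (b + 7) (.reg (b + 3)) (.add (.get (X + 1) (.reg (b + 6))) (.reg (b + 38))))

set_option maxHeartbeats 1000000 in
theorem fftLevelC_spec {O : ℕ → ℕ → ℤ} {b X : ℕ} {cm : Cmd} {J : State → Prop}
    {q Q M L r l : ℕ} (h : CMul O (b + 32) cm J q Q M) (hL : Q + 2 ≤ L) (hrL : r + 2 ≤ L)
    (hX : X = b + 2 ∨ X = b + 4) (hl : l < r) {ζ : ℂ} (hζ1 : ‖ζ‖ = 1)
    (hζ : ζ ^ 2 ^ r = 1) {x : ℕ → ℂ} {B δ E : ℝ} (hx : ∀ i, ‖x i‖ ≤ B) (hEq : E ≤ 2 ^ q)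
    (hB1 : 2 ^ q * (2 ^ r * B) + (E + ((2 ^ l * B + 1) * δ + 2)) ≤ 2 ^ Q)
    (hB2 : 2 ^ q * 1 + δ ≤ 2 ^ Q)
    {σ : State} (hJ : J σ) (hr : σ.reg b = r) (hR : σ.reg (b + 1) = (2 ^ r : ℕ))
    (hl' : σ.reg (b + 2) = l)
    (hW : ∀ i : ℕ, i < 2 ^ r → ‖σ.cv b i - 2 ^ q * ζ ^ i‖ ≤ δ)
    (hXv : ∀ i : ℕ, i < 2 ^ r → ‖σ.cv X i - 2 ^ q * partialDft ζ r x l i‖ ≤ E) :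
    Tri O (fftLevelC b X cm) σ ((2 ^ r + 1) * (M + 16000 * L)) fun σ' => J σ' ∧
      (∀ i : ℕ, i < 2 ^ r → ‖σ'.cv (b + 6) i - 2 ^ q * partialDft ζ r x (l + 1) i‖ ≤
        2 * E + ((2 ^ l * B + 1) * δ + 2)) ∧
      (∀ i : ℕ, i < 2 ^ r → len (σ'.mem (b + 6) i) ≤ L ∧ len (σ'.mem (b + 7) i) ≤ L) ∧
      Same (fun r => r < b + 32 ∧ (r < b + 3 ∨ b + 9 ≤ r))
        (fun a => a < b + 32 ∧ a ≠ b + 6 ∧ a ≠ b + 7) σ σ' := by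
  have hL1 : 1 ≤ L := by omega
  have hδ0 : 0 ≤ δ := (norm_nonneg _).trans (hW 0 (by positivity))
  have hE0 : 0 ≤ E := (norm_nonneg _).trans (hXv 0 (by positivity))
  have hB0 : 0 ≤ B := (norm_nonneg _).trans (hx 0)
  have hstab : ∀ τ τ', J τ → Same (fun r => b + 36 ≤ r ∧ r ≠ b + 37 ∧ r ≠ b + 38)
      (fun a => b + 32 ≤ a) τ τ' → J τ' := h.stable
  have hidx : ∀ i : ℕ, i < 2 ^ r → len (i : ℤ) ≤ L := fun i hi =>
    (len_natCast_le.2 hi).trans (by omega)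
  have hRL : len ((2 ^ r : ℕ) : ℤ) ≤ L := by
    have := len_two_pow r
    push_cast; omega
  have hrl : len (r : ℤ) ≤ L := (len_natCast_le_self r).trans (by omega)
  have hll : len (l : ℤ) ≤ L := (len_natCast_le_self l).trans (by omega)
  have hn : ∀ i, ‖partialDft ζ r x l i‖ ≤ 2 ^ l * B := norm_partialDft_le hζ1 r hx l
  have hlr : (2 : ℝ) ^ l * B ≤ 2 ^ r * B := by gcongr; norm_num
  have hlr' : (2 : ℝ) ^ q * (2 ^ l * B) ≤ 2 ^ q * (2 ^ r * B) := by gcongr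
  have hG : 0 ≤ (2 ^ l * B + 1) * δ + 2 := by positivity
  have hXlen : ∀ i : ℕ, i < 2 ^ r → len (σ.mem X i) ≤ L ∧ len (σ.mem (X + 1) i) ≤ L := by
    intro i hi
    obtain ⟨a, b⟩ := abs_le_of_approx (Q := Q) (hXv i hi) (hn i) (by linarith)
    exact ⟨len_le_of_abs_le a (by omega), len_le_of_abs_le b (by omega)⟩
  have hζn : ∀ k, ‖ζ ^ k‖ ≤ 1 := fun k => by rw [norm_pow, hζ1, one_pow]
  have hWlen : ∀ i : ℕ, i < 2 ^ r → len (σ.mem b i) ≤ L ∧ len (σ.mem (b + 1) i) ≤ L := by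
    intro i hi
    obtain ⟨a, b⟩ := abs_le_of_approx (Q := Q) (hW i hi) (hζn i) hB2
    exact ⟨len_le_of_abs_le a (by omega), len_le_of_abs_le b (by omega)⟩
  let I : ℕ → State → Prop := fun k τ => J τ ∧ τ.reg (b + 3) = k ∧
    (∀ i : ℕ, i < k → ‖τ.cv (b + 6) i - 2 ^ q * partialDft ζ r x (l + 1) i‖ ≤
        2 * E + ((2 ^ l * B + 1) * δ + 2)) ∧
    (∀ i : ℕ, i < k → len (τ.mem (b + 6) i) ≤ L ∧ len (τ.mem (b + 7) i) ≤ L) ∧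
      Same (fun r => r < b + 32 ∧ (r < b + 3 ∨ b + 9 ≤ r))
        (fun a => a < b + 32 ∧ a ≠ b + 6 ∧ a ≠ b + 7) σ τ
  refine (Tri.for I (2 ^ r) (fun _ => 4 * 60 ^ 2 * (L * (1 + 0)) +
    (M + 4 * 12 ^ 2 * (L * (1 + 0)))) hRL hL1 ?_ ?_ ?_ ?_).mono ?_ ?_
  · rintro k τ ⟨-, -, -, -, hs⟩
    rw [hs.1 _ ⟨by omega, by omega⟩, hR]
  · rintro k τ hI; exact hI.2.1
  · rintro i τ hi ⟨hJi, h3, hv, hvl, hs⟩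
    have ht := butterflyIdx_lt hl hi
    have h2r : 2 ^ r = 2 ^ (r - 1) + 2 ^ (r - 1) := by
      rw [← two_mul, ← pow_succ']; congr 1; omega
    have htw : i % 2 ^ (l + 1) * 2 ^ (r - l - 1) < 2 ^ r := by
      have : i % 2 ^ (l + 1) < 2 ^ (l + 1) := Nat.mod_lt _ (by positivity)
      calc _ < 2 ^ (l + 1) * 2 ^ (r - l - 1) := Nat.mul_lt_mul_of_pos_right this (by positivity)
        _ = _ := by rw [← pow_add]; congr 1; omega
    set t := butterflyIdx l i with ht'
    set tw := i % 2 ^ (l + 1) * 2 ^ (r - l - 1) with htw'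
    have hcX : ∀ j, τ.mem X j = σ.mem X j := hs.2 X ⟨by omega, by omega, by omega⟩
    have hcX1 : ∀ j, τ.mem (X + 1) j = σ.mem (X + 1) j := hs.2 (X + 1) ⟨by omega, by omega, by omega⟩
    have hcb : ∀ j, τ.mem b j = σ.mem b j := hs.2 b ⟨by omega, by omega, by omega⟩
    have hcb1 : ∀ j, τ.mem (b + 1) j = σ.mem (b + 1) j := hs.2 (b + 1) ⟨by omega, by omega, by omega⟩
    have hrb : τ.reg b = r := by rw [hs.1 _ ⟨by omega, by omega⟩, hr]
    have hrb1 : τ.reg (b + 1) = 2 ^ r := by rw [hs.1 _ ⟨by omega, by omega⟩, hR]; norm_cast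
    have hrb2 : τ.reg (b + 2) = l := by rw [hs.1 _ ⟨by omega, by omega⟩, hl']
    have t1 : ((l : ℤ) + 1).toNat = l + 1 := by omega
    have t2 : ((r : ℤ) - l - 1).toNat = r - l - 1 := by omega
    have ep : (i : ℤ) / 2 ^ (l + 1) = ((i / 2 ^ (l + 1) : ℕ) : ℤ) := intCast_div_two_pow _ _
    have ek : (i : ℤ) - ((i / 2 ^ (l + 1) : ℕ) : ℤ) * 2 ^ (l + 1) = ((i % 2 ^ (l + 1) : ℕ) : ℤ) :=
      intCast_sub_div_mul _ _
    have ep' : (i : ℤ) / 2 ^ l = ((i / 2 ^ l : ℕ) : ℤ) := intCast_div_two_pow _ _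
    have ek' : (i : ℤ) - ((i / 2 ^ l : ℕ) : ℤ) * 2 ^ l = ((i % 2 ^ l : ℕ) : ℤ) :=
      intCast_sub_div_mul _ _
    have et : ((i / 2 ^ (l + 1) : ℕ) : ℤ) * 2 ^ l + ((i % 2 ^ l : ℕ) : ℤ) = (t : ℤ) := by
      rw [ht', butterflyIdx]; norm_cast
    have etw : ((i % 2 ^ (l + 1) : ℕ) : ℤ) * 2 ^ (r - l - 1) = (tw : ℤ) := by
      rw [htw']; norm_cast
    have eR : (2 : ℤ) ^ r / 2 = 2 ^ (r - 1) := by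
      rw [show (2 : ℤ) ^ r = 2 ^ (r - 1) * 2 by rw [← pow_succ]; congr 1; omega]; simp
    have et2 : (t : ℤ) + 2 ^ (r - 1) = ((t + 2 ^ (r - 1) : ℕ) : ℤ) := by norm_cast
    have hRL' : len (2 ^ r) ≤ L := by rw [len_two_pow]; omega
    have b1 := hidx i hi
    have b2 := hidx (i / 2 ^ (l + 1)) ((Nat.div_le_self _ _).trans_lt hi)
    have b3 := hidx (i % 2 ^ (l + 1)) ((Nat.mod_le _ _).trans_lt hi)
    have b4 := hidx t (by omega)
    have b5 := hidx (t + 2 ^ (r - 1)) (by omega)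
    have b6 := hidx tw htw
    obtain ⟨x1, x2⟩ := hXlen (t + 2 ^ (r - 1)) (by omega)
    obtain ⟨x3, x4⟩ := hXlen t (by omega)
    obtain ⟨w1, w2⟩ := hWlen tw htw
    refine (Tri.line 60 (L := L) (ℓ := 0) (Q := fun τ' => J τ' ∧ τ'.reg (b + 3) = i ∧
      τ'.reg (b + 6) = t ∧ gi (τ'.reg (b + 32)) (τ'.reg (b + 33)) = σ.cv X (t + 2 ^ (r - 1) : ℕ) ∧
      gi (τ'.reg (b + 34)) (τ'.reg (b + 35)) = σ.cv b tw ∧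
      Same (fun r => r < b + 32 ∧ (r < b + 4 ∨ b + 9 ≤ r)) (· < b + 32) τ τ') hL1
      (by simp [Cmd.Straight]) (by simp [Cmd.sz, Expr.sz]) ?_ ?_).seq fun τ₁ hτ₁ => ?_
    · simp only [Cmd.Leaf, Expr.Leaf, Expr.eval, Cmd.exec, State.setR_reg, State.setR_mem,
        add_right_inj, Nat.reduceEqDiff, if_true, if_false, left_eq_add,
        OfNat.ofNat_ne_zero, h3, hrb, hrb1, hrb2, hcX, hcX1, hcb, hcb1, t1, t2, ep, ek, ep', ek', et,
        etw, Int.toNat_one, pow_one, eR, et2, Int.toNat_natCast, len_one]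
      refine ⟨⟨b1, hll, hL1⟩, ⟨b1, b2, ⟨hll, hL1⟩, by omega⟩, ⟨⟨b2, hll, by omega⟩, b1, ⟨b1, hll⟩,
        hll, by omega⟩, ⟨b3, ⟨⟨hrl, hll⟩, hL1⟩, by omega⟩, ⟨b4, hRL', hL1⟩, ⟨b5, x1⟩, ⟨b5, x2⟩,
        ⟨b6, w1⟩, b6, w2⟩
    · simp only [Cmd.exec, Expr.eval]
      refine ⟨hstab _ _ hJi ⟨fun r hr => ?_, fun a ha j => ?_⟩, by simp [h3], ?_, ?_, ?_,
        fun r hr => ?_, fun a ha j => ?_⟩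
      · simp; grind
      · simp
      · simp only [State.setR_reg, State.setR_mem, add_right_inj, Nat.reduceEqDiff, if_true,
          if_false, left_eq_add, OfNat.ofNat_ne_zero, h3, hrb, hrb1, hrb2, hcX, hcX1,
          hcb, hcb1, t1, t2, ep, ek, ep', ek', et, etw, Int.toNat_one, Int.toNat_natCast,
          pow_one, eR, et2]
      · simp only [State.setR_reg, State.setR_mem, add_right_inj, Nat.reduceEqDiff, if_true,
          if_false, left_eq_add, OfNat.ofNat_ne_zero, h3, hrb, hrb1, hrb2, hcX, hcX1,
          hcb, hcb1, t1, t2, ep, ek, ep', ek', et, etw, Int.toNat_one, Int.toNat_natCast,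
          pow_one, eR, et2, State.cv]
      · simp only [State.setR_reg, State.setR_mem, add_right_inj, Nat.reduceEqDiff, if_true,
          if_false, left_eq_add, OfNat.ofNat_ne_zero, h3, hrb, hrb1, hrb2, hcX, hcX1,
          hcb, hcb1, t1, t2, ep, ek, ep', ek', et, etw, Int.toNat_one, Int.toNat_natCast,
          pow_one, eR, et2, State.cv]
      · simp; grind
      · simp
    obtain ⟨j1, i1, e6, e1, e2, s1⟩ := hτ₁
    refine (h.run_approx j1 (α := partialDft ζ r x l (t + 2 ^ (r - 1))) (ω := ζ ^ tw) (Ea := E)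
      (Ew := δ) (Ab := 2 ^ l * B) (Om := 1) ?_ ?_ (hn _) (hζn _) hEq (by linarith) hB2).seq
        fun τ₂ hτ₂ => ?_
    · show ‖gi (τ₁.reg (b + 32)) (τ₁.reg (b + 33)) - _‖ ≤ _
      rw [e1]; exact hXv _ (by omega)
    · show ‖gi (τ₁.reg (b + 34)) (τ₁.reg (b + 35)) - _‖ ≤ _
      rw [e2]; exact hW _ htw
    obtain ⟨j2, a2, s2⟩ := hτ₂
    change ‖gi (τ₂.reg (b + 37)) (τ₂.reg (b + 38)) - _‖ ≤ _ at a2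
    have hpn : ‖partialDft ζ r x l (t + 2 ^ (r - 1)) * ζ ^ tw‖ ≤ 2 ^ l * B := by
      rw [norm_mul, norm_pow, hζ1, one_pow, mul_one]; exact hn _
    obtain ⟨m7, m8⟩ := abs_le_of_approx (Q := Q) a2 hpn (by linarith)
    have m7' := len_le_of_abs_le (L := L) m7 (by omega)
    have m8' := len_le_of_abs_le (L := L) m8 (by omega)
    have i2 : τ₂.reg (b + 3) = i := by rw [s2.1 _ (by omega), i1]
    have e62 : τ₂.reg (b + 6) = t := by rw [s2.1 _ (by omega), e6]
    have s02 : Same (fun r => r < b + 32 ∧ (r < b + 4 ∨ b + 9 ≤ r)) (· < b + 32) τ τ₂ :=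
      s1.trans (s2.mono (fun r hr => hr.1) fun a ha => ha)
    have hX2 : ∀ j, τ₂.mem X j = σ.mem X j := fun j => by rw [s02.2 X (by omega), hcX]
    have hX21 : ∀ j, τ₂.mem (X + 1) j = σ.mem (X + 1) j := fun j => by
      rw [s02.2 (X + 1) (by omega), hcX1]
    have n1 : (X = b + 5) = False := by simp; omega
    have hval : ‖gi (σ.mem X t + τ₂.reg (b + 37)) (σ.mem (X + 1) t + τ₂.reg (b + 38)) -
        2 ^ q * partialDft ζ r x (l + 1) i‖ ≤ 2 * E + ((2 ^ l * B + 1) * δ + 2) := by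
      rw [partialDft_succ hζ x hl, ← gi_add, mul_add, add_sub_add_comm]
      refine (norm_add_le _ _).trans ?_
      have := hXv t (by omega)
      rw [State.cv] at this
      linarith
    have hlen1 : len (σ.mem X t + τ₂.reg (b + 37)) ≤ L ∧
        len (σ.mem (X + 1) t + τ₂.reg (b + 38)) ≤ L := by
      obtain ⟨u, v⟩ := abs_le_of_approx (Q := Q) (hXv t (by omega)) (hn t) (by linarith)
      exact ⟨(len_add_le (len_le_of_abs_le u le_rfl) (len_le_of_abs_le m7 le_rfl)).trans (by omega),
        (len_add_le (len_le_of_abs_le v le_rfl) (len_le_of_abs_le m8 le_rfl)).trans (by omega)⟩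
    refine Tri.line 12 (L := L) (ℓ := 0) hL1 (by simp [Cmd.Straight]) (by simp [Cmd.sz, Expr.sz])
      ?_ ?_
    · simp [Cmd.Leaf, Expr.Leaf, Cmd.exec, Expr.eval, n1, i2, e62, hX2, hX21, b1, b4, x3, x4, m7',
        m8']
    · simp only [Cmd.exec, Expr.eval, I]
      refine ⟨by simp [i2], hstab _ _ j2 ⟨fun r hr => ?_, fun a ha j => ?_⟩, by simp, ?_, ?_,
        fun r hr => ?_, fun a ha j => ?_⟩
      · simp; grind
      · simp; grind
      · intro j hj
        rcases Nat.lt_or_ge j i with hji | hji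
        · have e := s02.cv (X := b + 6) (by omega) (by omega) j
          have : ((j : ℤ) = i) = False := by simp; omega
          have hj' := hv j hji
          rw [← e] at hj'
          simpa [State.cv, i2, this] using hj'
        · obtain rfl : j = i := by omega
          simpa [State.cv, i2, e62, hX2, hX21, n1] using hval
      · intro j hj
        rcases Nat.lt_or_ge j i with hji | hji
        · have : ((j : ℤ) = i) = False := by simp; omega
          have hj' := hvl j hji
          rw [← s02.2 _ (by omega), ← s02.2 (b + 7) (by omega)] at hj'
          simpa [i2, this] using hj'
        · obtain rfl : j = i := by omega
          simpa [i2, e62, hX2, hX21, n1] using hlen1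
      · have := s02.1 r ⟨hr.1, by omega⟩
        have := hs.1 r hr
        simp; grind
      · have := s02.2 a ha.1 j
        have := hs.2 a ha j
        simp; grind
  · refine ⟨hstab _ _ hJ ⟨fun r hr => ?_, fun a ha j => by simp⟩, by simp, fun i hi => by omega,
      fun i hi => by omega, fun r hr => ?_, fun a ha j => by simp⟩
    · simp; grind
    · simp; grind
  · rw [Finset.sum_const, Finset.card_range, smul_eq_mul]
    nlinarith [Nat.zero_le (2 ^ r * L)]
  · rintro τ ⟨h1, -, h2, h3, h4⟩
    exact ⟨h1, h2, h3, h4⟩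

/-- The Fourier transform, in place, of the complex array `X`. -/
def fftC (b X : ℕ) (cm : Cmd) : Cmd :=
  .for (b + 2) b (.seq (fftLevelC b X cm) (copyC b X (b + 6)))

/-- The error of the transform after `l` levels. -/
noncomputable def fftErr (B δ E : ℝ) (l : ℕ) : ℝ := 2 ^ l * (E + l * (B * δ + δ + 2))

theorem fftErr_succ {B δ E : ℝ} (hB : 0 ≤ B) (hδ : 0 ≤ δ) (l : ℕ) :
    2 * fftErr B δ E l + ((2 ^ l * B + 1) * δ + 2) ≤ fftErr B δ E (l + 1) := by
  have h1 : (1 : ℝ) ≤ 2 ^ l := one_le_pow₀ (by norm_num)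
  have h2 : (2 ^ l * B + 1) * δ + 2 ≤ 2 ^ (l + 1) * (B * δ + δ + 2) := by
    rw [pow_succ]
    nlinarith [mul_nonneg hB hδ, mul_nonneg (by linarith : (0 : ℝ) ≤ 2 ^ l) hδ,
      mul_nonneg (by linarith : (0 : ℝ) ≤ 2 ^ l) (mul_nonneg hB hδ)]
  rw [fftErr, fftErr, Nat.cast_succ]
  refine (add_le_add_right h2 _).trans (le_of_eq ?_)
  ring

theorem fftErr_mono {B δ E : ℝ} (hB : 0 ≤ B) (hδ : 0 ≤ δ) (hE : 0 ≤ E) {l r : ℕ} (h : l ≤ r) :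
    fftErr B δ E l ≤ fftErr B δ E r := by
  have : (l : ℝ) ≤ r := by exact_mod_cast h
  unfold fftErr
  gcongr
  norm_num

theorem fftC_spec {O : ℕ → ℕ → ℤ} {b X : ℕ} {cm : Cmd} {J : State → Prop}
    {q Q M L r : ℕ} (h : CMul O (b + 32) cm J q Q M) (hL : Q + 2 ≤ L) (hrL : r + 2 ≤ L)
    (hX : X = b + 2 ∨ X = b + 4) {ζ : ℂ} (hζ1 : ‖ζ‖ = 1)
    (hζ : ζ ^ 2 ^ r = 1) {x : ℕ → ℂ} {B δ E : ℝ} (hx : ∀ i, ‖x i‖ ≤ B)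
    (hEq : fftErr B δ E r ≤ 2 ^ q) (hB1 : 2 ^ q * (2 ^ r * B) + fftErr B δ E r ≤ 2 ^ Q)
    (hB2 : 2 ^ q * 1 + δ ≤ 2 ^ Q)
    {σ : State} (hJ : J σ) (hr : σ.reg b = r) (hR : σ.reg (b + 1) = (2 ^ r : ℕ))
    (hW : ∀ i : ℕ, i < 2 ^ r → ‖σ.cv b i - 2 ^ q * ζ ^ i‖ ≤ δ)
    (hXv : ∀ i : ℕ, i < 2 ^ r → ‖σ.cv X i - 2 ^ q * x i‖ ≤ E) :
    Tri O (fftC b X cm) σ ((r + 1) * (2 ^ r + 1) * (M + 17000 * L)) fun σ' => J σ' ∧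
      (∀ i : ℕ, i < 2 ^ r → ‖σ'.cv X i - 2 ^ q * partialDft ζ r x r i‖ ≤ fftErr B δ E r) ∧
      Same (fun r => r < b + 32 ∧ (r < b + 2 ∨ b + 9 ≤ r))
        (fun a => a < b + 32 ∧ a ≠ X ∧ a ≠ X + 1 ∧ a ≠ b + 6 ∧ a ≠ b + 7) σ σ' := by
  have hL1 : 1 ≤ L := by omega
  have hB0 : 0 ≤ B := (norm_nonneg _).trans (hx 0)
  have hδ0 : 0 ≤ δ := (norm_nonneg _).trans (hW 0 (by positivity))
  have hE0 : 0 ≤ E := (norm_nonneg _).trans (hXv 0 (by positivity))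
  have hstab : ∀ τ τ', J τ → Same (fun r => b + 36 ≤ r ∧ r ≠ b + 37 ∧ r ≠ b + 38)
      (fun a => b + 32 ≤ a) τ τ' → J τ' := h.stable
  have hrl : len (r : ℤ) ≤ L := (len_natCast_le_self r).trans (by omega)
  have hRL : len ((2 ^ r : ℕ) : ℤ) ≤ L := by
    have := len_two_pow r
    push_cast; omega
  let I : ℕ → State → Prop := fun k τ => J τ ∧ τ.reg (b + 2) = k ∧
    (∀ i : ℕ, i < 2 ^ r → ‖τ.cv X i - 2 ^ q * partialDft ζ r x k i‖ ≤ fftErr B δ E k) ∧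
      Same (fun r => r < b + 32 ∧ (r < b + 2 ∨ b + 9 ≤ r))
        (fun a => a < b + 32 ∧ a ≠ X ∧ a ≠ X + 1 ∧ a ≠ b + 6 ∧ a ≠ b + 7) σ τ
  refine (Tri.for I r (fun _ => (2 ^ r + 1) * (M + 16000 * L) + (2 ^ r + 1) * (400 * L)) hrl hL1
    ?_ ?_ ?_ ?_).mono ?_ ?_
  · rintro k τ ⟨-, -, -, hs⟩
    rw [hs.1 _ ⟨by omega, by omega⟩, hr]
  · rintro k τ hI; exact hI.2.1
  · rintro l τ hl ⟨hJl, h2, hv, hs⟩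
    have hstep := fftErr_succ (E := E) hB0 hδ0 l
    have hlr := fftErr_mono (E := E) hB0 hδ0 hE0 hl.le
    have hlr' := fftErr_mono (E := E) hB0 hδ0 hE0 (Nat.succ_le_of_lt hl)
    have hEl0 : 0 ≤ fftErr B δ E l := (norm_nonneg _).trans (hv 0 (by positivity))
    refine (fftLevelC_spec h hL hrL hX hl hζ1 hζ hx (hlr.trans hEq) (δ := δ) (σ := τ) ?_ hB2 hJl
      ?_ ?_ h2 ?_ hv).seq ?_
    · rw [Nat.succ_eq_add_one] at hlr'; linarith
    · rw [hs.1 _ ⟨by omega, by omega⟩, hr]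
    · rw [hs.1 _ ⟨by omega, by omega⟩, hR]
    · intro i hi
      rw [hs.cv (by omega) (by omega)]
      exact hW i hi
    rintro τ₁ ⟨j1, v1, l1, s1⟩
    refine (copyC_spec hL1 hRL (by omega) (by
      rw [s1.1 _ ⟨by omega, by omega⟩, hs.1 _ ⟨by omega, by omega⟩, hR]) l1).mono le_rfl ?_
    rintro τ₂ ⟨v2, s2⟩
    refine ⟨?_, hstab _ _ j1 ⟨fun r hr => ?_, fun a ha j => ?_⟩, by simp, ?_, fun r hr => ?_,
      fun a ha j => ?_⟩
    · rw [s2.1 _ (by omega), s1.1 _ ⟨by omega, by omega⟩, h2]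
    · have := s2.1 r (by omega)
      simp; grind
    · have := s2.2 a ⟨by omega, by omega⟩ j
      simp; grind
    · intro i hi
      have := (v1 i hi).trans hstep
      rw [← v2 i hi] at this
      exact this
    · have := s2.1 r (by omega)
      have := s1.1 r ⟨hr.1, by omega⟩
      have := hs.1 r hr
      simp; grind
    · have := s2.2 a ⟨by omega, by omega⟩ j
      have := s1.2 a ⟨by omega, by omega, by omega⟩ j
      have := hs.2 a ha j
      simp; grind
  · refine ⟨hstab _ _ hJ ⟨fun r hr => ?_, fun a ha j => by simp⟩, by simp, fun i hi => ?_,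
      fun r hr => ?_, fun a ha j => by simp⟩
    · simp; grind
    · rw [partialDft_zero, fftErr]; simpa [State.cv] using hXv i hi
    · simp; grind
  · rw [Finset.sum_const, Finset.card_range, smul_eq_mul]
    have : 0 < 2 ^ r := by positivity
    generalize 2 ^ r = R at *
    nlinarith [Nat.zero_le (R * L), Nat.zero_le (r * R * L), Nat.zero_le (R * M),
      Nat.zero_le (r * R * M), Nat.zero_le (r * L)]
  · rintro τ ⟨h1, -, h2, h3⟩
    exact ⟨h1, h2, h3⟩

/-- The pointwise product of the complex arrays `b + 2` and `b + 4`, in place of the former. -/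
def pointwiseC (b : ℕ) (cm : Cmd) : Cmd :=
  .for (b + 3) (b + 1) <|
    .seq (.seq (.assign (b + 32) (.get (b + 2) (.reg (b + 3)))) <|
      .seq (.assign (b + 33) (.get (b + 3) (.reg (b + 3)))) <|
      .seq (.assign (b + 34) (.get (b + 4) (.reg (b + 3)))) <|
        .assign (b + 35) (.get (b + 5) (.reg (b + 3)))) <|
    .seq cm <|
      .seq (.put (b + 2) (.reg (b + 3)) (.reg (b + 37)))
        (.put (b + 3) (.reg (b + 3)) (.reg (b + 38)))

theorem pointwiseC_spec {O : ℕ → ℕ → ℤ} {b : ℕ} {cm : Cmd} {J : State → Prop}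
    {q Q M L R : ℕ} (h : CMul O (b + 32) cm J q Q M) (hL : Q + 2 ≤ L) (hRL : len (R : ℤ) ≤ L)
    {x y : ℕ → ℂ} {A B E F : ℝ} (hx : ∀ i, ‖x i‖ ≤ A) (hy : ∀ i, ‖y i‖ ≤ B) (hEq : E ≤ 2 ^ q)
    (hA : 2 ^ q * A + E ≤ 2 ^ Q) (hB : 2 ^ q * B + F ≤ 2 ^ Q)
    (hAB : 2 ^ q * (A * B) + (E * B + (A + 1) * F + 2) ≤ 2 ^ Q)
    {σ : State} (hJ : J σ) (hR : σ.reg (b + 1) = R)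
    (hX : ∀ i : ℕ, i < R → ‖σ.cv (b + 2) i - 2 ^ q * x i‖ ≤ E)
    (hY : ∀ i : ℕ, i < R → ‖σ.cv (b + 4) i - 2 ^ q * y i‖ ≤ F) :
    Tri O (pointwiseC b cm) σ ((R + 1) * (M + 2000 * L)) fun σ' => J σ' ∧
      (∀ i : ℕ, i < R → ‖σ'.cv (b + 2) i - 2 ^ q * (x i * y i)‖ ≤ E * B + (A + 1) * F + 2) ∧
      Same (fun r => r < b + 32 ∧ r ≠ b + 3) (fun a => a < b + 32 ∧ a ≠ b + 2 ∧ a ≠ b + 3) σ σ' := by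
  have hL1 : 1 ≤ L := by omega
  have hstab : ∀ τ τ', J τ → Same (fun r => b + 36 ≤ r ∧ r ≠ b + 37 ∧ r ≠ b + 38)
      (fun a => b + 32 ≤ a) τ τ' → J τ' := h.stable
  let I : ℕ → State → Prop := fun k τ => J τ ∧ τ.reg (b + 3) = k ∧
    (∀ i : ℕ, i < k → ‖τ.cv (b + 2) i - 2 ^ q * (x i * y i)‖ ≤ E * B + (A + 1) * F + 2) ∧
    (∀ i : ℕ, k ≤ i → τ.cv (b + 2) i = σ.cv (b + 2) i) ∧
    Same (fun r => r < b + 32 ∧ r ≠ b + 3) (fun a => a < b + 32 ∧ a ≠ b + 2 ∧ a ≠ b + 3) σ τ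
  refine (Tri.for I R (fun _ => 4 * 12 ^ 2 * (L * (1 + 0)) + (M + 4 * 8 ^ 2 * (L * (1 + 0)))) hRL
    hL1 ?_ ?_ ?_ ?_).mono ?_ ?_
  · rintro k τ ⟨-, -, -, -, hs⟩
    rw [hs.1 _ ⟨by omega, by omega⟩, hR]
  · rintro k τ hI; exact hI.2.1
  · rintro k τ hk ⟨hJk, h3, hv, hv', hs⟩
    have hkL : len (k : ℤ) ≤ L := (len_natCast_mono hk.le).trans hRL
    have hXk := hX k hk
    rw [← hv' k le_rfl] at hXk
    have hYk := hY k hk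
    rw [← hs.cv (X := b + 4) ⟨by omega, by omega, by omega⟩ ⟨by omega, by omega, by omega⟩] at hYk
    obtain ⟨m0, m1⟩ := abs_le_of_approx (Q := Q) hXk (hx k) hA
    obtain ⟨m2, m3⟩ := abs_le_of_approx (Q := Q) hYk (hy k) hB
    have m0 := len_le_of_abs_le (L := L) m0 (by omega)
    have m1 := len_le_of_abs_le (L := L) m1 (by omega)
    have m2 := len_le_of_abs_le (L := L) m2 (by omega)
    have m3 := len_le_of_abs_le (L := L) m3 (by omega)
    rw [show b + 2 + 1 = b + 3 by ring] at m1
    rw [show b + 4 + 1 = b + 5 by ring] at m3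
    refine (Tri.line 12 (L := L) (ℓ := 0) (Q := fun τ' => J τ' ∧ τ'.reg (b + 3) = k ∧
      gi (τ'.reg (b + 32)) (τ'.reg (b + 33)) = τ.cv (b + 2) k ∧
      gi (τ'.reg (b + 34)) (τ'.reg (b + 35)) = τ.cv (b + 4) k ∧
      Same (· < b + 32) (· < b + 32) τ τ') hL1
      (by simp [Cmd.Straight]) (by simp [Cmd.sz, Expr.sz]) ?_ ?_).seq fun τ₁ hτ₁ => ?_
    · simp [Cmd.Leaf, Expr.Leaf, Expr.eval, Cmd.exec, *]
    · simp only [Cmd.exec, Expr.eval]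
      refine ⟨hstab _ _ hJk ⟨fun r hr => ?_, fun a ha j => ?_⟩, by simp [h3], ?_, ?_,
        fun r hr => ?_, fun a ha j => ?_⟩
      · simp; grind
      · simp
      · simp [State.cv, h3]
      · simp [State.cv, h3]
      · simp; grind
      · simp
    obtain ⟨j1, i1, e1, e2, s1⟩ := hτ₁
    refine (h.run_approx j1 (α := x k) (ω := y k) (Ea := E) (Ew := F) (Ab := A) (Om := B) ?_ ?_
      (hx k) (hy k) hEq hA hB).seq fun τ₂ hτ₂ => ?_
    · show ‖gi (τ₁.reg (b + 32)) (τ₁.reg (b + 33)) - _‖ ≤ _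
      rw [e1]; exact hXk
    · show ‖gi (τ₁.reg (b + 34)) (τ₁.reg (b + 35)) - _‖ ≤ _
      rw [e2]; exact hYk
    obtain ⟨j2, a2, s2⟩ := hτ₂
    change ‖gi (τ₂.reg (b + 37)) (τ₂.reg (b + 38)) - _‖ ≤ _ at a2
    have hxy : ‖x k * y k‖ ≤ A * B := by
      rw [norm_mul]
      exact mul_le_mul (hx k) (hy k) (norm_nonneg _) ((norm_nonneg _).trans (hx k))
    obtain ⟨m7, m8⟩ := abs_le_of_approx (Q := Q) a2 hxy hAB
    have m7 := len_le_of_abs_le (L := L) m7 (by omega)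
    have m8 := len_le_of_abs_le (L := L) m8 (by omega)
    have i2 : τ₂.reg (b + 3) = k := by rw [s2.1 _ (by omega), i1]
    have s02 := s1.trans s2
    refine Tri.line 8 (L := L) (ℓ := 0) hL1 (by simp [Cmd.Straight]) (by simp [Cmd.sz, Expr.sz])
      ?_ ?_
    · simp [Cmd.Leaf, Expr.Leaf, Cmd.exec, *]
    · simp only [Cmd.exec, Expr.eval]
      refine ⟨by simp [i2], hstab _ _ j2 ⟨fun r hr => ?_, fun a ha j => ?_⟩, by simp, ?_, ?_,
        fun r hr => ?_, fun a ha j => ?_⟩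
      · simp; grind
      · simp; grind
      · intro j hj
        rcases Nat.lt_or_ge j k with hjk | hjk
        · have e := s02.cv (X := b + 2) (by omega) (by omega) j
          have : ((j : ℤ) = k) = False := by simp; omega
          have hj' := hv j hjk
          rw [← e] at hj'
          simpa [State.cv, i2, this] using hj'
        · obtain rfl : j = k := by omega
          simpa [State.cv, i2] using a2
      · intro j hj
        have e := s02.cv (X := b + 2) (by omega) (by omega) j
        have : ((j : ℤ) = k) = False := by simp; omega
        rw [← hv' j (by omega), ← e]
        simp [State.cv, i2, this]
      · have := s02.1 r hr.1
        have := hs.1 r hr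
        simp; grind
      · have := s02.2 a ha.1 j
        have := hs.2 a ha j
        simp; grind
  · refine ⟨hstab _ _ hJ ⟨fun r hr => ?_, fun a ha j => by simp⟩, by simp, fun i hi => by omega,
      fun i hi => by simp [State.cv], fun r hr => ?_, fun a ha j => by simp⟩
    · simp; grind
    · simp; grind
  · rw [Finset.sum_const, Finset.card_range, smul_eq_mul]
    nlinarith [Nat.zero_le (R * L), Nat.zero_le (R * M)]
  · rintro τ ⟨h1, -, h2, -, h3⟩
    exact ⟨h1, h2, h3⟩

/-- The cyclic convolution of the complex arrays `b + 2` and `b + 4`, in place of the former, up to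
the factor `2 ^ r` and the reversal of the order. -/
def convC (b : ℕ) (cm : Cmd) : Cmd :=
  .seq (fftC b (b + 2) cm) <| .seq (fftC b (b + 4) cm) <|
    .seq (pointwiseC b cm) (fftC b (b + 2) cm)

theorem sum_rootOfUnity_pow {ζ : ℂ} {R : ℕ} (hζ : IsPrimitiveRoot ζ R) (m : ℕ) :
    ∑ k ∈ Finset.range R, ζ ^ (k * m) = if R ∣ m then (R : ℂ) else 0 := by
  have e : ∀ k, ζ ^ (k * m) = (ζ ^ m) ^ k := fun k => by rw [← pow_mul, mul_comm]
  simp_rw [e]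
  split_ifs with h
  · rw [(hζ.pow_eq_one_iff_dvd m).2 h]; simp
  · have h1 : ζ ^ m ≠ 1 := fun h' => h ((hζ.pow_eq_one_iff_dvd m).1 h')
    rw [geom_sum_eq h1, ← pow_mul, mul_comm, pow_mul, hζ.pow_eq_one, one_pow, sub_self, zero_div]

/-- The transform of the product of two transforms is a reversed cyclic convolution. -/
theorem sum_dft_mul_dft {ζ : ℂ} {R : ℕ} (hζ : IsPrimitiveRoot ζ R) (x y : ℕ → ℂ)
    (i : ℕ) :
    ∑ k ∈ Finset.range R, (∑ j ∈ Finset.range R, x j * ζ ^ (j * k)) *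
      (∑ s ∈ Finset.range R, y s * ζ ^ (s * k)) * ζ ^ (k * i) =
    R * ∑ j ∈ Finset.range R, ∑ s ∈ Finset.range R, if R ∣ j + s + i then x j * y s else 0 := by
  simp_rw [Finset.sum_mul_sum, Finset.sum_mul]
  rw [Finset.sum_comm, Finset.mul_sum]
  refine Finset.sum_congr rfl fun j _ => ?_
  rw [Finset.sum_comm, Finset.mul_sum]
  refine Finset.sum_congr rfl fun s _ => ?_
  have : ∀ k, x j * ζ ^ (j * k) * (y s * ζ ^ (s * k)) * ζ ^ (k * i) =
      x j * y s * ζ ^ (k * (j + s + i)) := by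
    intro k
    rw [show k * (j + s + i) = j * k + s * k + k * i by ring, pow_add, pow_add]; ring
  simp_rw [this, ← Finset.mul_sum, sum_rootOfUnity_pow hζ]
  split_ifs <;> ring

theorem natCast_le_two_pow (r : ℕ) : (r : ℝ) ≤ 2 ^ r := by
  exact_mod_cast (Nat.lt_two_pow_self (n := r)).le

theorem fftErr_le {B ε δ E : ℝ} (hB : 1 ≤ B) (hε : 2 ≤ ε) (hδ : δ ≤ ε) (hE : E ≤ ε) (r : ℕ) :
    fftErr B δ E r ≤ 4 * 4 ^ r * ε * B := by
  have h1 : (1 : ℝ) ≤ 2 ^ r := one_le_pow₀ (by norm_num)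
  have h2 : E + r * (B * δ + δ + 2) ≤ ε * B + 2 ^ r * (3 * (ε * B)) := by
    have a : B * δ ≤ ε * B := by rw [mul_comm]; gcongr
    have b : ε ≤ ε * B := le_mul_of_one_le_right (by linarith) hB
    have : r * (B * δ + δ + 2) ≤ 2 ^ r * (3 * (ε * B)) := by
      refine (mul_le_mul_of_nonneg_left (by linarith : B * δ + δ + 2 ≤ 3 * (ε * B))
        (Nat.cast_nonneg r)).trans ?_
      exact mul_le_mul_of_nonneg_right (natCast_le_two_pow r) (by positivity)
    linarith
  have h4 : (4 : ℝ) ^ r = 2 ^ r * 2 ^ r := by rw [← mul_pow]; norm_num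
  rw [fftErr, h4]
  calc _ ≤ 2 ^ r * (ε * B + 2 ^ r * (3 * (ε * B))) := by gcongr
    _ ≤ 2 ^ r * (2 ^ r * (ε * B) + 2 ^ r * (3 * (ε * B))) := by
        have : ε * B ≤ 2 ^ r * (ε * B) := le_mul_of_one_le_left (by positivity) h1
        gcongr
    _ = _ := by ring

/-- The error `E₁` of the transforms of the factors does not exceed the scale `S`. -/
theorem fft_error_le_scale {R S ε B E₁ : ℝ} (hR : 1 ≤ R) (hB : 1 ≤ B) (hε : 2 ≤ ε)
    (hE₁ : E₁ ≤ 4 * (R * R) * ε * B) (hq : 16 * (R * R * (R * R)) * ε * B ^ 2 ≤ S) : E₁ ≤ S := by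
  refine hE₁.trans (le_trans ?_ hq)
  have h1 : 1 ≤ R * R := by nlinarith
  have h2 : (1 : ℝ) ≤ R * R * B := by nlinarith
  have h3 : 0 ≤ R * R * ε * B := by positivity
  calc 4 * (R * R) * ε * B = 4 * (R * R * ε * B) * 1 := by ring
    _ ≤ 16 * (R * R * ε * B) * (R * R * B) :=
      mul_le_mul (by linarith) h2 zero_le_one (by positivity)
    _ = _ := by ring

/-- The error after the pointwise multiplication of two transforms. -/
theorem pointwise_error_le {R ε B E₁ : ℝ} (hR : 1 ≤ R) (hB : 1 ≤ B) (hε : 2 ≤ ε) (hE₀ : 0 ≤ E₁)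
    (hE₁ : E₁ ≤ 4 * (R * R) * ε * B) :
    E₁ * (R * B) + (R * B + 1) * E₁ + 2 ≤ 13 * (R * R * R) * (ε * B * B) := by
  have h1 : 1 ≤ R * B := by nlinarith
  have h2 : E₁ * (R * B) ≤ 4 * (R * R * R) * (ε * B * B) :=
    (mul_le_mul_of_nonneg_right hE₁ (by positivity)).trans (le_of_eq (by ring))
  have h3 : E₁ ≤ E₁ * (R * B) := le_mul_of_one_le_right hE₀ h1
  have h4 : (1 : ℝ) ≤ R * R * R := by nlinarith [mul_self_nonneg (R - 1)]
  have h5 : (1 : ℝ) ≤ B * B := by nlinarith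
  have h6 : 2 ≤ ε * B * B := by nlinarith
  have h7 : 2 ≤ R * R * R * (ε * B * B) := by nlinarith
  have e : (R * B + 1) * E₁ = E₁ * (R * B) + E₁ := by ring
  rw [e]; linarith

/-- No intermediate result of the convolution, at scale `S`, exceeds the bound `T` for the operands of
a multiplication. -/
theorem conv_magnitudes_le {R S T ε B E₁ : ℝ} (hR : 1 ≤ R) (hB : 1 ≤ B) (hε : 2 ≤ ε) (hεE : ε ≤ E₁)
    (hE : E₁ ≤ S) (hq : 16 * (R * R * (R * R)) * ε * B ^ 2 ≤ S) (hT : S * S ≤ T) :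
    S * (R * B) + E₁ ≤ T ∧ S * 1 + ε ≤ T ∧ S * (R * B * (R * B)) + S ≤ T ∧
      S * (R * (R * B * (R * B))) + S ≤ T := by
  have h1 : 1 ≤ R * B := by nlinarith
  have h2 : R * B ≤ R * B * (R * B) := le_mul_of_one_le_left (by positivity) h1
  have h3 : R * B * (R * B) ≤ R * (R * B * (R * B)) := le_mul_of_one_le_left (by positivity) hR
  have h4 : R * (R * B * (R * B)) ≤ S / 2 := by
    have h : 2 ≤ 16 * R * ε := by nlinarith
    have h0 : 0 ≤ R * (R * B * (R * B)) := by positivity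
    have e : 16 * (R * R * (R * R)) * ε * B ^ 2 = R * (R * B * (R * B)) * (16 * R * ε) := by ring
    have := mul_le_mul_of_nonneg_left h h0
    linarith
  have hS : 0 ≤ S := by linarith
  have h5 : S * (R * (R * B * (R * B))) ≤ S * (S / 2) := mul_le_mul_of_nonneg_left h4 hS
  have h6 : S * 2 ≤ S * S := mul_le_mul_of_nonneg_left (by linarith) hS
  have h7 : S * (R * B * (R * B)) ≤ S * (R * (R * B * (R * B))) :=
    mul_le_mul_of_nonneg_left h3 hS
  have h8 : S * (R * B) ≤ S * (R * B * (R * B)) := mul_le_mul_of_nonneg_left h2 hS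
  refine ⟨by linarith, by linarith, by linarith, by linarith⟩

/-- The error after the last transform of a convolution. -/
theorem inverse_fft_error_le {r : ℕ} {ε B E₂ : ℝ} (hr : (r : ℝ) ≤ 2 ^ r) (hR : (1 : ℝ) ≤ 2 ^ r) (hB : 1 ≤ B)
    (hε : 2 ≤ ε) (hE₂ : E₂ ≤ 13 * (2 ^ r * 2 ^ r * 2 ^ r) * (ε * B * B)) :
    fftErr (2 ^ r * B * (2 ^ r * B)) ε E₂ r ≤ 16 * (2 ^ r * 2 ^ r * 2 ^ r * 2 ^ r) * ε * B ^ 2 := by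
  rw [fftErr]
  generalize (2 : ℝ) ^ r = R at *
  have h1 : 1 ≤ R * R * (B * B) := by nlinarith [mul_self_nonneg (R - 1), mul_self_nonneg (B - 1)]
  have h2 : R * B * (R * B) * ε + ε + 2 ≤ 3 * (R * R * (ε * B * B)) := by
    have : ε * 1 ≤ ε * (R * R * (B * B)) := mul_le_mul_of_nonneg_left h1 (by linarith)
    have e : R * B * (R * B) * ε = R * R * (ε * B * B) := by ring
    have e' : ε * (R * R * (B * B)) = R * R * (ε * B * B) := by ring
    linarith
  have h3 : r * (R * B * (R * B) * ε + ε + 2) ≤ R * (3 * (R * R * (ε * B * B))) :=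
    mul_le_mul hr h2 (by positivity) (by linarith)
  calc _ ≤ R * (13 * (R * R * R) * (ε * B * B) + R * (3 * (R * R * (ε * B * B)))) := by gcongr
    _ = _ := by ring

/-- The convolution loses a factor `16 * 16 ^ r * B ^ 2` of precision at most. -/
theorem convC_spec {O : ℕ → ℕ → ℤ} {b : ℕ} {cm : Cmd} {J : State → Prop}
    {q Q M L r : ℕ} (h : CMul O (b + 32) cm J q Q M) (hL : Q + 2 ≤ L) (hrL : r + 2 ≤ L)
    {ζ : ℂ} (hζ : IsPrimitiveRoot ζ (2 ^ r)) {x y : ℕ → ℂ} {B ε : ℝ} (hB : 1 ≤ B) (hε : 2 ≤ ε)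
    (hx : ∀ i, ‖x i‖ ≤ B) (hy : ∀ i, ‖y i‖ ≤ B)
    (hq : 16 * 16 ^ r * ε * B ^ 2 ≤ 2 ^ q) (hQ : 2 * q ≤ Q)
    {σ : State} (hJ : J σ) (hr : σ.reg b = r) (hR : σ.reg (b + 1) = (2 ^ r : ℕ))
    (hW : ∀ i : ℕ, i < 2 ^ r → ‖σ.cv b i - 2 ^ q * ζ ^ i‖ ≤ ε)
    (hX : ∀ i : ℕ, i < 2 ^ r → ‖σ.cv (b + 2) i - 2 ^ q * x i‖ ≤ ε)
    (hY : ∀ i : ℕ, i < 2 ^ r → ‖σ.cv (b + 4) i - 2 ^ q * y i‖ ≤ ε) :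
    Tri O (convC b cm) σ (4 * ((r + 1) * (2 ^ r + 1) * (M + 17000 * L))) fun σ' => J σ' ∧
      (∀ i : ℕ, i < 2 ^ r → ‖σ'.cv (b + 2) i - 2 ^ q * (2 ^ r * ∑ j ∈ Finset.range (2 ^ r),
        ∑ s ∈ Finset.range (2 ^ r), if 2 ^ r ∣ j + s + i then x j * y s else 0)‖ ≤
          16 * 16 ^ r * ε * B ^ 2) ∧
      Same (fun r => r < b + 32 ∧ (r < b + 2 ∨ b + 9 ≤ r))
        (fun a => a < b + 32 ∧ (a < b + 2 ∨ b + 8 ≤ a)) σ σ' := by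
  have hζ1 : ‖ζ‖ = 1 := hζ.norm'_eq_one (by positivity)
  have hR1 : (1 : ℝ) ≤ 2 ^ r := one_le_pow₀ (by norm_num)
  have h4r : (4 : ℝ) ^ r = 2 ^ r * 2 ^ r := by rw [← mul_pow]; norm_num
  have h16r : (16 : ℝ) ^ r = 2 ^ r * 2 ^ r * 2 ^ r * 2 ^ r := by
    rw [← mul_pow, ← mul_pow, ← mul_pow]; norm_num
  have hrr := natCast_le_two_pow r
  have hε0 : 0 ≤ ε := by linarith
  have hε1 : 1 ≤ ε := by linarith
  have hRL : len ((2 ^ r : ℕ) : ℤ) ≤ L := by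
    have := len_two_pow r
    push_cast; omega
  have hcast : ((2 ^ r : ℕ) : ℂ) = 2 ^ r := by push_cast; rfl
  have hSQ : (2 : ℝ) ^ q * 2 ^ q ≤ 2 ^ Q := by
    rw [← pow_add]; exact pow_le_pow_right₀ (by norm_num) (by omega)
  have hE1 := fftErr_le hB hε le_rfl le_rfl r (δ := ε) (E := ε)
  have hεE : ε ≤ fftErr B ε ε r := by
    rw [fftErr]
    have : 0 ≤ (r : ℝ) * (B * ε + ε + 2) := by positivity
    nlinarith
  rw [h16r, mul_assoc (2 ^ r * 2 ^ r)] at hq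
  rw [h4r] at hE1
  have hE1S := fft_error_le_scale hR1 hB hε hE1 hq
  have hE2 := pointwise_error_le hR1 hB hε (by linarith) hE1
  obtain ⟨hQ1, hQ2, hQ3, hQ4⟩ := conv_magnitudes_le (T := 2 ^ Q) hR1 hB hε hεE hE1S hq hSQ
  set E1 := fftErr B ε ε r with hE1def
  set E2 := E1 * (2 ^ r * B) + (2 ^ r * B + 1) * E1 + 2 with hE2def
  have hE20 : 0 ≤ E2 := by
    have : 0 ≤ E1 := by linarith
    positivity
  have hE3 : fftErr (2 ^ r * B * (2 ^ r * B)) ε E2 r ≤ 16 * 16 ^ r * ε * B ^ 2 := by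
    rw [h16r]; exact inverse_fft_error_le hrr hR1 hB hε hE2
  have hE3S : fftErr (2 ^ r * B * (2 ^ r * B)) ε E2 r ≤ 2 ^ q := by
    refine hE3.trans ?_
    rw [h16r, mul_assoc (2 ^ r * 2 ^ r)]; exact hq
  have hE2S : E2 ≤ 2 ^ q := by
    refine le_trans ?_ hE3S
    rw [fftErr]
    have : 0 ≤ (r : ℝ) * (2 ^ r * B * (2 ^ r * B) * ε + ε + 2) := by positivity
    nlinarith
  refine ((fftC_spec h hL hrL (Or.inl rfl) hζ1 hζ.pow_eq_one hx hE1S hQ1 hQ2 hJ hr hR hW hX).seq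
    (T₂ := (r + 1) * (2 ^ r + 1) * (M + 17000 * L) + ((2 ^ r + 1) * (M + 2000 * L) +
      (r + 1) * (2 ^ r + 1) * (M + 17000 * L))) ?_).mono ?_ fun _ h => h
  · rintro σ₁ ⟨j1, v1, s1⟩
    refine (fftC_spec h hL hrL (Or.inr rfl) hζ1 hζ.pow_eq_one hy hE1S hQ1 hQ2 j1 ?_ ?_ (fun i hi => ?_)
      fun i hi => ?_).seq ?_
    · rw [s1.1 _ ⟨by omega, by omega⟩, hr]
    · rw [s1.1 _ ⟨by omega, by omega⟩, hR]
    · rw [s1.cv (by omega) (by omega)]; exact hW i hi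
    · rw [s1.cv (by omega) (by omega)]; exact hY i hi
    rintro σ₂ ⟨j2, v2, s2⟩
    have s02 := (s1.mono (R' := fun r => r < b + 32 ∧ (r < b + 2 ∨ b + 9 ≤ r))
      (A' := fun a => a < b + 32 ∧ (a < b + 2 ∨ b + 8 ≤ a)) (fun r h => h)
      (fun a h => by omega)).trans (s2.mono (fun r h => h) (fun a h => by omega))
    refine (pointwiseC_spec h hL hRL (norm_partialDft_le hζ1 r hx r) (norm_partialDft_le hζ1 r hy r)
      hE1S hQ1 hQ1 ?_ j2 ?_ (fun i hi => ?_) v2).seq ?_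
    · exact (add_le_add_right hE2S _).trans hQ3
    · rw [s02.1 _ ⟨by omega, by omega⟩, hR]
    · rw [s2.cv (by omega) (by omega)]; exact v1 i hi
    rintro σ₃ ⟨j3, v3, s3⟩
    have s03 := s02.trans (s3.mono (fun r h => by omega) (fun a h => by omega))
    refine (fftC_spec h hL hrL (Or.inl rfl) hζ1 hζ.pow_eq_one (B := 2 ^ r * B * (2 ^ r * B)) (E := E2)
      (x := fun i => partialDft ζ r x r i * partialDft ζ r y r i) (fun i => ?_) hE3S ?_ hQ2
      j3 ?_ ?_ (fun i hi => ?_) v3).mono le_rfl ?_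
    · rw [norm_mul]
      exact mul_le_mul (norm_partialDft_le hζ1 r hx r i) (norm_partialDft_le hζ1 r hy r i)
        (norm_nonneg _) (by positivity)
    · exact (add_le_add_right hE3S _).trans hQ4
    · rw [s03.1 _ ⟨by omega, by omega⟩, hr]
    · rw [s03.1 _ ⟨by omega, by omega⟩, hR]
    · rw [s03.cv (by omega) (by omega)]; exact hW i hi
    rintro σ₄ ⟨j4, v4, s4⟩
    refine ⟨j4, fun i hi => ?_, s03.trans (s4.mono (fun r h => h) (fun a h => by omega))⟩
    have := (v4 i hi).trans hE3
    rw [partialDft_self _ _ _ hi, Finset.sum_congr rfl (g := fun k =>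
      (∑ j ∈ Finset.range (2 ^ r), x j * ζ ^ (j * k)) *
        (∑ s ∈ Finset.range (2 ^ r), y s * ζ ^ (s * k)) * ζ ^ (k * i)),
      sum_dft_mul_dft hζ, hcast] at this
    · exact this
    · intro k hk
      rw [Finset.mem_range] at hk
      rw [partialDft_self _ _ _ hk, partialDft_self _ _ _ hk]
  · have : (2 ^ r + 1) * (M + 2000 * L) ≤ (r + 1) * (2 ^ r + 1) * (M + 17000 * L) := by
      have : (2 ^ r + 1) * 1 ≤ (2 ^ r + 1) * (r + 1) := Nat.mul_le_mul_left _ (by omega)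
      exact Nat.mul_le_mul (by linarith) (by omega)
    omega

/-- Prepare the Fourier transform: the number `π`, and the powers of a primitive root of unity of
order `2 ^ r` in the array `b`. -/
def setupC (b : ℕ) (cm : Cmd) : Cmd :=
  .seq (piC b) <| .seq (.assign (b + 14) (.shr (.reg (b + 1)) (.const 1))) <|
    .seq (rootC b (b + 14) cm) (powersC b b (b + 1) cm)

theorem setupC_spec {O : ℕ → ℕ → ℤ} {b : ℕ} {cm : Cmd} {J : State → Prop}
    {q Q M L ℓ r : ℕ} (h : CMul O (b + 32) cm J q Q M) (hq : 8 ≤ q) (hQ : q + 2 ≤ Q)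
    (hL : 2 * q + 10 ≤ L) (hLQ : Q + 2 ≤ L) (hr4 : 4 ≤ r) (hrL : r + 2 ≤ L)
    (hℓ : len ((2 * q + 1 : ℕ) : ℤ) ≤ ℓ) (hrℓ : r + 1 ≤ ℓ)
    (hrq : (2 : ℝ) ^ r * (66 * q) ≤ 2 ^ q)
    {σ : State} (hJ : J σ) (hr : σ.reg b = r) (hR : σ.reg (b + 1) = (2 ^ r : ℕ)) :
    Tri O (setupC b cm) σ ((q + 1) * (M + 10000 * (L * (1 + ℓ))) + (2 ^ r + 1) * (M + 2300 * L))
      fun σ' => J σ' ∧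
        |(σ'.reg (b + 10) : ℝ) - 2 ^ q * Real.pi| ≤ 11 * q ∧
        (∀ i : ℕ, i < 2 ^ r → ‖σ'.cv b i -
          2 ^ q * Complex.exp (2 * Real.pi * Complex.I / (2 ^ r : ℕ)) ^ i‖ ≤ 2 ^ r * (66 * q)) ∧
        Same (fun r => r < b + 32 ∧ (r < b + 3 ∨ b + 15 ≤ r))
          (fun a => a < b + 32 ∧ a ≠ b ∧ a ≠ b + 1) σ σ' := by
  have hL1 : 1 ≤ L := by omega
  have hq' : σ.reg (b + 36) = q := h.prec σ hJ
  have hqr : (8 : ℝ) ≤ q := by exact_mod_cast hq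
  have hstab : ∀ τ τ', J τ → Same (fun r => b + 36 ≤ r ∧ r ≠ b + 37 ∧ r ≠ b + 38)
      (fun a => b + 32 ≤ a) τ τ' → J τ' := h.stable
  have hqL : len (q : ℤ) ≤ L := (len_natCast_le_self q).trans (by omega)
  have hRL : len ((2 ^ r : ℕ) : ℤ) ≤ L := by
    have := len_two_pow r
    push_cast; omega
  have hdvd : 2 ^ r / 2 = 2 ^ (r - 1) := by
    rw [show 2 ^ r = 2 ^ (r - 1) * 2 by rw [← pow_succ]; congr 1; omega]; simp
  have hνlen : len ((2 ^ (r - 1) : ℕ) : ℤ) = r := by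
    have := len_two_pow (r - 1)
    push_cast; omega
  have hR1 : (1 : ℝ) ≤ 2 ^ r := one_le_pow₀ (by norm_num)
  refine ((piC_spec (by omega) hL hℓ (by omega) hq').seq fun σ₁ hσ₁ => ?_).mono
    (T := (q + 1) * (6000 * (L * (1 + ℓ))) + (4 * 4 ^ 2 * (L * (1 + 0)) +
      ((q + 1) * (M + 4000 * (L * (1 + ℓ))) + (2 ^ r + 1) * (M + 2000 * L)))) ?_ fun _ h => h
  · obtain ⟨p1, s1⟩ := hσ₁
    have j1 : J σ₁ := hstab _ _ hJ ⟨fun r hr => s1.1 r (by omega), fun a ha j => s1.2 a trivial j⟩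
    have r1 : σ₁.reg (b + 1) = 2 ^ r := by rw [s1.1 _ (by omega), hR]; push_cast; rfl
    refine (Tri.line 4 (L := L) (ℓ := 0) (Q := fun τ => J τ ∧ τ.reg (b + 14) = (2 ^ (r - 1) : ℕ) ∧
      Same (fun r => r ≠ b + 14) (fun _ => True) σ₁ τ) hL1 (by simp [Cmd.Straight])
      (by simp [Cmd.sz, Expr.sz]) ?_ ?_).seq fun σ₂ hσ₂ => ?_
    · simp [Cmd.Leaf, Expr.Leaf, r1, len_one, hL1]
      simpa using hRL
    · simp only [Cmd.exec, Expr.eval]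
      refine ⟨hstab _ _ j1 ⟨fun r hr => ?_, fun a ha j => by simp⟩, ?_, fun r hr => ?_,
        fun a ha j => by simp⟩
      · simp; grind
      · simp [r1]
        have := congrArg (Nat.cast (R := ℤ)) hdvd
        push_cast at this
        exact this
      · simp; grind
    obtain ⟨j2, e14, s2⟩ := hσ₂
    refine (rootC_spec h hq hQ hLQ (ℓ := ℓ) ?_ ?_ (by omega) (by omega) j2 e14 ?_).seq
      fun σ₃ hσ₃ => ?_
    · exact (len_natCast_mono (by omega)).trans hℓ
    · exact (by norm_num : 8 = 2 ^ 3).le.trans (Nat.pow_le_pow_right (by norm_num) (by omega))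
    · rw [s2.1 _ (by omega)]; exact p1
    obtain ⟨j3, v3, s3⟩ := hσ₃
    have hζ : Complex.exp (Real.pi / (2 ^ (r - 1) : ℕ) * Complex.I) =
        Complex.exp (2 * Real.pi * Complex.I / (2 ^ r : ℕ)) := by
      congr 1
      rw [show 2 ^ r = 2 ^ (r - 1) * 2 by rw [← pow_succ]; congr 1; omega]
      push_cast
      field_simp
    rw [hζ] at v3
    have hprim := Complex.isPrimitiveRoot_exp (2 ^ r) (by positivity)
    have hbound : (2 ^ r : ℕ) * (2 * (32 * q : ℝ) + 2) ≤ 2 ^ r * (66 * q) := by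
      push_cast
      gcongr; linarith
    refine (powersC_spec h (by omega) hLQ hRL hqL (cnt := b + 1) (by omega) (by omega)
      (hprim.norm'_eq_one (by positivity)).le (hbound.trans hrq) ?_ j3 ?_ v3).mono le_rfl ?_
    · have : (32 : ℝ) * q ≤ 66 * q := by linarith
      nlinarith
    · rw [s3.1 _ (by omega), s2.1 _ (by omega), s1.1 _ (by omega), hR]
    rintro σ₄ ⟨j4, v4, s4⟩
    refine ⟨j4, ?_, fun i hi => (v4 i hi.le).trans (le_trans ?_ hbound), fun r hr => ?_,
      fun a ha j => ?_⟩
    · rw [s4.1 _ (by omega), s3.1 _ (by omega), s2.1 _ (by omega)]; exact p1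
    · have : (i : ℝ) ≤ (2 ^ r : ℕ) := by exact_mod_cast hi.le
      gcongr
    · rw [s4.1 _ (by omega), s3.1 _ (by omega), s2.1 _ (by omega), s1.1 _ (by omega)]
    · rw [s4.2 _ (by omega), s3.2 _ (by omega), s2.2 _ trivial, s1.2 _ trivial]
  · nlinarith [Nat.zero_le (2 ^ r * L)]

/-! ### Multiplication with a table of squares -/

/-- The sum of the values of finitely many expressions. -/
def Expr.sum (f : ℕ → Expr) : ℕ → Expr
  | 0 => .const 0
  | k + 1 => .add (Expr.sum f k) (f k)

theorem Expr.eval_sum {O : ℕ → ℕ → ℤ} {σ : State} (f : ℕ → Expr) :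
    ∀ k, (Expr.sum f k).eval O σ = ∑ i ∈ Finset.range k, (f i).eval O σ
  | 0 => rfl
  | k + 1 => by rw [Expr.sum, Expr.eval, Expr.eval_sum f k, Finset.sum_range_succ]

theorem Expr.leaf_sum {O : ℕ → ℕ → ℤ} {σ : State} {L ℓ : ℕ} (f : ℕ → Expr) :
    ∀ k, (∀ i < k, (f i).Leaf O σ L ℓ) → (Expr.sum f k).Leaf O σ L ℓ
  | 0, _ => by simp [Expr.sum, Expr.Leaf, len_zero]
  | k + 1, h => ⟨Expr.leaf_sum f k fun i hi => h i (by omega), h k (by omega)⟩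

/-- The `i`-fold of the content of register `r`. -/
def Expr.nsmulReg (r i : ℕ) : Expr := Expr.sum (fun _ => .reg r) i

/-- The digit number `i` of the content of register `v` in base `2 ^ n`, where `n` is the content
of register `r`. -/
def Expr.digit (r v i : ℕ) : Expr :=
  .sub (.shr (.reg v) (Expr.nsmulReg r i)) (.shl (.shr (.reg v) (Expr.nsmulReg r (i + 1))) (.reg r))

/-- The product of a digit of register `B + 5` and a digit of register `B + 6`, computed from
entries of the table of squares: `4 x y = (x + y) ^ 2 - (x - y) ^ 2`. -/
def Expr.digitMul (B i j : ℕ) : Expr :=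
  .shr (.sub (.get B (.add (Expr.digit (B + 3) (B + 5) i) (Expr.digit (B + 3) (B + 6) j)))
    (.get B (.sub (Expr.digit (B + 3) (B + 5) i) (Expr.digit (B + 3) (B + 6) j)))) (.const 2)

/-- The product of the natural numbers in registers `B + 5` and `B + 6`. -/
def Expr.tableMul (B K : ℕ) : Expr :=
  Expr.sum (fun i => Expr.sum (fun j => .shl (Expr.digitMul B i j)
    (.add (Expr.nsmulReg (B + 3) i) (Expr.nsmulReg (B + 3) j))) K) K

/-- Move the factors in registers `B` and `B + 1` to the range of natural numbers. -/
def offsetC (B : ℕ) : Cmd :=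
  .seq (.assign (B + 5) (.add (.reg B) (.shl (.const 1) (.reg (B + 4)))))
    (.assign (B + 6) (.add (.reg (B + 1)) (.shl (.const 1) (.reg (B + 4)))))

/-- Recover a product from the product, given as an expression, of the shifted factors. -/
def Expr.unoffset (B : ℕ) (e : Expr) : Expr :=
  .add (.sub e (.shl (.add (.reg (B + 5)) (.reg (B + 6))) (.reg (B + 4))))
    (.shl (.const 1) (.add (.reg (B + 4)) (.reg (B + 4))))

/-- Multiplication of integers with at most `K` digits in base `2 ^ n` with a table of squares;
register `B + 3` holds `n`, register `B + 4` holds the bound `Q`. -/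
def tableMulC (B K : ℕ) : Cmd :=
  .seq (offsetC B) (.assign (B + 2) (Expr.unoffset B (Expr.tableMul B K)))

/-- Fill the table of squares. -/
def tablePrepC (B : ℕ) : Cmd :=
  .seq (.assign (B + 8) (.shl (.const 1) (.add (.reg (B + 3)) (.const 1)))) <|
  .for (B + 7) (B + 8) <|
    .seq (.put B (.reg (B + 7)) (.mul (.reg (B + 7)) (.reg (B + 7))))
      (.put B (.sub (.const 0) (.reg (B + 7))) (.mul (.reg (B + 7)) (.reg (B + 7))))

/-- The table of squares is in place. -/
def TableReady (B n Q : ℕ) (σ : State) : Prop :=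
  σ.reg (B + 3) = n ∧ σ.reg (B + 4) = Q ∧ ∀ x : ℤ, |x| < 2 ^ (n + 1) → σ.mem B x = x * x

theorem eval_nsmulReg {O : ℕ → ℕ → ℤ} {σ : State} {r n : ℕ} (h : σ.reg r = n) (i : ℕ) :
    (Expr.nsmulReg r i).eval O σ = (i * n : ℕ) := by
  simp [Expr.nsmulReg, Expr.eval_sum, Expr.eval, h]

theorem eval_digit {O : ℕ → ℕ → ℤ} {σ : State} {r n v x : ℕ} (h : σ.reg r = n)
    (hx : σ.reg v = x) (i : ℕ) :
    (Expr.digit r v i).eval O σ = (x / 2 ^ (i * n) % 2 ^ n : ℕ) := by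
  have e : x / 2 ^ ((i + 1) * n) = x / 2 ^ (i * n) / 2 ^ n := by
    rw [Nat.div_div_eq_div_mul, ← pow_add]; congr 2; ring
  rw [Expr.digit]
  simp only [Expr.eval, eval_nsmulReg h, hx, h, Int.toNat_natCast]
  rw [intCast_div_two_pow, intCast_div_two_pow, e, intCast_sub_div_mul]

theorem sum_digits (n x : ℕ) : ∀ K,
    ∑ i ∈ Finset.range K, x / 2 ^ (i * n) % 2 ^ n * 2 ^ (i * n) = x % 2 ^ (K * n)
  | 0 => by simp [Nat.mod_one]
  | K + 1 => by
      rw [Finset.sum_range_succ, sum_digits n x K, Nat.succ_mul, pow_add, Nat.mod_mul]; ring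

theorem sum_digits_eq {n x K : ℕ} (hx : x < 2 ^ (K * n)) :
    ∑ i ∈ Finset.range K, ((x / 2 ^ (i * n) % 2 ^ n : ℕ) : ℤ) * 2 ^ (i * n) = x := by
  have := sum_digits n x K
  rw [Nat.mod_eq_of_lt hx] at this
  exact_mod_cast this

/-- Sums and differences of digits are covered by the table of squares. -/
theorem abs_add_sub_lt {n : ℕ} {x y : ℕ} (hx : x < 2 ^ n) (hy : y < 2 ^ n) :
    |(x : ℤ) + y| < 2 ^ (n + 1) ∧ |(x : ℤ) - y| < 2 ^ (n + 1) := by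
  have hx' : (x : ℤ) < 2 ^ n := by exact_mod_cast hx
  have hy' : (y : ℤ) < 2 ^ n := by exact_mod_cast hy
  rw [pow_succ, abs_lt, abs_lt]
  omega

theorem eval_tableMul {O : ℕ → ℕ → ℤ} {σ : State} {B K n Q x y : ℕ} (h : TableReady B n Q σ)
    (hx : σ.reg (B + 5) = x) (hy : σ.reg (B + 6) = y) (hxK : x < 2 ^ (K * n))
    (hyK : y < 2 ^ (K * n)) : (Expr.tableMul B K).eval O σ = x * y := by
  rw [Expr.tableMul, Expr.eval_sum]
  simp_rw [Expr.eval_sum]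
  rw [← sum_digits_eq hxK, ← sum_digits_eq hyK, Finset.sum_mul_sum]
  refine Finset.sum_congr rfl fun i _ => Finset.sum_congr rfl fun j _ => ?_
  have hn : 0 < 2 ^ n := by positivity
  obtain ⟨h1, h2⟩ := abs_add_sub_lt (Nat.mod_lt (x / 2 ^ (i * n)) hn)
    (Nat.mod_lt (y / 2 ^ (j * n)) hn)
  simp only [Expr.eval, Expr.digitMul, eval_digit h.1 hx, eval_digit h.1 hy, eval_nsmulReg h.1,
    h.2.2 _ h1, h.2.2 _ h2]
  generalize ((x / 2 ^ (i * n) % 2 ^ n : ℕ) : ℤ) = u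
  generalize ((y / 2 ^ (j * n) % 2 ^ n : ℕ) : ℤ) = v
  have e1 : ((u + v) * (u + v) - (u - v) * (u - v)) / 2 ^ (2 : ℤ).toNat = u * v := by
    rw [show (u + v) * (u + v) - (u - v) * (u - v) = u * v * 4 by ring]
    exact Int.mul_ediv_cancel _ (by norm_num)
  have e2 : ((i * n : ℕ) + (j * n : ℕ) : ℤ).toNat = i * n + j * n := by norm_cast
  rw [e1, e2, pow_add]
  ring

theorem leaf_digit {O : ℕ → ℕ → ℤ} {σ : State} {r n v L : ℕ} (h : σ.reg r = n)
    (hv : len (σ.reg v) ≤ L) (hn : n ≤ L) (i : ℕ) : (Expr.digit r v i).Leaf O σ L 0 := by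
  have hr : len (σ.reg r) ≤ L := by rw [h]; exact (len_natCast_le_self n).trans hn
  have hs : ∀ k, (Expr.nsmulReg r k).Leaf O σ L 0 := fun k => Expr.leaf_sum _ _ fun _ _ => hr
  refine ⟨⟨hv, hs i⟩, ⟨hv, hs (i + 1)⟩, hr, ?_⟩
  simp [Expr.eval, h, hn]

theorem leaf_tableMul {O : ℕ → ℕ → ℤ} {σ : State} {B K n Q x y L : ℕ} (h : TableReady B n Q σ)
    (hx : σ.reg (B + 5) = x) (hy : σ.reg (B + 6) = y) (hxL : len (x : ℤ) ≤ L)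
    (hyL : len (y : ℤ) ≤ L) (hL : 2 * K * n + 2 * n + 4 ≤ L) :
    (Expr.tableMul B K).Leaf O σ L 0 := by
  refine Expr.leaf_sum _ _ fun i hi => Expr.leaf_sum _ _ fun j hj => ?_
  have hn : 0 < 2 ^ n := by positivity
  obtain ⟨h1, h2⟩ := abs_add_sub_lt (Nat.mod_lt (x / 2 ^ (i * n)) hn)
    (Nat.mod_lt (y / 2 ^ (j * n)) hn)
  have hnL : n ≤ L := by omega
  have hr : len (σ.reg (B + 3)) ≤ L := by rw [h.1]; exact (len_natCast_le_self n).trans hnL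
  have dx := leaf_digit (O := O) h.1 (v := B + 5) (by rw [hx]; exact hxL) hnL i
  have dy := leaf_digit (O := O) h.1 (v := B + 6) (by rw [hy]; exact hyL) hnL j
  have hsq : ∀ z : ℤ, |z| < 2 ^ (n + 1) → len (z * z) ≤ L := by
    intro z hz
    refine (len_mul_le z z).trans ?_
    have := len_le_iff.2 hz
    omega
  refine ⟨⟨⟨⟨⟨dx, dy⟩, ?_⟩, ⟨dx, dy⟩, ?_⟩, ?_⟩, ⟨Expr.leaf_sum _ _ fun _ _ => hr,
    Expr.leaf_sum _ _ fun _ _ => hr⟩, ?_⟩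
  · simp only [Expr.eval, eval_digit h.1 hx, eval_digit h.1 hy, h.2.2 _ h1]
    exact hsq _ h1
  · simp only [Expr.eval, eval_digit h.1 hx, eval_digit h.1 hy, h.2.2 _ h2]
    exact hsq _ h2
  · have : len 2 = 2 := by decide
    simp only [Expr.Leaf]; omega
  · simp only [Expr.eval, eval_nsmulReg h.1]
    have e2 : ((i * n : ℕ) + (j * n : ℕ) : ℤ).toNat = i * n + j * n := by norm_cast
    rw [e2]
    nlinarith [Nat.mul_le_mul_right n hi.le, Nat.mul_le_mul_right n hj.le]

theorem add_two_pow_eq_natCast {x : ℤ} {Q : ℕ} (h : |x| ≤ 2 ^ Q) :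
    ∃ k : ℕ, x + 2 ^ Q = k ∧ k < 2 ^ (Q + 2) := by
  have := abs_le.1 h
  refine ⟨(x + 2 ^ Q).toNat, by omega, ?_⟩
  have : (((x + 2 ^ Q).toNat : ℕ) : ℤ) < 2 ^ (Q + 2) := by
    rw [Int.toNat_of_nonneg (by omega)]
    have : (0 : ℤ) < 2 ^ Q := by positivity
    rw [pow_add]; linarith
  exact_mod_cast this

/-- As `K` is a constant, only a bounded number of table entries is used for a product, and the cost is
linear in the length of the factors. -/
theorem tableMulC_spec {O : ℕ → ℕ → ℤ} {B K n Q L : ℕ} (hK : Q + 2 ≤ K * n)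
    (hL : 2 * K * n + 2 * n + 2 * Q + 4 ≤ L) :
    RMul O B (tableMulC B K) (TableReady B n Q) Q
      (4 * (tableMulC B K).sz ^ 2 * (L * (1 + 0))) where
  stable σ σ' h hs := by
    refine ⟨?_, ?_, fun x hx => ?_⟩
    · rw [hs.1 _ (by omega), h.1]
    · rw [hs.1 _ (by omega), h.2.1]
    · rw [hs.2 _ le_rfl, h.2.2 x hx]
  run σ h hx hy := by
    have hL1 : 1 ≤ L := by omega
    have lx := len_le_of_abs_le (L := L) hx (by omega)
    have ly := len_le_of_abs_le (L := L) hy (by omega)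
    obtain ⟨x, ex, xl⟩ := add_two_pow_eq_natCast hx
    obtain ⟨y, ey, yl⟩ := add_two_pow_eq_natCast hy
    have hxL : len (x : ℤ) ≤ L := (len_natCast_le.2 xl).trans (by omega)
    have hyL : len (y : ℤ) ≤ L := (len_natCast_le.2 yl).trans (by omega)
    have hpow : 2 ^ (Q + 2) ≤ 2 ^ (K * n) := Nat.pow_le_pow_right (by norm_num) hK
    set τ := (offsetC B).exec O σ with hτ
    have t5 : τ.reg (B + 5) = x := by
      simp [hτ, offsetC, Cmd.exec, Expr.eval, h.2.1, ← ex]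
    have t6 : τ.reg (B + 6) = y := by
      simp [hτ, offsetC, Cmd.exec, Expr.eval, h.2.1, ← ey]
    have t4 : τ.reg (B + 4) = Q := by
      simp [hτ, offsetC, Cmd.exec, Expr.eval, h.2.1]
    have tready : TableReady B n Q τ := by
      refine ⟨?_, t4, fun x hx => ?_⟩
      · simp [hτ, offsetC, Cmd.exec, h.1]
      · simp [hτ, offsetC, Cmd.exec, h.2.2 x hx]
    have hmul := eval_tableMul (O := O) tready t5 t6 (xl.trans_le hpow) (yl.trans_le hpow)
    have hQL : len (Q : ℤ) ≤ L := (len_natCast_le_self Q).trans (by omega)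
    have eQ : ((Q : ℤ) + Q).toNat = 2 * Q := by omega
    refine Tri.straight hL1 (by simp [tableMulC, offsetC, Cmd.Straight]) ?_ ?_
    · refine ⟨?_, ?_⟩
      · simp [offsetC, Cmd.Leaf, Expr.Leaf, Cmd.exec, Expr.eval, h.2.1, len_one, *]
        omega
      · refine ⟨⟨leaf_tableMul tready t5 t6 hxL hyL (by omega), ?_⟩, ?_⟩
        · simp only [Expr.Leaf, Expr.eval, ← hτ, t5, t6, t4, Int.toNat_natCast]
          exact ⟨⟨hxL, hyL⟩, hQL, by omega⟩
        · simp only [Expr.Leaf, Expr.eval, ← hτ, t4, len_one, eQ]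
          exact ⟨hL1, ⟨hQL, hQL⟩, by omega⟩
    · simp only [tableMulC, Cmd.exec]
      rw [← hτ]
      have e : (Expr.unoffset B (Expr.tableMul B K)).eval O τ = σ.reg B * σ.reg (B + 1) := by
        simp only [Expr.unoffset, Expr.eval, hmul, t5, t6, t4, eQ, Int.toNat_natCast]
        rw [← ex, ← ey, two_mul, pow_add]; ring
      rw [e]
      have r1 : ∀ r, r < B → τ.reg r = σ.reg r := by
        intro r hr
        simp [hτ, offsetC, Cmd.exec]; grind
      refine ⟨⟨?_, ?_, fun x hx => ?_⟩, by simp, fun r hr => ?_, fun a ha j => ?_⟩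
      · simpa using tready.1
      · simpa using tready.2.1
      · simpa using tready.2.2 x hx
      · rw [State.setR_reg, if_neg (by omega), r1 r hr]
      · simp [hτ, offsetC, Cmd.exec]

theorem tablePrepC_spec {O : ℕ → ℕ → ℤ} {B n Q L : ℕ} (hL : n + 3 ≤ L) {σ : State}
    (hn : σ.reg (B + 3) = n) (hQ : σ.reg (B + 4) = Q) :
    Tri O (tablePrepC B) σ ((2 ^ (n + 1) + 1) * (1000 * L ^ 2)) fun σ' => TableReady B n Q σ' ∧
      Same (· < B) (· < B) σ σ' := by
  have hL1 : 1 ≤ L := by omega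
  have hnL : len (n : ℤ) ≤ L := (len_natCast_le_self n).trans (by omega)
  have hNL : len ((2 ^ (n + 1) : ℕ) : ℤ) ≤ L := by
    have := len_two_pow (n + 1)
    push_cast; omega
  let I : ℕ → State → Prop := fun k τ => τ.reg (B + 7) = k ∧
    (∀ x : ℤ, |x| < k → τ.mem B x = x * x) ∧
    Same (fun r => r ≠ B + 7 ∧ r ≠ B + 8) (fun a => a ≠ B) σ τ ∧ τ.reg (B + 8) = (2 ^ (n + 1) : ℕ)
  refine ((Tri.line 6 (L := L) (ℓ := 0) (Q := fun τ => I 0 (τ.setR (B + 7) 0)) hL1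
    (by simp [Cmd.Straight]) (by simp [Cmd.sz, Expr.sz]) ?_ ?_).seq (T₂ := (∑ k ∈ Finset.range
      (2 ^ (n + 1)), 4 * 12 ^ 2 * (L * (1 + L))) + (2 ^ (n + 1) + 1) * (100 * L))
      (R := I (2 ^ (n + 1))) fun τ hτ => ?_).mono ?_ ?_
  · simp [Cmd.Leaf, Expr.Leaf, Expr.eval, hn, len_one, hnL]
    omega
  · simp only [Cmd.exec, Expr.eval, I]
    refine ⟨by simp, fun x hx => ?_, ⟨fun r hr => ?_, fun a ha j => by simp⟩, ?_⟩
    · have := abs_nonneg x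
      simp at hx; omega
    · simp; grind
    · simp [hn, show ((n : ℤ) + 1).toNat = n + 1 by omega]
  · refine Tri.for I (2 ^ (n + 1)) _ hNL hL1 ?_ ?_ ?_ hτ
    · rintro k τ ⟨-, -, -, h8⟩; exact h8
    · rintro k τ hI; exact hI.1
    rintro k τ hk ⟨h7, hv, hs, h8⟩
    have hkL : len (k : ℤ) ≤ L := (len_natCast_mono hk.le).trans hNL
    refine Tri.line 12 (L := L) (ℓ := L) hL1 (by simp [Cmd.Straight]) (by simp [Cmd.sz, Expr.sz])
      ?_ ?_
    · simp [Cmd.Leaf, Expr.Leaf, Cmd.exec, Expr.eval, h7, hkL, len_zero]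
    · simp only [Cmd.exec, Expr.eval, I]
      refine ⟨by simp [h7], by simp, fun x hx => ?_, ⟨fun r hr => ?_, fun a ha j => ?_⟩, ?_⟩
      · by_cases h1 : x = k
        · subst h1; simp [h7]
        by_cases h2 : x = -k
        · subst h2; simp [h7]
        · have : |x| < k := by
            rw [abs_lt] at hx ⊢
            push_cast at hx
            omega
          simp [h7, h1, h2, hv x this]
      · have := hs.1 r hr
        simp; grind
      · have := hs.2 a ha j
        simp; grind
      · simpa using h8
  · rw [Finset.sum_const, Finset.card_range, smul_eq_mul]
    have : L ≤ L ^ 2 := by nlinarith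
    nlinarith [Nat.zero_le (2 ^ (n + 1) * L ^ 2), Nat.mul_le_mul_left (2 ^ (n + 1)) this]
  · rintro τ ⟨-, hv, hs, -⟩
    refine ⟨⟨?_, ?_, fun x hx => hv x (by exact_mod_cast hx)⟩, fun r hr => ?_, fun a ha j => ?_⟩
    · rw [hs.1 _ (by omega), hn]
    · rw [hs.1 _ (by omega), hQ]
    · exact hs.1 r (by omega)
    · exact hs.2 a (by omega) j

/-! ### Splitting into bits and recombining -/

/-- Split the content of register `v`, a natural number with at most `2 ^ κ` bits, into its bits,
stored in array `A`, by repeated halving: a block of `2 h` bits at index `p` is split into blocks of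
`h` bits at indices `p` and `p + h`. Register `B + 32` holds `κ`, register `B + 33` holds `2 ^ κ`. -/
def splitC (B A v : ℕ) : Cmd :=
  .seq (.seq (.put A (.const 0) (.reg v)) (.seq (.assign (B + 8) (.const 1))
    (.assign (B + 9) (.shr (.reg (B + 33)) (.const 1))))) <|
  .for (B + 7) (B + 32) <|
    .seq (.assign (B + 11) (.const 0)) <|
    .seq (.for (B + 10) (B + 8) <|
      .seq (.assign (B + 12) (.shr (.get A (.reg (B + 11))) (.reg (B + 9)))) <|
      .seq (.put A (.add (.reg (B + 11)) (.reg (B + 9))) (.reg (B + 12))) <|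
      .seq (.put A (.reg (B + 11))
        (.sub (.get A (.reg (B + 11))) (.shl (.reg (B + 12)) (.reg (B + 9)))))
        (.assign (B + 11) (.add (.reg (B + 11)) (.add (.reg (B + 9)) (.reg (B + 9)))))) <|
    .seq (.assign (B + 8) (.add (.reg (B + 8)) (.reg (B + 8))))
      (.assign (B + 9) (.shr (.reg (B + 9)) (.const 1)))

/-- Halving a block of `2 h` bits at position `p`. -/
theorem block_split (x p h : ℕ) :
    x / 2 ^ p % 2 ^ (2 * h) / 2 ^ h = x / 2 ^ (p + h) % 2 ^ h ∧
    ((x / 2 ^ p % 2 ^ (2 * h) : ℕ) : ℤ) - (x / 2 ^ (p + h) % 2 ^ h : ℕ) * 2 ^ h =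
      (x / 2 ^ p % 2 ^ h : ℕ) := by
  have e : x / 2 ^ p % 2 ^ (2 * h) / 2 ^ h = x / 2 ^ (p + h) % 2 ^ h := by
    rw [two_mul, pow_add, Nat.mod_mul_right_div_self, Nat.div_div_eq_div_mul, ← pow_add]
  refine ⟨e, ?_⟩
  rw [← e]
  have h1 : x / 2 ^ p % 2 ^ (2 * h) % 2 ^ h = x / 2 ^ p % 2 ^ h :=
    Nat.mod_mod_of_dvd _ (pow_dvd_pow 2 (by omega))
  have h2 := Nat.mod_add_div (x / 2 ^ p % 2 ^ (2 * h)) (2 ^ h)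
  rw [h1] at h2
  have h3 : ((x / 2 ^ p % 2 ^ (2 * h) : ℕ) : ℤ) = (x / 2 ^ p % 2 ^ h : ℕ) +
    2 ^ h * (x / 2 ^ p % 2 ^ (2 * h) / 2 ^ h : ℕ) := by exact_mod_cast h2.symm
  rw [h3]; ring

theorem mul_two_mul_inj {i j h : ℕ} (hh : 0 < h) : ((i * h : ℕ) : ℤ) = (j * (2 * h) : ℕ) ↔
    i = 2 * j := by
  rw [Nat.cast_inj, show j * (2 * h) = 2 * j * h by ring, Nat.mul_left_inj (by omega)]

theorem mul_two_mul_add_inj {i j h : ℕ} (hh : 0 < h) :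
    ((i * h : ℕ) : ℤ) = (j * (2 * h) : ℕ) + h ↔ i = 2 * j + 1 := by
  rw [← Nat.cast_add, Nat.cast_inj, show j * (2 * h) + h = (2 * j + 1) * h by ring,
    Nat.mul_left_inj (by omega)]

theorem splitLevel_spec {O : ℕ → ℕ → ℤ} {B A κ l h x : ℕ} (hh : 2 ^ l * (2 * h) = 2 ^ κ)
    {σ : State} (h8 : σ.reg (B + 8) = (2 ^ l : ℕ)) (h9 : σ.reg (B + 9) = h)
    (h11 : σ.reg (B + 11) = 0)
    (hT : ∀ i < 2 ^ l, σ.mem A (i * (2 * h) : ℕ) = (x / 2 ^ (i * (2 * h)) % 2 ^ (2 * h) : ℕ)) :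
    Tri O (.for (B + 10) (B + 8) <|
      .seq (.assign (B + 12) (.shr (.get A (.reg (B + 11))) (.reg (B + 9)))) <|
      .seq (.put A (.add (.reg (B + 11)) (.reg (B + 9))) (.reg (B + 12))) <|
      .seq (.put A (.reg (B + 11))
        (.sub (.get A (.reg (B + 11))) (.shl (.reg (B + 12)) (.reg (B + 9)))))
        (.assign (B + 11) (.add (.reg (B + 11)) (.add (.reg (B + 9)) (.reg (B + 9)))))) σ
      (2 ^ κ * (3000 * (κ + 4)))
      fun σ' => (∀ i < 2 * 2 ^ l, σ'.mem A (i * h : ℕ) = (x / 2 ^ (i * h) % 2 ^ h : ℕ)) ∧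
        Same (fun r => r < B + 10 ∨ B + 13 ≤ r) (· ≠ A) σ σ' := by
  have hh0 : 0 < h := by
    rcases Nat.eq_zero_or_pos h with rfl | h0
    · have : 0 < 2 ^ κ := by positivity
      simp at hh; omega
    · exact h0
  have hlκ : 2 ^ l ≤ 2 ^ κ := by rw [← hh]; exact Nat.le_mul_of_pos_right _ (by omega)
  have hhκ : 2 * h ≤ 2 ^ κ := by rw [← hh]; exact Nat.le_mul_of_pos_left _ (by positivity)
  have hκlen : ∀ k : ℕ, k ≤ 2 ^ κ → len (k : ℤ) ≤ κ + 1 := fun k hk =>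
    len_natCast_le.2 (by rw [pow_succ]; have : 0 < 2 ^ κ := by positivity
                         omega)
  let L := 2 * h + κ + 3
  have hL1 : 1 ≤ L := by omega
  let I : ℕ → State → Prop := fun k τ => τ.reg (B + 10) = k ∧ τ.reg (B + 11) = (k * (2 * h) : ℕ) ∧
    (∀ i < 2 * k, τ.mem A (i * h : ℕ) = (x / 2 ^ (i * h) % 2 ^ h : ℕ)) ∧
    (∀ i < 2 ^ l, k ≤ i → τ.mem A (i * (2 * h) : ℕ) = (x / 2 ^ (i * (2 * h)) % 2 ^ (2 * h) : ℕ)) ∧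
    Same (fun r => r < B + 10 ∨ B + 13 ≤ r) (· ≠ A) σ τ
  refine (Tri.for I (2 ^ l) (fun _ => 4 * 24 ^ 2 * (L * (1 + 0))) (L := κ + 1) (hκlen _ hlκ)
    (by omega) ?_ ?_ ?_ ?_).mono ?_ ?_
  · rintro k τ ⟨-, -, -, -, hs⟩
    rw [hs.1 _ (by omega), h8]
  · rintro k τ hI; exact hI.1
  · rintro k τ hk ⟨e10, e11, hlo, hhi, hs⟩
    have e9 : τ.reg (B + 9) = h := by rw [hs.1 _ (by omega), h9]
    have hm := hhi k hk le_rfl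
    obtain ⟨b1, b2⟩ := block_split x (k * (2 * h)) h
    have b1' : ((x / 2 ^ (k * (2 * h)) % 2 ^ (2 * h) : ℕ) : ℤ) / 2 ^ h =
        (x / 2 ^ (k * (2 * h) + h) % 2 ^ h : ℕ) := by
      rw [intCast_div_two_pow, b1]
    have hkh : k * (2 * h) + 2 * h ≤ 2 ^ κ := by
      rw [← hh, ← Nat.succ_mul]; exact Nat.mul_le_mul_right _ hk
    have l11 : len ((k * (2 * h) : ℕ) : ℤ) ≤ L := (hκlen _ (by omega)).trans (by omega)
    have l9 : len (h : ℤ) ≤ L := (hκlen _ (by omega)).trans (by omega)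
    have lt : len ((x / 2 ^ (k * (2 * h)) % 2 ^ (2 * h) : ℕ) : ℤ) ≤ L :=
      (len_natCast_le.2 (Nat.mod_lt _ (by positivity)) : _ ≤ 2 * h).trans (by omega)
    have lhi : len ((x / 2 ^ (k * (2 * h) + h) % 2 ^ h : ℕ) : ℤ) ≤ L :=
      (len_natCast_le.2 (Nat.mod_lt _ (by positivity)) : _ ≤ h).trans (by omega)
    have hne : ((k * (2 * h) : ℕ) : ℤ) ≠ (k * (2 * h) : ℕ) + h := by omega
    have hhL : h ≤ L := by omega
    generalize ((x / 2 ^ (k * (2 * h)) % 2 ^ (2 * h) : ℕ) : ℤ) = t at *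
    generalize hu : ((x / 2 ^ (k * (2 * h) + h) % 2 ^ h : ℕ) : ℤ) = u at *
    generalize hp : ((k * (2 * h) : ℕ) : ℤ) = p at *
    refine Tri.line 24 (L := L) (ℓ := 0) hL1 (by simp [Cmd.Straight]) (by simp [Cmd.sz, Expr.sz])
      ?_ ?_
    · simp only [Cmd.Leaf, Expr.Leaf, Cmd.exec, Expr.eval, State.setR_reg, State.setR_mem,
        State.setM_reg, State.setM_mem]
      simp [e9, e11, hm, b1', l11, l9, lt, lhi, hh0.ne', hhL]
    · simp only [Cmd.exec, Expr.eval, I]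
      have hA : ∀ i : ℕ, τ.mem A i = τ.mem A i := fun _ => rfl
      refine ⟨by simp [e10], by simp, ?_, fun i hi => ?_, fun i hi hki => ?_, fun r hr => ?_,
        fun a ha j => ?_⟩
      · simp [e11, e9, ← hp]; ring
      · have c1 := mul_two_mul_inj (i := i) (j := k) hh0
        have c2 := mul_two_mul_add_inj (i := i) (j := k) hh0
        rw [hp] at c1 c2
        simp only [State.setR_reg, State.setR_mem, State.setM_reg, State.setM_mem]
        simp only [e11, e9, hm, b1', c1, c2, Int.toNat_natCast, true_and,
          Nat.add_left_cancel_iff, if_true, if_false, Nat.reduceEqDiff]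
        by_cases i1 : i = 2 * k
        · subst i1
          simp [hne, b2]
          rw [show 2 * k * h = k * (2 * h) by ring]
        by_cases i2 : i = 2 * k + 1
        · subst i2
          simp [← hu]
          rw [show (2 * k + 1) * h = k * (2 * h) + h by ring]
        · simp [i1, i2]
          exact_mod_cast hlo i (by omega)
      · have c1 := mul_two_mul_inj (i := 2 * i) (j := k) hh0
        have c2 := mul_two_mul_add_inj (i := 2 * i) (j := k) hh0
        rw [show 2 * i * h = i * (2 * h) by ring, hp] at c1 c2
        simp only [State.setR_reg, State.setR_mem, State.setM_reg, State.setM_mem]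
        simp only [e11, e9, c1, c2,
          Nat.add_left_cancel_iff, if_true, if_false, Nat.reduceEqDiff]
        rw [if_neg (by omega), if_neg (by omega)]
        exact hhi i hi (by omega)
      · have := hs.1 r hr
        simp; grind
      · have := hs.2 a ha j
        simp; grind
  · refine ⟨by simp, by simp [h11], by simp, fun i hi _ => by simpa using hT i hi, fun r hr => ?_,
      fun a ha j => by simp⟩
    simp; grind
  · rw [Finset.sum_const, Finset.card_range, smul_eq_mul]
    simp only [L]
    have : 2 ^ l * (2 * h + κ + 3) ≤ 2 ^ κ * (κ + 4) := by
      nlinarith [Nat.mul_le_mul_right (κ + 3) hlκ]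
    have h1 : 1 ≤ 2 ^ κ := Nat.one_le_two_pow
    nlinarith [Nat.mul_le_mul_right (κ + 1) hlκ, Nat.mul_le_mul_right (κ + 1) h1]
  · rintro τ ⟨-, -, hlo, -, hs⟩
    exact ⟨hlo, hs⟩

theorem splitC_spec {O : ℕ → ℕ → ℤ} {B A v κ x : ℕ} (hκ : 1 ≤ κ) {σ : State}
    (hr : σ.reg (B + 32) = κ) (hR : σ.reg (B + 33) = (2 ^ κ : ℕ)) (hv : σ.reg v = x)
    (hx : x < 2 ^ 2 ^ κ) :
    Tri O (splitC B A v) σ (2 ^ κ * (κ + 1) * (6000 * (κ + 4)))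
      fun σ' => (∀ i < 2 ^ κ, σ'.mem A (i : ℕ) = (x / 2 ^ i % 2 : ℕ)) ∧
        Same (fun r => r < B + 7 ∨ B + 13 ≤ r) (· ≠ A) σ σ' := by
  have hhalf : ∀ l < κ, 2 ^ (κ - l) = 2 * 2 ^ (κ - (l + 1)) := fun l hl => by
    rw [← pow_succ']; congr 1; omega
  have hdiv : ∀ l < κ, ((2 ^ (κ - l) : ℕ) : ℤ) / 2 ^ 1 = (2 ^ (κ - (l + 1)) : ℕ) := fun l hl => by
    rw [hhalf l hl]; push_cast; omega
  have hlen : ∀ l ≤ κ, len ((2 ^ l : ℕ) : ℤ) ≤ κ + 1 := fun l hl => by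
    have := len_two_pow l
    push_cast; omega
  have hκL : len (κ : ℤ) ≤ κ + 1 := (len_natCast_le_self κ).trans (by omega)
  let I : ℕ → State → Prop := fun l τ => τ.reg (B + 7) = l ∧ τ.reg (B + 8) = (2 ^ l : ℕ) ∧
    τ.reg (B + 9) = ((2 ^ (κ - l) : ℕ) : ℤ) / 2 ^ 1 ∧
    (∀ i < 2 ^ l, τ.mem A (i * 2 ^ (κ - l) : ℕ) =
      (x / 2 ^ (i * 2 ^ (κ - l)) % 2 ^ 2 ^ (κ - l) : ℕ)) ∧
    Same (fun r => r < B + 7 ∨ B + 13 ≤ r) (· ≠ A) σ τ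
  have hX : len (x : ℤ) ≤ 2 ^ κ := len_natCast_le.2 hx
  have hone : 1 ≤ 2 ^ κ := Nat.one_le_two_pow
  refine ((Tri.line 10 (L := 2 ^ κ + κ + 1) (ℓ := 0) (Q := fun τ => I 0 (τ.setR (B + 7) 0))
    (by omega) (by simp [Cmd.Straight]) (by simp [Cmd.sz, Expr.sz]) ?_ ?_).seq (fun τ hτ =>
      Tri.for I κ (fun _ => 4 * 2 ^ 2 * ((κ + 1) * (1 + 0)) + (2 ^ κ * (3000 * (κ + 4)) +
        4 * 8 ^ 2 * ((κ + 1) * (1 + 0)))) (L := κ + 1) hκL (by omega) ?_ ?_ ?_ hτ)).mono ?_ ?_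
  · have h1 := hlen κ le_rfl
    push_cast at h1
    simp [Cmd.Leaf, Expr.Leaf, Cmd.exec, Expr.eval, hv, hR, len_zero, len_one]
    omega
  · simp only [Cmd.exec, Expr.eval, I]
    refine ⟨by simp, by simp, by simp [hR], fun i hi => ?_, fun r hr => ?_, fun a ha j => ?_⟩
    · obtain rfl : i = 0 := by simpa using hi
      simp [hv, Nat.mod_eq_of_lt hx]
    · simp; grind
    · simp; grind
  · rintro l τ ⟨-, -, -, -, hs⟩
    rw [hs.1 _ (by omega), hr]
  · rintro l τ hI; exact hI.1
  · rintro l τ hl ⟨e7, e8, e9, hT, hs⟩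
    rw [hdiv l hl] at e9
    rw [hhalf l hl] at hT
    refine (Tri.line 2 (L := κ + 1) (ℓ := 0) (Q := fun τ' => τ'.reg (B + 11) = 0 ∧
      Same (fun r => r ≠ B + 11) (fun _ => True) τ τ')
      (by omega) (by simp [Cmd.Straight]) (by simp [Cmd.sz, Expr.sz]) ?_ ?_).seq fun τ₁ hτ₁ => ?_
    · simp [Cmd.Leaf, Expr.Leaf, len_zero]
    · simp only [Cmd.exec, Expr.eval]
      refine ⟨by simp, fun r hr => ?_, fun a ha j => by simp⟩
      simp; grind
    obtain ⟨f11, s1⟩ := hτ₁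
    refine (splitLevel_spec (κ := κ) (l := l) (h := 2 ^ (κ - (l + 1))) (x := x) ?_ ?_ ?_ f11
      fun i hi => ?_).seq fun τ₂ hτ₂ => ?_
    · rw [← hhalf l hl, ← pow_add]; congr 1; omega
    · rw [s1.1 _ (by omega), e8]
    · rw [s1.1 _ (by omega), e9]
    · rw [s1.2 _ trivial]; exact hT i hi
    obtain ⟨hT2, s2⟩ := hτ₂
    have g8 : τ₂.reg (B + 8) = (2 ^ l : ℕ) := by rw [s2.1 _ (by omega), s1.1 _ (by omega), e8]
    have g9 : τ₂.reg (B + 9) = (2 ^ (κ - (l + 1)) : ℕ) := by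
      rw [s2.1 _ (by omega), s1.1 _ (by omega), e9]
    refine Tri.line 8 (L := κ + 1) (ℓ := 0) (by omega) (by simp [Cmd.Straight])
      (by simp [Cmd.sz, Expr.sz]) ?_ ?_
    · have h1 := hlen l hl.le
      have h2 := hlen (κ - (l + 1)) (by omega)
      push_cast at h1 h2
      simp [Cmd.Leaf, Expr.Leaf, Cmd.exec, g8, g9, len_one, h1, h2]
    · simp only [Cmd.exec, Expr.eval, I]
      refine ⟨?_, by simp, ?_, ?_, fun i hi => ?_, fun r hr => ?_, fun a ha j => ?_⟩
      · have h1 := s2.1 (B + 7) (by omega)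
        have h2 := s1.1 (B + 7) (by omega)
        simp [h1, h2, e7]
      · simp [g8, pow_succ]; ring
      · simp [g9]
      · have := hT2 i (by rw [pow_succ] at hi; omega)
        simpa using this
      · have h1 := s2.1 r (by omega)
        have h2 := s1.1 r (by omega)
        have h3 := hs.1 r hr
        simp; grind
      · have h1 := s2.2 a ha j
        have h2 := s1.2 a trivial j
        have h3 := hs.2 a ha j
        simp; grind
  · rw [Finset.sum_const, Finset.card_range, smul_eq_mul]
    generalize 2 ^ κ = R at *
    nlinarith [Nat.mul_le_mul_right (κ + 1) hone, Nat.mul_le_mul_right (κ * κ) hone,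
      Nat.mul_le_mul_right κ hone]
  · rintro τ ⟨-, -, -, hT, hs⟩
    exact ⟨fun i hi => by simpa using hT i hi, hs⟩

/-- Replace the numbers `v k ≤ 2 ^ κ` in array `V` by `∑ k, v k * 2 ^ k`, stored at index `0`, by
repeated pairing of neighbouring blocks. -/
def combineC (B V : ℕ) : Cmd :=
  .seq (.seq (.assign (B + 8) (.shr (.reg (B + 33)) (.const 1))) (.assign (B + 9) (.const 1))) <|
  .for (B + 7) (B + 32) <|
    .seq (.assign (B + 11) (.const 0)) <|
    .seq (.for (B + 10) (B + 8) <|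
      .seq (.put V (.reg (B + 11)) (.add (.get V (.reg (B + 11)))
        (.shl (.get V (.add (.reg (B + 11)) (.reg (B + 9)))) (.reg (B + 9)))))
        (.assign (B + 11) (.add (.reg (B + 11)) (.add (.reg (B + 9)) (.reg (B + 9)))))) <|
    .seq (.assign (B + 8) (.shr (.reg (B + 8)) (.const 1)))
      (.assign (B + 9) (.add (.reg (B + 9)) (.reg (B + 9))))

/-- The value of the block number `i` of `h` digits. -/
def blockVal (v : ℕ → ℕ) (h i : ℕ) : ℕ := ∑ k ∈ Finset.range h, v (i * h + k) * 2 ^ k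

/-- Two neighbouring blocks make up a block of twice the length. -/
theorem blockVal_two_mul (v : ℕ → ℕ) (h i : ℕ) :
    blockVal v (2 * h) i = blockVal v h (2 * i) + blockVal v h (2 * i + 1) * 2 ^ h := by
  unfold blockVal
  rw [two_mul h, Finset.sum_range_add, Finset.sum_mul]
  congr 1
  · exact Finset.sum_congr rfl fun k _ => by congr 2; ring
  · refine Finset.sum_congr rfl fun k _ => ?_
    rw [pow_add, show i * (h + h) + (h + k) = (2 * i + 1) * h + k by ring]; ring

theorem len_blockVal_le {v : ℕ → ℕ} {κ : ℕ} (hv : ∀ k, v k ≤ 2 ^ κ) (h i : ℕ) :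
    len (blockVal v h i : ℤ) ≤ κ + h := by
  rw [len_natCast_le, blockVal, pow_add]
  calc ∑ k ∈ Finset.range h, v (i * h + k) * 2 ^ k
      ≤ ∑ k ∈ Finset.range h, 2 ^ κ * 2 ^ k := Finset.sum_le_sum fun k _ => by gcongr; exact hv _
    _ = 2 ^ κ * ∑ k ∈ Finset.range h, 2 ^ k := by rw [Finset.mul_sum]
    _ < _ := by
      gcongr
      exact Nat.geomSum_lt le_rfl (by simp)

theorem combineLevel_spec {O : ℕ → ℕ → ℤ} {B V κ c h : ℕ} {v : ℕ → ℕ} (hv : ∀ k, v k ≤ 2 ^ κ)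
    (hh : c * (2 * h) = 2 ^ κ)
    {σ : State} (h8 : σ.reg (B + 8) = c) (h9 : σ.reg (B + 9) = h)
    (h11 : σ.reg (B + 11) = 0)
    (hT : ∀ i < 2 * c, σ.mem V (i * h : ℕ) = blockVal v h i) :
    Tri O (.for (B + 10) (B + 8) <|
      .seq (.put V (.reg (B + 11)) (.add (.get V (.reg (B + 11)))
        (.shl (.get V (.add (.reg (B + 11)) (.reg (B + 9)))) (.reg (B + 9)))))
        (.assign (B + 11) (.add (.reg (B + 11)) (.add (.reg (B + 9)) (.reg (B + 9)))))) σ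
      (2 ^ κ * (3000 * (κ + 4)))
      fun σ' => (∀ i < c, σ'.mem V (i * (2 * h) : ℕ) = blockVal v (2 * h) i) ∧
        Same (fun r => r < B + 10 ∨ B + 12 ≤ r) (· ≠ V) σ σ' := by
  have hpos : 0 < 2 ^ κ := by positivity
  have hh0 : 0 < h := by
    rcases Nat.eq_zero_or_pos h with rfl | h0
    · simp at hh; omega
    · exact h0
  have hc0 : 0 < c := by
    rcases Nat.eq_zero_or_pos c with rfl | h0
    · simp at hh; omega
    · exact h0
  have hlκ : c ≤ 2 ^ κ := by rw [← hh]; exact Nat.le_mul_of_pos_right _ (by omega)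
  have hhκ : 2 * h ≤ 2 ^ κ := by rw [← hh]; exact Nat.le_mul_of_pos_left _ hc0
  have hκlen : ∀ k : ℕ, k ≤ 2 ^ κ → len (k : ℤ) ≤ κ + 1 := fun k hk =>
    len_natCast_le.2 (by rw [pow_succ]; omega)
  let L := 2 * h + κ + 3
  have hL1 : 1 ≤ L := by omega
  let I : ℕ → State → Prop := fun k τ => τ.reg (B + 10) = k ∧ τ.reg (B + 11) = (k * (2 * h) : ℕ) ∧
    (∀ i < k, τ.mem V (i * (2 * h) : ℕ) = blockVal v (2 * h) i) ∧
    (∀ i < 2 * c, 2 * k ≤ i → τ.mem V (i * h : ℕ) = blockVal v h i) ∧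
    Same (fun r => r < B + 10 ∨ B + 12 ≤ r) (· ≠ V) σ τ
  refine (Tri.for I c (fun _ => 4 * 18 ^ 2 * (L * (1 + 0))) (L := κ + 1) (hκlen _ hlκ)
    (by omega) ?_ ?_ ?_ ?_).mono ?_ ?_
  · rintro k τ ⟨-, -, -, -, hs⟩
    rw [hs.1 _ (by omega), h8]
  · rintro k τ hI; exact hI.1
  · rintro k τ hk ⟨e10, e11, hlo, hhi, hs⟩
    have e9 : τ.reg (B + 9) = h := by rw [hs.1 _ (by omega), h9]
    have m1 := hhi (2 * k) (by omega) le_rfl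
    have m2 := hhi (2 * k + 1) (by omega) (by omega)
    rw [show 2 * k * h = k * (2 * h) by ring] at m1
    rw [show (2 * k + 1) * h = k * (2 * h) + h by ring, Nat.cast_add] at m2
    have hkh : k * (2 * h) + 2 * h ≤ 2 ^ κ := by
      rw [← hh, ← Nat.succ_mul]; exact Nat.mul_le_mul_right _ hk
    have l11 : len ((k * (2 * h) : ℕ) : ℤ) ≤ L := (hκlen _ (by omega)).trans (by omega)
    have l9 : len (h : ℤ) ≤ L := (hκlen _ (by omega)).trans (by omega)
    have lb1 : len (blockVal v h (2 * k) : ℤ) ≤ L := (len_blockVal_le hv _ _).trans (by omega)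
    have lb2 : len (blockVal v h (2 * k + 1) : ℤ) ≤ L := (len_blockVal_le hv _ _).trans (by omega)
    have hhL : h ≤ L := by omega
    have hb := blockVal_two_mul v h k
    generalize hp : ((k * (2 * h) : ℕ) : ℤ) = p at *
    refine Tri.line 18 (L := L) (ℓ := 0) hL1 (by simp [Cmd.Straight]) (by simp [Cmd.sz, Expr.sz])
      ?_ ?_
    · simp [Cmd.Leaf, Expr.Leaf, Cmd.exec, Expr.eval, e9, e11, m1, m2, l11, l9, lb1, lb2, hhL]
    · simp only [Cmd.exec, Expr.eval, I]
      refine ⟨by simp [e10], by simp, ?_, fun i hi => ?_, fun i hi hki => ?_, fun r hr => ?_,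
        fun a ha j => ?_⟩
      · simp [e11, e9, ← hp]; ring
      · have c1 := mul_two_mul_inj (i := 2 * i) (j := k) hh0
        rw [show 2 * i * h = i * (2 * h) by ring, hp] at c1
        simp only [State.setR_mem, State.setM_mem]
        simp only [e11, e9, m1, m2, c1, Int.toNat_natCast, true_and]
        by_cases i1 : i = k
        · subst i1
          simp [hb]
        · rw [if_neg (by omega)]
          exact hlo i (by omega)
      · have c1 := mul_two_mul_inj (i := i) (j := k) hh0
        rw [hp] at c1
        simp only [State.setR_mem, State.setM_mem, e11, c1]
        rw [if_neg (by omega)]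
        exact hhi i hi (by omega)
      · have := hs.1 r hr
        simp; grind
      · have := hs.2 a ha j
        simp; grind
  · refine ⟨by simp, by simp [h11], by simp, fun i hi _ => by simpa using hT i hi, fun r hr => ?_,
      fun a ha j => by simp⟩
    simp; grind
  · rw [Finset.sum_const, Finset.card_range, smul_eq_mul]
    simp only [L]
    have : c * (2 * h + κ + 3) ≤ 2 ^ κ * (κ + 4) := by
      nlinarith [Nat.mul_le_mul_right (κ + 3) hlκ]
    nlinarith [Nat.mul_le_mul_right (κ + 1) hlκ, Nat.mul_le_mul_right (κ + 1) hpos]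
  · rintro τ ⟨-, -, hlo, -, hs⟩
    exact ⟨hlo, hs⟩

theorem combineC_spec {O : ℕ → ℕ → ℤ} {B V κ : ℕ} {v : ℕ → ℕ} (hv : ∀ k, v k ≤ 2 ^ κ)
    (hκ : 1 ≤ κ) {σ : State}
    (hr : σ.reg (B + 32) = κ) (hR : σ.reg (B + 33) = (2 ^ κ : ℕ))
    (hV : ∀ i < 2 ^ κ, σ.mem V (i : ℕ) = v i) :
    Tri O (combineC B V) σ (2 ^ κ * (κ + 1) * (6000 * (κ + 4)))
      fun σ' => σ'.mem V 0 = ∑ k ∈ Finset.range (2 ^ κ), (v k : ℤ) * 2 ^ k ∧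
        Same (fun r => r < B + 7 ∨ B + 12 ≤ r) (· ≠ V) σ σ' := by
  have hhalf : ∀ l < κ, 2 ^ (κ - l) = 2 * 2 ^ (κ - (l + 1)) := fun l hl => by
    rw [← pow_succ']; congr 1; omega
  have hdiv : ∀ l < κ, ((2 ^ (κ - l) : ℕ) : ℤ) / 2 ^ 1 = (2 ^ (κ - (l + 1)) : ℕ) := fun l hl => by
    rw [hhalf l hl]; push_cast; omega
  have hlen : ∀ l ≤ κ, len ((2 ^ l : ℕ) : ℤ) ≤ κ + 1 := fun l hl => by
    have := len_two_pow l
    push_cast; omega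
  have hκL : len (κ : ℤ) ≤ κ + 1 := (len_natCast_le_self κ).trans (by omega)
  let I : ℕ → State → Prop := fun l τ => τ.reg (B + 7) = l ∧ τ.reg (B + 9) = (2 ^ l : ℕ) ∧
    τ.reg (B + 8) = ((2 ^ (κ - l) : ℕ) : ℤ) / 2 ^ 1 ∧
    (∀ i < 2 ^ (κ - l), τ.mem V (i * 2 ^ l : ℕ) = blockVal v (2 ^ l) i) ∧
    Same (fun r => r < B + 7 ∨ B + 12 ≤ r) (· ≠ V) σ τ
  have hone : 1 ≤ 2 ^ κ := Nat.one_le_two_pow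
  refine ((Tri.line 8 (L := κ + 1) (ℓ := 0) (Q := fun τ => I 0 (τ.setR (B + 7) 0))
    (by omega) (by simp [Cmd.Straight]) (by simp [Cmd.sz, Expr.sz]) ?_ ?_).seq (fun τ hτ =>
      Tri.for I κ (fun _ => 4 * 2 ^ 2 * ((κ + 1) * (1 + 0)) + (2 ^ κ * (3000 * (κ + 4)) +
        4 * 8 ^ 2 * ((κ + 1) * (1 + 0)))) (L := κ + 1) hκL (by omega) ?_ ?_ ?_ hτ)).mono ?_ ?_
  · have h1 := hlen κ le_rfl
    push_cast at h1
    simp [Cmd.Leaf, Expr.Leaf, hR, h1, len_one]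
  · simp only [Cmd.exec, Expr.eval, I]
    refine ⟨by simp, by simp, by simp [hR], fun i hi => ?_, fun r hr => ?_, fun a ha j => by simp⟩
    · simpa [blockVal] using hV i hi
    · simp; grind
  · rintro l τ ⟨-, -, -, -, hs⟩
    rw [hs.1 _ (by omega), hr]
  · rintro l τ hI; exact hI.1
  · rintro l τ hl ⟨e7, e9, e8, hT, hs⟩
    rw [hdiv l hl] at e8
    rw [hhalf l hl] at hT
    refine (Tri.line 2 (L := κ + 1) (ℓ := 0) (Q := fun τ' => τ'.reg (B + 11) = 0 ∧
      Same (fun r => r ≠ B + 11) (fun _ => True) τ τ')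
      (by omega) (by simp [Cmd.Straight]) (by simp [Cmd.sz, Expr.sz]) ?_ ?_).seq fun τ₁ hτ₁ => ?_
    · simp [Cmd.Leaf, Expr.Leaf, len_zero]
    · simp only [Cmd.exec, Expr.eval]
      refine ⟨by simp, fun r hr => ?_, fun a ha j => by simp⟩
      simp; grind
    obtain ⟨f11, s1⟩ := hτ₁
    refine (combineLevel_spec (κ := κ) (c := 2 ^ (κ - (l + 1))) (h := 2 ^ l) hv ?_ ?_ ?_ f11
      fun i hi => ?_).seq fun τ₂ hτ₂ => ?_
    · rw [← pow_succ', ← pow_add]; congr 1; omega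
    · rw [s1.1 _ (by omega), e8]
    · rw [s1.1 _ (by omega), e9]
    · rw [s1.2 _ trivial]; exact hT i hi
    obtain ⟨hT2, s2⟩ := hτ₂
    have g8 : τ₂.reg (B + 8) = (2 ^ (κ - (l + 1)) : ℕ) := by
      rw [s2.1 _ (by omega), s1.1 _ (by omega), e8]
    have g9 : τ₂.reg (B + 9) = (2 ^ l : ℕ) := by
      rw [s2.1 _ (by omega), s1.1 _ (by omega), e9]
    refine Tri.line 8 (L := κ + 1) (ℓ := 0) (by omega) (by simp [Cmd.Straight])
      (by simp [Cmd.sz, Expr.sz]) ?_ ?_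
    · have h1 := hlen l hl.le
      have h2 := hlen (κ - (l + 1)) (by omega)
      push_cast at h1 h2
      simp [Cmd.Leaf, Expr.Leaf, Cmd.exec, g8, g9, len_one, h1, h2]
    · simp only [Cmd.exec, Expr.eval, I]
      refine ⟨?_, by simp, ?_, ?_, fun i hi => ?_, fun r hr => ?_, fun a ha j => ?_⟩
      · have h1 := s2.1 (B + 7) (by omega)
        have h2 := s1.1 (B + 7) (by omega)
        simp [h1, h2, e7]
      · simp [g9, pow_succ]; ring
      · simp [g8]
      · have := hT2 i hi
        rw [← pow_succ'] at this
        simpa using this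
      · have h1 := s2.1 r (by omega)
        have h2 := s1.1 r (by omega)
        have h3 := hs.1 r hr
        simp; grind
      · have h1 := s2.2 a ha j
        have h2 := s1.2 a trivial j
        have h3 := hs.2 a ha j
        simp; grind
  · rw [Finset.sum_const, Finset.card_range, smul_eq_mul]
    generalize 2 ^ κ = R at *
    nlinarith [Nat.mul_le_mul_right (κ + 1) hone, Nat.mul_le_mul_right (κ * κ) hone,
      Nat.mul_le_mul_right κ hone]
  · rintro τ ⟨-, -, -, hT, hs⟩
    refine ⟨?_, hs⟩
    have := hT 0 (by positivity)
    simp only [blockVal, zero_mul, zero_add, Nat.cast_zero] at this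
    rw [this]; push_cast; rfl

/-! ### Multiplication with the fast Fourier transform -/

/-- Multiplication of integers: the bits of the shifted factors are convolved by Fourier
transforms, the result is rounded, and the carries are resolved. -/
def fftMulC (B : ℕ) : Cmd :=
  .seq (offsetC B) <| .seq (splitC B (B + 34) (B + 5)) <| .seq (splitC B (B + 36) (B + 6)) <|
  .seq (.for (B + 7) (B + 33) <|
    .seq (.put (B + 34) (.reg (B + 7)) (.shl (.get (B + 34) (.reg (B + 7))) (.reg (B + 68)))) <|
    .seq (.put (B + 35) (.reg (B + 7)) (.const 0)) <|
    .seq (.put (B + 36) (.reg (B + 7)) (.shl (.get (B + 36) (.reg (B + 7))) (.reg (B + 68))))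
      (.put (B + 37) (.reg (B + 7)) (.const 0))) <|
  .seq (convC (B + 32) (complexMul (B + 64) (builtinMul (B + 72)))) <|
  .seq (.put (B + 34) (.reg (B + 33)) (.get (B + 34) (.const 0))) <|
  .seq (.for (B + 7) (B + 33) <|
    .put B (.reg (B + 7)) (.shr (.add (.get (B + 34) (.sub (.reg (B + 33)) (.reg (B + 7))))
      (.shl (.const 1) (.sub (.add (.reg (B + 68)) (.reg (B + 32))) (.const 1))))
      (.add (.reg (B + 68)) (.reg (B + 32))))) <|
  .seq (combineC B B) (.assign (B + 2) (Expr.unoffset B (.get B (.const 0))))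

/-- The registers and the table of roots of unity needed by `fftMulC` are in place. -/
def FftMulReady (B κ Q : ℕ) (σ : State) : Prop :=
  σ.reg (B + 4) = Q ∧ σ.reg (B + 32) = κ ∧ σ.reg (B + 33) = (2 ^ κ : ℕ) ∧
  σ.reg (B + 68) = (16 * κ : ℕ) ∧
  ∀ i : ℕ, i < 2 ^ κ → ‖σ.cv (B + 32) i - 2 ^ (16 * κ) *
    Complex.exp (2 * Real.pi * Complex.I / (2 ^ κ : ℕ)) ^ i‖ ≤ 2 ^ κ * (66 * (16 * κ : ℕ))

/-- The convolution of two sequences of `R` numbers. -/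
def digitConv (X Y : ℕ → ℕ) (R k : ℕ) : ℕ :=
  ∑ j ∈ Finset.range R, ∑ s ∈ Finset.range R, if j + s = k then X j * Y s else 0

theorem digitConv_le {X Y : ℕ → ℕ} (hX : ∀ i, X i ≤ 1) (hY : ∀ i, Y i ≤ 1) (R k : ℕ) :
    digitConv X Y R k ≤ R := by
  have h : ∀ j ∈ Finset.range R,
      (∑ s ∈ Finset.range R, if j + s = k then X j * Y s else 0) ≤ 1 := by
    intro j _
    calc _ ≤ ∑ s ∈ Finset.range R, if s = k - j then 1 else 0 := by
          refine Finset.sum_le_sum fun s _ => ?_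
          by_cases h : j + s = k
          · rw [if_pos h, if_pos (by omega)]
            exact Nat.mul_le_mul (hX j) (hY s)
          · rw [if_neg h]; exact Nat.zero_le _
      _ ≤ 1 := by
          rw [Finset.sum_ite_eq']
          split_ifs <;> simp
  exact (Finset.sum_le_sum h).trans (by simp)

theorem sum_digitConv {X Y : ℕ → ℕ} {R : ℕ} (h : ∀ j s, R ≤ j + s → X j * Y s = 0) :
    ∑ k ∈ Finset.range R, digitConv X Y R k * 2 ^ k =
      (∑ j ∈ Finset.range R, X j * 2 ^ j) * ∑ s ∈ Finset.range R, Y s * 2 ^ s := by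
  unfold digitConv
  simp_rw [Finset.sum_mul_sum, Finset.sum_mul]
  rw [Finset.sum_comm]
  refine Finset.sum_congr rfl fun j _ => ?_
  rw [Finset.sum_comm]
  refine Finset.sum_congr rfl fun s _ => ?_
  simp_rw [ite_mul, zero_mul]
  rw [Finset.sum_ite_eq]
  split_ifs with hjs
  · rw [pow_add]; ring
  · have := h j s (by simpa using hjs)
    rw [mul_mul_mul_comm, this, zero_mul]

/-- A cyclic convolution without wrap-around. -/
theorem cyclic_eq_digitConv {X Y : ℕ → ℕ} {R : ℕ} (h : ∀ j s, R ≤ j + s → X j * Y s = 0) {k : ℕ}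
    (hk : k < R) :
    (∑ j ∈ Finset.range R, ∑ s ∈ Finset.range R,
      if R ∣ j + s + (R - k) % R then (X j : ℂ) * Y s else 0) = (digitConv X Y R k : ℂ) := by
  unfold digitConv
  push_cast
  refine Finset.sum_congr rfl fun j _ => Finset.sum_congr rfl fun s _ => ?_
  rcases lt_or_ge (j + s) R with hjs | hjs
  · have : R ∣ j + s + (R - k) % R ↔ j + s = k := by
      rw [(Nat.dvd_iff_mod_eq_zero), Nat.add_mod_mod, ← Nat.dvd_iff_mod_eq_zero]
      constructor
      · rintro ⟨c, hc⟩
        have h1 : c < 2 := by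
          by_contra hc2
          have := Nat.mul_le_mul_left R (by omega : 2 ≤ c)
          omega
        have h2 : c ≠ 0 := by rintro rfl; omega
        obtain rfl : c = 1 := by omega
        omega
      · intro h; exact ⟨1, by omega⟩
    simp only [this]
  · have h0 : (X j : ℂ) * Y s = 0 := by exact_mod_cast h j s hjs
    rw [h0]; split_ifs <;> simp

/-- A natural number is recovered from a fixed-point approximation by rounding. -/
theorem round_eq {a : ℤ} {v p : ℕ} {E : ℝ} (h : |(a : ℝ) - 2 ^ (p + 1) * v| ≤ E) (hE : E < 2 ^ p) :
    (a + 2 ^ p) / 2 ^ (p + 1) = v := by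
  have h' := abs_lt.1 (h.trans_lt hE)
  have h1 : ((2 ^ (p + 1) * v - 2 ^ p : ℤ) : ℝ) < (a : ℝ) := by push_cast; linarith
  have h2 : (a : ℝ) < ((2 ^ (p + 1) * v + 2 ^ p : ℤ) : ℝ) := by push_cast; linarith
  rw [Int.cast_lt] at h1 h2
  have hp : (2 : ℤ) ^ (p + 1) = 2 * 2 ^ p := by ring
  rw [Int.ediv_eq_iff_of_pos (by positivity)]
  constructor <;> rw [hp] at h1 h2 ⊢ <;> linarith

/-- With `16 κ` binary digits, the error of the convolution of two sequences of bits is less than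
`1 / 2`, even after the scaling by `2 ^ κ`. -/
theorem fftMul_bounds {κ : ℕ} (hκ : 4 ≤ κ) :
    16 * 16 ^ κ * (2 ^ κ * (66 * (16 * κ : ℕ))) * (1 : ℝ) ^ 2 < 2 ^ (16 * κ + κ - 1) ∧
    16 * 16 ^ κ * (2 ^ κ * (66 * (16 * κ : ℕ))) * (1 : ℝ) ^ 2 ≤ 2 ^ (16 * κ) ∧
    (2 : ℝ) ^ κ * (66 * (16 * κ : ℕ)) ≤ 2 ^ (16 * κ) := by
  have h1 : 66 * ((16 * κ : ℕ) : ℝ) ≤ 2 ^ (κ + 11) := by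
    have := natCast_le_two_pow κ
    push_cast
    rw [pow_add]; nlinarith
  have h2 : 16 * 16 ^ κ * (2 ^ κ * (66 * (16 * κ : ℕ))) * (1 : ℝ) ^ 2 ≤ 2 ^ (6 * κ + 15) := by
    calc _ ≤ 16 * 16 ^ κ * (2 ^ κ * 2 ^ (κ + 11)) * (1 : ℝ) ^ 2 := by gcongr
      _ = 2 ^ (6 * κ + 15) := by
        rw [show (16 : ℝ) = 2 ^ 4 by norm_num, ← pow_mul]
        ring
  refine ⟨h2.trans_lt (pow_lt_pow_right₀ (by norm_num) (by omega)),
    h2.trans (pow_le_pow_right₀ (by norm_num) (by omega)), ?_⟩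
  calc _ ≤ (2 : ℝ) ^ κ * 2 ^ (κ + 11) := by gcongr
    _ = 2 ^ (2 * κ + 11) := by ring
    _ ≤ _ := pow_le_pow_right₀ (by norm_num) (by omega)

theorem FftMulReady.of_same {B κ Q : ℕ} {σ σ' : State} (h : FftMulReady B κ Q σ)
    (hs : Same (fun r => r = B + 4 ∨ r = B + 32 ∨ r = B + 33 ∨ r = B + 68)
      (fun a => a = B + 32 ∨ a = B + 33) σ σ') : FftMulReady B κ Q σ' := by
  refine ⟨?_, ?_, ?_, ?_, fun i hi => ?_⟩
  · rw [hs.1 _ (by omega), h.1]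
  · rw [hs.1 _ (by omega), h.2.1]
  · rw [hs.1 _ (by omega), h.2.2.1]
  · rw [hs.1 _ (by omega), h.2.2.2.1]
  · rw [hs.cv (by omega) (by omega)]
    exact h.2.2.2.2 i hi

/-- Left shift of all entries of the arrays that hold the bits. -/
theorem scaleLoop_spec {O : ℕ → ℕ → ℤ} {B κ Q : ℕ} {X Y : ℕ → ℕ} (hX : ∀ i, X i ≤ 1)
    (hY : ∀ i, Y i ≤ 1) (hκ : 4 ≤ κ) {σ : State} (hr : FftMulReady B κ Q σ)
    (hx : ∀ i < 2 ^ κ, σ.mem (B + 34) (i : ℕ) = X i)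
    (hy : ∀ i < 2 ^ κ, σ.mem (B + 36) (i : ℕ) = Y i) :
    Tri O (.for (B + 7) (B + 33) <|
      .seq (.put (B + 34) (.reg (B + 7)) (.shl (.get (B + 34) (.reg (B + 7))) (.reg (B + 68)))) <|
      .seq (.put (B + 35) (.reg (B + 7)) (.const 0)) <|
      .seq (.put (B + 36) (.reg (B + 7)) (.shl (.get (B + 36) (.reg (B + 7))) (.reg (B + 68))))
        (.put (B + 37) (.reg (B + 7)) (.const 0))) σ ((2 ^ κ + 1) * (2000 * (16 * κ)))
      fun σ' => (∀ i < 2 ^ κ, σ'.cv (B + 34) (i : ℕ) = 2 ^ (16 * κ) * (X i : ℂ) ∧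
          σ'.cv (B + 36) (i : ℕ) = 2 ^ (16 * κ) * (Y i : ℂ)) ∧
        Same (· ≠ B + 7) (fun a => a < B + 34 ∨ B + 38 ≤ a) σ σ' := by
  obtain ⟨-, -, h33, h68, -⟩ := hr
  have hκL : len ((2 ^ κ : ℕ) : ℤ) ≤ 16 * κ := by
    have := len_two_pow κ
    push_cast; omega
  have hw : len ((16 * κ : ℕ) : ℤ) ≤ 16 * κ := len_natCast_le_self _
  have hwt : (16 * (κ : ℤ)).toNat = 16 * κ := by omega
  have hbit : ∀ n : ℕ, n ≤ 1 → len (n : ℤ) ≤ 16 * κ := fun n hn =>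
    (len_natCast_le_self n).trans (by omega)
  let I : ℕ → State → Prop := fun k τ => τ.reg (B + 7) = k ∧
    (∀ i < k, τ.mem (B + 34) (i : ℕ) = X i * 2 ^ (16 * κ) ∧ τ.mem (B + 35) (i : ℕ) = 0 ∧
      τ.mem (B + 36) (i : ℕ) = Y i * 2 ^ (16 * κ) ∧ τ.mem (B + 37) (i : ℕ) = 0) ∧
    (∀ i < 2 ^ κ, k ≤ i → τ.mem (B + 34) (i : ℕ) = X i ∧ τ.mem (B + 36) (i : ℕ) = Y i) ∧
    Same (· ≠ B + 7) (fun a => a < B + 34 ∨ B + 38 ≤ a) σ τ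
  refine (Tri.for I (2 ^ κ) (fun _ => 4 * 20 ^ 2 * (16 * κ * (1 + 0))) (L := 16 * κ) hκL
    (by omega) ?_ ?_ ?_ ?_).mono ?_ ?_
  · rintro k τ ⟨-, -, -, hs⟩
    rw [hs.1 _ (by omega), h33]
  · rintro k τ hI; exact hI.1
  · rintro k τ hk ⟨e7, hlo, hhi, hs⟩
    have e68 : τ.reg (B + 68) = (16 * κ : ℕ) := by rw [hs.1 _ (by omega), h68]
    obtain ⟨m1, m2⟩ := hhi k hk le_rfl
    have hkL : len (k : ℤ) ≤ 16 * κ := (len_natCast_mono hk.le).trans hκL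
    refine Tri.line 20 (L := 16 * κ) (ℓ := 0) (by omega) (by simp [Cmd.Straight])
      (by simp [Cmd.sz, Expr.sz]) ?_ ?_
    · have b1 := hbit _ (hX k)
      have b2 := hbit _ (hY k)
      push_cast at hw
      simp [Cmd.Leaf, Expr.Leaf, Cmd.exec, Expr.eval, e7, e68, m1, m2, hw, hkL, b1, b2, len_zero,
        hwt]
    · simp only [Cmd.exec, Expr.eval, I]
      refine ⟨by simp [e7], by simp, fun i hi => ?_, fun i hi hki => ?_, fun r hr => ?_,
        fun a ha j => ?_⟩
      · by_cases hik : i = k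
        · subst hik
          simp [e7, e68, m1, m2, hwt]
        · have := hlo i (by omega)
          simp [e7, hik, this]
      · have := hhi i hi (by omega)
        have hne : i ≠ k := by omega
        simp [e7, hne, this]
      · have := hs.1 r hr
        simp; grind
      · have := hs.2 a ha j
        simp; grind
  · refine ⟨by simp, by simp, fun i hi _ => ⟨by simpa using hx i hi, by simpa using hy i hi⟩,
      fun r hr => ?_, fun a ha j => by simp⟩
    simp; grind
  · rw [Finset.sum_const, Finset.card_range, smul_eq_mul]
    nlinarith [Nat.zero_le (2 ^ κ * κ)]
  · rintro τ ⟨-, hlo, -, hs⟩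
    refine ⟨fun i hi => ?_, hs⟩
    obtain ⟨a1, a2, a3, a4⟩ := hlo i hi
    simp [State.cv, gi, a1, a2, a3, a4, mul_comm]

/-- Rounding of the values of the convolution. -/
theorem roundLoop_spec {O : ℕ → ℕ → ℤ} {B κ Q : ℕ} {v : ℕ → ℕ} {E : ℝ} (hκ : 4 ≤ κ)
    (hE : E < 2 ^ (16 * κ + κ - 1)) (hv : ∀ k, v k ≤ 2 ^ κ) {σ : State}
    (hr : FftMulReady B κ Q σ)
    (hx : ∀ k < 2 ^ κ, |(σ.mem (B + 34) ((2 ^ κ - k : ℕ) : ℤ) : ℝ) - 2 ^ (16 * κ + κ) * v k| ≤ E) :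
    Tri O (.for (B + 7) (B + 33) <|
      .put B (.reg (B + 7)) (.shr (.add (.get (B + 34) (.sub (.reg (B + 33)) (.reg (B + 7))))
        (.shl (.const 1) (.sub (.add (.reg (B + 68)) (.reg (B + 32))) (.const 1))))
        (.add (.reg (B + 68)) (.reg (B + 32))))) σ ((2 ^ κ + 1) * (2000 * (20 * κ)))
      fun σ' => (∀ i < 2 ^ κ, σ'.mem B (i : ℕ) = v i) ∧ Same (· ≠ B + 7) (· ≠ B) σ σ' := by
  obtain ⟨-, h32, h33, h68, -⟩ := hr
  have hκL : len ((2 ^ κ : ℕ) : ℤ) ≤ 20 * κ := by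
    have := len_two_pow κ
    push_cast; omega
  have hκ' : len (κ : ℤ) ≤ 20 * κ := (len_natCast_le_self _).trans (by omega)
  have hw : len ((16 * κ : ℕ) : ℤ) ≤ 20 * κ := (len_natCast_le_self _).trans (by omega)
  have hwt : (16 * (κ : ℤ) + κ - 1).toNat = 16 * κ + κ - 1 := by omega
  have hwt' : (16 * (κ : ℤ) + κ).toNat = 16 * κ + κ := by omega
  have hp1 : 16 * κ + κ - 1 + 1 = 16 * κ + κ := by omega
  let I : ℕ → State → Prop := fun k τ => τ.reg (B + 7) = k ∧
    (∀ i < k, τ.mem B (i : ℕ) = v i) ∧ Same (· ≠ B + 7) (· ≠ B) σ τ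
  refine (Tri.for I (2 ^ κ) (fun _ => 4 * 18 ^ 2 * (20 * κ * (1 + 0))) (L := 20 * κ) hκL
    (by omega) ?_ ?_ ?_ ?_).mono ?_ ?_
  · rintro k τ ⟨-, -, hs⟩
    rw [hs.1 _ (by omega), h33]
  · rintro k τ hI; exact hI.1
  · rintro k τ hk ⟨e7, hlo, hs⟩
    have e68 : τ.reg (B + 68) = (16 * κ : ℕ) := by rw [hs.1 _ (by omega), h68]
    have e32 : τ.reg (B + 32) = κ := by rw [hs.1 _ (by omega), h32]
    have e33 : τ.reg (B + 33) = (2 ^ κ : ℕ) := by rw [hs.1 _ (by omega), h33]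
    have hm := hx k hk
    rw [← hs.2 (B + 34) (by omega)] at hm
    have hround := round_eq (p := 16 * κ + κ - 1) (v := v k) (by rwa [hp1]) hE
    rw [hp1] at hround
    have ek : ((2 ^ κ - k : ℕ) : ℤ) = 2 ^ κ - (k : ℤ) := by
      rw [Nat.cast_sub hk.le]; push_cast; rfl
    rw [ek] at hm
    have hlm : len (τ.mem (B + 34) (2 ^ κ - (k : ℤ))) ≤ 20 * κ := by
      rw [len_le_iff]
      have h1 : |(τ.mem (B + 34) (2 ^ κ - (k : ℤ)) : ℝ)| < 2 ^ (20 * κ) := by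
        have hvk : (v k : ℝ) ≤ 2 ^ κ := by exact_mod_cast hv k
        calc _ ≤ |(τ.mem (B + 34) (2 ^ κ - (k : ℤ)) : ℝ) - 2 ^ (16 * κ + κ) * v k| +
              |2 ^ (16 * κ + κ) * (v k : ℝ)| := by
              have := abs_add_le ((τ.mem (B + 34) (2 ^ κ - (k : ℤ)) : ℝ) -
                2 ^ (16 * κ + κ) * v k) (2 ^ (16 * κ + κ) * v k)
              rwa [sub_add_cancel] at this
          _ ≤ E + 2 ^ (16 * κ + κ) * 2 ^ κ := by
              rw [abs_of_nonneg (a := 2 ^ (16 * κ + κ) * (v k : ℝ)) (by positivity)]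
              gcongr
          _ < 2 ^ (18 * κ) + 2 ^ (18 * κ) := by
              have : (2 : ℝ) ^ (16 * κ + κ - 1) ≤ 2 ^ (18 * κ) :=
                pow_le_pow_right₀ (by norm_num) (by omega)
              have e : (2 : ℝ) ^ (16 * κ + κ) * 2 ^ κ = 2 ^ (18 * κ) := by ring
              linarith
          _ = 2 ^ (18 * κ + 1) := by ring
          _ ≤ _ := pow_le_pow_right₀ (by norm_num) (by omega)
      exact_mod_cast h1
    have hkL : len (k : ℤ) ≤ 20 * κ := (len_natCast_mono hk.le).trans hκL
    rw [ek] at hround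
    have h20 : 16 * κ + κ - 1 ≤ 20 * κ := by omega
    refine Tri.line 18 (L := 20 * κ) (ℓ := 0) (by omega) (by simp [Cmd.Straight])
      (by simp [Cmd.sz, Expr.sz]) ?_ ?_
    · push_cast at hw hκL
      simp only [Cmd.Leaf, Expr.Leaf, Expr.eval, e7, e68, e32, e33]
      push_cast
      simp only [hw, hκL, hκ', hkL, hlm, hwt, len_one, h20, true_and, and_true]
      omega
    · simp only [Cmd.exec, Expr.eval, I]
      refine ⟨by simp [e7], by simp, fun i hi => ?_, fun r hr => ?_, fun a ha j => ?_⟩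
      · by_cases hik : i = k
        · subst hik
          simp [e7, e68, e32, e33, hwt, hwt']
          exact hround
        · have := hlo i (by omega)
          simp [e7, hik, this]
      · have := hs.1 r hr
        simp; grind
      · have := hs.2 a ha j
        simp; grind
  · refine ⟨by simp, by simp, fun r hr => ?_, fun a ha j => by simp⟩
    simp; grind
  · rw [Finset.sum_const, Finset.card_range, smul_eq_mul]
    nlinarith [Nat.zero_le (2 ^ κ * κ)]
  · rintro τ ⟨-, hlo, hs⟩
    exact ⟨hlo, hs⟩

theorem sum_bits_eq {x κ : ℕ} (hx : x < 2 ^ 2 ^ κ) :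
    ∑ i ∈ Finset.range (2 ^ κ), x / 2 ^ i % 2 * 2 ^ i = x := by
  have := sum_digits 1 x (2 ^ κ)
  simpa [Nat.mod_eq_of_lt hx] using this

/-- Numbers with at most half as many bits as the transform is long have a convolution without
wrap-around. -/
theorem bit_mul_bit_eq_zero {x y Q R : ℕ} (hx : x < 2 ^ Q) (hy : y < 2 ^ Q) (hR : 2 * Q ≤ R)
    (j s : ℕ) (h : R ≤ j + s) : x / 2 ^ j % 2 * (y / 2 ^ s % 2) = 0 := by
  rcases le_or_gt Q j with hj | hj
  · rw [Nat.div_eq_of_lt (hx.trans_le (Nat.pow_le_pow_right (by norm_num) hj)), Nat.zero_mod,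
      zero_mul]
  · rw [Nat.div_eq_of_lt (hy.trans_le (Nat.pow_le_pow_right (by norm_num) (by omega : Q ≤ s))),
      Nat.zero_mod, mul_zero]

/-- There are `O(2 ^ κ κ)` complex products of numbers of `O(κ)` bits; the built-in multiplication is
charged `O(κ ^ 2)` for each of them. -/
theorem fftMulC_spec {O : ℕ → ℕ → ℤ} {B κ Q : ℕ} (hκ : 4 ≤ κ) (hQ : 2 * (Q + 2) ≤ 2 ^ κ) :
    RMul O B (fftMulC B) (FftMulReady B κ Q) Q (30000000 * (2 ^ κ * κ ^ 3)) where
  stable σ σ' h hs := h.of_same ⟨fun r hr => hs.1 r (by omega), fun a ha => hs.2 a (by omega)⟩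
  run σ h hx hy := by
    obtain ⟨x, ex, xl⟩ := add_two_pow_eq_natCast hx
    obtain ⟨y, ey, yl⟩ := add_two_pow_eq_natCast hy
    have hpow : 2 ^ (Q + 2) ≤ 2 ^ 2 ^ κ := Nat.pow_le_pow_right (by norm_num) (by omega)
    have hQL : len (Q : ℤ) ≤ 2 ^ κ := (len_natCast_le_self Q).trans (by omega)
    have lx := len_le_of_abs_le (L := 2 ^ κ) hx (by omega)
    have ly := len_le_of_abs_le (L := 2 ^ κ) hy (by omega)
    have hR1 : 1 ≤ 2 ^ κ := Nat.one_le_two_pow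
    obtain ⟨hb1, hb2, hb3⟩ := fftMul_bounds hκ
    set X : ℕ → ℕ := fun i => x / 2 ^ i % 2 with hXdef
    set Y : ℕ → ℕ := fun i => y / 2 ^ i % 2 with hYdef
    have hX1 : ∀ i, X i ≤ 1 := fun i => by simp only [X]; omega
    have hY1 : ∀ i, Y i ≤ 1 := fun i => by simp only [Y]; omega
    have hXY : ∀ j s, 2 ^ κ ≤ j + s → X j * Y s = 0 := bit_mul_bit_eq_zero xl yl hQ
    set E : ℝ := 16 * 16 ^ κ * (2 ^ κ * (66 * (16 * κ : ℕ))) * (1 : ℝ) ^ 2 with hEdef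
    refine Tri.mono (T := 4 * 12 ^ 2 * (2 ^ κ * (1 + 0)) + (2 ^ κ * (κ + 1) * (6000 * (κ + 4)) +
      (2 ^ κ * (κ + 1) * (6000 * (κ + 4)) + ((2 ^ κ + 1) * (2000 * (16 * κ)) +
      (4 * ((κ + 1) * (2 ^ κ + 1) * ((4 * (64 * ((32 * κ + 1) * (32 * κ + 2))) + 1500 * (65 * κ)) +
        17000 * (65 * κ))) + (4 * 4 ^ 2 * (20 * κ * (1 + 0)) + ((2 ^ κ + 1) * (2000 * (20 * κ)) +
      (2 ^ κ * (κ + 1) * (6000 * (κ + 4)) + 4 * 20 ^ 2 * (2 ^ κ * (1 + 0))))))))))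
      ?_ ?_ fun _ h => h
    · -- pass to natural numbers
      refine (Tri.line 12 (L := 2 ^ κ) (ℓ := 0) (Q := fun τ => τ.reg (B + 5) = x ∧
        τ.reg (B + 6) = y ∧ Same (fun r => r ≠ B + 5 ∧ r ≠ B + 6) (fun _ => True) σ τ)
        hR1 (by simp [offsetC, Cmd.Straight]) (by simp [offsetC, Cmd.sz, Expr.sz]) ?_ ?_).seq
        fun σ₁ hσ₁ => ?_
      · simp [offsetC, Cmd.Leaf, Expr.Leaf, Cmd.exec, Expr.eval, h.1, len_one, *]
        omega
      · simp only [offsetC, Cmd.exec, Expr.eval]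
        refine ⟨by simp [h.1, ← ex], by simp [h.1, ← ey], fun r hr => ?_, fun a ha j => by simp⟩
        simp; grind
      obtain ⟨x1, y1, s1⟩ := hσ₁
      have h1 := h.of_same (s1.mono (by omega) (fun _ _ => trivial))
      refine (splitC_spec (by omega) h1.2.1 h1.2.2.1 x1 (xl.trans_le hpow)).seq fun σ₂ hσ₂ => ?_
      obtain ⟨x2, s2⟩ := hσ₂
      have h2 := h1.of_same (s2.mono (by omega) (by omega))
      refine (splitC_spec (x := y) (by omega) h2.2.1 h2.2.2.1 ?_ (yl.trans_le hpow)).seq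
        fun σ₃ hσ₃ => ?_
      · rw [s2.1 _ (by omega), y1]
      obtain ⟨y3, s3⟩ := hσ₃
      have h3 := h2.of_same (s3.mono (by omega) (by omega))
      refine (scaleLoop_spec hX1 hY1 hκ h3 (fun i hi => ?_) y3).seq fun σ₄ hσ₄ => ?_
      · rw [s3.2 _ (by omega)]; exact x2 i hi
      obtain ⟨v4, s4⟩ := hσ₄
      have h4 := h3.of_same (s4.mono (by omega) (by omega))
      have hprec : len ((16 * κ : ℕ) : ℤ) ≤ 65 * κ := (len_natCast_le_self _).trans (by omega)
      have hcm := complexMul_spec (c := B + 64) (q := 16 * κ) (L := 65 * κ)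
        (builtinMul_spec O (B + 72) (32 * κ)) hprec (by omega)
      refine (convC_spec (b := B + 32) (r := κ) hcm (by omega) (by omega)
        (Complex.isPrimitiveRoot_exp (2 ^ κ) (by positivity)) (x := fun i => (X i : ℂ))
        (y := fun i => (Y i : ℂ)) (B := 1) (ε := 2 ^ κ * (66 * (16 * κ : ℕ))) le_rfl ?_ ?_ ?_ hb2
        (by omega) ⟨trivial, h4.2.2.2.1⟩ h4.2.1 h4.2.2.1 h4.2.2.2.2 (fun i hi => ?_)
        (fun i hi => ?_)).seq fun σ₅ hσ₅ => ?_
      · have h1 : (1 : ℝ) ≤ 2 ^ κ := one_le_pow₀ (by norm_num)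
        have h2 : (4 : ℝ) ≤ κ := by exact_mod_cast hκ
        push_cast; nlinarith
      · intro i
        rw [Complex.norm_natCast]; exact_mod_cast hX1 i
      · intro i
        rw [Complex.norm_natCast]; exact_mod_cast hY1 i
      · rw [show B + 32 + 2 = B + 34 by omega, (v4 i hi).1, sub_self, norm_zero]; positivity
      · rw [show B + 32 + 4 = B + 36 by omega, (v4 i hi).2, sub_self, norm_zero]; positivity
      obtain ⟨⟨-, p5⟩, v5, s5⟩ := hσ₅
      have h5 : FftMulReady B κ Q σ₅ := by
        refine ⟨?_, ?_, ?_, p5, fun i hi => ?_⟩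
        · rw [s5.1 _ (by omega), h4.1]
        · rw [s5.1 _ (by omega), h4.2.1]
        · rw [s5.1 _ (by omega), h4.2.2.1]
        · rw [s5.cv (by omega) (by omega)]
          exact h4.2.2.2.2 i hi
      have hval : ∀ k < 2 ^ κ, |(σ₅.mem (B + 34) ((2 ^ κ - k) % 2 ^ κ : ℕ) : ℝ) -
          2 ^ (16 * κ + κ) * digitConv X Y (2 ^ κ) k| ≤ E := by
        intro k hk
        have := v5 ((2 ^ κ - k) % 2 ^ κ) (Nat.mod_lt _ (by positivity))
        rw [cyclic_eq_digitConv hXY hk] at this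
        refine le_trans (le_of_eq ?_) ((Complex.abs_re_le_norm _).trans this)
        congr 1
        rw [← mul_assoc, ← pow_add, show ((2 : ℂ) ^ (16 * κ + κ) * (digitConv X Y (2 ^ κ) k : ℂ)) =
          ((2 ^ (16 * κ + κ) * digitConv X Y (2 ^ κ) k : ℝ) : ℂ) by push_cast; rfl]
        rw [Complex.sub_re, Complex.ofReal_re]
        simp [State.cv, gi, add_assoc]
      have hl0 : len (σ₅.mem (B + 34) 0) ≤ 20 * κ := by
        have h0 := hval 0 (by positivity)
        rw [Nat.sub_zero, Nat.mod_self] at h0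
        rw [len_le_iff]
        have hvk : (digitConv X Y (2 ^ κ) 0 : ℝ) ≤ 2 ^ κ := by
          exact_mod_cast digitConv_le hX1 hY1 _ 0
        have h1 : |(σ₅.mem (B + 34) 0 : ℝ)| < 2 ^ (20 * κ) := by
          calc _ ≤ |(σ₅.mem (B + 34) 0 : ℝ) - 2 ^ (16 * κ + κ) * digitConv X Y (2 ^ κ) 0| +
                |2 ^ (16 * κ + κ) * (digitConv X Y (2 ^ κ) 0 : ℝ)| := by
                have := abs_add_le ((σ₅.mem (B + 34) 0 : ℝ) -
                  2 ^ (16 * κ + κ) * digitConv X Y (2 ^ κ) 0)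
                  (2 ^ (16 * κ + κ) * digitConv X Y (2 ^ κ) 0)
                rwa [sub_add_cancel] at this
            _ ≤ E + 2 ^ (16 * κ + κ) * 2 ^ κ := by
                rw [abs_of_nonneg (a := 2 ^ (16 * κ + κ) * (digitConv X Y (2 ^ κ) 0 : ℝ))
                  (by positivity)]
                gcongr
                exact h0
            _ < 2 ^ (18 * κ) + 2 ^ (18 * κ) := by
                have : (2 : ℝ) ^ (16 * κ + κ - 1) ≤ 2 ^ (18 * κ) :=
                  pow_le_pow_right₀ (by norm_num) (by omega)
                have e : (2 : ℝ) ^ (16 * κ + κ) * 2 ^ κ = 2 ^ (18 * κ) := by ring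
                linarith
            _ = 2 ^ (18 * κ + 1) := by ring
            _ ≤ _ := pow_le_pow_right₀ (by norm_num) (by omega)
        exact_mod_cast h1
      have hκL : len ((2 ^ κ : ℕ) : ℤ) ≤ 20 * κ := by
        have := len_two_pow κ
        push_cast; omega
      -- the entry number `0` is needed at index `2 ^ κ` as well
      refine (Tri.line 4 (L := 20 * κ) (ℓ := 0)
        (Q := fun τ => τ = σ₅.setM (B + 34) (2 ^ κ : ℕ) (σ₅.mem (B + 34) 0))
        (by omega) (by simp [Cmd.Straight]) (by simp [Cmd.sz, Expr.sz]) ?_ ?_).seq fun σ₆ hσ₆ => ?_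
      · simp only [Cmd.Leaf, Expr.Leaf, Expr.eval, h5.2.2.1, len_zero, hl0, hκL, Nat.zero_le,
          and_true]
      · simp only [Cmd.exec, Expr.eval, h5.2.2.1]
      have s6 : Same (fun _ => True) (· ≠ B + 34) σ₅ σ₆ := by
        subst hσ₆
        exact ⟨fun r hr => by simp, fun a ha j => by simp; grind⟩
      have h6 := h5.of_same (s6.mono (fun _ _ => trivial) (by omega))
      refine (roundLoop_spec hκ hb1 (digitConv_le hX1 hY1 (2 ^ κ)) h6 (fun k hk => ?_)).seq
        fun σ₇ hσ₇ => ?_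
      · have hv := hval k hk
        subst hσ₆
        rcases Nat.eq_zero_or_pos k with rfl | hk0
        · rw [Nat.sub_zero, Nat.mod_self] at hv
          simpa using hv
        · rw [Nat.mod_eq_of_lt (by omega)] at hv
          rw [State.setM_mem, if_neg (by omega)]
          exact hv
      obtain ⟨v7, s7⟩ := hσ₇
      have h7 := h6.of_same (s7.mono (by omega) (by omega))
      refine (combineC_spec (digitConv_le hX1 hY1 (2 ^ κ)) (by omega) h7.2.1 h7.2.2.1 v7).seq
        fun σ₈ hσ₈ => ?_
      obtain ⟨v8, s8⟩ := hσ₈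
      have h8 := h7.of_same (s8.mono (by omega) (by omega))
      have hprod : σ₈.mem B 0 = (x : ℤ) * y := by
        have := sum_digitConv hXY
        rw [sum_bits_eq (xl.trans_le hpow), sum_bits_eq (yl.trans_le hpow)] at this
        rw [v8]
        exact_mod_cast this
      have s58 : Same (fun r => r ≠ B + 7 ∧ (r < B + 7 ∨ B + 12 ≤ r)) (fun a => a < B) σ₅ σ₈ :=
        (s6.mono (by simp) (by omega)).trans ((s7.mono (by omega) (by omega)).trans
          (s8.mono (by omega) (by omega)))
      have s14 : Same (fun r => r ≠ B + 7 ∧ (r < B + 7 ∨ B + 13 ≤ r)) (fun a => a < B) σ₁ σ₄ :=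
        (s2.mono (by omega) (by omega)).trans ((s3.mono (by omega) (by omega)).trans
          (s4.mono (by omega) (by omega)))
      have s18 : Same (fun r => r < B + 7) (fun a => a < B) σ₁ σ₈ :=
        (s14.mono (by omega) (by omega)).trans ((s5.mono (by omega) (by omega)).trans
          (s58.mono (by omega) (by omega)))
      have x8 : σ₈.reg (B + 5) = x := by rw [s18.1 _ (by omega), x1]
      have y8 : σ₈.reg (B + 6) = y := by rw [s18.1 _ (by omega), y1]
      have hxL : len (x : ℤ) ≤ Q + 2 := len_natCast_le.2 xl
      have hyL : len (y : ℤ) ≤ Q + 2 := len_natCast_le.2 yl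
      have hxyL := len_mul_le (x : ℤ) y
      have eQ : ((Q : ℤ) + Q).toNat = 2 * Q := by omega
      have heval : (Expr.unoffset B (.get B (.const 0))).eval O σ₈ =
          σ.reg B * σ.reg (B + 1) := by
        simp only [Expr.unoffset, Expr.eval, hprod, x8, y8, h8.1, eQ, Int.toNat_natCast]
        rw [← ex, ← ey, two_mul, pow_add]; ring
      refine Tri.line 20 (L := 2 ^ κ) (ℓ := 0) hR1 (by simp [Cmd.Straight])
        (by simp [Expr.unoffset, Cmd.sz, Expr.sz]) ?_ ?_
      · simp only [Cmd.Leaf, Expr.Leaf, Expr.unoffset, Expr.eval, hprod, x8, y8, h8.1, eQ,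
          Int.toNat_natCast, len_zero, len_one]
        omega
      · simp only [Cmd.exec, heval]
        refine ⟨h8.of_same ⟨fun r hr => ?_, fun a ha j => by simp⟩, by simp, fun r hr => ?_,
          fun a ha j => ?_⟩
        · simp; omega
        · rw [State.setR_reg, if_neg (by omega), s18.1 _ (by omega), s1.1 _ (by omega)]
        · rw [State.setR_mem, s18.2 _ ha, s1.2 _ trivial]
    · have hone : 2 ^ κ + 1 ≤ 2 * 2 ^ κ := by omega
      generalize 2 ^ κ = R at *
      have k1 : κ + 1 ≤ 2 * κ := by omega
      have k4 : κ + 4 ≤ 2 * κ := by omega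
      have k32 : (32 * κ + 1) * (32 * κ + 2) ≤ 33 * κ * (33 * κ) :=
        Nat.mul_le_mul (by omega) (by omega)
      have c2 : κ * 16 ≤ κ * κ ^ 2 := Nat.mul_le_mul_left κ (by nlinarith)
      have c1 : 4 * κ ^ 2 ≤ κ * κ ^ 2 := Nat.mul_le_mul_right _ hκ
      have e3 : κ * κ ^ 2 = κ ^ 3 := by ring
      rw [e3] at c1 c2
      have r0 : 64 * R ≤ R * κ ^ 3 := by
        rw [mul_comm]; exact Nat.mul_le_mul_left R (by omega)
      have r1 : R * κ * 16 ≤ R * κ ^ 3 := by rw [mul_assoc]; exact Nat.mul_le_mul_left R c2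
      have r2 : 4 * (R * κ ^ 2) ≤ R * κ ^ 3 := by
        rw [mul_left_comm]; exact Nat.mul_le_mul_left R c1
      have a1 : R * (κ + 1) * (6000 * (κ + 4)) ≤ 24000 * (R * κ ^ 2) := by
        calc _ ≤ R * (2 * κ) * (6000 * (2 * κ)) := by gcongr
          _ = _ := by ring
      have a2 : (κ + 1) * (R + 1) * ((4 * (64 * ((32 * κ + 1) * (32 * κ + 2))) +
          1500 * (65 * κ)) + 17000 * (65 * κ)) ≤
          2 * κ * (2 * R) * (4 * (64 * (33 * κ * (33 * κ))) + 18500 * (65 * κ)) := by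
        have : 1500 * (65 * κ) + 17000 * (65 * κ) = 18500 * (65 * κ) := by ring
        rw [add_assoc, this]
        gcongr
      have a3 : 2 * κ * (2 * R) * (4 * (64 * (33 * κ * (33 * κ))) + 18500 * (65 * κ)) =
        1115136 * (R * κ ^ 3) + 4810000 * (R * κ ^ 2) := by ring
      have a4 : (R + 1) * κ ≤ 2 * (R * κ) := by
        calc _ ≤ 2 * R * κ := by gcongr
          _ = _ := by ring
      have a5 : κ ≤ R * κ := Nat.le_mul_of_pos_left _ hR1
      linarith

/-- Preparations for `fftMulC`, for factors bounded by `2 ^ Q`, where register `B + 4` holds `Q`. -/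
def fftPrepC (B : ℕ) : Cmd :=
  .seq (.seq (.assign (B + 32) (.const 4)) (.assign (B + 33) (.const 16))) <|
  .seq (.loop (.sub (.add (.add (.reg (B + 4)) (.reg (B + 4))) (.const 4)) (.reg (B + 33))) <|
    .seq (.assign (B + 33) (.add (.reg (B + 33)) (.reg (B + 33))))
      (.assign (B + 32) (.add (.reg (B + 32)) (.const 1)))) <|
  .seq (.assign (B + 68) (.mul (.const 16) (.reg (B + 32))))
    (setupC (B + 32) (complexMul (B + 64) (builtinMul (B + 72))))

theorem fftPrepC_spec {O : ℕ → ℕ → ℤ} {B Q κ : ℕ} (hQ : 6 ≤ Q) (hκ : κ = Nat.clog 2 (2 * Q + 4))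
    {σ : State} (h4 : σ.reg (B + 4) = Q) :
    Tri O (fftPrepC B) σ (1000000000 * (2 ^ κ * κ ^ 3)) fun σ' =>
      FftMulReady B κ Q σ' ∧ Same (· < B) (· < B) σ σ' := by
  have hκ4 : 4 ≤ κ := by
    by_contra h
    have h1 : 2 * Q + 4 ≤ 2 ^ κ := by rw [hκ]; exact Nat.le_pow_clog (by norm_num) _
    have h2 : 2 ^ κ ≤ 2 ^ 3 := Nat.pow_le_pow_right (by norm_num) (by omega)
    omega
  have hup : 2 * Q + 4 ≤ 2 ^ κ := by rw [hκ]; exact Nat.le_pow_clog (by norm_num) _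
  have hpow : ∀ k, 2 ^ k < 2 * Q + 4 ↔ k < κ := fun k => by
    rw [hκ, Nat.lt_clog_iff_pow_lt (by norm_num)]
  have hone : 1 ≤ 2 ^ κ := Nat.one_le_two_pow
  have hlenR : ∀ k : ℕ, k ≤ 2 ^ κ → len (k : ℤ) ≤ κ + 1 := fun k hk =>
    len_natCast_le.2 (by rw [pow_succ]; omega)
  have l4 : len 4 ≤ κ + 1 := (by decide : len 4 = 3).le.trans (by omega)
  have l16 : len 16 ≤ κ + 1 := (by decide : len 16 = 5).le.trans (by omega)
  have lQ := hlenR Q (by omega)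
  let I : ℕ → State → Prop := fun k τ => τ.reg (B + 32) = (4 + k : ℕ) ∧
    τ.reg (B + 33) = (2 ^ (4 + k) : ℕ) ∧ Same (fun r => r ≠ B + 32 ∧ r ≠ B + 33) (fun _ => True) σ τ
  refine Tri.mono (T := 4 * 4 ^ 2 * ((κ + 1) * (1 + 0)) +
    ((∑ _k ∈ Finset.range (κ - 4), 4 * 8 ^ 2 * ((κ + 1) * (1 + 0)) +
      (κ - 4 + 1) * (4 * 7 ^ 2 * ((κ + 1) * (1 + 0)) + 1)) +
      (4 * 4 ^ 2 * ((κ + 1) * (1 + 5)) + ((16 * κ + 1) *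
        ((4 * (64 * ((32 * κ + 1) * (32 * κ + 2))) + 1500 * (65 * κ)) +
          10000 * (65 * κ * (1 + 33 * κ))) + (2 ^ κ + 1) *
        ((4 * (64 * ((32 * κ + 1) * (32 * κ + 2))) + 1500 * (65 * κ)) + 2300 * (65 * κ))))))
    ?_ ?_ fun _ h => h
  · refine (Tri.line 4 (L := κ + 1) (ℓ := 0) (Q := I 0) (by omega) (by simp [Cmd.Straight])
      (by simp [Cmd.sz, Expr.sz]) ?_ ?_).seq fun σ₁ h₁ => ?_
    · simp [Cmd.Leaf, Expr.Leaf, l4, l16]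
    · simp only [Cmd.exec, Expr.eval, I]
      refine ⟨by simp, by simp, fun r hr => ?_, fun a ha j => by simp⟩
      simp; grind
    refine (Tri.loop I (κ - 4) (fun _ => 4 * 8 ^ 2 * ((κ + 1) * (1 + 0)))
      (4 * 7 ^ 2 * ((κ + 1) * (1 + 0)) + 1) ?_ ?_ h₁).seq fun σ₂ h₂ => ?_
    · rintro k τ hk ⟨e32, e33, hs⟩
      have e4 : τ.reg (B + 4) = Q := by rw [hs.1 _ (by omega), h4]
      have lk := hlenR (2 ^ (4 + k)) (Nat.pow_le_pow_right (by norm_num) (by omega))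
      refine ⟨?_, Nat.succ_le_succ ?_⟩
      · have := hpow (4 + k)
        simp only [Expr.eval, e4, e33]
        have e : (0 : ℤ) < Q + Q + 4 - (2 ^ (4 + k) : ℕ) ↔ 2 ^ (4 + k) < 2 * Q + 4 := by omega
        rw [e, this]; omega
      · refine Expr.cost_le (by omega) _ ?_
        simp only [Expr.Leaf, e4, e33, lQ, l4, lk, and_self]
    · rintro k τ hk ⟨e32, e33, hs⟩
      have lk := hlenR (2 ^ (4 + k)) (Nat.pow_le_pow_right (by norm_num) (by omega))
      have lk' : len ((4 + k : ℕ) : ℤ) ≤ κ + 1 := (len_natCast_le_self _).trans (by omega)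
      refine Tri.line 8 (L := κ + 1) (ℓ := 0) (by omega) (by simp [Cmd.Straight])
        (by simp [Cmd.sz, Expr.sz]) ?_ ?_
      · push_cast at lk lk'
        simp [Cmd.Leaf, Expr.Leaf, Cmd.exec, e33, e32, len_one, lk, lk']
      · simp only [Cmd.exec, Expr.eval, I]
        refine ⟨by simp [e32]; ring, by simp [e33]; ring, fun r hr => ?_, fun a ha j => ?_⟩
        · have := hs.1 r hr
          simp; grind
        · simpa using hs.2 a ha j
    obtain ⟨e32, e33, s2⟩ := h₂
    rw [show 4 + (κ - 4) = κ by omega] at e32 e33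
    have lκ : len (κ : ℤ) ≤ κ + 1 := (len_natCast_le_self κ).trans (by omega)
    refine (Tri.line 4 (L := κ + 1) (ℓ := 5) (Q := fun τ => τ.reg (B + 68) = (16 * κ : ℕ) ∧
      Same (fun r => r ≠ B + 68) (fun _ => True) σ₂ τ) (by omega) (by simp [Cmd.Straight])
      (by simp [Cmd.sz, Expr.sz]) ?_ ?_).seq fun σ₃ h₃ => ?_
    · have : len 16 ≤ 5 := by decide
      simp [Cmd.Leaf, Expr.Leaf, Expr.eval, l16, e32, lκ, this]
    · simp only [Cmd.exec, Expr.eval]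
      refine ⟨by simp [e32], fun r hr => ?_, fun a ha j => by simp⟩
      simp; grind
    obtain ⟨e68, s3⟩ := h₃
    have hprec : len ((16 * κ : ℕ) : ℤ) ≤ 65 * κ := (len_natCast_le_self _).trans (by omega)
    have hcm := complexMul_spec (c := B + 64) (q := 16 * κ) (L := 65 * κ)
      (builtinMul_spec O (B + 72) (32 * κ)) hprec (by omega)
    refine (setupC_spec (b := B + 32) (L := 65 * κ) (ℓ := 33 * κ) (r := κ) hcm (by omega) (by omega)
      (by omega) (by omega) hκ4 (by omega) ((len_natCast_le_self _).trans (by omega)) (by omega)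
      (fftMul_bounds hκ4).2.2 ⟨trivial, e68⟩ ?_ ?_).mono le_rfl ?_
    · rw [s3.1 _ (by omega), e32]
    · rw [s3.1 _ (by omega), e33]
    rintro σ₄ ⟨⟨-, p4⟩, -, v4, s4⟩
    refine ⟨⟨?_, ?_, ?_, p4, v4⟩, fun r hr => ?_, fun a ha j => ?_⟩
    · rw [s4.1 _ (by omega), s3.1 _ (by omega), s2.1 _ (by omega), h4]
    · rw [s4.1 _ (by omega), s3.1 _ (by omega), e32]
    · rw [s4.1 _ (by omega), s3.1 _ (by omega), e33]
    · rw [s4.1 _ (by omega), s3.1 _ (by omega), s2.1 _ (by omega)]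
    · rw [s4.2 _ (by omega), s3.2 _ trivial, s2.2 _ trivial]
  · rw [Finset.sum_const, Finset.card_range, smul_eq_mul]
    generalize 2 ^ κ = R at *
    have k32 : (32 * κ + 1) * (32 * κ + 2) ≤ 33 * κ * (33 * κ) :=
      Nat.mul_le_mul (by omega) (by omega)
    have a1 : (κ - 4) * (4 * 8 ^ 2 * ((κ + 1) * (1 + 0))) ≤ κ * (4 * 8 ^ 2 * ((κ + κ) * (1 + 0))) := by
      gcongr <;> omega
    have a2 : (κ - 4 + 1) * (4 * 7 ^ 2 * ((κ + 1) * (1 + 0)) + 1) ≤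
        κ * (4 * 7 ^ 2 * ((κ + κ) * (1 + 0)) + κ) := by
      gcongr <;> omega
    have a3 : (16 * κ + 1) * ((4 * (64 * ((32 * κ + 1) * (32 * κ + 2))) + 1500 * (65 * κ)) +
        10000 * (65 * κ * (1 + 33 * κ))) ≤ (17 * κ) * ((4 * (64 * (33 * κ * (33 * κ))) +
          1500 * (65 * κ)) + 10000 * (65 * κ * (34 * κ))) := by
      gcongr <;> omega
    have a4 : (R + 1) * ((4 * (64 * ((32 * κ + 1) * (32 * κ + 2))) + 1500 * (65 * κ)) +
        2300 * (65 * κ)) ≤ (2 * R) * ((4 * (64 * (33 * κ * (33 * κ))) + 1500 * (65 * κ)) +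
          2300 * (65 * κ)) := by
      gcongr
      omega
    have c1 : κ ≤ κ ^ 2 := by nlinarith
    have c2 : κ ^ 2 ≤ κ ^ 3 := by rw [pow_succ]; nlinarith
    have c3 : κ ^ 3 ≤ R * κ ^ 3 := Nat.le_mul_of_pos_left _ hone
    have r1 : R * κ ≤ R * κ ^ 3 := by gcongr; omega
    have r2 : R * κ ^ 2 ≤ R * κ ^ 3 := by gcongr
    refine (Nat.add_le_add_left (Nat.add_le_add (Nat.add_le_add a1 a2)
      (Nat.add_le_add_left (Nat.add_le_add a3 a4) _)) _).trans ?_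
    ring_nf
    ring_nf at c1 c2 c3 r1 r2
    omega

/-! ### Reduction of the evaluation problem to a convolution -/

/-- The sum of the terms of a sequence with indices below `D` in a residue class. -/
noncomputable def foldSum (f : ℕ → ℂ) (ν D j : ℕ) : ℂ :=
  ∑ k ∈ Finset.range D, if k % ν = j then f k else 0

theorem norm_foldSum_le {f : ℕ → ℂ} (hf : ∀ k, ‖f k‖ ≤ 1) (ν D j : ℕ) : ‖foldSum f ν D j‖ ≤ D := by
  have := norm_sum_le_of_le (f := fun k => if k % ν = j then f k else 0) (n := fun _ => 1)
    (Finset.range D) fun k _ => by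
      split_ifs
      · exact hf k
      · simp
  simpa [foldSum] using this

/-- At a root of unity of order dividing `ν`, exponents matter modulo `ν` only. -/
theorem sum_foldSum {f : ℕ → ℂ} {ν : ℕ} (hν : 0 < ν) (D : ℕ) {w : ℂ} (hw : w ^ ν = 1) :
    ∑ j ∈ Finset.range ν, foldSum f ν D j * w ^ j = ∑ k ∈ Finset.range D, f k * w ^ k := by
  unfold foldSum
  simp_rw [Finset.sum_mul]
  rw [Finset.sum_comm]
  refine Finset.sum_congr rfl fun k _ => ?_
  simp_rw [ite_mul, zero_mul]
  rw [Finset.sum_ite_eq, if_pos (Finset.mem_range.2 (Nat.mod_lt k hν)),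
    pow_eq_pow_mod k hw]

/-- The sequence `conj η ^ (t ^ 2)`, `|t| < ν`, with indices modulo `R`. -/
noncomputable def chirp (η : ℂ) (ν R t : ℕ) : ℂ :=
  if t < ν then (starRingEnd ℂ) (η ^ t ^ 2)
  else if R < t + ν then (starRingEnd ℂ) (η ^ (R - t) ^ 2) else 0

theorem norm_chirp_le {η : ℂ} (hη : ‖η‖ = 1) (ν R t : ℕ) : ‖chirp η ν R t‖ ≤ 1 := by
  unfold chirp
  split_ifs <;> simp [hη]

theorem pow_mul_conj_pow {η : ℂ} (hη : ‖η‖ = 1) (k : ℕ) : η ^ k * (starRingEnd ℂ) (η ^ k) = 1 := by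
  rw [Complex.mul_conj, Complex.normSq_eq_norm_sq, norm_pow, hη]; simp

/-- Bluestein's identity `2 j K = j ^ 2 + K ^ 2 - (K - j) ^ 2` turns a discrete Fourier transform
into a convolution. -/
theorem bluestein {η : ℂ} (hη : ‖η‖ = 1) {ν R K : ℕ} (hR : 2 * ν ≤ R) (hK : K < ν) (c : ℕ → ℂ) :
    η ^ K ^ 2 * ∑ j ∈ Finset.range R, ∑ s ∈ Finset.range R,
      (if R ∣ j + s + (R - K) % R then
        (if j < ν then c j * η ^ j ^ 2 else 0) * chirp η ν R s else 0) =
      ∑ j ∈ Finset.range ν, c j * (η ^ (2 * K)) ^ j := by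
  have hinner : ∀ j ∈ Finset.range R, (∑ s ∈ Finset.range R,
      if R ∣ j + s + (R - K) % R then
        (if j < ν then c j * η ^ j ^ 2 else 0) * chirp η ν R s else 0) =
      if j < ν then c j * η ^ j ^ 2 * (starRingEnd ℂ) (η ^ (K - j + (j - K)) ^ 2) else 0 := by
    intro j _
    by_cases hj : j < ν
    · simp only [hj, if_true]
      have hs : ∀ s ∈ Finset.range R, (R ∣ j + s + (R - K) % R ↔
          s = if j ≤ K then K - j else R + K - j) := by
        intro s hs
        rw [Finset.mem_range] at hs
        rw [Nat.dvd_iff_mod_eq_zero, Nat.add_mod_mod, ← Nat.dvd_iff_mod_eq_zero]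
        constructor
        · rintro ⟨e, he⟩
          have h1 : e < 3 := by
            by_contra h
            have := Nat.mul_le_mul_left R (by omega : 3 ≤ e)
            omega
          have h0 : e ≠ 0 := by rintro rfl; omega
          rcases (by omega : e = 1 ∨ e = 2) with rfl | rfl <;> split_ifs <;> omega
        · intro h
          split_ifs at h
          · exact ⟨1, by omega⟩
          · exact ⟨2, by omega⟩
      rw [Finset.sum_congr rfl fun s hs' => if_congr (hs s hs') rfl rfl, Finset.sum_ite_eq',
        if_pos (Finset.mem_range.2 (by split_ifs <;> omega))]
      congr 1
      unfold chirp
      split_ifs with h1 h2 h3 h4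
      · rw [Nat.sub_eq_zero_of_le h1, add_zero]
      · omega
      · omega
      · omega
      · congr 3; omega
      · omega
    · simp [hj]
  rw [Finset.sum_congr rfl hinner, Finset.mul_sum, ← Finset.sum_subset
    (Finset.range_subset_range.2 (by omega : ν ≤ R)) fun j _ hj => by
      rw [if_neg (by simpa using hj), mul_zero]]
  refine Finset.sum_congr rfl fun j hj => ?_
  rw [if_pos (Finset.mem_range.1 hj)]
  have e : K ^ 2 + j ^ 2 = (K - j + (j - K)) ^ 2 + 2 * K * j := by
    rcases le_total j K with h | h
    · obtain ⟨d, rfl⟩ := Nat.exists_eq_add_of_le h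
      rw [show j - (j + d) = 0 by omega, show j + d - j = d by omega]; ring
    · obtain ⟨d, rfl⟩ := Nat.exists_eq_add_of_le h
      rw [show K - (K + d) = 0 by omega, show K + d - K = d by omega]; ring
  calc _ = c j * (η ^ (K ^ 2 + j ^ 2) * (starRingEnd ℂ) (η ^ (K - j + (j - K)) ^ 2)) := by
        rw [pow_add]; ring
    _ = c j * (η ^ (2 * K * j) * (η ^ (K - j + (j - K)) ^ 2 *
          (starRingEnd ℂ) (η ^ (K - j + (j - K)) ^ 2))) := by rw [e, pow_add]; ring
    _ = _ := by rw [pow_mul_conj_pow hη, mul_one, pow_mul]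

/-! ### Truncation -/

/-- The terms of degree at least `D` of a polynomial contribute little at a point inside the unit
disc. -/
theorem norm_eval_sub_sum_le (p : Polynomial ℂ) {y : ℂ} (hy : ‖y‖ ≤ 1) (D : ℕ) :
    ‖p.eval y - ∑ k ∈ Finset.range D, p.coeff k * y ^ k‖ ≤ coeffNorm p * ‖y‖ ^ D := by
  have h1 : p.eval y = ∑ k ∈ Finset.range (D + p.natDegree + 1), p.coeff k * y ^ k :=
    Polynomial.eval_eq_sum_range' (by omega) y
  have h2 : coeffNorm p = ∑ k ∈ Finset.range (D + p.natDegree + 1), ‖p.coeff k‖ :=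
    p.sum_over_range' (fun _ => norm_zero) _ (by omega)
  rw [h1, h2]
  simp only [Finset.range_eq_Ico]
  rw [← Finset.sum_Ico_consecutive _ (Nat.zero_le D) (by omega),
    add_sub_cancel_left, Finset.sum_mul]
  refine (norm_sum_le _ _).trans ?_
  calc _ ≤ ∑ k ∈ Finset.Ico D (D + p.natDegree + 1), ‖p.coeff k‖ * ‖y‖ ^ D := by
        refine Finset.sum_le_sum fun k hk => ?_
        rw [norm_mul, norm_pow]
        exact mul_le_mul_of_nonneg_left (pow_le_pow_of_le_one (norm_nonneg _) hy
          (Finset.mem_Ico.1 hk).1) (norm_nonneg _)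
    _ ≤ _ := Finset.sum_le_sum_of_subset_of_nonneg
        (fun k hk => by simp at hk ⊢; omega) fun _ _ _ => by positivity

/-- The reason is `(1 - 1 / 2 ^ n) ^ (2 ^ n) ≤ exp (-1) < 1 / 2`. -/
theorem pow_terms_lt {n : ℕ} {x : ℝ} (h0 : 0 ≤ x) (hx : x ≤ 1 - 1 / 2 ^ n) (m : ℕ) :
    x ^ (2 ^ n * (m + 2)) < 1 / 2 ^ (m + 2) := by
  have hn : (0 : ℝ) < 2 ^ n := by positivity
  have h1 : x ≤ Real.exp (-(1 / 2 ^ n)) := by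
    have := Real.add_one_le_exp (-(1 / (2 : ℝ) ^ n))
    linarith
  calc x ^ (2 ^ n * (m + 2)) ≤ Real.exp (-(1 / 2 ^ n)) ^ (2 ^ n * (m + 2)) := by gcongr
    _ = Real.exp (-1) ^ (m + 2) := by
        rw [pow_mul, ← Real.exp_nat_mul]
        congr 2
        push_cast
        field_simp
    _ < (1 / 2) ^ (m + 2) := by
        refine pow_lt_pow_left₀ ?_ (Real.exp_pos _).le (by omega)
        rw [Real.exp_neg, one_div, inv_lt_inv₀ (Real.exp_pos _) (by norm_num)]
        linarith [Real.exp_one_gt_d9]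
    _ = _ := by rw [one_div_pow]

/-! ### The stages of the evaluation -/

/-- Sum up the terms `a k * z ^ k` in residue classes; register `5` holds the number of terms,
register `3` the modulus, arrays `4` and `5` the powers of `z`. -/
def foldC (cm : Cmd) : Cmd :=
  .seq (.assign 7 (.const 0)) <| .for 6 5 <|
    .seq (.seq (.assign 64 (.query (.add (.add (.reg 6) (.reg 6)) (.const 2)) (.reg 68))) <|
      .seq (.assign 65 (.query (.add (.add (.reg 6) (.reg 6)) (.const 3)) (.reg 68))) <|
      .seq (.assign 66 (.get 4 (.reg 6))) (.assign 67 (.get 5 (.reg 6)))) <|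
    .seq cm <|
    .seq (.seq (.put 34 (.reg 7) (.add (.get 34 (.reg 7)) (.reg 69))) <|
      .seq (.put 35 (.reg 7) (.add (.get 35 (.reg 7)) (.reg 70)))
        (.assign 7 (.add (.reg 7) (.const 1)))) <|
    .branch (.sub (.reg 3) (.reg 7)) .skip (.assign 7 (.const 0))

theorem foldC_spec {O : ℕ → ℕ → ℤ} {cm : Cmd} {J : State → Prop} {q Q M L D ν : ℕ}
    (h : CMul O 64 cm J q Q M) (hL : Q + 2 ≤ L) (hqL : q ≤ L) (hDL : len ((2 * D + 3 : ℕ) : ℤ) ≤ L)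
    (hνL : len (ν : ℤ) ≤ L) (hν : 0 < ν)
    {a Z : ℕ → ℂ} {ε : ℝ} (ha : ∀ k, ‖a k‖ ≤ 1) (hZ : ∀ k, ‖Z k‖ ≤ 1) (hq : (2 : ℝ) ≤ 2 ^ q)
    (hQa : (2 : ℝ) ^ q * 1 + 2 ≤ 2 ^ Q) (hQZ : (2 : ℝ) ^ q * 1 + ε ≤ 2 ^ Q)
    (hQp : (2 : ℝ) ^ q * 1 + (2 * ε + 4) ≤ 2 ^ Q)
    (hQD : (2 : ℝ) ^ q * D + D * (2 * ε + 4) ≤ 2 ^ Q)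
    (hO : ∀ k, ‖gi (O (2 * k + 2) q) (O (2 * k + 3) q) - 2 ^ q * a k‖ ≤ 2)
    {σ : State} (hJ : J σ) (h3 : σ.reg 3 = ν) (h5 : σ.reg 5 = D)
    (h45 : ∀ k : ℕ, k < D → ‖σ.cv 4 k - 2 ^ q * Z k‖ ≤ ε)
    (h34 : ∀ j : ℕ, σ.cv 34 j = 0) :
    Tri O (foldC cm) σ ((D + 1) * (M + 4000 * L)) fun σ' => J σ' ∧
      (∀ j : ℕ, j < ν → ‖σ'.cv 34 j - 2 ^ q * foldSum (fun k => a k * Z k) ν D j‖ ≤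
        D * (2 * ε + 4)) ∧ (∀ j : ℕ, ν ≤ j → σ'.cv 34 j = 0) ∧
      Same (fun r => r < 64 ∧ r ≠ 6 ∧ r ≠ 7) (fun a => a < 64 ∧ a ≠ 34 ∧ a ≠ 35) σ σ' := by
  have hL1 : 1 ≤ L := by omega
  have hstab : ∀ τ τ', J τ → Same (fun r => 68 ≤ r ∧ r ≠ 69 ∧ r ≠ 70) (fun a => 64 ≤ a) τ τ' → J τ' :=
    h.stable
  have hprec : ∀ τ, J τ → τ.reg 68 = q := h.prec
  have hDlen : ∀ k : ℕ, k ≤ 2 * D + 3 → len (k : ℤ) ≤ L := fun k hk => (len_natCast_mono hk).trans hDL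
  have hνlen : ∀ k : ℕ, k ≤ ν → len (k : ℤ) ≤ L := fun k hk => (len_natCast_mono hk).trans hνL
  have hqL' : len (q : ℤ) ≤ L := (len_natCast_le_self q).trans hqL
  have hf : ∀ k, ‖a k * Z k‖ ≤ 1 := fun k => by
    rw [norm_mul]; exact mul_le_one₀ (ha k) (norm_nonneg _) (hZ k)
  have l2 : len 2 ≤ L := hDlen 2 (by omega)
  have l3 : len 3 ≤ L := hDlen 3 (by omega)
  let I : ℕ → State → Prop := fun k τ => J τ ∧ τ.reg 6 = k ∧ τ.reg 7 = (k % ν : ℕ) ∧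
    (∀ j : ℕ, j < ν → ‖τ.cv 34 j - 2 ^ q * foldSum (fun k => a k * Z k) ν k j‖ ≤
      k * (2 * ε + 4)) ∧ (∀ j : ℕ, ν ≤ j → τ.cv 34 j = 0) ∧
    Same (fun r => r < 64 ∧ r ≠ 6 ∧ r ≠ 7) (fun a => a < 64 ∧ a ≠ 34 ∧ a ≠ 35) σ τ
  refine ((Tri.line 2 (L := L) (ℓ := 0) (Q := fun τ => I 0 (τ.setR 6 0)) hL1 (by simp [Cmd.Straight])
    (by simp [Cmd.sz, Expr.sz]) ?_ ?_).seq fun τ hτ => Tri.for I D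
      (fun _ => 4 * 22 ^ 2 * (L * (1 + 0)) + (M + (4 * 16 ^ 2 * (L * (1 + 0)) +
        ((4 * 3 ^ 2 * (L * (1 + 0)) + 1) + 4 * 2 ^ 2 * (L * (1 + 0)))))) (hDlen D (by omega)) hL1
        ?_ ?_ ?_ hτ).mono ?_ ?_
  · simp [Cmd.Leaf, Expr.Leaf, len_zero]
  · simp only [Cmd.exec, Expr.eval, I]
    refine ⟨hstab _ _ hJ ⟨fun r hr => ?_, fun a ha j => by simp⟩, by simp, by simp, fun j hj => ?_,
      fun j hj => ?_, fun r hr => ?_, fun a ha j => by simp⟩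
    · simp; grind
    · have := h34 j
      simp only [State.cv, State.setR_mem] at this ⊢
      rw [this]; simp [foldSum]
    · have := h34 j
      simpa only [State.cv, State.setR_mem] using this
    · simp; grind
  · rintro k τ ⟨-, -, -, -, -, hs⟩
    rw [hs.1 _ (by omega), h5]
  · rintro k τ hI; exact hI.2.1
  · rintro k τ hk ⟨hJk, e6, e7, hv, hv0, hs⟩
    have hkν : k % ν < ν := Nat.mod_lt k hν
    generalize hi : k % ν = i at e7 hkν
    have e68 := hprec τ hJk
    have hOk := hO k
    have hZk := h45 k hk
    rw [← hs.cv (X := 4) (by omega) (by omega)] at hZk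
    obtain ⟨m0, m1⟩ := abs_le_of_approx (Q := Q) hOk (ha k) hQa
    obtain ⟨m2, m3⟩ := abs_le_of_approx (Q := Q) hZk (hZ k) hQZ
    have m0 := len_le_of_abs_le (L := L) m0 (by omega)
    have m1 := len_le_of_abs_le (L := L) m1 (by omega)
    have m2 := len_le_of_abs_le (L := L) m2 (by omega)
    have m3 := len_le_of_abs_le (L := L) m3 (by omega)
    simp only [Nat.reduceAdd] at m3
    have hkL := hDlen k (by omega)
    have i2 : ((k : ℤ) + k + 2).toNat = 2 * k + 2 := by omega
    have i3 : ((k : ℤ) + k + 3).toNat = 2 * k + 3 := by omega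
    refine (Tri.line 22 (L := L) (ℓ := 0) (Q := fun τ' => J τ' ∧
      gi (τ'.reg 64) (τ'.reg 65) = gi (O (2 * k + 2) q) (O (2 * k + 3) q) ∧
      gi (τ'.reg 66) (τ'.reg 67) = τ.cv 4 k ∧
      Same (· < 64) (· < 64) τ τ') hL1
      (by simp [Cmd.Straight]) (by simp [Cmd.sz, Expr.sz]) ?_ ?_).seq fun τ₁ hτ₁ => ?_
    · simp [Cmd.Leaf, Expr.Leaf, Expr.eval, Cmd.exec, e6, e68, i2, i3, m0, m1, m2, m3, hkL, l2, l3,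
        hqL, hqL']
    · simp only [Cmd.exec, Expr.eval]
      refine ⟨hstab _ _ hJk ⟨fun r hr => ?_, fun a ha j => by simp⟩, ?_, ?_, fun r hr => ?_,
        fun a ha j => by simp⟩
      · simp; grind
      · simp [e6, e68, i2, i3]
      · simp [State.cv, e6]
      · simp; grind
    obtain ⟨j1, g1, g2, s1⟩ := hτ₁
    refine (h.run_approx j1 (α := a k) (ω := Z k) (Ea := 2) (Ew := ε) (Ab := 1) (Om := 1) ?_ ?_
      (ha k) (hZ k) hq hQa hQZ).seq fun τ₂ hτ₂ => ?_
    · simp only [Nat.reduceAdd]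
      rw [g1]; exact hOk
    · simp only [Nat.reduceAdd]
      rw [g2]; exact hZk
    obtain ⟨j2, a2, s2⟩ := hτ₂
    simp only [Nat.reduceAdd] at a2
    have a2' : ‖gi (τ₂.reg 69) (τ₂.reg 70) - 2 ^ q * (a k * Z k)‖ ≤ 2 * ε + 4 :=
      a2.trans (le_of_eq (by ring))
    have hε : 0 ≤ 2 * ε + 4 := (norm_nonneg _).trans a2'
    have s02 := s1.trans s2
    have r6 : τ₂.reg 6 = k := by rw [s02.1 _ (by omega), e6]
    have r7 : τ₂.reg 7 = i := by rw [s02.1 _ (by omega), e7]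
    have hv2 := hv _ hkν
    rw [← s02.cv (X := 34) (by omega) (by omega)] at hv2
    obtain ⟨m7, m8⟩ := abs_le_of_approx (Q := Q) a2' (hf k) hQp
    have hQk : (2 : ℝ) ^ q * k + k * (2 * ε + 4) ≤ 2 ^ Q := by
      refine le_trans ?_ hQD
      have : (k : ℝ) ≤ D := by exact_mod_cast hk.le
      gcongr
    obtain ⟨m4, m5⟩ := abs_le_of_approx (Q := Q) hv2 (norm_foldSum_le hf ν k _) hQk
    have m4 := len_le_of_abs_le (L := L) m4 (by omega)
    have m5 := len_le_of_abs_le (L := L) m5 (by omega)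
    have m7 := len_le_of_abs_le (L := L) m7 (by omega)
    have m8 := len_le_of_abs_le (L := L) m8 (by omega)
    simp only [Nat.reduceAdd] at m5
    have hkm := hνlen _ hkν.le
    have hkm1 := hνlen (i + 1) hkν
    have r3 : τ₂.reg 3 = ν := by rw [s02.1 _ (by omega), hs.1 _ (by omega), h3]
    refine (Tri.line 16 (L := L) (ℓ := 0) (Q := fun τ' => J τ' ∧ τ'.reg 6 = k ∧
      τ'.reg 7 = (i + 1 : ℕ) ∧ τ'.reg 3 = ν ∧
      (∀ j : ℕ, j < ν → ‖τ'.cv 34 j - 2 ^ q * foldSum (fun k => a k * Z k) ν (k + 1) j‖ ≤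
        (k + 1 : ℕ) * (2 * ε + 4)) ∧ (∀ j : ℕ, ν ≤ j → τ'.cv 34 j = 0) ∧
      Same (fun r => r < 64 ∧ r ≠ 6 ∧ r ≠ 7) (fun a => a < 64 ∧ a ≠ 34 ∧ a ≠ 35) σ τ') hL1
      (by simp [Cmd.Straight]) (by simp [Cmd.sz, Expr.sz]) ?_ ?_).seq fun τ₃ hτ₃ => ?_
    · simp only [Cmd.Leaf, Expr.Leaf, Cmd.exec, Expr.eval, State.setM_reg, State.setM_mem,
        r7]
      simp [m4, m5, m7, m8, hkm, len_one, hL1]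
    · simp only [Cmd.exec, Expr.eval]
      refine ⟨hstab _ _ j2 ⟨fun r hr => ?_, fun a ha j => ?_⟩, by simp [r6], by simp [r7],
        by simp [r3], fun j hj => ?_, fun j hj => ?_, fun r hr => ?_, fun a ha j => ?_⟩
      · simp; grind
      · simp; grind
      · have e : foldSum (fun k => a k * Z k) ν (k + 1) j = foldSum (fun k => a k * Z k) ν k j +
            if i = j then a k * Z k else 0 := by
          rw [foldSum, Finset.sum_range_succ, ← foldSum, hi]
        have hvj := hv j hj
        rw [← s02.cv (X := 34) (by omega) (by omega)] at hvj
        rw [e]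
        by_cases hjk : i = j
        · subst hjk
          rw [if_pos rfl]
          simp only [State.cv, Nat.reduceAdd] at hvj ⊢
          simp [r7]
          rw [← gi_add]
          have e2 : gi (τ₂.mem 34 i) (τ₂.mem 35 i) + gi (τ₂.reg 69) (τ₂.reg 70) - 2 ^ q *
              (foldSum (fun k => a k * Z k) ν k i + a k * Z k) =
              (gi (τ₂.mem 34 i) (τ₂.mem 35 i) - 2 ^ q * foldSum (fun k => a k * Z k) ν k i) +
              (gi (τ₂.reg 69) (τ₂.reg 70) - 2 ^ q * (a k * Z k)) := by ring
          rw [e2]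
          refine (norm_add_le _ _).trans ((add_le_add hvj a2').trans (le_of_eq ?_))
          ring
        · rw [if_neg hjk, add_zero]
          have hne : ¬ j = i := fun h => hjk h.symm
          simp only [State.cv] at hvj ⊢
          simp [r7, hne]
          refine hvj.trans ?_
          nlinarith
      · have h0 := hv0 j hj
        rw [← s02.cv (X := 34) (by omega) (by omega)] at h0
        have hne : ¬ j = i := by omega
        simp only [State.cv] at h0 ⊢
        simpa [r7, hne] using h0
      · have := hs.1 r hr
        have := s02.1 r (by omega)
        simp; grind
      · have := hs.2 a ha j
        have := s02.2 a (by omega) j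
        simp; grind
    obtain ⟨j3, f6, f7, f3, fv, fv0, fs⟩ := hτ₃
    have fix : ∀ τ' : State, τ'.mem = τ₃.mem → (∀ r, r ≠ 7 → τ'.reg r = τ₃.reg r) →
        τ'.reg 7 = ((k + 1) % ν : ℕ) → τ'.reg 6 = k ∧ I (k + 1) (τ'.setR 6 (k + 1)) := by
      intro τ' hm hr h7
      refine ⟨by rw [hr _ (by omega), f6], hstab _ _ j3 ⟨fun r hr' => ?_, fun a ha j => ?_⟩, by simp,
        by simpa using h7, fun j hj => ?_, fun j hj => ?_, fun r hr' => ?_, fun a ha j => ?_⟩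
      · have := hr r (by omega)
        simp; grind
      · rw [State.setR_mem, hm]
      · simpa only [State.cv, State.setR_mem, hm] using fv j hj
      · simpa only [State.cv, State.setR_mem, hm] using fv0 j hj
      · have h1 := hr r (by omega)
        have := fs.1 r hr'
        simp; grind
      · rw [State.setR_mem, hm]; exact fs.2 a ha j
    refine Tri.branch (Nat.succ_le_succ (Expr.cost_le hL1 _ ?_)) (fun hpos => ?_) fun hneg => ?_
    · simp only [Expr.Leaf, f3, f7]
      exact ⟨hνL, hkm1⟩
    · refine (Tri.line 2 (L := L) (ℓ := 0) hL1 (by simp [Cmd.Straight]) (by simp [Cmd.sz]) (by simp [Cmd.Leaf]) ?_)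
      simp only [Expr.eval, f3, f7] at hpos
      refine fix _ rfl (fun _ _ => rfl) ?_
      rw [Cmd.exec, f7]
      · rw [← Nat.mod_add_mod, hi, Nat.mod_eq_of_lt (by omega)]
      all_goals simp
    · refine (Tri.line 2 (L := L) (ℓ := 0) hL1 (by simp [Cmd.Straight]) (by simp [Cmd.sz, Expr.sz])
        (by simp [Cmd.Leaf, Expr.Leaf, len_zero]) ?_)
      simp only [Expr.eval, f3, f7] at hneg
      refine fix _ rfl (fun r hr => ?_) ?_
      · simp [Cmd.exec, hr]
      · have hz : (k + 1) % ν = 0 := by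
          have h1 : i + 1 = ν := by omega
          rw [← Nat.mod_add_mod, hi, h1, Nat.mod_self]
        simp [Cmd.exec, Expr.eval, hz]
  · rw [Finset.sum_const, Finset.card_range, smul_eq_mul]
    nlinarith [Nat.zero_le (D * L), Nat.zero_le (D * M)]
  · rintro τ ⟨g1, -, -, g2, g3, g4⟩
    exact ⟨g1, g2, g3, g4⟩

/-- The remainder of the square of register `r` modulo register `4`. -/
def Expr.sqMod (r : ℕ) : Expr :=
  .sub (.mul (.reg r) (.reg r)) (.mul (.div (.mul (.reg r) (.reg r)) (.reg 4)) (.reg 4))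

theorem eval_sqMod {O : ℕ → ℕ → ℤ} {σ : State} {r k μ : ℕ} (hr : σ.reg r = k) (h4 : σ.reg 4 = μ) :
    (Expr.sqMod r).eval O σ = (k ^ 2 % μ : ℕ) := by
  simp only [Expr.sqMod, Expr.eval, hr, h4]
  have h : k ^ 2 = μ * (k ^ 2 / μ) + k ^ 2 % μ := (Nat.div_add_mod _ _).symm
  have h' : ((k ^ 2 : ℕ) : ℤ) = μ * (k ^ 2 / μ : ℕ) + (k ^ 2 % μ : ℕ) := by exact_mod_cast h
  have e : ((k : ℤ) * k / μ) = (k ^ 2 / μ : ℕ) := by push_cast; rw [sq]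
  rw [e]
  rw [Nat.cast_pow, sq] at h'
  linarith

theorem leaf_sqMod {O : ℕ → ℕ → ℤ} {σ : State} {r k μ L ℓ : ℕ} (hr : σ.reg r = k)
    (h4 : σ.reg 4 = μ) (hkL : len (k : ℤ) ≤ L) (hμL : len (μ : ℤ) ≤ L) (hkℓ : len (k : ℤ) ≤ ℓ)
    (hμℓ : len (μ : ℤ) ≤ ℓ) : (Expr.sqMod r).Leaf O σ L ℓ := by
  simp only [Expr.sqMod, Expr.Leaf, Expr.eval, hr, h4]
  simp only [hkL, hμL, hkℓ, hμℓ, or_true, and_self]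

theorem conj_approx {a b : ℤ} {q : ℕ} {α : ℂ} {δ : ℝ} (h : ‖gi a b - 2 ^ q * α‖ ≤ δ) :
    ‖gi a (-b) - 2 ^ q * (starRingEnd ℂ) α‖ ≤ δ := by
  have e : gi a (-b) - 2 ^ q * (starRingEnd ℂ) α = (starRingEnd ℂ) (gi a b - 2 ^ q * α) := by
    rw [map_sub, map_mul, map_pow, conj_gi, map_ofNat]
  rw [e, Complex.norm_conj]; exact h

/-- Multiply the coefficients by `η ^ (j ^ 2)` and write the second factor of the convolution. -/
def chirpC (cm : Cmd) : Cmd :=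
  .for 6 3 <|
    .seq (.assign 8 (Expr.sqMod 6)) <|
    .seq (.seq (.assign 64 (.get 34 (.reg 6))) <| .seq (.assign 65 (.get 35 (.reg 6))) <|
      .seq (.assign 66 (.get 2 (.reg 8))) (.assign 67 (.get 3 (.reg 8)))) <|
    .seq cm <|
    .seq (.seq (.put 34 (.reg 6) (.reg 69)) (.put 35 (.reg 6) (.reg 70))) <|
    .seq (.seq (.put 36 (.reg 6) (.get 2 (.reg 8)))
      (.put 37 (.reg 6) (.sub (.const 0) (.get 3 (.reg 8))))) <|
    .seq (.put 36 (.sub (.reg 33) (.reg 6)) (.get 2 (.reg 8)))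
      (.put 37 (.sub (.reg 33) (.reg 6)) (.sub (.const 0) (.get 3 (.reg 8))))

theorem chirpC_spec {O : ℕ → ℕ → ℤ} {cm : Cmd} {J : State → Prop} {q Q M L ℓ R ν : ℕ}
    (h : CMul O 64 cm J q Q M) (hL : Q + 2 ≤ L) (hRL : len (R : ℤ) ≤ L) (hRℓ : len (R : ℤ) ≤ ℓ)
    (hν : 0 < ν) (hνR : 2 * ν ≤ R) {η : ℂ} (hη : ‖η‖ = 1) (hη1 : η ^ (2 * ν) = 1) {c : ℕ → ℂ}
    {A E δ : ℝ} (hc : ∀ j, ‖c j‖ ≤ A) (hEq : E ≤ 2 ^ q) (hQA : 2 ^ q * A + E ≤ 2 ^ Q)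
    (hQδ : 2 ^ q * 1 + δ ≤ 2 ^ Q) (hQp : 2 ^ q * (A * 1) + (E * 1 + (A + 1) * δ + 2) ≤ 2 ^ Q)
    {σ : State} (hJ : J σ) (h3 : σ.reg 3 = ν) (h4 : σ.reg 4 = (2 * ν : ℕ)) (h33 : σ.reg 33 = R)
    (hP : ∀ i : ℕ, i < 2 * ν → ‖σ.cv 2 i - 2 ^ q * η ^ i‖ ≤ δ)
    (hA : ∀ j : ℕ, j < ν → ‖σ.cv 34 j - 2 ^ q * c j‖ ≤ E)
    (hA0 : ∀ j : ℕ, ν ≤ j → σ.cv 34 j = 0) (hB0 : ∀ j : ℕ, σ.cv 36 j = 0) :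
    Tri O (chirpC cm) σ ((ν + 1) * (M + 8000 * (L * (1 + ℓ)))) fun σ' => J σ' ∧
      (∀ j : ℕ, ‖σ'.cv 34 j - 2 ^ q * (if j < ν then c j * η ^ j ^ 2 else 0)‖ ≤
        E * 1 + (A + 1) * δ + 2) ∧
      (∀ j : ℕ, j < R → ‖σ'.cv 36 j - 2 ^ q * chirp η ν R j‖ ≤ δ) ∧
      Same (fun r => r < 64 ∧ r ≠ 6 ∧ r ≠ 8) (fun a => a < 64 ∧ (a < 34 ∨ 38 ≤ a)) σ σ' := by
  have hL1 : 1 ≤ L := by omega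
  have hstab : ∀ τ τ', J τ → Same (fun r => 68 ≤ r ∧ r ≠ 69 ∧ r ≠ 70) (fun a => 64 ≤ a) τ τ' → J τ' :=
    h.stable
  have hlen : ∀ k : ℕ, k ≤ R → len (k : ℤ) ≤ L := fun k hk => (len_natCast_mono hk).trans hRL
  have hlen' : ∀ k : ℕ, k ≤ R → len (k : ℤ) ≤ ℓ := fun k hk => (len_natCast_mono hk).trans hRℓ
  have hδ0 : 0 ≤ δ := (norm_nonneg _).trans (hP 0 (by omega))
  have hE0 : 0 ≤ E := (norm_nonneg _).trans (hA 0 hν)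
  have hA1 : 0 ≤ A := (norm_nonneg _).trans (hc 0)
  have hηk : ∀ k : ℕ, ‖η ^ k‖ ≤ 1 := fun k => by rw [norm_pow, hη, one_pow]
  let I : ℕ → State → Prop := fun k τ => J τ ∧ τ.reg 6 = k ∧
    (∀ j : ℕ, j < k → ‖τ.cv 34 j - 2 ^ q * (c j * η ^ j ^ 2)‖ ≤ E * 1 + (A + 1) * δ + 2) ∧
    (∀ j : ℕ, k ≤ j → τ.cv 34 j = σ.cv 34 j) ∧
    (∀ j : ℕ, j < k → ‖τ.cv 36 j - 2 ^ q * (starRingEnd ℂ) (η ^ j ^ 2)‖ ≤ δ) ∧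
    (∀ j : ℕ, j < k → ‖τ.cv 36 (R - j : ℤ) - 2 ^ q * (starRingEnd ℂ) (η ^ j ^ 2)‖ ≤ δ) ∧
    (∀ j : ℕ, k ≤ j → j + k ≤ R → τ.cv 36 j = 0) ∧
    Same (fun r => r < 64 ∧ r ≠ 6 ∧ r ≠ 8) (fun a => a < 64 ∧ (a < 34 ∨ 38 ≤ a)) σ τ
  refine (Tri.for I ν (fun _ => 4 * 14 ^ 2 * (L * (1 + ℓ)) + (4 * 12 ^ 2 * (L * (1 + 0)) + (M +
    4 * 34 ^ 2 * (L * (1 + 0))))) (hlen ν (by omega)) hL1 ?_ ?_ ?_ ?_).mono ?_ ?_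
  · rintro k τ ⟨-, -, -, -, -, -, -, hs⟩
    rw [hs.1 _ (by omega), h3]
  · rintro k τ hI; exact hI.2.1
  · rintro k τ hk ⟨hJk, e6, hv, hv', hb, hb', hb0, hs⟩
    have e4 : τ.reg 4 = (2 * ν : ℕ) := by rw [hs.1 _ (by omega), h4]
    have hkL := hlen k (by omega)
    have hmod : k ^ 2 % (2 * ν) < 2 * ν := Nat.mod_lt _ (by omega)
    have hpow : η ^ (k ^ 2 % (2 * ν)) = η ^ k ^ 2 := (pow_eq_pow_mod _ hη1).symm
    have hPt := hP _ hmod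
    rw [hpow] at hPt
    generalize hi : k ^ 2 % (2 * ν) = i at hPt hmod
    refine (Tri.line 14 (L := L) (ℓ := ℓ) (Q := fun τ' => τ'.reg 8 = i ∧
      Same (fun r => r ≠ 8) (fun _ => True) τ τ') hL1 (by simp [Cmd.Straight])
      (by simp [Cmd.sz, Expr.sz, Expr.sqMod]) ?_ ?_).seq fun τ₀ hτ₀ => ?_
    · exact leaf_sqMod e6 e4 hkL (hlen _ hνR) (hlen' k (by omega)) (hlen' _ hνR)
    · simp only [Cmd.exec, eval_sqMod e6 e4]
      refine ⟨by simp [← hi], fun r hr => ?_, fun a ha j => by simp⟩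
      simp; grind
    obtain ⟨f8, s0⟩ := hτ₀
    have f6 : τ₀.reg 6 = k := by rw [s0.1 _ (by omega), e6]
    have hAk := hA k hk
    rw [← hv' k le_rfl, ← s0.cv (X := 34) trivial trivial] at hAk
    rw [← hs.cv (X := 2) (by omega) (by omega), ← s0.cv (X := 2) trivial trivial] at hPt
    obtain ⟨m0, m1⟩ := abs_le_of_approx (Q := Q) hAk (hc k) hQA
    obtain ⟨m2, m3⟩ := abs_le_of_approx (Q := Q) hPt (hηk _) hQδ
    have m0 := len_le_of_abs_le (L := L) m0 (by omega)
    have m1 := len_le_of_abs_le (L := L) m1 (by omega)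
    have m2 := len_le_of_abs_le (L := L) m2 (by omega)
    have m3 := len_le_of_abs_le (L := L) m3 (by omega)
    simp only [Nat.reduceAdd] at m1 m3
    have hiL := hlen i (by omega)
    refine (Tri.line 12 (L := L) (ℓ := 0) (Q := fun τ' => J τ' ∧
      gi (τ'.reg 64) (τ'.reg 65) = τ₀.cv 34 k ∧ gi (τ'.reg 66) (τ'.reg 67) = τ₀.cv 2 i ∧
      Same (· < 64) (· < 64) τ₀ τ') hL1
      (by simp [Cmd.Straight]) (by simp [Cmd.sz, Expr.sz]) ?_ ?_).seq fun τ₁ hτ₁ => ?_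
    · simp [Cmd.Leaf, Expr.Leaf, Expr.eval, Cmd.exec, f6, f8, m0, m1, m2, m3, hkL, hiL]
    · simp only [Cmd.exec, Expr.eval]
      refine ⟨hstab _ _ hJk ⟨fun r hr => ?_, fun a ha j => ?_⟩, ?_, ?_, fun r hr => ?_,
        fun a ha j => by simp⟩
      · have := s0.1 r (by omega)
        simp; grind
      · simpa using s0.2 a trivial j
      · simp [State.cv, f6]
      · simp [State.cv, f8]
      · simp; grind
    obtain ⟨j1, g1, g2, s1⟩ := hτ₁
    refine (h.run_approx j1 (α := c k) (ω := η ^ k ^ 2) (Ea := E) (Ew := δ) (Ab := A) (Om := 1) ?_ ?_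
      (hc k) (hηk _) hEq hQA hQδ).seq fun τ₂ hτ₂ => ?_
    · simp only [Nat.reduceAdd]
      rw [g1]; exact hAk
    · simp only [Nat.reduceAdd]
      rw [g2]; exact hPt
    obtain ⟨j2, a2, s2⟩ := hτ₂
    simp only [Nat.reduceAdd] at a2
    have s02 := s1.trans s2
    have r6 : τ₂.reg 6 = k := by rw [s02.1 _ (by omega), f6]
    have r8 : τ₂.reg 8 = i := by rw [s02.1 _ (by omega), f8]
    have r33 : τ₂.reg 33 = R := by
      rw [s02.1 _ (by omega), s0.1 _ (by omega), hs.1 _ (by omega), h33]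
    have hprod : ‖c k * η ^ k ^ 2‖ ≤ A * 1 := by
      rw [norm_mul]; exact mul_le_mul (hc k) (hηk _) (norm_nonneg _) hA1
    obtain ⟨m7, m8⟩ := abs_le_of_approx (Q := Q) a2 hprod hQp
    have m7 := len_le_of_abs_le (L := L) m7 (by omega)
    have m8 := len_le_of_abs_le (L := L) m8 (by omega)
    rw [← s02.cv (X := 2) (by omega) (by omega)] at hPt
    rw [← s02.2 2 (by omega)] at m2
    rw [← s02.2 3 (by omega)] at m3
    have hconj := conj_approx hPt
    simp only [Nat.reduceAdd] at hconj
    have scv : ∀ X j, X < 63 → τ₂.cv X j = τ.cv X j := fun X j hX => by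
      rw [s02.cv (X := X) (by omega) (by omega), s0.cv (X := X) trivial trivial]
    refine Tri.line 34 (L := L) (ℓ := 0) hL1 (by simp [Cmd.Straight]) (by simp [Cmd.sz, Expr.sz])
      ?_ ?_
    · simp [Cmd.Leaf, Expr.Leaf, Expr.eval, Cmd.exec, r6, r8, r33, m2, m3, m7, m8, hkL, hiL, hRL,
        len_zero]
    · simp only [Cmd.exec, Expr.eval, I]
      refine ⟨by simp [r6], hstab _ _ j2 ⟨fun r hr => ?_, fun a ha j => ?_⟩, by simp, fun j hj => ?_,
        fun j hj => ?_, fun j hj => ?_, fun j hj => ?_, fun j hj hjR => ?_, fun r hr => ?_,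
        fun a ha j => ?_⟩
      · simp; grind
      · simp; grind
      · by_cases hjk : j = k
        · subst hjk
          simpa [State.cv, r6] using a2
        · have := hv j (by omega)
          rw [← scv 34 _ (by omega)] at this
          simp only [State.cv] at this ⊢
          simpa [r6, hjk] using this
      · have := hv' j (by omega)
        rw [← scv 34 _ (by omega)] at this
        have hjk : j ≠ k := by omega
        simp only [State.cv] at this ⊢
        simpa [r6, hjk] using this
      · have hne : ¬ (j : ℤ) = (R : ℤ) - k := by omega
        by_cases hjk : j = k
        · subst hjk
          simpa [State.cv, r6, r8, r33, hne] using hconj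
        · have := hb j (by omega)
          rw [← scv 36 _ (by omega)] at this
          simp only [State.cv] at this ⊢
          simpa [r6, r8, r33, hne, hjk] using this
      · by_cases hjk : j = k
        · subst hjk
          simpa [State.cv, r6, r8, r33] using hconj
        · have := hb' j (by omega)
          rw [← scv 36 _ (by omega)] at this
          have hne : ¬ (R : ℤ) - j = k := by omega
          simp only [State.cv] at this ⊢
          simpa [r6, r8, r33, hne, hjk] using this
      · have := hb0 j (by omega) (by omega)
        rw [← scv 36 _ (by omega)] at this
        have hjk : j ≠ k := by omega
        have hne : ¬ (j : ℤ) = (R : ℤ) - k := by omega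
        simp only [State.cv] at this ⊢
        simpa [r6, r8, r33, hne, hjk] using this
      · have h1 := hs.1 r hr
        have h2 := s0.1 r (by omega)
        have h3 := s02.1 r (by omega)
        simp; grind
      · have h1 := hs.2 a ha j
        have h2 := s0.2 a trivial j
        have h3 := s02.2 a (by omega) j
        simp; grind
  · refine ⟨hstab _ _ hJ ⟨fun r hr => ?_, fun a ha j => by simp⟩, by simp, by simp, fun j _ => rfl,
      by simp, by simp, fun j _ _ => hB0 j, fun r hr => ?_, fun a ha j => by simp⟩
    · simp; grind
    · simp; grind
  · rw [Finset.sum_const, Finset.card_range, smul_eq_mul]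
    nlinarith [Nat.zero_le (ν * L), Nat.zero_le (ν * M), Nat.zero_le (ν * (L * ℓ)),
      Nat.zero_le (L * ℓ)]
  · rintro τ ⟨g1, -, g2, g3, g4, g5, g6, g7⟩
    refine ⟨g1, fun j => ?_, fun j hj => ?_, g7⟩
    · split_ifs with hj
      · exact g2 j hj
      · rw [g3 j (by omega), hA0 j (by omega), mul_zero, sub_zero, norm_zero]
        positivity
    · unfold chirp
      split_ifs with h1 h2
      · exact g4 j h1
      · have := g5 (R - j) (by omega)
        rwa [Nat.cast_sub hj.le, sub_sub_cancel] at this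
      · rw [g6 j (by omega) (by omega), mul_zero, sub_zero, norm_zero]
        exact hδ0

/-- Scale the results of the convolution, and multiply them by `η ^ (K ^ 2)`, `K = 8 k`. -/
def outC (cm : Cmd) : Cmd :=
  .for 6 1 <|
    .seq (.assign 7 (.shl (.reg 6) (.const 3))) <| .seq (.assign 8 (Expr.sqMod 7)) <|
    .seq (.seq (.assign 64 (.shr (.get 34 (.sub (.reg 33) (.reg 7))) (.reg 32))) <|
      .seq (.assign 65 (.shr (.get 35 (.sub (.reg 33) (.reg 7))) (.reg 32))) <|
      .seq (.assign 66 (.get 2 (.reg 8))) (.assign 67 (.get 3 (.reg 8)))) <|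
    .seq cm <| .seq (.put 0 (.reg 6) (.reg 69)) (.put 1 (.reg 6) (.reg 70))

theorem outC_spec {O : ℕ → ℕ → ℤ} {cm : Cmd} {J : State → Prop} {q Q M L ℓ R r ν N : ℕ}
    (h : CMul O 64 cm J q Q M) (hL : Q + 2 ≤ L) (hRL : len (R : ℤ) ≤ L) (hRℓ : len (R : ℤ) ≤ ℓ)
    (hrL : r ≤ L) (hL3 : 3 ≤ L) (hν : 8 * N = ν) (hN : 0 < N) (hνR : 2 * ν ≤ R) {η : ℂ} (hη : ‖η‖ = 1)
    (hη1 : η ^ (2 * ν) = 1) {V : ℕ → ℂ} {A E δ : ℝ} (hV : ∀ k, ‖V k‖ ≤ A)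
    (hEq : E + 2 ≤ 2 ^ q) (hQA : 2 ^ q * A + (E + 2) ≤ 2 ^ Q)
    (hQr : 2 ^ q * (2 ^ r * A) + E ≤ 2 ^ Q)
    (hQδ : 2 ^ q * 1 + δ ≤ 2 ^ Q) (hQp : 2 ^ q * (A * 1) + ((E + 2) * 1 + (A + 1) * δ + 2) ≤ 2 ^ Q)
    {σ : State} (hJ : J σ) (h1 : σ.reg 1 = N) (h4 : σ.reg 4 = (2 * ν : ℕ)) (h32 : σ.reg 32 = r)
    (h33 : σ.reg 33 = R)
    (hP : ∀ i : ℕ, i < 2 * ν → ‖σ.cv 2 i - 2 ^ q * η ^ i‖ ≤ δ)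
    (hA : ∀ k : ℕ, k < N → ‖σ.cv 34 ((R : ℤ) - (8 * k : ℕ)) - 2 ^ q * (2 ^ r * V k)‖ ≤ E) :
    Tri O (outC cm) σ ((N + 1) * (M + 6000 * (L * (1 + ℓ)))) fun σ' => J σ' ∧
      ∀ k : ℕ, k < N → ‖σ'.cv 0 k - 2 ^ q * (V k * η ^ (8 * k) ^ 2)‖ ≤
        (E + 2) * 1 + (A + 1) * δ + 2 := by
  have hL1 : 1 ≤ L := by omega
  have hstab : ∀ τ τ', J τ → Same (fun r => 68 ≤ r ∧ r ≠ 69 ∧ r ≠ 70) (fun a => 64 ≤ a) τ τ' → J τ' :=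
    h.stable
  have hlen : ∀ k : ℕ, k ≤ R → len (k : ℤ) ≤ L := fun k hk => (len_natCast_mono hk).trans hRL
  have hlen' : ∀ k : ℕ, k ≤ R → len (k : ℤ) ≤ ℓ := fun k hk => (len_natCast_mono hk).trans hRℓ
  have hηk : ∀ k : ℕ, ‖η ^ k‖ ≤ 1 := fun k => by rw [norm_pow, hη, one_pow]
  have hA1 : 0 ≤ A := (norm_nonneg _).trans (hV 0)
  have hr1 : (1 : ℝ) ≤ 2 ^ r := one_le_pow₀ (by norm_num)
  have l3 : len 3 ≤ L := (by decide : len 3 = 2).le.trans (by omega)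
  have hrL' : len (r : ℤ) ≤ L := (len_natCast_le_self r).trans hrL
  let I : ℕ → State → Prop := fun k τ => J τ ∧ τ.reg 6 = k ∧
    (∀ j : ℕ, j < k → ‖τ.cv 0 j - 2 ^ q * (V j * η ^ (8 * j) ^ 2)‖ ≤
      (E + 2) * 1 + (A + 1) * δ + 2) ∧
    Same (fun r => r < 64 ∧ r ≠ 6 ∧ r ≠ 7 ∧ r ≠ 8) (fun a => a < 64 ∧ 2 ≤ a) σ τ
  refine (Tri.for I N (fun _ => 4 * 4 ^ 2 * (L * (1 + 0)) + (4 * 14 ^ 2 * (L * (1 + ℓ)) +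
    (4 * 20 ^ 2 * (L * (1 + 0)) + (M + 4 * 6 ^ 2 * (L * (1 + 0)))))) (hlen N (by omega)) hL1
      ?_ ?_ ?_ ?_).mono ?_ ?_
  · rintro k τ ⟨-, -, -, hs⟩
    rw [hs.1 _ (by omega), h1]
  · rintro k τ hI; exact hI.2.1
  · rintro k τ hk ⟨hJk, e6, hv, hs⟩
    have e4 : τ.reg 4 = (2 * ν : ℕ) := by rw [hs.1 _ (by omega), h4]
    have hkL := hlen k (by omega)
    have hmod : (8 * k) ^ 2 % (2 * ν) < 2 * ν := Nat.mod_lt _ (by omega)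
    have hpow : η ^ ((8 * k) ^ 2 % (2 * ν)) = η ^ (8 * k) ^ 2 := (pow_eq_pow_mod _ hη1).symm
    have hPt := hP _ hmod
    rw [hpow] at hPt
    generalize hi : (8 * k) ^ 2 % (2 * ν) = i at hPt hmod
    refine (Tri.line 4 (L := L) (ℓ := 0) (Q := fun τ' => τ'.reg 7 = (8 * k : ℕ) ∧
      Same (fun r => r ≠ 7) (fun _ => True) τ τ') hL1 (by simp [Cmd.Straight])
      (by simp [Cmd.sz, Expr.sz]) ?_ ?_).seq fun τ' hτ' => ?_
    · simp [Cmd.Leaf, Expr.Leaf, Expr.eval, e6, hkL, l3, hL3]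
    · simp only [Cmd.exec, Expr.eval]
      refine ⟨by simp [e6]; ring, fun r hr => ?_, fun a ha j => by simp⟩
      simp; grind
    obtain ⟨f7, s'⟩ := hτ'
    have f4 : τ'.reg 4 = (2 * ν : ℕ) := by rw [s'.1 _ (by omega), e4]
    refine (Tri.line 14 (L := L) (ℓ := ℓ) (Q := fun τ' => τ'.reg 8 = i ∧ τ'.reg 7 = (8 * k : ℕ) ∧
      Same (fun r => r ≠ 7 ∧ r ≠ 8) (fun _ => True) τ τ') hL1 (by simp [Cmd.Straight])
      (by simp [Cmd.sz, Expr.sz, Expr.sqMod]) ?_ ?_).seq fun τ₀ hτ₀ => ?_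
    · exact leaf_sqMod f7 f4 (hlen _ (by omega)) (hlen _ hνR) (hlen' _ (by omega)) (hlen' _ hνR)
    · simp only [Cmd.exec, eval_sqMod f7 f4]
      refine ⟨by simp [← hi], by simp [f7], fun r hr => ?_, fun a ha j => ?_⟩
      · have := s'.1 r (by omega)
        simp; grind
      · simpa using s'.2 a trivial j
    obtain ⟨f8, f7, s0⟩ := hτ₀
    have f6 : τ₀.reg 6 = k := by rw [s0.1 _ (by omega), e6]
    have f32 : τ₀.reg 32 = r := by rw [s0.1 _ (by omega), hs.1 _ (by omega), h32]
    have f33 : τ₀.reg 33 = R := by rw [s0.1 _ (by omega), hs.1 _ (by omega), h33]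
    have hAk := hA k hk
    rw [← hs.cv (X := 34) (by omega) (by omega), ← s0.cv (X := 34) trivial trivial] at hAk
    rw [← hs.cv (X := 2) (by omega) (by omega), ← s0.cv (X := 2) trivial trivial] at hPt
    have hVr : ‖2 ^ r * V k‖ ≤ 2 ^ r * A := by
      rw [norm_mul, norm_pow, Complex.norm_ofNat]
      exact mul_le_mul_of_nonneg_left (hV k) (by positivity)
    obtain ⟨m0, m1⟩ := abs_le_of_approx (Q := Q) hAk hVr hQr
    obtain ⟨m2, m3⟩ := abs_le_of_approx (Q := Q) hPt (hηk _) hQδ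
    have m0 := len_le_of_abs_le (L := L) m0 (by omega)
    have m1 := len_le_of_abs_le (L := L) m1 (by omega)
    have m2 := len_le_of_abs_le (L := L) m2 (by omega)
    have m3 := len_le_of_abs_le (L := L) m3 (by omega)
    simp only [Nat.reduceAdd] at m1 m3
    have hiL := hlen i (by omega)
    have h8L := hlen (8 * k) (by omega)
    have hscaled : ‖gi (τ₀.mem 34 ((R : ℤ) - (8 * k : ℕ)) / 2 ^ r)
        (τ₀.mem 35 ((R : ℤ) - (8 * k : ℕ)) / 2 ^ r) - 2 ^ q * V k‖ ≤ E + 2 := by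
      have e1 := norm_gi_shr_sub (τ₀.mem 34 ((R : ℤ) - (8 * k : ℕ)))
        (τ₀.mem 35 ((R : ℤ) - (8 * k : ℕ))) r
      have hE0 := (norm_nonneg _).trans hAk
      have e2 : ‖gi (τ₀.mem 34 ((R : ℤ) - (8 * k : ℕ))) (τ₀.mem 35 ((R : ℤ) - (8 * k : ℕ))) / 2 ^ r -
          2 ^ q * V k‖ ≤ E := by
        have : gi (τ₀.mem 34 ((R : ℤ) - (8 * k : ℕ))) (τ₀.mem 35 ((R : ℤ) - (8 * k : ℕ))) / 2 ^ r -
            2 ^ q * V k = (τ₀.cv 34 ((R : ℤ) - (8 * k : ℕ)) - 2 ^ q * (2 ^ r * V k)) / 2 ^ r := by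
          have : (2 : ℂ) ^ r ≠ 0 := pow_ne_zero _ two_ne_zero
          rw [State.cv]
          field_simp
        rw [this, norm_div, norm_pow, Complex.norm_ofNat]
        exact (div_le_self (norm_nonneg _) hr1).trans hAk
      calc _ ≤ _ := norm_sub_le_norm_sub_add_norm_sub _ (gi (τ₀.mem 34 ((R : ℤ) - (8 * k : ℕ)))
            (τ₀.mem 35 ((R : ℤ) - (8 * k : ℕ))) / 2 ^ r) _
        _ ≤ 2 + E := add_le_add e1 e2
        _ = _ := by ring
    refine (Tri.line 20 (L := L) (ℓ := 0) (Q := fun τ' => J τ' ∧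
      τ'.reg 64 = τ₀.mem 34 ((R : ℤ) - (8 * k : ℕ)) / 2 ^ r ∧
      τ'.reg 65 = τ₀.mem 35 ((R : ℤ) - (8 * k : ℕ)) / 2 ^ r ∧
      gi (τ'.reg 66) (τ'.reg 67) = τ₀.cv 2 i ∧ Same (· < 64) (· < 64) τ₀ τ') hL1
      (by simp [Cmd.Straight]) (by simp [Cmd.sz, Expr.sz]) ?_ ?_).seq fun τ₁ hτ₁ => ?_
    · simp only [Cmd.Leaf, Expr.Leaf, Expr.eval, Cmd.exec]
      simp only [State.setR_reg, State.setR_mem, f7, f8, f32, f33, Nat.reduceEqDiff, if_false, m0, m1, m2, m3,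
        hiL, hRL, h8L, hrL', and_self]
    · simp only [Cmd.exec, Expr.eval]
      refine ⟨hstab _ _ hJk ⟨fun r hr => ?_, fun a ha j => ?_⟩, ?_, ?_, ?_, fun r hr => ?_,
        fun a ha j => by simp⟩
      · have := s0.1 r (by omega)
        simp; grind
      · simpa using s0.2 a trivial j
      · simp [f7, f32, f33]
      · simp [f7, f32, f33]
      · simp [State.cv, f8]
      · simp; grind
    obtain ⟨j1, g0, g1, g2, s1⟩ := hτ₁
    refine (h.run_approx j1 (α := V k) (ω := η ^ (8 * k) ^ 2) (Ea := E + 2) (Ew := δ) (Ab := A)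
      (Om := 1) ?_ ?_ (hV k) (hηk _) hEq hQA hQδ).seq fun τ₂ hτ₂ => ?_
    · simp only [Nat.reduceAdd]
      rw [g0, g1]; exact hscaled
    · simp only [Nat.reduceAdd]
      rw [g2]; exact hPt
    obtain ⟨j2, a2, s2⟩ := hτ₂
    simp only [Nat.reduceAdd] at a2
    have s02 := s1.trans s2
    have r6 : τ₂.reg 6 = k := by rw [s02.1 _ (by omega), f6]
    have hprod : ‖V k * η ^ (8 * k) ^ 2‖ ≤ A * 1 := by
      rw [norm_mul]; exact mul_le_mul (hV k) (hηk _) (norm_nonneg _) hA1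
    obtain ⟨m7, m8⟩ := abs_le_of_approx (Q := Q) a2 hprod hQp
    have m7 := len_le_of_abs_le (L := L) m7 (by omega)
    have m8 := len_le_of_abs_le (L := L) m8 (by omega)
    refine Tri.line 6 (L := L) (ℓ := 0) hL1 (by simp [Cmd.Straight]) (by simp [Cmd.sz, Expr.sz])
      ?_ ?_
    · simp [Cmd.Leaf, Expr.Leaf, Cmd.exec, r6, m7, m8, hkL]
    · simp only [Cmd.exec, Expr.eval, I]
      refine ⟨by simp [r6], hstab _ _ j2 ⟨fun r hr => ?_, fun a ha j => ?_⟩, by simp, fun j hj => ?_,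
        fun r hr => ?_, fun a ha j => ?_⟩
      · simp; grind
      · simp; grind
      · by_cases hjk : j = k
        · subst hjk
          simpa [State.cv, r6] using a2
        · have := hv j (by omega)
          rw [← s0.cv (X := 0) trivial trivial, ← s02.cv (X := 0) (by omega) (by omega)] at this
          simp only [State.cv] at this ⊢
          simpa [r6, hjk] using this
      · have h1 := hs.1 r hr
        have h2 := s0.1 r (by omega)
        have h3 := s02.1 r (by omega)
        simp; grind
      · have h1 := hs.2 a ha j
        have h2 := s0.2 a trivial j
        have h3 := s02.2 a (by omega) j
        simp; grind
  · refine ⟨hstab _ _ hJ ⟨fun r hr => ?_, fun a ha j => by simp⟩, by simp, by simp, fun r hr => ?_,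
      fun a ha j => by simp⟩
    · simp; grind
    · simp; grind
  · rw [Finset.sum_const, Finset.card_range, smul_eq_mul]
    nlinarith [Nat.zero_le (N * L), Nat.zero_le (N * M), Nat.zero_le (N * (L * ℓ)),
      Nat.zero_le (L * ℓ)]
  · rintro τ ⟨g1, -, g2, -⟩
    exact ⟨g1, g2⟩

/-! ### The evaluation program -/

/-- Compute the parameters from `n`, `N`, `m` in registers `0`, `1`, `2`: the precision
`q = 100 (n + m)`, the bound `2 q` for the lengths of factors, the length `2 ^ (n + 8)` of the
Fourier transforms, the modulus `8 N` and its double, and the number `2 ^ n (m + 2)` of terms. -/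
def paramC : Cmd :=
  .seq (.assign 68 (.mul (.const 100) (.add (.reg 0) (.reg 2)))) <|
  .seq (.assign 75 (.reg 0)) <|
  .seq (.assign 76 (.add (.reg 68) (.reg 68))) <|
  .seq (.assign 32 (.add (.reg 0) (.const 8))) <|
  .seq (.assign 33 (.shl (.const 1) (.reg 32))) <|
  .seq (.assign 3 (.shl (.reg 1) (.const 3))) <|
  .seq (.assign 4 (.shl (.reg 1) (.const 4)))
    (.assign 5 (.shl (.add (.reg 2) (.const 2)) (.reg 0)))

/-- Bluestein's method with the complex multiplication `cm`: set up the Fourier transform; tabulate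
the powers of `exp (π i / ν)` and of `z`; fold the terms modulo `ν`, weight the sums, convolve them
with the chirp, and multiply by the outer factor; register `0` tells the precision of the result. The
complex arrays are: `2` the powers of `exp (π i / ν)`, `4` the powers of `z`, `32` the roots of unity
for the Fourier transform, `34` and `36` the sequences to be convolved. -/
def bluesteinC (cm : Cmd) : Cmd :=
  .seq (setupC 32 cm) <| .seq (rootC 32 3 cm) <| .seq (powersC 32 2 4 cm) <|
  .seq (.seq (.assign 44 (.query (.const 0) (.reg 68))) (.assign 45 (.query (.const 1) (.reg 68)))) <|
  .seq (powersC 32 4 5 cm) <| .seq (foldC cm) <| .seq (chirpC cm) <| .seq (convC 32 cm) <|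
  .seq (.seq (.put 34 (.reg 33) (.get 34 (.const 0))) (.put 35 (.reg 33) (.get 35 (.const 0)))) <|
  .seq (outC cm) (.assign 0 (.reg 68))

/-- Approximate evaluation at the points `z * exp (2 π i k / N)`, with a multiplication routine `mu`
and the preparations `prep` for it. -/
def evalC (prep mu : Cmd) : Cmd :=
  .seq paramC <| .seq prep (bluesteinC (complexMul 64 mu))

/-- The errors of the stages, in units of the last place, for `s = n + m`: `Ef` after the summation in
residue classes, `Ex` after the multiplication by the chirp, `Ec` after the convolution, and `F` at the
end. Here `D` bounds the numbers themselves, `δ` is the error of the roots of unity, and `W` and `ρ`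
stand for the powers `2 ^ r` and `16 ^ r` that enter through the convolution. -/
theorem eval_bounds {s : ℕ} (hs : 2 ≤ s) {D δ W ρ : ℝ} (hD1 : 1 ≤ D) (hD : D ≤ 2 ^ (s + 1))
    (hδ0 : 0 ≤ δ) (hδ : δ ≤ 2 ^ (2 * s + 20)) (hW : W ≤ 2 ^ (s + 7)) (hρ0 : 0 ≤ ρ)
    (hρ : ρ ≤ 2 ^ (4 * s + 28)) {Ef Ex Ec F : ℝ} (hEf : Ef = D * (2 * (6 * D) + 4))
    (hEx : Ex = Ef * 1 + (D + 1) * δ + 2) (hEc : Ec = 16 * ρ * Ex * D ^ 2)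
    (hF : F = (Ec + 2) * 1 + (D + 1) * δ + 2) :
    ∃ U : ℝ, U = 2 ^ (9 * s + 58) ∧ 2 * (6 * D) + 4 ≤ U ∧ δ ≤ U ∧ Ef ≤ U ∧ Ex ≤ U ∧
      Ec + 2 ≤ U ∧ F ≤ U ∧ W * D ≤ U ∧ 0 ≤ Ef ∧ 0 ≤ Ec := by
  obtain ⟨x, hx⟩ : ∃ x : ℝ, x = 2 ^ s := ⟨_, rfl⟩
  have hx1 : (4 : ℝ) ≤ x := by
    rw [hx, show (4 : ℝ) = 2 ^ 2 by norm_num]; exact pow_le_pow_right₀ (by norm_num) hs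
  have hpow : ∀ a b : ℕ, (2 : ℝ) ^ (a * s + b) = x ^ a * 2 ^ b := fun a b => by
    rw [pow_add, mul_comm a s, pow_mul, hx]
  have hDx : D ≤ 2 * x := by rw [hx]; rw [pow_succ] at hD; linarith
  have hδx : δ ≤ x ^ 2 * 2 ^ 20 := by rw [← hpow]; exact hδ
  have hWx : W ≤ x * 2 ^ 7 := by rw [hx, ← pow_add]; exact hW
  have hρx : ρ ≤ x ^ 4 * 2 ^ 28 := by rw [← hpow]; exact hρ
  have hU : (2 : ℝ) ^ (9 * s + 58) = x ^ 9 * 2 ^ 58 := hpow 9 58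
  have p2 : x ≤ x ^ 2 := by nlinarith
  have p3 : x ^ 2 ≤ x ^ 3 := pow_le_pow_right₀ (by linarith) (by norm_num)
  have p9 : x ^ 3 ≤ x ^ 9 := pow_le_pow_right₀ (by linarith) (by norm_num)
  have hEf0 : 0 ≤ Ef := by rw [hEf]; positivity
  have b1 : Ef ≤ x ^ 2 * 2 ^ 6 := by
    rw [hEf]
    calc _ ≤ 2 * x * (2 * (6 * (2 * x)) + 4) := by gcongr
      _ ≤ _ := by nlinarith
  have b0 : (D + 1) * δ ≤ x ^ 3 * 2 ^ 22 := by
    calc _ ≤ (4 * x) * (x ^ 2 * 2 ^ 20) := by gcongr; linarith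
      _ = _ := by ring
  have hEx0 : 0 ≤ Ex := by rw [hEx]; positivity
  have b2 : Ex ≤ x ^ 3 * 2 ^ 23 := by
    rw [hEx]; nlinarith
  have hEc0 : 0 ≤ Ec := by rw [hEc]; positivity
  have b3 : Ec ≤ x ^ 9 * 2 ^ 57 := by
    rw [hEc]
    calc _ ≤ 16 * (x ^ 4 * 2 ^ 28) * (x ^ 3 * 2 ^ 23) * (2 * x) ^ 2 := by gcongr
      _ = _ := by ring
  refine ⟨x ^ 9 * 2 ^ 58, hU.symm, ?_, ?_, ?_, ?_, ?_, ?_, ?_, hEf0, hEc0⟩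
  · nlinarith
  · nlinarith
  · nlinarith
  · nlinarith
  · nlinarith
  · rw [hF]; nlinarith
  · calc W * D ≤ x * 2 ^ 7 * (2 * x) := by gcongr
      _ ≤ _ := by nlinarith

/-- A number `x ≤ U` at scale `S`, with an error `y ≤ U`, does not exceed `S * S`; so it is an admissible
operand for a multiplication of numbers with twice as many bits as the scale has. -/
theorem add_le_sq {S U x y : ℝ} (hS : 0 ≤ S) (hU1 : 1 ≤ U) (hU : 2 * U ≤ S) (hx : x ≤ U)
    (hy : y ≤ U) : S * x + y ≤ S * S := by
  have h1 : S * x ≤ S * U := mul_le_mul_of_nonneg_left hx hS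
  have h2 : S * (2 * U) ≤ S * S := mul_le_mul_of_nonneg_left hU hS
  have h3 : U ≤ S * U := le_mul_of_one_le_left (by linarith) (by linarith)
  linarith

theorem norm_gi_stream_sub_le {α : ℂ} {s s' : ℕ → ℤ} (h : IsBitStream α.re s)
    (h' : IsBitStream α.im s') (q : ℕ) : ‖gi (s q) (s' q) - 2 ^ q * α‖ ≤ 2 := by
  refine (Complex.norm_le_abs_re_add_abs_im _).trans ?_
  have h1 := h q
  have h2 := h' q
  have e : (2 : ℂ) ^ q * α = ((2 ^ q : ℝ) : ℂ) * α := by push_cast; rfl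
  rw [e, Complex.sub_re, Complex.sub_im, Complex.re_ofReal_mul, Complex.im_ofReal_mul, gi_re, gi_im,
    mul_comm, mul_comm _ α.im, abs_sub_comm, abs_sub_comm ((s' q : ℤ) : ℝ)]
  linarith

theorem paramC_spec {O : ℕ → ℕ → ℤ} {n N m L : ℕ} (hN : N ≤ 2 ^ (n + 4)) (hn : 0 < n) (hm : 0 < m)
    (hL : 200 * (n + m) ≤ L) {σ : State} (h0 : σ.reg 0 = n) (h1 : σ.reg 1 = N) (h2 : σ.reg 2 = m) :
    Tri O paramC σ (4 * 40 ^ 2 * (L * (1 + 7))) fun τ => τ.reg 68 = (100 * (n + m) : ℕ) ∧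
      τ.reg 75 = n ∧ τ.reg 76 = (200 * (n + m) : ℕ) ∧ τ.reg 32 = (n + 8 : ℕ) ∧
      τ.reg 33 = (2 ^ (n + 8) : ℕ) ∧ τ.reg 3 = (8 * N : ℕ) ∧ τ.reg 4 = (2 * (8 * N) : ℕ) ∧
      τ.reg 5 = (2 ^ n * (m + 2) : ℕ) ∧ τ.reg 1 = N ∧ τ.mem = σ.mem := by
  have lN : len (N : ℤ) ≤ L := (len_natCast_le.2 (hN.trans_lt
    (Nat.pow_lt_pow_right (by norm_num) (by omega : n + 4 < n + 5)))).trans (by omega)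
  have ln : len (n : ℤ) ≤ L := (len_natCast_le_self n).trans (by omega)
  have lm : len (m : ℤ) ≤ L := (len_natCast_le_self m).trans (by omega)
  have lq : len ((100 * (n + m) : ℕ) : ℤ) ≤ L := (len_natCast_le_self _).trans (by omega)
  have ln8 : len ((n + 8 : ℕ) : ℤ) ≤ L := (len_natCast_le_self _).trans (by omega)
  have l100 : len 100 = 7 := by decide
  have l8 : len 8 = 4 := by decide
  have l4 : len 4 = 3 := by decide
  have l3 : len 3 = 2 := by decide
  have l2 : len 2 = 2 := by decide
  have t8 : ((n : ℤ) + 8).toNat = n + 8 := by omega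
  push_cast at lq ln8
  have c1 : 7 ≤ L := by omega
  have c2 : 4 ≤ L := by omega
  have c3 : 3 ≤ L := by omega
  have c4 : 2 ≤ L := by omega
  have c5 : 1 ≤ L := by omega
  have c6 : n + 8 ≤ L := by omega
  have c7 : n ≤ L := by omega
  refine Tri.line 40 c5 (by simp [paramC, Cmd.Straight]) (by simp [paramC, Cmd.sz, Expr.sz]) ?_ ?_
  · simp only [paramC, Cmd.Leaf, Cmd.exec, Expr.Leaf, Expr.eval]
    simp [h0, h1, h2, l100, l8, l4, l3, l2, len_one, t8, lN, ln, lm, lq, ln8, c1, c2, c3, c4, c5, c6,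
      c7]
  · simp only [paramC, Cmd.exec, Expr.eval]
    refine ⟨?_, ?_, ?_, ?_, ?_, ?_, ?_, ?_, ?_, rfl⟩ <;> simp [h0, h1, h2, t8]
    all_goals ring

/-- The final error. The error `F` of the fixed-point computation is worth `F / 2 ^ q * 2 ^ E`, which is at
most `2 ‖p‖₁ / 2 ^ (m + 2)`; together with the terms that were cut off, less than
`3 ‖p‖₁ / 2 ^ (m + 2)`. -/
theorem norm_output_sub_lt {p : Polynomial ℂ} {E : ℤ} {q m D k : ℕ} {y : ℂ} {F : ℝ} {σ : State}
    (hp : (2 : ℝ) ^ E ≤ 2 * coeffNorm p) (h0 : σ.reg 0 = q) (hF : F * 2 ^ (m + 2) ≤ 2 ^ q)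
    (hy : ‖y‖ ≤ 1) (hyD : ‖y‖ ^ D < 1 / 2 ^ (m + 2))
    (hcv : ‖σ.cv 0 k -
      2 ^ q * ∑ i ∈ Finset.range D, p.coeff i / (((2 : ℝ) ^ E : ℝ) : ℂ) * y ^ i‖ ≤ F) :
    ‖output σ E k - p.eval y‖ < coeffNorm p / 2 ^ m := by
  have hE : (0 : ℝ) < 2 ^ E := by positivity
  have hpp : 0 < coeffNorm p := by linarith
  have h2 : ((((2 : ℝ) ^ E : ℝ) : ℂ)) = (2 : ℂ) ^ E := by push_cast; rfl
  have hS : ∑ i ∈ Finset.range D, p.coeff i * y ^ i =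
      (2 : ℂ) ^ E * ∑ i ∈ Finset.range D, p.coeff i / (((2 : ℝ) ^ E : ℝ) : ℂ) * y ^ i := by
    rw [Finset.mul_sum]
    refine Finset.sum_congr rfl fun i _ => ?_
    rw [h2]
    field_simp
  have htail := norm_eval_sub_sum_le p hy D
  have hout : output σ E k = σ.cv 0 k * ((2 : ℂ) ^ E / 2 ^ q) := by
    rw [output, h0, zpow_sub₀ (by norm_num), zpow_natCast]
    rfl
  have hdiff : output σ E k - ∑ i ∈ Finset.range D, p.coeff i * y ^ i = (σ.cv 0 k -
      2 ^ q * ∑ i ∈ Finset.range D, p.coeff i / (((2 : ℝ) ^ E : ℝ) : ℂ) * y ^ i) *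
        ((2 : ℂ) ^ E / 2 ^ q) := by
    rw [hout, hS]
    field_simp
  have h1 : ‖output σ E k - ∑ i ∈ Finset.range D, p.coeff i * y ^ i‖ ≤
      2 * coeffNorm p / 2 ^ (m + 2) := by
    rw [hdiff, norm_mul, norm_div, norm_zpow, norm_pow, Complex.norm_ofNat]
    calc _ ≤ F * ((2 : ℝ) ^ E / 2 ^ q) := by gcongr
      _ = F * 2 ^ (m + 2) / 2 ^ q * (2 ^ E / 2 ^ (m + 2)) := by field_simp
      _ ≤ 1 * (2 ^ E / 2 ^ (m + 2)) := by
        gcongr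
        rw [div_le_one (by positivity)]; exact hF
      _ ≤ _ := by rw [one_mul]; gcongr
  have h3 : coeffNorm p * ‖y‖ ^ D < coeffNorm p / 2 ^ (m + 2) := by
    rw [div_eq_mul_one_div]; exact mul_lt_mul_of_pos_left hyD hpp
  calc _ = ‖(output σ E k - ∑ i ∈ Finset.range D, p.coeff i * y ^ i) -
        (p.eval y - ∑ i ∈ Finset.range D, p.coeff i * y ^ i)‖ := by rw [sub_sub_sub_cancel_right]
    _ ≤ 2 * coeffNorm p / 2 ^ (m + 2) + coeffNorm p * ‖y‖ ^ D :=
      (norm_sub_le _ _).trans (add_le_add h1 htail)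
    _ < 2 * coeffNorm p / 2 ^ (m + 2) + coeffNorm p / 2 ^ (m + 2) := by linarith
    _ ≤ 4 * coeffNorm p / 2 ^ (m + 2) := by
      rw [← add_div]; gcongr; linarith
    _ = _ := by rw [pow_add]; field_simp; norm_num

/-- The common form of the bounds for the cost of the parts of `evalC`. -/
theorem part_cost_le {X s G M A Y α β : ℕ} (k : ℕ) (hG : 1 ≤ G)
    (hA : A ≤ α * (X * s)) (hAY : A * Y ≤ β * (X * s * G)) :
    A * (4 * M + 1500 * (500 * s) + k * (500 * s * Y)) ≤
      (4 * α + 750000 * α + 500 * k * β) * (X * (s * (M + s * G))) := by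
  have h1 : A * M ≤ α * (X * s) * M := Nat.mul_le_mul_right _ hA
  have h2 : A * s ≤ α * (X * s) * (s * G) :=
    Nat.mul_le_mul hA (Nat.le_mul_of_pos_right _ hG)
  have h3 : A * Y * (k * s) ≤ β * (X * s * G) * (k * s) := Nat.mul_le_mul_right _ hAY
  have e1 : A * (4 * M + 1500 * (500 * s) + k * (500 * s * Y)) =
      4 * (A * M) + 750000 * (A * s) + 500 * (A * Y * (k * s)) := by ring
  have e2 : (4 * α + 750000 * α + 500 * k * β) * (X * (s * (M + s * G))) =
      4 * (α * (X * s) * M) + 4 * (α * (X * s) * (s * G)) +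
      750000 * (α * (X * s) * (s * G)) + 750000 * (α * (X * s) * M) +
        500 * (β * (X * s * G) * (k * s)) + 500 * (k * β * (X * s * M)) := by ring
  rw [e1, e2]
  omega

theorem exp_pi_div_pow {ν : ℕ} (hν : 0 < ν) : Complex.exp (Real.pi / ν * Complex.I) ^ (2 * ν) = 1 := by
  have : (ν : ℂ) ≠ 0 := by exact_mod_cast hν.ne'
  rw [← Complex.exp_nat_mul, ← Complex.exp_two_pi_mul_I]
  congr 1
  push_cast
  field_simp

theorem norm_exp_pi_div (ν : ℕ) : ‖Complex.exp (Real.pi / ν * Complex.I)‖ = 1 := by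
  rw [show (Real.pi / ν * Complex.I : ℂ) = ((Real.pi / ν : ℝ) : ℂ) * Complex.I by push_cast; rfl]
  exact Complex.norm_exp_ofReal_mul_I _

set_option maxHeartbeats 1600000 in
/-- Correctness of the evaluation of `∑ a i * y ^ i`, `i < D`, at the points `y = z η ^ (2 K)`, `K = 8 k`,
for precisions `q` and `Q` that leave room for the errors collected in `eval_bounds`. -/
theorem bluesteinC_spec {O : ℕ → ℕ → ℤ} {cm : Cmd} {J : State → Prop}
    {q Q M L ℓ r ν N D : ℕ} (h : CMul O 64 cm J q Q M) (hq : 8 ≤ q) (hQ : q + 2 ≤ Q)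
    (hQ2 : 2 * q ≤ Q) (hL : 2 * q + 10 ≤ L) (hLQ : Q + 2 ≤ L) (hr4 : 4 ≤ r) (hrL : r + 2 ≤ L)
    (hℓ : len ((2 * q + 1 : ℕ) : ℤ) ≤ ℓ) (hrℓ : r + 1 ≤ ℓ)
    (hN : 0 < N) (hν : 8 * N = ν) (hνR : 2 * ν ≤ 2 ^ r) (hD1 : 1 ≤ D)
    (hDL : len ((2 * D + 3 : ℕ) : ℤ) ≤ L)
    {δ Ef Ex Ec U : ℝ} (hδ : δ = 2 ^ r * (66 * q)) (hEf : Ef = D * (2 * (6 * D) + 4))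
    (hEx : Ex = Ef * 1 + (D + 1) * δ + 2) (hEc : Ec = 16 * 16 ^ r * Ex * D ^ 2)
    (hU1 : 1 ≤ U) (hU2 : 2 * U ≤ 2 ^ q) (b1 : 2 * (6 * (D : ℝ)) + 4 ≤ U) (b2 : δ ≤ U) (b3 : Ef ≤ U)
    (b4 : Ex ≤ U) (b5 : Ec + 2 ≤ U) (b6 : (Ec + 2) * 1 + (D + 1) * δ + 2 ≤ U)
    (b7 : 2 ^ r * (D : ℝ) ≤ U) (hEf0 : 0 ≤ Ef) (hEc0 : 0 ≤ Ec)
    {η z : ℂ} {a : ℕ → ℂ} (hη : η = Complex.exp (Real.pi / ν * Complex.I)) (hz1 : ‖z‖ ≤ 1)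
    (ha1 : ∀ k, ‖a k‖ ≤ 1) (hO0 : ‖gi (O 0 q) (O 1 q) - 2 ^ q * z‖ ≤ 2)
    (haO : ∀ k, ‖gi (O (2 * k + 2) q) (O (2 * k + 3) q) - 2 ^ q * a k‖ ≤ 2)
    {σ : State} (hJ : J σ) (h1 : σ.reg 1 = N) (h3 : σ.reg 3 = ν) (h4 : σ.reg 4 = (2 * ν : ℕ))
    (h5 : σ.reg 5 = D) (h32 : σ.reg 32 = r) (h33 : σ.reg 33 = (2 ^ r : ℕ))
    (hmem : ∀ A j, A < 64 → σ.mem A j = 0) :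
    Tri O (bluesteinC cm) σ (((q + 1) * (M + 10000 * (L * (1 + ℓ))) + (2 ^ r + 1) * (M + 2300 * L)) +
      ((q + 1) * (M + 4000 * (L * (1 + ℓ))) + ((2 * ν + 1) * (M + 2000 * L) + (4 * 8 ^ 2 * (L * (1 + 0)) +
      ((D + 1) * (M + 2000 * L) + ((D + 1) * (M + 4000 * L) + ((ν + 1) * (M + 8000 * (L * (1 + ℓ))) +
      (4 * ((r + 1) * (2 ^ r + 1) * (M + 17000 * L)) + (4 * 12 ^ 2 * (L * (1 + 0)) +
      ((N + 1) * (M + 6000 * (L * (1 + ℓ))) + 4 * 3 ^ 2 * (L * (1 + 0))))))))))))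
      fun σ' => σ'.reg 0 = q ∧ ∀ k : ℕ, k < N → ‖σ'.cv 0 k -
        2 ^ q * ∑ i ∈ Finset.range D, a i * (z * η ^ (2 * (8 * k))) ^ i‖ ≤
          (Ec + 2) * 1 + (D + 1) * δ + 2 := by
  have hL1 : 1 ≤ L := by omega
  have hν0 : 0 < ν := by omega
  have hDL' : len (D : ℤ) ≤ L := (len_natCast_mono (by omega)).trans hDL
  have lR : len ((2 ^ r : ℕ) : ℤ) = r + 1 := by push_cast; exact len_two_pow r
  have lν2 : len ((2 * ν : ℕ) : ℤ) ≤ r + 1 := (len_natCast_mono hνR).trans lR.le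
  have lν : len (ν : ℤ) ≤ r + 1 := (len_natCast_mono (by omega)).trans lν2
  have lqL : len (q : ℤ) ≤ L := (len_natCast_le_self q).trans (by omega)
  have lqℓ : len (q : ℤ) ≤ ℓ := (len_natCast_mono (by omega)).trans hℓ
  have hSQ : (2 : ℝ) ^ q * 2 ^ q ≤ 2 ^ Q := by
    rw [← pow_add]; exact pow_le_pow_right₀ (by norm_num) (by omega)
  have hSx : ∀ {x y : ℝ}, x ≤ U → y ≤ U → 2 ^ q * x + y ≤ 2 ^ Q := fun hx hy =>
    (add_le_sq (by positivity) hU1 hU2 hx hy).trans hSQ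
  have hD1r : (1 : ℝ) ≤ D := by exact_mod_cast hD1
  have hU0 : 0 ≤ U := by linarith
  have hδ0 : 0 ≤ δ := by rw [hδ]; positivity
  have hDU : (D : ℝ) ≤ U := by linarith
  have hDδ : δ ≤ (D + 1) * δ := le_mul_of_one_le_left hδ0 (by linarith)
  have hδx : δ ≤ Ex := by rw [hEx]; linarith
  have hEx2 : 2 ≤ Ex := by rw [hEx]; linarith
  have hq1 : (1 : ℝ) ≤ q := by exact_mod_cast (by omega : 1 ≤ q)
  have hR1 : (1 : ℝ) ≤ 2 ^ r := one_le_pow₀ (by norm_num)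
  have h66 : 66 * (q : ℝ) ≤ δ := by rw [hδ]; exact le_mul_of_one_le_left (by linarith) hR1
  have hPδ : ((2 * ν : ℕ) : ℝ) * (2 * (32 * q) + 2) ≤ δ := by
    rw [hδ]
    have : ((2 * ν : ℕ) : ℝ) ≤ 2 ^ r := by exact_mod_cast hνR
    gcongr
    linarith
  have hη1 : ‖η‖ = 1 := by rw [hη]; exact norm_exp_pi_div ν
  have hη2 : η ^ (2 * ν) = 1 := by rw [hη]; exact exp_pi_div_pow hν0
  have hηk : ∀ k, ‖η ^ k‖ = 1 := fun k => by rw [norm_pow, hη1, one_pow]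
  have hZ1 : ∀ k, ‖z ^ k‖ ≤ 1 := fun k => by rw [norm_pow]; exact pow_le_one₀ (norm_nonneg _) hz1
  have haZ : ∀ k, ‖a k * z ^ k‖ ≤ 1 := fun k => by
    rw [norm_mul]; exact mul_le_one₀ (ha1 k) (norm_nonneg _) (hZ1 k)
  -- the sums, and their values before the multiplication by the outer factor
  obtain ⟨V, hV⟩ : ∃ V : ℕ → ℂ, V = fun k => (starRingEnd ℂ) (η ^ (8 * k) ^ 2) *
    ∑ i ∈ Finset.range D, (a i * z ^ i) * (η ^ (2 * (8 * k))) ^ i := ⟨_, rfl⟩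
  have hVD : ∀ k, ‖V k‖ ≤ D := fun k => by
    rw [hV, norm_mul, RCLike.norm_conj, hηk, one_mul]
    refine (norm_sum_le_of_le _ fun i _ => (?_ : _ ≤ (1 : ℝ))).trans (by simp)
    rw [norm_mul, norm_pow, hηk, one_pow, mul_one]
    exact haZ i
  have hVη : ∀ k, V k * η ^ (8 * k) ^ 2 =
      ∑ i ∈ Finset.range D, a i * (z * η ^ (2 * (8 * k))) ^ i := fun k => by
    have := pow_mul_conj_pow hη1 ((8 * k) ^ 2)
    rw [hV]
    dsimp only
    rw [mul_comm, ← mul_assoc, this, one_mul]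
    exact Finset.sum_congr rfl fun i _ => by rw [mul_pow, mul_assoc]
  have hVconv : ∀ k, k < N → ∑ j ∈ Finset.range (2 ^ r), ∑ t ∈ Finset.range (2 ^ r),
      (if 2 ^ r ∣ j + t + (2 ^ r - 8 * k) % 2 ^ r then
        (if j < ν then foldSum (fun i => a i * z ^ i) ν D j * η ^ j ^ 2 else 0) *
          chirp η ν (2 ^ r) t else 0) = V k := fun k hk => by
    have e := bluestein hη1 hνR (by omega : 8 * k < ν) (foldSum (fun i => a i * z ^ i) ν D)
    rw [sum_foldSum hν0 D (by rw [← pow_mul, mul_right_comm, pow_mul, hη2, one_pow])] at e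
    rw [hV]
    dsimp only
    rw [← e, ← mul_assoc, mul_comm ((starRingEnd ℂ) _), pow_mul_conj_pow hη1, one_mul]
  have hstab := h.stable
  have hprec := h.prec
  unfold bluesteinC
  refine (setupC_spec (b := 32) h hq hQ hL hLQ hr4 hrL hℓ hrℓ (by rw [← hδ]; linarith) hJ h32
    h33).seq fun τ₁ ⟨j1, hpi, hW1, s1⟩ => ?_
  simp only [Nat.reduceAdd] at hpi hW1 s1
  refine (rootC_spec (b := 32) h hq hQ hLQ lqℓ (by omega : 8 ≤ ν) (lν.trans (by omega))
    (lν.trans hrℓ) j1 (by rw [s1.1 _ (by omega), h3]) hpi).seq fun τ₂ ⟨j2, hroot, s2⟩ => ?_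
  simp only [Nat.reduceAdd] at hroot s2
  rw [← hη] at hroot
  refine (powersC_spec (b := 32) (dst := 2) (cnt := 4) (N := 2 * ν) h (by omega) hLQ
    (lν2.trans (by omega)) lqL (by omega) (by omega) hη1.le (hPδ.trans (by linarith)) (by linarith)
    j2 (by rw [s2.1 _ (by omega), s1.1 _ (by omega), h4]) hroot).seq fun τ₃ ⟨j3, hP, s3⟩ => ?_
  simp only [Nat.reduceAdd] at s3
  have hP : ∀ i : ℕ, i < 2 * ν → ‖τ₃.cv 2 i - 2 ^ q * η ^ i‖ ≤ δ := fun i hi =>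
    (hP i hi.le).trans (le_trans (by gcongr) hPδ)
  have s13 : Same (fun r => r < 6 ∨ r = 32 ∨ r = 33) (fun a => 34 ≤ a ∧ a < 64)
      σ τ₃ :=
    ((s1.mono (by omega) (by omega)).trans (s2.mono (by omega) (by omega))).trans
      (s3.mono (by omega) (by omega))
  have hW3 : ∀ i : ℕ, i < 2 ^ r → ‖τ₃.cv 32 i -
      2 ^ q * Complex.exp (2 * Real.pi * Complex.I / (2 ^ r : ℕ)) ^ i‖ ≤ δ := fun i hi => by
    rw [s3.cv (by omega) (by omega), s2.cv (by omega) (by omega), hδ]; exact hW1 i hi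
  have r68 : τ₃.reg 68 = q := hprec _ j3
  refine (Tri.line 8 (L := L) (ℓ := 0) (Q := fun τ => J τ ∧ τ.reg 44 = O 0 q ∧ τ.reg 45 = O 1 q ∧
    Same (fun r => r < 44) (fun _ => True) τ₃ τ) hL1 (by simp [Cmd.Straight])
    (by simp [Cmd.sz, Expr.sz]) ?_ ?_).seq fun τ₄ ⟨j4, h44, h45, s4⟩ => ?_
  · obtain ⟨m0, m1⟩ := abs_le_of_approx hO0 hz1 (hSx hU1 (by linarith))
    have m0 := len_le_of_abs_le (L := L) m0 (by omega)
    have m1 := len_le_of_abs_le (L := L) m1 (by omega)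
    have : q ≤ L := by omega
    simp [Cmd.Leaf, Expr.Leaf, Cmd.exec, Expr.eval, r68, m0, m1, len_zero, len_one, hL1, lqL, this]
  · simp only [Cmd.exec, Expr.eval]
    refine ⟨hstab _ _ j3 ⟨fun r hr => ?_, fun a ha j => by simp⟩, by simp [r68], by simp [r68],
      fun r hr => ?_, fun a ha j => by simp⟩
    · simp; grind
    · simp; grind
  refine (powersC_spec (b := 32) (dst := 4) (cnt := 5) (N := D) (x := z) (δ := 2) h (by omega) hLQ
    hDL' lqL (by omega) (by omega) hz1 ?_ ?_
    j4 (by rw [s4.1 _ (by omega), s13.1 _ (by omega), h5])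
    (by simp only [Nat.reduceAdd]; rw [h44, h45]; exact hO0)).seq fun τ₅ ⟨j5, hZ, s5⟩ => ?_
  · linarith
  · linarith
  simp only [Nat.reduceAdd] at s5
  have s35 : Same (fun r => r < 6 ∨ r = 32 ∨ r = 33) (fun a => a < 64 ∧ a ≠ 4 ∧ a ≠ 5)
      τ₃ τ₅ := (s4.mono (by omega) (fun _ _ => trivial)).trans (s5.mono (by omega) (by omega))
  have s15 := s13.trans (s35.mono (R' := fun r => r < 6 ∨ r = 32 ∨ r = 33)
    (A' := fun a => 34 ≤ a ∧ a < 64) (fun _ h => h) (by omega))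
  have h05 : ∀ A j, A = 34 ∨ A = 35 ∨ A = 36 ∨ A = 37 → τ₅.mem A j = 0 := fun A j hA => by
    rw [s15.2 A (by omega), hmem A j (by omega)]
  have h340 : ∀ j, τ₅.cv 34 j = 0 := fun j => by
    simp [State.cv, h05 34 j, h05 35 j, gi]
  have h360 : ∀ j, τ₅.cv 36 j = 0 := fun j => by
    simp [State.cv, h05 36 j, h05 37 j, gi]
  refine (foldC_spec h hLQ (by omega) hDL (lν.trans (by omega)) hν0 ha1 hZ1 (ε := 6 * D)
    (by linarith) ?_ ?_ ?_ ?_ haO j5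
    (by rw [s15.1 _ (by omega), h3]) (by rw [s15.1 _ (by omega), h5]) (fun k hk => ?_)
    (fun j => h340 j)).seq fun τ₆ ⟨j6, hA6, hA60, s6⟩ => ?_
  · exact hSx hU1 (by linarith)
  · exact hSx hU1 (by linarith)
  · exact hSx hU1 b1
  · exact hSx hDU (by rw [← hEf]; exact b3)
  · refine (hZ k hk.le).trans ?_
    have : (k : ℝ) ≤ D := by exact_mod_cast hk.le
    linarith
  rw [← hEf] at hA6
  refine (chirpC_spec h hLQ (lR.le.trans (by omega)) (lR.le.trans hrℓ) hν0 hνR hη1 hη2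
    (norm_foldSum_le haZ ν D) (by linarith) (hSx hDU b3) (hSx hU1 b2)
    ?_ j6 (by rw [s6.1 _ (by omega), s15.1 _ (by omega), h3])
    (by rw [s6.1 _ (by omega), s15.1 _ (by omega), h4])
    (by rw [s6.1 _ (by omega), s15.1 _ (by omega), h33])
    (fun i hi => ?_) hA6 hA60 (fun j => ?_)).seq fun τ₇ ⟨j7, hX7, hY7, s7⟩ => ?_
  · rw [← hEx, mul_one]; exact hSx hDU b4
  · rw [s6.cv (by omega) (by omega), s35.cv (by omega) (by omega)]; exact hP i hi
  · rw [s6.cv (by omega) (by omega)]; exact h360 j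
  rw [← hEx] at hX7
  have s57 : Same (fun r => r < 6 ∨ r = 32 ∨ r = 33) (fun a => a < 34) τ₅ τ₇ :=
    (s6.mono (by omega) (by omega)).trans (s7.mono (by omega) (by omega))
  have s17 : Same (fun r => r < 6 ∨ r = 32 ∨ r = 33) (fun _ => False) σ τ₇ :=
    (s15.mono (fun _ h => h) (fun _ h => h.elim)).trans (s57.mono (fun _ h => h) (fun _ h => h.elim))
  refine (convC_spec (b := 32) h hLQ hrL
    (Complex.isPrimitiveRoot_exp (2 ^ r) (by positivity)) hD1r hEx2
    (x := fun j => if j < ν then foldSum (fun i => a i * z ^ i) ν D j * η ^ j ^ 2 else 0)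
    (y := chirp η ν (2 ^ r)) (fun j => ?_) (fun j => (norm_chirp_le hη1 _ _ _).trans hD1r)
    (by rw [← hEc]; linarith) hQ2 j7 (by rw [s17.1 _ (by omega), h32])
    (by rw [s17.1 _ (by omega), h33])
    (fun i hi => ?_) (fun i hi => ?_) (fun i hi => ?_)).seq fun τ₈ ⟨j8, hC8, s8⟩ => ?_
  · split_ifs
    · rw [norm_mul, hηk, mul_one]; exact norm_foldSum_le haZ ν D j
    · rw [norm_zero]; linarith
  · rw [s57.cv (by omega) (by omega), s35.cv (by omega) (by omega)]; exact (hW3 i hi).trans hδx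
  · exact hX7 i
  · exact (hY7 i hi).trans hδx
  simp only [Nat.reduceAdd] at hC8 s8
  rw [← hEc] at hC8
  have hC : ∀ k : ℕ, k < N →
      ‖τ₈.cv 34 (((2 ^ r - 8 * k) % 2 ^ r : ℕ) : ℤ) - 2 ^ q * (2 ^ r * V k)‖ ≤ Ec := fun k hk => by
    rw [← hVconv k hk]; exact hC8 _ (Nat.mod_lt _ (by positivity))
  have hVr : ∀ k, ‖2 ^ r * V k‖ ≤ 2 ^ r * (D : ℝ) := fun k => by
    rw [norm_mul, norm_pow, Complex.norm_ofNat]; gcongr; exact hVD k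
  have f33 : τ₈.reg 33 = (2 ^ r : ℕ) := by rw [s8.1 _ (by omega), s17.1 _ (by omega), h33]
  -- index `R - 8 k` is meant modulo `R = 2 ^ r`: for `k = 0` the entry at index `0` is needed
  refine (Tri.line 12 (L := L) (ℓ := 0) (Q := fun τ => J τ ∧ (∀ k : ℕ, k < N →
    ‖τ.cv 34 (((2 ^ r : ℕ) : ℤ) - (8 * k : ℕ)) - 2 ^ q * (2 ^ r * V k)‖ ≤ Ec) ∧
    Same (fun _ => True) (fun a => a < 34) τ₈ τ) hL1 (by simp [Cmd.Straight])
    (by simp [Cmd.sz, Expr.sz]) ?_ ?_).seq fun τ₉ ⟨j9, hC9, s9⟩ => ?_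
  · have hC0 := hC 0 hN
    rw [mul_zero, tsub_zero, Nat.mod_self, Nat.cast_zero] at hC0
    obtain ⟨m0, m1⟩ := abs_le_of_approx hC0 (hVr 0) (hSx b7 (by linarith))
    have m0 := len_le_of_abs_le (L := L) m0 (by omega)
    have m1 := len_le_of_abs_le (L := L) m1 (by omega)
    have lRL := lR.le.trans (by omega : r + 1 ≤ L)
    push_cast at f33 lRL
    simp [Cmd.Leaf, Expr.Leaf, Cmd.exec, Expr.eval, f33, m0, m1, len_zero, lRL]
  · simp only [Cmd.exec, Expr.eval]
    refine ⟨hstab _ _ j8 ⟨fun r hr => rfl, fun a ha j => ?_⟩, fun k hk => ?_,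
      fun r hr => rfl, fun a ha j => ?_⟩
    · simp; grind
    · rcases Nat.eq_zero_or_pos k with rfl | hk0
      · have hC0 := hC 0 hN
        rw [mul_zero, tsub_zero, Nat.mod_self, Nat.cast_zero] at hC0
        rw [mul_zero, Nat.cast_zero, sub_zero]
        simpa [State.cv, f33] using hC0
      · have hCk := hC k hk
        rw [Nat.mod_eq_of_lt (by omega), Nat.cast_sub (by omega)] at hCk
        simp only [State.cv] at hCk ⊢
        simpa [f33, hk0.ne'] using hCk
    · simp; grind
  have s79 : Same (fun r => r < 6 ∨ r = 32 ∨ r = 33) (fun a => a < 32) τ₇ τ₉ :=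
    (s8.mono (by omega) (by omega)).trans (s9.mono (fun _ _ => trivial) (by omega))
  have s19 := s17.trans (s79.mono (fun _ h => h) (fun _ h => h.elim))
  refine (outC_spec h hLQ (lR.le.trans (by omega)) (lR.le.trans hrℓ) (by omega) (by omega) hν hN hνR
    hη1 hη2 hVD (by linarith) (hSx hDU b5) (hSx b7 (by linarith)) (hSx hU1 b2) ?_ j9
    (by rw [s19.1 _ (by omega), h1]) (by rw [s19.1 _ (by omega), h4])
    (by rw [s19.1 _ (by omega), h32]) (by rw [s19.1 _ (by omega), h33]) (fun i hi => ?_)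
    hC9).seq fun τ ⟨jt, hout⟩ => ?_
  · rw [mul_one]; exact hSx hDU b6
  · rw [s79.cv (by omega) (by omega), s57.cv (by omega) (by omega), s35.cv (by omega) (by omega)]
    exact hP i hi
  have r68 : τ.reg 68 = q := hprec _ jt
  refine Tri.line 3 (L := L) (ℓ := 0) hL1 (by simp [Cmd.Straight]) (by simp [Cmd.sz, Expr.sz]) ?_ ?_
  · simp [Cmd.Leaf, Expr.Leaf, r68, lqL]
  · simp only [Cmd.exec, Expr.eval]
    refine ⟨by simp [r68], fun k hk => ?_⟩
    rw [← hVη]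
    exact hout k hk

set_option maxHeartbeats 1000000 in
/-- The cost of `bluesteinC`, for the parameters of `evalC`. -/
theorem bluesteinC_cost_le {X s g M n N ν D r q : ℕ} (hX : n + 1 ≤ X) (hs : n + 1 ≤ s) (hq : q = 100 * s)
    (hr : r = n + 8) (hR : 2 ^ r = 256 * X) (hN : N ≤ 16 * X) (hν : 8 * N = ν) (hD : D ≤ 2 * s * X) :
    4 * 40 ^ 2 * (500 * s * (1 + 7)) +
      (((q + 1) * (4 * M + 1500 * (500 * s) + 10000 * (500 * s * (1 + (20 + n + g)))) +
          (2 ^ r + 1) * (4 * M + 1500 * (500 * s) + 2300 * (500 * s))) +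
      ((q + 1) * (4 * M + 1500 * (500 * s) + 4000 * (500 * s * (1 + (20 + n + g)))) +
      ((2 * ν + 1) * (4 * M + 1500 * (500 * s) + 2000 * (500 * s)) + (4 * 8 ^ 2 * (500 * s * (1 + 0)) +
      ((D + 1) * (4 * M + 1500 * (500 * s) + 2000 * (500 * s)) +
      ((D + 1) * (4 * M + 1500 * (500 * s) + 4000 * (500 * s)) +
      ((ν + 1) * (4 * M + 1500 * (500 * s) + 8000 * (500 * s * (1 + (20 + n + g)))) +
      (4 * ((r + 1) * (2 ^ r + 1) * (4 * M + 1500 * (500 * s) + 17000 * (500 * s))) +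
      (4 * 12 ^ 2 * (500 * s * (1 + 0)) +
      ((N + 1) * (4 * M + 1500 * (500 * s) + 6000 * (500 * s * (1 + (20 + n + g)))) +
        4 * 3 ^ 2 * (500 * s * (1 + 0)))))))))))) ≤
      10 ^ 12 * (X * (s * (M + s * (22 + g)))) := by
  obtain ⟨G, hG⟩ : ∃ G, G = 22 + g := ⟨_, rfl⟩
  obtain ⟨Y, hY⟩ : ∃ Y, Y = 1 + (20 + n + g) := ⟨_, rfl⟩
  have hG1 : 1 ≤ G := by omega
  have hYn : Y ≤ (n + 1) * G := by rw [hG, hY]; nlinarith [Nat.zero_le (n * g)]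
  have hYX : Y ≤ X * G := hYn.trans (Nat.mul_le_mul_right _ hX)
  have hYs : Y ≤ s * G := hYn.trans (Nat.mul_le_mul_right _ hs)
  have hsX : s ≤ X * s := Nat.le_mul_of_pos_left _ (by omega)
  have hXs : X ≤ X * s := Nat.le_mul_of_pos_right _ (by omega)
  have hDs : D ≤ 2 * (X * s) := by rw [mul_comm X s, ← mul_assoc]; exact hD
  have hmul1 : ∀ {A α : ℕ}, A ≤ α * (X * s) → A * 1 ≤ α * (X * s * G) := fun h => by
    rw [mul_one]; exact h.trans (Nat.mul_le_mul_left _ (Nat.le_mul_of_pos_right _ hG1))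
  have hq1 : q + 1 ≤ 101 * s := by omega
  have hqa : q + 1 ≤ 101 * (X * s) := by omega
  have hqb : (q + 1) * Y ≤ 101 * (X * s * G) := by
    calc _ ≤ 101 * s * (X * G) := Nat.mul_le_mul hq1 hYX
      _ = _ := by ring
  have hνb : ∀ {A α : ℕ}, A ≤ α * X → A * Y ≤ α * (X * s * G) := fun {A α} h => by
    calc _ ≤ α * X * (s * G) := Nat.mul_le_mul h hYs
      _ = _ := by ring
  have hRa : 2 ^ r + 1 ≤ 257 * (X * s) := by omega
  have hva : (r + 1) * (2 ^ r + 1) ≤ 2570 * (X * s) := by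
    calc _ ≤ (10 * s) * (257 * X) := Nat.mul_le_mul (by omega) (by omega)
      _ = _ := by ring
  have hc : s ≤ X * (s * (M + s * G)) := by
    calc s ≤ X * s * (s * G) :=
          hsX.trans (Nat.le_mul_of_pos_right _ (Nat.mul_pos (by omega) hG1))
      _ ≤ X * s * (M + s * G) := by gcongr; omega
      _ = _ := by ring
  have c1 := part_cost_le (M := M) 10000 hG1 hqa hqb
  have c2 := part_cost_le (M := M) 2300 hG1 hRa (hmul1 hRa)
  have c3 := part_cost_le (M := M) 4000 hG1 hqa hqb
  have c4 := part_cost_le (M := M) 2000 hG1 (A := 2 * ν + 1) (α := 257) (β := 257) (by omega) (hmul1 (by omega))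
  have c5 := part_cost_le (M := M) 2000 hG1 (A := D + 1) (α := 3) (β := 3) (by omega) (hmul1 (by omega))
  have c6 := part_cost_le (M := M) 4000 hG1 (A := D + 1) (α := 3) (β := 3) (by omega) (hmul1 (by omega))
  have c7 := part_cost_le (M := M) 8000 hG1 (A := ν + 1) (α := 129) (β := 129) (by omega) (hνb (by omega))
  have c8 := part_cost_le (M := M) 17000 hG1 hva (hmul1 hva)
  have c9 := part_cost_le (M := M) 6000 hG1 (A := N + 1) (α := 17) (β := 17) (by omega) (hνb (by omega))
  rw [mul_one] at c2 c4 c5 c6 c8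
  rw [← hG, ← hY]
  generalize X * (s * (M + s * G)) = W at *
  linarith

set_option maxHeartbeats 1000000 in
/-- The evaluation with a multiplication routine of cost `M`, prepared at the cost `Tp`. The summand
`(n + m) (22 + Nat.size m)` pays, on the average, for what is done besides a call of the routine; this
includes built-in products and quotients in which one operand has only `O(n + log m)` bits. -/
theorem evalC_spec {O : ℕ → ℕ → ℤ} {prep mu : Cmd} {I : State → Prop} {n N m M Tp : ℕ} {z : ℂ}
    {p : Polynomial ℂ} {E : ℤ} (hn : 0 < n) (hm : 0 < m) (hN : 0 < N) (hN2 : N ≤ 2 ^ (n + 4))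
    (hz : ‖z‖ ≤ 1 - 1 / (2 : ℝ) ^ n) (hO : Presents O z p E)
    (hmul : RMul O 72 mu I (200 * (n + m)) M)
    (hprep : ∀ σ : State, σ.reg 75 = n → σ.reg 76 = (200 * (n + m) : ℕ) →
      Tri O prep σ Tp fun σ' => I σ' ∧ Same (· < 72) (· < 72) σ σ') {σ : State}
    (h0 : σ.reg 0 = n) (h1 : σ.reg 1 = N) (h2 : σ.reg 2 = m) (hmem : ∀ a j, σ.mem a j = 0) :
    Tri O (evalC prep mu) σ
      (Tp + 10 ^ 12 * (2 ^ n * ((n + m) * (M + (n + m) * (22 + Nat.size m))))) fun σ' =>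
      ∀ k : ℕ, k < N → ‖output σ' E k -
        p.eval (z * Complex.exp (2 * Real.pi * k / N * Complex.I))‖ < coeffNorm p / (2 : ℝ) ^ m := by
  have hpar := paramC_spec (O := O) (L := 500 * (n + m)) hN2 hn hm (by omega) h0 h1 h2
  obtain ⟨s, hs⟩ : ∃ s, s = n + m := ⟨_, rfl⟩
  obtain ⟨X, hX⟩ : ∃ X, X = 2 ^ n := ⟨_, rfl⟩
  obtain ⟨g, hg⟩ : ∃ g, g = Nat.size m := ⟨_, rfl⟩
  obtain ⟨q, hq⟩ : ∃ q, q = 100 * s := ⟨_, rfl⟩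
  obtain ⟨Q, hQ⟩ : ∃ Q, Q = 200 * s := ⟨_, rfl⟩
  obtain ⟨r, hr⟩ : ∃ r, r = n + 8 := ⟨_, rfl⟩
  obtain ⟨ν, hν⟩ : ∃ ν, 8 * N = ν := ⟨_, rfl⟩
  obtain ⟨D, hD⟩ : ∃ D, D = X * (m + 2) := ⟨_, rfl⟩
  rw [← hX, ← hs, ← hg]
  rw [← hX, ← hs, ← hq, ← hQ, ← hr, ← hD, hν] at hpar
  rw [← hs, ← hQ] at hmul hprep
  have hs2 : 2 ≤ s := by omega
  have hXn : n + 1 ≤ X := by rw [hX]; exact Nat.lt_two_pow_self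
  have hX1 : 1 ≤ X := by omega
  have hRX : 2 ^ r = 256 * X := by rw [hr, pow_add, hX]; ring
  have hNX : N ≤ 16 * X := by rw [hX]; rw [pow_add] at hN2; omega
  have hDX : D ≤ 2 * s * X := by
    rw [hD, mul_comm]; exact Nat.mul_le_mul_right _ (by omega)
  have hD2 : D ≤ 2 ^ (s + 1) := by
    have h1 : m + 1 ≤ 2 ^ m := Nat.lt_two_pow_self
    have h2 : m + 2 ≤ 2 ^ (m + 1) := by rw [pow_succ]; omega
    rw [hD, hX, hs, show n + m + 1 = n + (m + 1) by ring, pow_add]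
    exact Nat.mul_le_mul_left _ h2
  have hD1 : 1 ≤ D := by rw [hD]; exact Nat.mul_pos hX1 (by omega)
  have lD : len ((2 * D + 3 : ℕ) : ℤ) ≤ 500 * s := by
    refine len_natCast_le.2 (lt_of_lt_of_le ?_ (Nat.pow_le_pow_right (by norm_num)
      (by omega : s + 5 ≤ 500 * s)))
    have : 1 ≤ 2 ^ s := Nat.one_le_two_pow
    rw [pow_add]; rw [pow_add] at hD2; omega
  have hg1 : 1 ≤ g := by rw [hg]; exact Nat.size_pos.2 hm
  have lqℓ : len ((2 * q + 1 : ℕ) : ℤ) ≤ 20 + n + g := by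
    refine len_natCast_le.2 ?_
    have hmg : m < 2 ^ g := by rw [hg]; exact Nat.lt_size_self m
    have e1 : X ≤ X * 2 ^ g := Nat.le_mul_of_pos_right _ (by positivity)
    have e2 : 2 ^ g ≤ X * 2 ^ g := Nat.le_mul_of_pos_left _ hX1
    rw [pow_add, pow_add, ← hX, hq, hs, mul_assoc]
    omega
  have lq : len (q : ℤ) ≤ 500 * s := (len_natCast_le_self q).trans (by omega)
  have hD1r : (1 : ℝ) ≤ D := by exact_mod_cast hD1
  have hδb : (2 : ℝ) ^ r * (66 * q) ≤ 2 ^ (2 * s + 20) := by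
    have : 2 ^ r * (66 * q) ≤ 2 ^ (2 * s + 20) := by
      have h1 : s + 1 ≤ 2 ^ s := Nat.lt_two_pow_self
      calc _ ≤ 2 ^ r * (2 ^ 13 * 2 ^ s) := Nat.mul_le_mul_left _ (by omega)
        _ = 2 ^ (r + (13 + s)) := by rw [pow_add, pow_add]
        _ ≤ _ := Nat.pow_le_pow_right (by norm_num) (by omega)
    exact_mod_cast this
  obtain ⟨U, hU, b1, b2, b3, b4, b5, b6, b7, hEf0, hEc0⟩ := eval_bounds hs2 hD1r
    (by exact_mod_cast hD2) (by positivity) hδb (W := 2 ^ r)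
    (pow_le_pow_right₀ (by norm_num) (by omega)) (ρ := 16 ^ r) (by positivity)
    (by
      rw [show (16 : ℝ) = 2 ^ 4 by norm_num, ← pow_mul]
      exact pow_le_pow_right₀ (by norm_num) (by omega)) rfl rfl rfl rfl
  have hU1 : 1 ≤ U := by rw [hU]; exact one_le_pow₀ (by norm_num)
  have hUF : U * 2 ^ (m + 2) ≤ 2 ^ q := by
    rw [hU, ← pow_add]; exact pow_le_pow_right₀ (by norm_num) (by omega)
  have hU2 : 2 * U ≤ 2 ^ q := by
    rw [hU, ← pow_succ']; exact pow_le_pow_right₀ (by norm_num) (by omega)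
  obtain ⟨η, hη⟩ : ∃ η, η = Complex.exp (Real.pi / ν * Complex.I) := ⟨_, rfl⟩
  have hz1 : ‖z‖ ≤ 1 := hz.trans (sub_le_self _ (by positivity))
  have ha1 : ∀ k, ‖p.coeff k / (((2 : ℝ) ^ E : ℝ) : ℂ)‖ ≤ 1 := fun k => by
    have h2E : (0 : ℝ) < 2 ^ E := by positivity
    rw [norm_div, Complex.norm_real, Real.norm_of_nonneg h2E.le, div_le_one h2E]
    exact hO.coeff_le k
  have haO : ∀ k, ‖gi (O (2 * k + 2) q) (O (2 * k + 3) q) -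
      2 ^ q * (p.coeff k / (((2 : ℝ) ^ E : ℝ) : ℂ))‖ ≤ 2 := fun k => by
    refine norm_gi_stream_sub_le ?_ ?_ q
    · rw [Complex.div_ofReal_re]; exact hO.re_coeff k
    · rw [Complex.div_ofReal_im]; exact hO.im_coeff k
  have hw : ∀ k : ℕ, z * η ^ (2 * (8 * k)) =
      z * Complex.exp (2 * Real.pi * k / N * Complex.I) := fun k => by
    have : (N : ℂ) ≠ 0 := by exact_mod_cast hN.ne'
    rw [hη, ← Complex.exp_nat_mul, ← hν]
    congr 2
    push_cast
    field_simp
  refine Tri.mono (hpar.seq fun τ ⟨p68, p75, p76, p32, p33, p3, p4, p5, p1, pm⟩ =>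
    (hprep τ p75 p76).seq fun τ' ⟨hI, s1⟩ =>
      bluesteinC_spec (complexMul_spec (c := 64) (q := q) (L := 500 * s) hmul lq (by omega))
        (by omega) (by omega) (by omega) (by omega) (by omega) (by omega) (by omega) lqℓ (by omega) hN
        hν (by omega) hD1 lD rfl rfl rfl rfl hU1 hU2 b1 b2 b3 b4 b5 b6 b7 hEf0 hEc0 hη hz1 ha1
        (norm_gi_stream_sub_le hO.re_z hO.im_z q) haO
        ⟨hI, by rw [s1.1 _ (by omega), p68]⟩ (by rw [s1.1 _ (by omega), p1])
        (by rw [s1.1 _ (by omega), p3]) (by rw [s1.1 _ (by omega), p4])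
        (by rw [s1.1 _ (by omega), p5]) (by rw [s1.1 _ (by omega), p32])
        (by rw [s1.1 _ (by omega), p33]) fun A j hA => by rw [s1.2 A (by omega), pm, hmem])
    ?_ fun σ' ⟨e0, he⟩ k hk => ?_
  · rw [add_left_comm]
    exact Nat.add_le_add_left (bluesteinC_cost_le hXn (by omega) hq hr hRX hNX hν hDX) Tp
  · have hk' := (he k hk).trans b6
    rw [hw] at hk'
    have hw1 : ‖z * Complex.exp (2 * Real.pi * k / N * Complex.I)‖ = ‖z‖ := by
      rw [norm_mul, show (2 * Real.pi * k / N * Complex.I : ℂ) =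
        ((2 * Real.pi * k / N : ℝ) : ℂ) * Complex.I by push_cast; rfl,
        Complex.norm_exp_ofReal_mul_I, mul_one]
    refine norm_output_sub_lt hO.le_norm e0 hUF (hw1.le.trans hz1) ?_ hk'
    rw [hw1, hD, hX]
    exact pow_terms_lt (norm_nonneg _) hz m

/-- The evaluation program: the products are read off a table of squares if `m ≤ n`, and computed by
Fourier transforms otherwise. In the former case, the factors are bounded by `2 ^ (200 (n + m))`; after
the shift to natural numbers they have at most `400 n + 2` bits, that is, `402` digits in base
`2 ^ n`. -/
def mainC : Cmd :=
  .branch (.sub (.reg 2) (.reg 0)) (evalC (fftPrepC 72) (fftMulC 72))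
    (evalC (tablePrepC 72) (tableMulC 72 402))

/-- If a multiplication costs `O(s G ^ 3)`, with `s = n + m` and `G` logarithmic in `m`, then the total
cost is as claimed. -/
theorem total_cost_le {X s G M Tp μ : ℕ} (hX : 1 ≤ X) (hs : 1 ≤ s) (hG : 1 ≤ G)
    (hM : M ≤ μ * (s * G ^ 3)) (hT : Tp ≤ μ * (X * s ^ 2 * G ^ 3)) :
    (8 * s) + (Tp + 10 ^ 12 * (X * (s * (M + s * G)))) ≤
      (8 + μ + 10 ^ 12 * (μ + 1)) * (X * s ^ 2 * G ^ 3) := by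
  have h1 : s ≤ X * s ^ 2 * G ^ 3 := by
    calc s = 1 * (s * 1) * 1 := by ring
      _ ≤ X * (s * s) * G ^ 3 := by gcongr; exact Nat.one_le_pow _ _ hG
      _ = _ := by ring
  have h2 : X * (s * M) ≤ X * (s * (μ * (s * G ^ 3))) := by gcongr
  have h3 : X * (s * (s * G)) ≤ X * (s * (s * G ^ 3)) := by
    gcongr
    exact Nat.le_self_pow (by norm_num) G
  have e1 : X * (s * (μ * (s * G ^ 3))) = μ * (X * s ^ 2 * G ^ 3) := by ring
  have e2 : X * (s * (s * G ^ 3)) = X * s ^ 2 * G ^ 3 := by ring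
  have e3 : X * (s * (M + s * G)) = X * (s * M) + X * (s * (s * G)) := by ring
  rw [e1] at h2
  rw [e2] at h3
  rw [e3, add_mul, add_mul, mul_assoc (10 ^ 12), add_mul, one_mul]
  generalize X * s ^ 2 * G ^ 3 = W at *
  linarith

theorem size_add_le_log {m : ℕ} (hm : 0 < m) : (22 : ℝ) + Nat.size m ≤ 23 * (1 + Real.log m) := by
  have hg : 0 < Nat.size m := Nat.size_pos.2 hm
  have h1 : 2 ^ (Nat.size m - 1) ≤ m := Nat.lt_size.1 (by omega)
  have hl := Real.log_two_gt_d9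
  have h2 : ((Nat.size m - 1 : ℕ) : ℝ) * Real.log 2 ≤ Real.log m := by
    rw [← Real.log_pow]
    exact Real.log_le_log (by positivity) (by exact_mod_cast h1)
  have h3 : ((Nat.size m - 1 : ℕ) : ℝ) * (1 / 2) ≤ Real.log m := le_trans (by gcongr; linarith) h2
  rw [Nat.cast_sub hg] at h3
  push_cast at h3
  have : 0 ≤ Real.log m := Real.log_natCast_nonneg m
  linarith

theorem mainC_spec : ∃ K : ℕ, ∀ {O : ℕ → ℕ → ℤ} {n N m : ℕ} {z : ℂ} {p : Polynomial ℂ} {E : ℤ},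
    0 < n → 0 < N → N ≤ 2 ^ (n + 4) → 0 < m → ‖z‖ ≤ 1 - 1 / (2 : ℝ) ^ n → Presents O z p E →
    Tri O mainC (initState n N m) (K * (2 ^ n * (n + m) ^ 2 * (22 + Nat.size m) ^ 3)) fun σ' =>
      ∀ k : ℕ, k < N → ‖output σ' E k -
        p.eval (z * Complex.exp (2 * Real.pi * k / N * Complex.I))‖ < coeffNorm p / (2 : ℝ) ^ m := by
  obtain ⟨c, hc⟩ : ∃ c, c = (tableMulC 72 402).sz := ⟨_, rfl⟩
  obtain ⟨μ, hμ⟩ : ∃ μ, μ = 10 ^ 12 + 6440 * c ^ 2 := ⟨_, rfl⟩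
  refine ⟨8 + μ + 10 ^ 12 * (μ + 1), fun {O n N m z p E} hn hN hN2 hm hz hO => ?_⟩
  have h0 : (initState n N m).reg 0 = n := rfl
  have h1 : (initState n N m).reg 1 = N := rfl
  have h2 : (initState n N m).reg 2 = m := rfl
  obtain ⟨G, hG⟩ : ∃ G, G = 22 + Nat.size m := ⟨_, rfl⟩
  obtain ⟨s, hs⟩ : ∃ s, s = n + m := ⟨_, rfl⟩
  have hX1 : 1 ≤ 2 ^ n := Nat.one_le_two_pow
  have hs1 : 1 ≤ s := by omega
  have hG1 : 1 ≤ G := by omega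
  have hG3 : 1 ≤ G ^ 3 := Nat.one_le_pow _ _ hG1
  have ln : len (n : ℤ) ≤ n := len_natCast_le_self n
  have lm : len (m : ℤ) ≤ m := len_natCast_le_self m
  have htest : (Expr.sub (.reg 2) (.reg 0)).cost O (initState n N m) + 1 ≤ 8 * s := by
    simp only [Expr.cost, Expr.eval, h0, h2]
    omega
  suffices h : ∃ M Tp, M ≤ μ * (s * G ^ 3) ∧ Tp ≤ μ * (2 ^ n * s ^ 2 * G ^ 3) ∧
      (((n : ℤ) < m → ∃ I, RMul O 72 (fftMulC 72) I (200 * (n + m)) M ∧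
        ∀ σ : State, σ.reg 75 = n → σ.reg 76 = (200 * (n + m) : ℕ) →
          Tri O (fftPrepC 72) σ Tp fun σ' => I σ' ∧ Same (· < 72) (· < 72) σ σ') ∧
      ((m : ℤ) ≤ n → ∃ I, RMul O 72 (tableMulC 72 402) I (200 * (n + m)) M ∧
        ∀ σ : State, σ.reg 75 = n → σ.reg 76 = (200 * (n + m) : ℕ) →
          Tri O (tablePrepC 72) σ Tp fun σ' => I σ' ∧ Same (· < 72) (· < 72) σ σ')) by
    obtain ⟨M, Tp, hM, hT, hpos, hneg⟩ := h
    have key := total_cost_le hX1 hs1 hG1 hM hT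
    rw [hs, hG] at key
    refine (Tri.branch (T' := 8 * (n + m)) (by rw [← hs]; exact htest) (fun h => ?_)
      (fun h => ?_)).mono key fun _ h => h
    · simp only [Expr.eval, h0, h2] at h
      obtain ⟨I, hI, hprep⟩ := hpos (by omega)
      exact evalC_spec hn hm hN hN2 hz hO hI hprep h0 h1 h2 fun _ _ => rfl
    · simp only [Expr.eval, h0, h2] at h
      obtain ⟨I, hI, hprep⟩ := hneg (by omega)
      exact evalC_spec hn hm hN hN2 hz hO hI hprep h0 h1 h2 fun _ _ => rfl
  rcases lt_or_ge n m with hnm | hnm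
  · obtain ⟨κ, hκ⟩ : ∃ κ, κ = Nat.clog 2 (2 * (200 * (n + m)) + 4) := ⟨_, rfl⟩
    have hup : 2 * (200 * (n + m)) + 4 ≤ 2 ^ κ := by rw [hκ]; exact Nat.le_pow_clog (by norm_num) _
    have hκ4 : 4 ≤ κ := by
      by_contra h
      have : 2 ^ κ ≤ 2 ^ 3 := Nat.pow_le_pow_right (by norm_num) (by omega)
      omega
    have hlow : 2 ^ κ ≤ 808 * s := by
      have h := Nat.pow_pred_clog_lt_self (b := 2) (by norm_num)
        (by omega : 1 < 2 * (200 * (n + m)) + 4)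
      rw [← hκ] at h
      obtain ⟨j, rfl⟩ : ∃ j, κ = j + 1 := ⟨κ - 1, by omega⟩
      rw [Nat.pred_succ] at h
      rw [pow_succ]; omega
    have hκG : κ ≤ G := by
      have hmg : m < 2 ^ Nat.size m := Nat.lt_size_self m
      have : κ ≤ Nat.size m + 10 := by
        rw [hκ]
        refine Nat.clog_le_of_le_pow ?_
        rw [pow_add]; omega
      omega
    have hκ3 : 2 ^ κ * κ ^ 3 ≤ 808 * (s * G ^ 3) := by
      calc _ ≤ 808 * s * G ^ 3 := by gcongr
        _ = _ := by ring
    have hsX : s * G ^ 3 ≤ 2 ^ n * s ^ 2 * G ^ 3 := by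
      gcongr
      calc s = 1 * s ^ 1 := by ring
        _ ≤ 2 ^ n * s ^ 2 := by gcongr; omega
    refine ⟨_, _, ?_, ?_, fun _ => ⟨_, fftMulC_spec (κ := κ) hκ4 (by omega), fun σ _ h76 =>
      fftPrepC_spec (by omega) hκ h76⟩, fun h => absurd h (by omega)⟩
    · have : 30000000 * 808 * (s * G ^ 3) ≤ μ * (s * G ^ 3) := Nat.mul_le_mul_right _ (by omega)
      linarith
    · have : 1000000000 * 808 * (s * G ^ 3) ≤ μ * (2 ^ n * s ^ 2 * G ^ 3) :=
        Nat.mul_le_mul (by omega) hsX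
      linarith
  · refine ⟨_, _, ?_, ?_, fun h => absurd h (by omega), fun _ => ⟨_,
      tableMulC_spec (n := n) (L := 1610 * s) (by omega) (by omega), fun σ h75 h76 =>
      tablePrepC_spec (L := n + 3) le_rfl h75 h76⟩⟩
    · rw [← hc]
      calc 4 * c ^ 2 * (1610 * s * (1 + 0)) = 6440 * c ^ 2 * (s * 1) := by ring
        _ ≤ μ * (s * G ^ 3) := by gcongr; omega
    · calc (2 ^ (n + 1) + 1) * (1000 * (n + 3) ^ 2) ≤ (3 * 2 ^ n) * (1000 * (4 * s) ^ 2) := by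
            gcongr
            · rw [pow_succ]; omega
            · omega
        _ = 48000 * (2 ^ n * s ^ 2 * 1) := by ring
        _ ≤ μ * (2 ^ n * s ^ 2 * G ^ 3) := by gcongr; omega

end BitRAM

theorem mainTheorem9 :
    ∃ (P : BitRAM.Cmd) (C : ℝ) (c : ℕ), 0 < C ∧
      ∀ (n N m : ℕ), 0 < n → 0 < N → N ≤ 2 ^ (n + 4) → 0 < m →
        ∀ (z : ℂ) (p : Polynomial ℂ) (E : ℤ) (O : ℕ → ℕ → ℤ),
          ‖z‖ ≤ 1 - 1 / (2 : ℝ) ^ n → BitRAM.Presents O z p E →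
            ∃ (σ : BitRAM.State) (t : ℕ),
              BitRAM.Runs O P (BitRAM.initState n N m) σ t ∧
              (t : ℝ) ≤ C * (2 : ℝ) ^ n * ((m : ℝ) + n) ^ 2 * (1 + Real.log m) ^ c ∧
              ∀ k : ℕ, k < N →
                ‖BitRAM.output σ E k -
                    p.eval (z * Complex.exp (2 * Real.pi * k / N * Complex.I))‖ <
                  coeffNorm p / (2 : ℝ) ^ m := by
  obtain ⟨K, hK⟩ := BitRAM.mainC_spec
  refine ⟨BitRAM.mainC, (K + 1) * 23 ^ 3, 3, by positivity,
    fun n N m hn hN hN2 hm z p E O hz hO => ?_⟩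
  obtain ⟨σ, t, hrun, ht, hout⟩ := hK hn hN hN2 hm hz hO
  refine ⟨σ, t, hrun, ?_, hout⟩
  have hlog := BitRAM.size_add_le_log hm
  calc (t : ℝ) ≤ K * (2 ^ n * (n + m) ^ 2 * (22 + Nat.size m) ^ 3) := by exact_mod_cast ht
    _ ≤ (K + 1) * (2 ^ n * (n + m) ^ 2 * (23 * (1 + Real.log m)) ^ 3) := by
      gcongr
      linarith
    _ = _ := by ring
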